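/- **Setting.** Let $L,v_F>0$, let $N$ be an odd positive integer and $\tilde a=L/N$. Throughout $r,s,\alpha\in\{+,-\}$ and $X\in\{C,S\}$; two-dimensional momenta are written ${\bf p}=(p_+,p_-)$, with $|{\bf p}|^2=p_+^2+p_-^2$. Put $\Lambda_s^*=\{{\bf k}: k_\pm\in\frac{2\pi}{L}(\mathbb Z+\frac12),\ -\frac{\pi}{\tilde a}\le k_{-s}<\frac{\pi}{\tilde a}\}$, $\hat\Lambda_s^*=\{{\bf p}\in\frac{2\pi}{L}\mathbb Z^2: -\frac{\pi}{\tilde a}\le p_{-s}<\frac{\pi}{\tilde a},\ p_s\ne0\}$, $\tilde\Lambda_{1D}^*=\{p\in\frac{2\pi}{L}\mathbb Z:-\frac{\pi}{\tilde a}\le p<\frac{\pi}{\tilde a}\}$, $\Lambda_{1D}=\{x\in\tilde a\mathbb Z:-\frac L2\le x<\frac L2\}$, and let $\chi({\bf p})=1$ if $-\frac{\pi}{\tilde a}\le p_\pm<\frac{\pi}{\tilde a}$ and $\chi({\bf p})=0$ otherwise. Let $\mathcal F$ be the fermion Fock space of the operators $c_{r,s,\alpha}({\bf k})$, ${\bf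 k}\in\Lambda_s^*$, with $\{c_m,c_{m'}^\dagger\}=\delta_{m,m'}$, $\{c_m,c_{m'}\}=0$, over the Dirac vacuum $\Omega$: $c_{r,s,\alpha}({\bf k})\Omega=0$ if $rk_s>0$ and $c_{r,s,\alpha}^\dagger({\bf k})\Omega=0$ if $rk_s<0$. With $:\!\mathcal O\!:\,=\mathcal O-\langle\Omega,\mathcal O\Omega\rangle$ and ${\bf e}_{-s}$ the unit vector of the $(-s)$-direction, define $$\hat J_{r,s,\alpha}({\bf p})=\sum_{{\bf k}_1,{\bf k}_2\in\Lambda_s^*}\sum_{n\in\mathbb Z}:\!c^\dagger_{r,s,\alpha}({\bf k}_1)c_{r,s,\alpha}({\bf k}_2)\!:\ \delta_{{\bf k}_1+{\bf p},\,{\bf k}_2+2\pi n{\bf e}_{-s}/\tilde a},\qquad \hat J_{r,s,\alpha}({\bf p})^\dagger=\hat J_{r,s,\alpha}(-{\bf p}),$$ and let $\stackrel{\times}{\times}\cdot\stackrel{\times}{\times}$ denote boson normal ordering: a first factor $\hat J_{r,s,\alpha}({\bf p})$ stays to the left of the second factor if $rp_s<0$ and is moved to its right if $rp_s\ge0$,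 extended bilinearly. With $\sigma_C(\alpha)=1$, $\sigma_S(\alpha)=\alpha$ put $\hat J^X_{r,s}=\sum_\alpha\sigma_X(\alpha)\hat J_{r,s,\alpha}$ and, for ${\bf p}\in\hat\Lambda_s^*$, $$\hat\Phi_{X;s}({\bf p})=\sqrt{\tfrac{\tilde a}{8\pi}}\,\tfrac1{{\rm i}p_s}\bigl(\hat J^X_{+,s}+\hat J^X_{-,s}\bigr)({\bf p}),\qquad \hat\Pi_{X;s}({\bf p})=\sqrt{\tfrac{\tilde a}{8\pi}}\bigl(-\hat J^X_{+,s}+\hat J^X_{-,s}\bigr)({\bf p}),$$ $b_{s,\alpha}({\bf p})=\mp\frac{{\rm i}}{L}\sqrt{2\pi\tilde a/|p_s|}\,\hat J_{\pm,s,\alpha}({\bf p})$ if $\pm p_s>0$, and $b_{X;s}=\frac1{\sqrt2}\sum_\alpha\sigma_X(\alpha)b_{s,\alpha}$. The zero modes are $\hat N_{r,s,\alpha}(p_{-s})=\sqrt{\tilde a/2\pi}\,\hat J_{r,s,\alpha}({\bf p})|_{p_s=0}$, $N_{r,s,\alpha}(x)=\sqrt{2\pi\tilde a}\sum_{p\in\tilde\Lambda^*_{1D}}\frac1L\hat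 N_{r,s,\alpha}(p)e^{{\rm i}px}$, $Q_{X;r,s}=\frac1{\sqrt2}\sum_\alpha\sigma_X(\alpha)[N_{+,s,\alpha}+rN_{-,s,\alpha}]$ and likewise $\hat Q_{X;r,s}$ from $\hat N$. For real couplings $\gamma_0^X,\gamma_1^X,\gamma_2^X$ with $\gamma_0^S=0$ let $H_M=H_C+H_S$ with $$H_X=\frac{v_F}2\sum_s\sum_{{\bf p}\in\hat\Lambda_s^*}\Bigl(\frac{2\pi}L\Bigr)^2\stackrel{\times}{\times}\Bigl((1+(\gamma_0^X-\gamma_1^X)\chi)\hat\Pi_{X;s}^\dagger\hat\Pi_{X;s}+(1+(\gamma_0^X+\gamma_1^X)\chi)p_s^2\hat\Phi_{X;s}^\dagger\hat\Phi_{X;s}+\gamma_2^Xp_+p_-\chi\,\hat\Phi_{X;s}^\dagger\hat\Phi_{X;-s}\Bigr)\stackrel{\times}{\times}+H_{X;z.m.},$$ $$H_{X;z.m.}=\frac{v_F}2\Bigl(\frac{2\pi}L\Bigr)^2\Bigl[\sum_s\sum_{{\bf p}\in\hat\Lambda_s^*}\stackrel{\times}{\times}\bigl(\hat\Xi_{X;s}^\dagger\hat\Phi_{X;s}+\hat\Phi_{X;s}^\dagger\hat\Xi_{X;s}\bigr)\stackrel{\times}{\times}+\frac12\sum_{r,s}\sum_{p\in\tilde\Lambda_{1D}^*}(1+\gamma_0^X+r\gamma_1^X)\hat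 Q_{X;r,s}^\dagger\hat Q_{X;r,s}+\gamma_2^X\hat Q_{X;+,+}(0)\hat Q_{X;+,-}(0)\Bigr],$$ $\hat\Xi_{X;s}({\bf p})=-\frac1{\sqrt2}\gamma_2^X{\rm i}p_s\chi({\bf p})\hat Q_{X;+,-s}(p_s)\delta_{p_{-s},0}$. Let $H_M'$ be the same expression in which the terms of the first sum of each $H_X$ that contain a coupling constant are not normal ordered (ordinary operator products; this is how they arise from the fermion interaction), the coupling-free terms $\hat\Pi^\dagger\hat\Pi+p_s^2\hat\Phi^\dagger\hat\Phi$ still being normal ordered. All these operators are defined on the dense domain of finite linear combinations of Slater states over $\Omega$. **Theorem.** Assume $1+\gamma_0^C>0$ and $$|\gamma_1^C|<|1+\gamma_0^C|,\quad|\gamma_2^C|<|1+\gamma_0^C+\gamma_1^C|,\quad|\gamma_1^S|<1,\quad|\gamma_2^S|<|1+\gamma_1^S|.\qquad(*)$$ Then $H_M$ and $H_M'$ are essentially self-adjoint, and there is a unitary operator $\mathcal U$ on $\mathcal F$ such that, as identities of self-adjoint operators (closures, with equality of domains), $$\mathcal U^\dagger H_M'\,\mathcal U=\sum_s\sum_{{\bf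 p}\in\hat\Lambda_s^*}\bigl(\omega_{C;s}({\bf p})b_{C;s}^\dagger({\bf p})b_{C;s}({\bf p})+\omega_{S;s}({\bf p})b_{S;s}^\dagger({\bf p})b_{S;s}({\bf p})\bigr)+\tilde H_Q+\mathcal E^{(0)},$$ and the same identity holds for $H_M$ with $\mathcal E^{(0)}$ replaced by $\mathcal E^{(0)}-\frac{v_F}2\gamma_0^C\sum_s\sum_{{\bf p}\in\hat\Lambda_s^*}\chi({\bf p})|p_s|$. Here $$\omega_{X;\pm}({\bf p})=\begin{cases}\tilde v_F^X\sqrt{\frac12\bigl(|{\bf p}|^2\pm\sqrt{|{\bf p}|^4-A_X(2p_+p_-)^2}\bigr)}&\text{if }\gamma_2^X\chi({\bf p})p_+p_-\ne0,\\ v_F\sqrt{(1+\gamma_0^X\chi({\bf p}))^2-(\gamma_1^X\chi({\bf p}))^2}\;|p_\pm|&\text{if }\gamma_2^X\chi({\bf p})p_+p_-=0,\end{cases}$$ $A_X=1-[\gamma_2^X/(1+\gamma_0^X+\gamma_1^X)]^2$, $\tilde v_F^X=v_F\sqrt{(1+\gamma_0^X)^2-(\gamma_1^X)^2}$, $$\tilde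 H_Q=\frac{v_F\pi}{2L}\sum_X\Bigl(\sum_{s}\sum_{x\in\Lambda_{1D}}\bigl[(1+\gamma_0^X+\gamma_1^X)A_XQ_{X;+,s}(x)^2+(1+\gamma_0^X-\gamma_1^X)Q_{X;-,s}(x)^2\bigr]+\frac{\tilde a}L\sum_s\Bigl[\tfrac{(\gamma_2^X)^2}{1+\gamma_0^X+\gamma_1^X}\bigl(\sum_xQ_{X;+,s}(x)\bigr)^2+\gamma_2^X\bigl(\sum_xQ_{X;+,s}(x)\bigr)\bigl(\sum_xQ_{X;+,-s}(x)\bigr)\Bigr]\Bigr),$$ $$\mathcal E^{(0)}=\frac12\sum_s\sum_{{\bf p}\in\hat\Lambda_s^*}\bigl(\omega_{C;s}({\bf p})+\omega_{S;s}({\bf p})-2v_F|p_s|\bigr),$$ the last sum being convergent; the constants are the ground-state energies of $H_M'$ and $H_M$ respectively (the minimum of the energy, attained at an eigenvector). Moreover, if $N\ge3$ (and with no assumption on the sign of $1+\gamma_0^C$), the constraints $(*)$ hold if and only if the dispersion relations are well defined and strictly positive, $\omega_{C;s}({\bf p})>0$ and $\omega_{S;s}({\bf p})>0$ for all $s$ and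 ${\bf p}\in\hat\Lambda_s^*$. -/

import Mathlib

namespace NodalMattis

noncomputable section

/-! ### Index sets

Signs `±` (chirality `r`, Fermi-arc index `s`, spin `α`) are elements of `ℤˣ`. The system has size
`L`, the short-distance scale is `ã = L / N`, and momenta are labelled by integers: a boson momentum
component is `(2π/L) n`, a fermion momentum component is `(2π/L) (n + 1/2)`. The bound
`-π/ã ≤ · < π/ã` becomes `-N ≤ 2 n < N` for bosons and `-N ≤ 2 n + 1 < N` for fermions. -/

/-- The component `k_{-s} = (2π/L)(l + 1/2)`, `-π/ã ≤ k_{-s} < π/ã`, of a nodal fermion momentum. -/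
abbrev Perp (N : ℕ) : Type := {l : ℤ // -(N : ℤ) ≤ 2 * l + 1 ∧ 2 * l + 1 < (N : ℤ)}

/-- Fermion momenta `k ∈ Λ_s^*`, as the pair of the labels of `k_s` (unbounded) and of `k_{-s}`. -/
abbrev FMom (N : ℕ) : Type := ℤ × Perp N

/-- One-particle labels `(r, s, α, k)` of the nodal fermions. -/
@[ext] structure Mode (N : ℕ) : Type where
  r : ℤˣ
  s : ℤˣ
  α : ℤˣ
  k : FMom N

/-- Lexicographic key, used only to order the modes for the fermion signs. -/
def Mode.key {N : ℕ} (m : Mode N) : ℤ ×ₗ ℤ ×ₗ ℤ ×ₗ ℤ ×ₗ ℤ :=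
  toLex ((m.r : ℤ), toLex ((m.s : ℤ), toLex ((m.α : ℤ), toLex (m.k.1, (m.k.2 : ℤ)))))

theorem Mode.key_injective {N : ℕ} : Function.Injective (Mode.key (N := N)) := by
  intro a b h
  simp only [Mode.key, EmbeddingLike.apply_eq_iff_eq, Prod.mk.injEq] at h
  obtain ⟨h1, h2, h3, h4, h5⟩ := h
  exact Mode.ext (Units.ext h1) (Units.ext h2) (Units.ext h3) (Prod.ext h4 (Subtype.ext h5))

instance {N : ℕ} : LinearOrder (Mode N) := LinearOrder.lift' Mode.key Mode.key_injective

/-- Boson momentum labels: `p s` is the label of `p_s`, i.e. `p_s = (2π/L) (p s)`. -/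
abbrev BMom : Type := ℤˣ → ℤ

/-- `-π/ã ≤ (2π/L) n < π/ã`. -/
def InBox (N : ℕ) (n : ℤ) : Prop := -(N : ℤ) ≤ 2 * n ∧ 2 * n < (N : ℤ)

instance (N : ℕ) (n : ℤ) : Decidable (InBox N n) := inferInstanceAs (Decidable (_ ∧ _))

/-- Pairs `(s, p)` with `p ∈ Λ̂_s^*`: `p_{-s}` lies in the box and `p_s ≠ 0`. -/
abbrev HatIdx (N : ℕ) : Type := {i : ℤˣ × BMom // InBox N (i.2 (-i.1)) ∧ i.2 i.1 ≠ 0}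

/-- The labels `n` with `-N ≤ 2 n < N`. They label both the momenta `(2π/L) n` of `Λ̃_1D^*` and the
positions `ã n` of `Λ_1D`. -/
def box (N : ℕ) : Finset ℤ := (Finset.Ico (-(N : ℤ)) (N : ℤ)).filter (InBox N)

/-! ### The nodal fermion Fock space -/

/-- Algebraic Fock space: finite linear combinations of the orthonormal Slater states `|E⟩`, with `E`
the finite set of particle and hole excitations on top of the Dirac sea. -/
abbrev FockAlg (N : ℕ) : Type := Finset (Mode N) →₀ ℂ

/-- The fermion Fock space: the Hilbert space with orthonormal basis the Slater states. -/
abbrev Fock (N : ℕ) : Type := lp (fun _ : Finset (Mode N) => ℂ) 2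

/-- Operators on the algebraic Fock space. -/
abbrev Op (N : ℕ) : Type := Module.End ℂ (FockAlg N)

variable {N : ℕ}

/-- The operator with prescribed values on the Slater states. -/
def ofBasis (f : Finset (Mode N) → FockAlg N) : Op N := Finsupp.linearCombination ℂ f

/-- The Slater state `|E⟩`. -/
def ket (E : Finset (Mode N)) : FockAlg N := Finsupp.single E 1

/-- The Dirac vacuum `Ω`. -/
def vac : FockAlg N := ket ∅

/-- The vacuum expectation value `⟨Ω, A Ω⟩`. -/
def vev (A : Op N) : ℂ := (A vac) ∅

/-- The sum `∑_i T i` of a family of operators such that, for every Slater state `|E⟩`, only finitely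
many of the vectors `T i |E⟩` are non-zero. -/
def opSum {ι : Type} (T : ι → Op N) : Op N := ofBasis fun E => ∑ᶠ i, T i (ket E)

/-- The sign `(-1)^(number of excitations preceding m)`. -/
def jwSign (E : Finset (Mode N)) (m : Mode N) : ℂ := (-1) ^ (E.filter fun m' => m' < m).card

/-- Creation of the excitation `m`. -/
def excite (m : Mode N) : Op N :=
  ofBasis fun E => if m ∈ E then 0 else jwSign E m • ket (insert m E)

/-- Annihilation of the excitation `m`. -/
def deexcite (m : Mode N) : Op N :=
  ofBasis fun E => if m ∈ E then jwSign E m • ket (E.erase m) else 0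

/-- The mode is filled in the Dirac sea: `r k_s < 0`. -/
def InSea (m : Mode N) : Prop := (m.r : ℤ) * (2 * m.k.1 + 1) < 0

instance (m : Mode N) : Decidable (InSea m) := inferInstanceAs (Decidable (_ < _))

/-- Fermion annihilation operators, normalised to `{c m, c† m'} = δ_{m,m'}`; thus
`c = (2π/L) ψ̂_{r,s,α}(k)`. One has `c m Ω = 0` if `r k_s > 0` and `c† m Ω = 0` if `r k_s < 0`. -/
def c (m : Mode N) : Op N := if InSea m then excite m else deexcite m

/-- Fermion creation operators, the adjoints of `c`. -/
def cdag (m : Mode N) : Op N := if InSea m then deexcite m else excite m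

/-- The fermion normal-ordered bilinear `:c†(m₁) c(m₂):`. -/
def fermiProd (m₁ m₂ : Mode N) : Op N := cdag m₁ * c m₂ - vev (cdag m₁ * c m₂) • 1

/-- The spin-dependent density `Ĵ_{r,s,α}(p)`: the sum of `:c†_{r,s,α}(k₁) c_{r,s,α}(k₂):` over all
`k₁, k₂ ∈ Λ_s^*` with `k₁ + p = k₂ + (2πn/ã) e_{-s}` for some integer `n`. -/
def density (r s α : ℤˣ) (p : BMom) : Op N :=
  opSum fun kk : FMom N × FMom N =>
    open Classical in
    if kk.1.1 + p s = kk.2.1 ∧ ∃ n : ℤ, (kk.1.2 : ℤ) + p (-s) = kk.2.2 + n * N then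
      fermiProd ⟨r, s, α, kk.1⟩ ⟨r, s, α, kk.2⟩
    else 0

/-! ### Linear combinations of densities and boson normal ordering -/

/-- Labels `(r, s, α, p)` of the densities. -/
abbrev Lab : Type := ℤˣ × ℤˣ × ℤˣ × BMom

/-- Formal complex linear combinations of the densities. -/
abbrev LinBos : Type := Lab →₀ ℂ

/-- The density `Ĵ_{r,s,α}(p)` as a formal linear combination. -/
def gen (r s α : ℤˣ) (p : BMom) : LinBos := Finsupp.single (r, s, α, p) 1

/-- The operator of a formal linear combination of densities. -/
def op (A : LinBos) : Op N := A.sum fun i a => a • density i.1 i.2.1 i.2.2.1 i.2.2.2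

/-- The adjoint, determined by `Ĵ_{r,s,α}(p)† = Ĵ_{r,s,α}(-p)` and antilinearity. -/
def dag (A : LinBos) : LinBos :=
  A.sum fun i a => (starRingEnd ℂ a) • gen i.1 i.2.1 i.2.2.1 (-i.2.2.2)

/-- The ordinary product of two linear combinations of densities. -/
def plainProd (A B : LinBos) : Op N := op A * op B

/-- The boson normal-ordered product: the bilinear extension of
`Ĵ_{r,s,α}(p) Ĵ' ↦ Ĵ_{r,s,α}(p) Ĵ'` if `r p_s < 0` and `↦ Ĵ' Ĵ_{r,s,α}(p)` if `r p_s ≥ 0`. -/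
def normalProd (A B : LinBos) : Op N :=
  A.sum fun i a => a •
    (if (i.1 : ℤ) * i.2.2.2 i.2.1 < 0 then density i.1 i.2.1 i.2.2.1 i.2.2.2 * op B
      else op B * density i.1 i.2.1 i.2.2.1 i.2.2.2)

/-- The charge and the spin channel. -/
inductive Chan : Type
  | C
  | S

/-- Spin weight of a channel: `1` for charge, `α` for spin. -/
def Chan.weight : Chan → ℤˣ → ℂ
  | .C, _ => 1
  | .S, α => ((α : ℤ) : ℂ)

/-- `ã = L / N`. -/
def aTilde (L : ℝ) (N : ℕ) : ℝ := L / N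

/-- The momentum component with label `n`. -/
def mom (L : ℝ) (n : ℤ) : ℝ := 2 * Real.pi / L * n

/-- `Ĵ^0_{r,s}(p)` in the charge channel and `Ĵ^3_{r,s}(p)` in the spin channel. -/
def J (X : Chan) (r s : ℤˣ) (p : BMom) : LinBos := ∑ α : ℤˣ, X.weight α • gen r s α p

/-- The boson field `Φ̂_{X;s}(p)`. -/
def PhiField (L : ℝ) (N : ℕ) (X : Chan) (s : ℤˣ) (p : BMom) : LinBos :=
  ((Real.sqrt (aTilde L N / (8 * Real.pi)) : ℂ) * (1 / (Complex.I * (mom L (p s) : ℂ)))) •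
    (J X 1 s p + J X (-1) s p)

/-- The conjugate boson field `Π̂_{X;s}(p)`. -/
def PiField (L : ℝ) (N : ℕ) (X : Chan) (s : ℤˣ) (p : BMom) : LinBos :=
  (Real.sqrt (aTilde L N / (8 * Real.pi)) : ℂ) • (-J X 1 s p + J X (-1) s p)

/-- The boson annihilation operators `b_{s,α}(p)`, `p_s ≠ 0`. -/
def bSpin (L : ℝ) (N : ℕ) (s α : ℤˣ) (p : BMom) : LinBos :=
  if 0 < p s then
    (-(Complex.I / (L : ℂ)) *
      (Real.sqrt (2 * Real.pi * aTilde L N / |mom L (p s)|) : ℂ)) • gen 1 s α p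
  else
    ((Complex.I / (L : ℂ)) *
      (Real.sqrt (2 * Real.pi * aTilde L N / |mom L (p s)|) : ℂ)) • gen (-1) s α p

/-- The charge and spin boson annihilation operators `b_{X;s}(p) = (b_{s,↑}(p) ± b_{s,↓}(p))/√2`. -/
def b (L : ℝ) (N : ℕ) (X : Chan) (s : ℤˣ) (p : BMom) : LinBos :=
  (1 / (Real.sqrt 2 : ℂ)) • ∑ α : ℤˣ, X.weight α • bSpin L N s α p

/-! ### Zero modes -/

/-- The momentum with `p_s = 0` and `p_{-s}` labelled by `n`. -/
def transverse (s : ℤˣ) (n : ℤ) : BMom := fun t => if t = s then 0 else n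

/-- `N̂_{r,s,α}(p_{-s})`. -/
def zeroModeHat (L : ℝ) (N : ℕ) (r s α : ℤˣ) (n : ℤ) : LinBos :=
  (Real.sqrt (aTilde L N / (2 * Real.pi)) : ℂ) • gen r s α (transverse s n)

/-- `N_{r,s,α}(x)` for `x = ã j`. -/
def zeroMode (L : ℝ) (N : ℕ) (r s α : ℤˣ) (j : ℤ) : LinBos :=
  (Real.sqrt (2 * Real.pi * aTilde L N) : ℂ) • ∑ n ∈ box N,
    ((1 / (L : ℂ)) * Complex.exp (Complex.I * (mom L n * (aTilde L N * j) : ℝ))) •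
      zeroModeHat L N r s α n

/-- `Q̂_{X;r,s}(p)`. -/
def QHat (L : ℝ) (N : ℕ) (X : Chan) (r s : ℤˣ) (n : ℤ) : LinBos :=
  (1 / (Real.sqrt 2 : ℂ)) • ∑ α : ℤˣ, X.weight α •
    (zeroModeHat L N 1 s α n + ((r : ℤ) : ℂ) • zeroModeHat L N (-1) s α n)

/-- `Q_{X;r,s}(x)` for `x = ã j`. -/
def Q (L : ℝ) (N : ℕ) (X : Chan) (r s : ℤˣ) (j : ℤ) : LinBos :=
  (1 / (Real.sqrt 2 : ℂ)) • ∑ α : ℤˣ, X.weight α •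
    (zeroMode L N 1 s α j + ((r : ℤ) : ℂ) • zeroMode L N (-1) s α j)

/-! ### The Hamiltonian -/

/-- The dimensionless couplings `γ_0^X, γ_1^X, γ_2^X` of a channel. -/
structure Coupling : Type where
  γ0 : ℝ
  γ1 : ℝ
  γ2 : ℝ

/-- The cutoff function `χ(p)`. -/
def chi (N : ℕ) (p : BMom) : ℝ := if InBox N (p 1) ∧ InBox N (p (-1)) then 1 else 0

/-- `Ξ̂_{X;s}(p)`. -/
def Xi (L : ℝ) (N : ℕ) (X : Chan) (g : Coupling) (s : ℤˣ) (p : BMom) : LinBos :=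
  if p (-s) = 0 then
    (-(1 / (Real.sqrt 2 : ℂ)) * (g.γ2 : ℂ) * Complex.I * (mom L (p s) : ℂ) * (chi N p : ℂ)) •
      QHat L N X 1 (-s) (p s)
  else 0

/-- The zero mode part `H_{X;z.m.}`. -/
def zeroModeHam (L vF : ℝ) (N : ℕ) (X : Chan) (g : Coupling) : Op N :=
  ((vF / 2 * (2 * Real.pi / L) ^ 2 : ℝ) : ℂ) •
    ((opSum fun i : HatIdx N =>
        normalProd (dag (Xi L N X g i.1.1 i.1.2)) (PhiField L N X i.1.1 i.1.2) +
          normalProd (dag (PhiField L N X i.1.1 i.1.2)) (Xi L N X g i.1.1 i.1.2)) +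
      (1 / 2 : ℂ) • (∑ r : ℤˣ, ∑ s : ℤˣ, ∑ n ∈ box N,
        ((1 + g.γ0 + (r : ℤ) * g.γ1 : ℝ) : ℂ) •
          plainProd (dag (QHat L N X r s n)) (QHat L N X r s n)) +
      (g.γ2 : ℂ) • plainProd (QHat L N X 1 1 0) (QHat L N X 1 (-1) 0))

/-- The Hamiltonian `H_X` of a channel. The product `P` is the one used in the interaction terms (those
with a coupling constant); the free terms are always boson normal ordered. With `P = normalProd` the
whole expression is boson normal ordered. -/
def chanHam (P : LinBos → LinBos → Op N) (L vF : ℝ) (X : Chan) (g : Coupling) : Op N :=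
  ((vF / 2 : ℝ) : ℂ) • (opSum fun i : HatIdx N =>
      let s := i.1.1
      let p := i.1.2
      (((2 * Real.pi / L) ^ 2 : ℝ) : ℂ) •
        (normalProd (dag (PiField L N X s p)) (PiField L N X s p) +
          ((mom L (p s) ^ 2 : ℝ) : ℂ) • normalProd (dag (PhiField L N X s p)) (PhiField L N X s p) +
          (chi N p : ℂ) •
            (((g.γ0 - g.γ1 : ℝ) : ℂ) • P (dag (PiField L N X s p)) (PiField L N X s p) +
              (((g.γ0 + g.γ1) * mom L (p s) ^ 2 : ℝ) : ℂ) •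
                P (dag (PhiField L N X s p)) (PhiField L N X s p) +
              ((g.γ2 * (mom L (p 1) * mom L (p (-1))) : ℝ) : ℂ) •
                P (dag (PhiField L N X s p)) (PhiField L N X (-s) p)))) +
    zeroModeHam L vF N X g

/-- The spinfull Mattis Hamiltonian `H_M = H_C + H_S`. -/
def mattisHam (P : LinBos → LinBos → Op N) (L vF : ℝ) (gC gS : Coupling) : Op N :=
  chanHam P L vF .C gC + chanHam P L vF .S gS

/-! ### The diagonal form -/

/-- `A_X`. -/
def Coupling.A (g : Coupling) : ℝ := 1 - (g.γ2 / (1 + g.γ0 + g.γ1)) ^ 2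

/-- The renormalised velocity `ṽ_F^X`. -/
def Coupling.vTilde (g : Coupling) (vF : ℝ) : ℝ := vF * Real.sqrt ((1 + g.γ0) ^ 2 - g.γ1 ^ 2)

/-- The dispersion relation `ω_{X;s}(p)`. -/
def omega (L vF : ℝ) (N : ℕ) (g : Coupling) (s : ℤˣ) (p : BMom) : ℝ :=
  let pp := mom L (p 1)
  let pm := mom L (p (-1))
  if g.γ2 * chi N p * (pp * pm) ≠ 0 then
    g.vTilde vF * Real.sqrt (1 / 2 * ((pp ^ 2 + pm ^ 2) +
      (s : ℤ) * Real.sqrt ((pp ^ 2 + pm ^ 2) ^ 2 - g.A * (2 * (pp * pm)) ^ 2)))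
  else
    vF * Real.sqrt ((1 + g.γ0 * chi N p) ^ 2 - (g.γ1 * chi N p) ^ 2) * |mom L (p s)|

/-- One channel of the bracket in `H̃_Q`. -/
def zeroModeDiag (L : ℝ) (N : ℕ) (X : Chan) (g : Coupling) : Op N :=
  let Qop : ℤˣ → ℤˣ → ℤ → Op N := fun r s j => op (Q L N X r s j)
  (∑ s : ℤˣ, ∑ j ∈ box N,
      ((((1 + g.γ0 + g.γ1) * g.A : ℝ) : ℂ) • Qop 1 s j ^ 2 +
        ((1 + g.γ0 - g.γ1 : ℝ) : ℂ) • Qop (-1) s j ^ 2)) +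
    ((aTilde L N / L : ℝ) : ℂ) • ∑ s : ℤˣ,
      (((g.γ2 ^ 2 / (1 + g.γ0 + g.γ1) : ℝ) : ℂ) • (∑ j ∈ box N, Qop 1 s j) ^ 2 +
        (g.γ2 : ℂ) • ((∑ j ∈ box N, Qop 1 s j) * ∑ j ∈ box N, Qop 1 (-s) j))

/-- `H̃_Q`. -/
def HQ (L vF : ℝ) (N : ℕ) (gC gS : Coupling) : Op N :=
  ((vF * Real.pi / (2 * L) : ℝ) : ℂ) • (zeroModeDiag L N .C gC + zeroModeDiag L N .S gS)

/-- The summand `ω_{C;s}(p) + ω_{S;s}(p) - 2 v_F |p_s|` of `2 ℰ^(0)`. -/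
def energyTerm (L vF : ℝ) (N : ℕ) (gC gS : Coupling) (i : HatIdx N) : ℝ :=
  omega L vF N gC i.1.1 i.1.2 + omega L vF N gS i.1.1 i.1.2 - 2 * vF * |mom L (i.1.2 i.1.1)|

/-- `ℰ^(0)`. -/
def energy0 (L vF : ℝ) (N : ℕ) (gC gS : Coupling) : ℝ :=
  1 / 2 * ∑' i : HatIdx N, energyTerm L vF N gC gS i

/-- The constant `(v_F/2) γ_0^C ∑_s ∑_p χ(p) |p_s|` by which boson normal ordering of the
interaction lowers the charge Hamiltonian. -/
def orderingShift (L vF : ℝ) (N : ℕ) (gC : Coupling) : ℝ :=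
  1 / 2 * ∑' i : HatIdx N, vF * gC.γ0 * chi N i.1.2 * |mom L (i.1.2 i.1.1)|

/-- The diagonal Hamiltonian: charge and spin oscillators, `H̃_Q`, and a constant. -/
def diagHam (L vF : ℝ) (N : ℕ) (gC gS : Coupling) (e : ℝ) : Op N :=
  (opSum fun i : HatIdx N =>
      (omega L vF N gC i.1.1 i.1.2 : ℂ) •
          (op (dag (b L N .C i.1.1 i.1.2)) * op (b L N .C i.1.1 i.1.2)) +
        (omega L vF N gS i.1.1 i.1.2 : ℂ) •
          (op (dag (b L N .S i.1.1 i.1.2)) * op (b L N .S i.1.1 i.1.2))) +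
    HQ L vF N gC gS + (e : ℂ) • 1

/-! ### Operators on the Hilbert space -/

/-- The inclusion of the algebraic Fock space into the Hilbert space. -/
def incl (N : ℕ) : FockAlg N →ₗ[ℂ] Fock N :=
  Finsupp.linearCombination ℂ fun E => (lp.single 2 E (1 : ℂ) : Fock N)

theorem incl_apply (v : FockAlg N) (E : Finset (Mode N)) : (incl N v : Fock N) E = v E := by
  induction v using Finsupp.induction_linear with
  | zero => simp
  | add f g hf hg => simp [hf, hg]
  | single F a =>
    simp only [incl, Finsupp.linearCombination_single, lp.coeFn_smul, Pi.smul_apply]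
    by_cases h : E = F
    · subst h; simp
    · simp [h]

theorem incl_injective : Function.Injective (incl N) := by
  intro v w h
  ext E
  rw [← incl_apply v E, ← incl_apply w E, h]

/-- An operator on the algebraic Fock space, as a densely defined operator on the Hilbert space. -/
def pmap (A : Op N) : Fock N →ₗ.[ℂ] Fock N where
  domain := LinearMap.range (incl N)
  toFun := (incl N ∘ₗ A) ∘ₗ (LinearEquiv.ofInjective (incl N) incl_injective).symm.toLinearMap

/-- Essential self-adjointness. -/
def EssSelfAdjoint (A : Op N) : Prop := (pmap A).IsClosable ∧ IsSelfAdjoint (pmap A).closure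

/-- The operator identity `U† H U = D` between the self-adjoint operators given by `H` and `D`
(the closures), domains included. -/
def Diagonalises (U : Fock N ≃ₗᵢ[ℂ] Fock N) (H D : Op N) : Prop :=
  EssSelfAdjoint H ∧ EssSelfAdjoint D ∧
    ∀ x y : Fock N, (x, y) ∈ (pmap D).closure.graph ↔ (U x, U y) ∈ (pmap H).closure.graph

/-- `e` is the ground-state energy of (the closure of) `H`: a lower bound and an eigenvalue. -/
def IsGroundEnergy (H : Op N) (e : ℝ) : Prop :=
  (∀ x : (pmap H).closure.domain,
      e * ‖(x : Fock N)‖ ^ 2 ≤ (inner ℂ (x : Fock N) ((pmap H).closure x)).re) ∧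
    ∃ x : (pmap H).closure.domain, (x : Fock N) ≠ 0 ∧
      (pmap H).closure x = (e : ℂ) • (x : Fock N)

/-- The constraints on the couplings. -/
def Constraints (gC gS : Coupling) : Prop :=
  |gC.γ1| < |1 + gC.γ0| ∧ |gC.γ2| < |1 + gC.γ0 + gC.γ1| ∧
    |gS.γ1| < 1 ∧ |gS.γ2| < |1 + gS.γ1|

end

end NodalMattis

/-! ### Operators, fermions and the energy grading on the algebraic Fock space. -/

namespace NodalMattis

noncomputable section

variable {N : ℕ}

/-! The densities are second quantisations of translations of the fermion momenta. Normal ordering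
over the Dirac sea leaves a central Schwinger term that counts the states carried across the Fermi
point (`density_lie`). Consequently the charge and spin densities with p_s ≠ 0, suitably normalised,
are independent harmonic oscillators (`osc`, `oscDag`), while those with p_s = 0 commute with all
densities and annihilate Ω.

Written in oscillators, the Hamiltonian is quadratic. Outside the cutoff it is a sum of free number
operators. Inside there are finitely many oscillators, coupled in pairs (s, p), (-s, p), and for
momenta on an axis there is a linear coupling to the zero modes. Completing the square replaces each
field φ by φ - y with y a commuting zero mode operator, and the square of y that has to be
subtracted produces the factor A_X in the zero mode energy (`chanHam_plain`). Combining p and -p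
with coefficients (1 ± i)/2 makes all fields and shifts symmetric.

What remains is a finite system of coupled oscillators: rescale the fields so that all masses agree,
rotate by an orthogonal matrix, then squeeze each mode to its frequency (`exists_normal_modes`). For
a pair the rescaled potential is a 2×2 matrix with trace v²|p|² and determinant v⁴ A_X (p₊p₋)²,
where v is the renormalised velocity; its eigenvalues are the squares of ω_±, and
`exists_mode_angle` gives the rotation. The rotation comes from equality of Gram matrices
(`exists_rotation`). A squeezing with an operator-valued shift is built from explicit coefficient
sequences of squeezed number states over joint vacuum and shift eigenvectors; it is onto because the
transposed matrix is, up to a factor, the inverse squeezing (`exists_squeeze`).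

Domains are controlled by the relation `Transforms`, which says only that U maps the graph of the
new operator on Slater combinations into the closed graph of the old one. This suffices: the
diagonal operator preserves the finite-dimensional levels, so it has an eigenbasis of Slater
combinations; U carries it to an eigenbasis inside the closed graph of a symmetric operator, and
such an operator has a self-adjoint closure diagonal in that basis (`Transforms.diagonalises`).

The ground-state energy is the constant of the diagonal form, since the other terms are nonnegative
(here 1 + γ_0^C > 0 enters) and annihilate Ω. Boson normal ordering of the interaction changes the
Hamiltonian by a constant only. Conversely, positivity of the dispersion relations at two momenta
already forces the constraints (`constraint_of_omega_pos`). -/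

instance : Ring (Op N) := Module.End.instRing

/-! ### Locally finite sums of operators -/

theorem ofBasis_ket (f : Finset (Mode N) → FockAlg N) (E : Finset (Mode N)) :
    ofBasis f (ket E) = f E := by
  simp [ofBasis, ket]

theorem op_ext {A B : Op N} (h : ∀ E, A (ket E) = B (ket E)) : A = B := by
  refine Finsupp.lhom_ext fun E a => ?_
  have : (Finsupp.single E a : FockAlg N) = a • ket E := by simp [ket]
  rw [this, map_smul, map_smul, h]

theorem ket_induction {p : FockAlg N → Prop} (v : FockAlg N) (h0 : p 0)
    (hadd : ∀ x y, p x → p y → p (x + y)) (hket : ∀ (a : ℂ) E, p (a • ket E)) : p v := by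
  induction v using Finsupp.induction_linear with
  | zero => exact h0
  | add f g hf hg => exact hadd f g hf hg
  | single E a => simpa [ket] using hket a E

/-- On every Slater state only finitely many members of the family do not vanish. -/
def LocFin {ι : Type} (T : ι → Op N) : Prop := ∀ E, {i | T i (ket E) ≠ 0}.Finite

section LocFin

variable {ι κ : Type} {T S : ι → Op N}

theorem LocFin.finite (hT : LocFin T) (v : FockAlg N) : {i | T i v ≠ 0}.Finite := by
  induction v using ket_induction with
  | h0 => simp
  | hadd x y hx hy =>
    refine (hx.union hy).subset fun i hi => ?_
    by_contra hcon
    simp only [Set.mem_union, Set.mem_ofPred_eq, not_or, not_not] at hcon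
    exact hi (by rw [map_add, hcon.1, hcon.2, add_zero])
  | hket a E =>
    refine (hT E).subset fun i hi h => hi ?_
    rw [map_smul, h, smul_zero]

/-- The defining formula concerns Slater states only; local finiteness makes `finsum` additive,
which extends it to all vectors. -/
theorem opSum_apply (hT : LocFin T) (v : FockAlg N) : opSum T v = ∑ᶠ i, T i v := by
  induction v using ket_induction with
  | h0 => simp
  | hadd x y hx hy =>
    rw [map_add, hx, hy, ← finsum_add_distrib (hT.finite x) (hT.finite y)]
    simp
  | hket a E =>
    rw [map_smul, opSum, ofBasis_ket, smul_finsum]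
    simp

theorem opSum_apply_eq_sum (hT : LocFin T) (v : FockAlg N) {s : Finset ι}
    (hs : ∀ i, T i v ≠ 0 → i ∈ s) : opSum T v = ∑ i ∈ s, T i v := by
  rw [opSum_apply hT]
  exact finsum_eq_sum_of_support_subset _ fun i hi => hs i hi

theorem LocFin.mul_left (hT : LocFin T) (A : Op N) : LocFin fun i => A * T i := fun E =>
  (hT E).subset fun i hi h => hi (by simp [h])

theorem LocFin.mul_right (hT : LocFin T) (A : Op N) : LocFin fun i => T i * A := fun E =>
  (hT.finite (A (ket E))).subset fun i hi h => hi (by simpa using h)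

theorem LocFin.add (hT : LocFin T) (hS : LocFin S) : LocFin fun i => T i + S i := fun E =>
  ((hT E).union (hS E)).subset fun i hi => by
    by_contra hcon
    simp only [Set.mem_union, Set.mem_ofPred_eq, not_or, not_not] at hcon
    exact hi (by simp [hcon.1, hcon.2])

theorem LocFin.smul (hT : LocFin T) (a : ι → ℂ) : LocFin fun i => a i • T i := fun E =>
  (hT E).subset fun i hi h => hi (by simp [h])

theorem LocFin.neg (hT : LocFin T) : LocFin fun i => -T i := fun E =>
  (hT E).subset fun i hi h => hi (by simp [h])

theorem LocFin.sub (hT : LocFin T) (hS : LocFin S) : LocFin fun i => T i - S i := by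
  simpa only [sub_eq_add_neg] using hT.add hS.neg

theorem LocFin.comp (hT : LocFin T) {f : κ → ι} (hf : Function.Injective f) :
    LocFin fun j => T (f j) := fun E => (hT E).preimage hf.injOn

theorem LocFin.of_support {s : Set ι} (hs : s.Finite) (h : ∀ i ∉ s, T i = 0) : LocFin T :=
  fun E => hs.subset fun i hi => by
    by_contra hcon
    exact hi (by simp [h i hcon])

theorem opSum_add (hT : LocFin T) (hS : LocFin S) :
    opSum (fun i => T i + S i) = opSum T + opSum S := by
  refine LinearMap.ext fun v => ?_
  rw [LinearMap.add_apply, opSum_apply hT, opSum_apply hS, opSum_apply (hT.add hS),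
    ← finsum_add_distrib (hT.finite v) (hS.finite v)]
  simp

theorem opSum_neg (hT : LocFin T) : opSum (fun i => -T i) = -opSum T := by
  refine LinearMap.ext fun v => ?_
  rw [LinearMap.neg_apply, opSum_apply hT, opSum_apply hT.neg, ← finsum_neg_distrib]
  simp

theorem opSum_sub (hT : LocFin T) (hS : LocFin S) :
    opSum (fun i => T i - S i) = opSum T - opSum S := by
  have h : opSum T - opSum S = opSum T + -opSum S := sub_eq_add_neg _ _
  rw [h, ← opSum_neg hS, ← opSum_add hT hS.neg]
  exact congrArg opSum (funext fun i => sub_eq_add_neg _ _)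

theorem mul_opSum (hT : LocFin T) (A : Op N) : A * opSum T = opSum fun i => A * T i := by
  refine LinearMap.ext fun v => ?_
  rw [Module.End.mul_apply, opSum_apply hT, opSum_apply (hT.mul_left A)]
  have := A.toAddMonoidHom.map_finsum (f := fun i => T i v) (hT.finite v)
  simpa using this

theorem opSum_mul (hT : LocFin T) (A : Op N) : opSum T * A = opSum fun i => T i * A := by
  refine LinearMap.ext fun v => ?_
  rw [Module.End.mul_apply, opSum_apply hT, opSum_apply (hT.mul_right A)]
  simp

theorem smul_opSum (hT : LocFin T) (a : ℂ) : a • opSum T = opSum fun i => a • T i := by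
  have := mul_opSum hT (a • (1 : Op N))
  simpa using this

theorem opSum_lie (hT : LocFin T) (A : Op N) : ⁅opSum T, A⁆ = opSum fun i => ⁅T i, A⁆ := by
  simp only [Ring.lie_def]
  rw [opSum_sub (hT.mul_right A) (hT.mul_left A), opSum_mul hT, mul_opSum hT]

theorem lie_opSum (hT : LocFin T) (A : Op N) : ⁅A, opSum T⁆ = opSum fun i => ⁅A, T i⁆ := by
  simp only [Ring.lie_def]
  rw [opSum_sub (hT.mul_left A) (hT.mul_right A), opSum_mul hT, mul_opSum hT]

theorem LocFin.lie (hT : LocFin T) (A : Op N) : LocFin fun i => ⁅A, T i⁆ := by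
  simp only [Ring.lie_def]
  exact (hT.mul_left A).sub (hT.mul_right A)

theorem opSum_congr (h : ∀ i, T i = S i) : opSum T = opSum S := by
  rw [funext h]

theorem opSum_comp_equiv (e : κ ≃ ι) (T : ι → Op N) : opSum (fun j => T (e j)) = opSum T := by
  refine op_ext fun E => ?_
  rw [opSum, opSum, ofBasis_ket, ofBasis_ket]
  exact finsum_comp_equiv e (f := fun i => T i (ket E))

theorem opSum_eq_sum {s : Finset ι} (h : ∀ i ∉ s, T i = 0) : opSum T = ∑ i ∈ s, T i := by
  refine op_ext fun E => ?_
  rw [opSum, ofBasis_ket, LinearMap.sum_apply]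
  refine finsum_eq_sum_of_support_subset _ fun i hi => ?_
  by_contra hcon
  exact hi (by simp [h i hcon])

theorem opSum_commute (hT : LocFin T) {A : Op N} (h : ∀ i, Commute (T i) A) :
    Commute (opSum T) A := by
  change opSum T * A = A * opSum T
  rw [opSum_mul hT, mul_opSum hT]
  exact opSum_congr h

end LocFin

/-! ### The inner product of the algebraic Fock space -/

/-- The norm is pulled back along `incl`, so that norms and formal adjoints on the algebraic space
are those of the Hilbert space. -/
instance : NormedAddCommGroup (FockAlg N) :=
  NormedAddCommGroup.induced (FockAlg N) (Fock N) (incl N) incl_injective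

instance : InnerProductSpace ℂ (FockAlg N) where
  norm_smul_le a x := by
    change ‖incl N (a • x)‖ ≤ ‖a‖ * ‖incl N x‖
    rw [map_smul, norm_smul]
  inner x y := inner ℂ (incl N x) (incl N y)
  norm_sq_eq_re_inner x := norm_sq_eq_re_inner (𝕜 := ℂ) (incl N x)
  conj_inner_symm x y := inner_conj_symm (incl N x) (incl N y)
  add_left x y z := by rw [map_add, inner_add_left]
  smul_left x y a := by rw [map_smul, inner_smul_left]

theorem inner_incl (x y : FockAlg N) : inner ℂ (incl N x) (incl N y) = inner ℂ x y := rfl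

theorem norm_incl (x : FockAlg N) : ‖incl N x‖ = ‖x‖ := rfl

theorem incl_ket (E : Finset (Mode N)) : incl N (ket E) = lp.single 2 E (1 : ℂ) := by
  simp [incl, ket]

theorem ket_inner (E : Finset (Mode N)) (x : FockAlg N) : inner ℂ (ket E) x = x E := by
  rw [← inner_incl, incl_ket]
  rw [lp.inner_single_left]
  simp [incl_apply]

theorem ket_apply (E F : Finset (Mode N)) : (ket E : FockAlg N) F = if E = F then 1 else 0 := by
  simp [ket, Finsupp.single_apply]

theorem ext_inner_ket {x y : FockAlg N} (h : ∀ E, inner ℂ (ket E) x = inner ℂ (ket E) y) :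
    x = y := by
  ext E
  rw [← ket_inner, h, ket_inner]

/-- `B` is a formal adjoint of `A` on the algebraic Fock space. -/
def IsAdj (A B : Op N) : Prop := ∀ x y : FockAlg N, inner ℂ (A x) y = inner ℂ x (B y)

namespace IsAdj

variable {A B A' B' : Op N}

theorem symm (h : IsAdj A B) : IsAdj B A := fun x y => by
  rw [← inner_conj_symm, ← h, inner_conj_symm]

theorem of_ket (h : ∀ E F, inner ℂ (A (ket E)) (ket F) = inner ℂ (ket E) (B (ket F))) :
    IsAdj A B := fun x y => by
  induction x using ket_induction with
  | h0 => simp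
  | hadd x x' hx hx' => rw [map_add, inner_add_left, inner_add_left, hx, hx']
  | hket a E =>
    rw [map_smul, inner_smul_left, inner_smul_left]
    congr 1
    induction y using ket_induction with
    | h0 => simp
    | hadd x x' hx hx' => rw [map_add, inner_add_right, inner_add_right, hx, hx']
    | hket a E => rw [map_smul, inner_smul_right, inner_smul_right, h]

theorem add (h : IsAdj A B) (h' : IsAdj A' B') : IsAdj (A + A') (B + B') := fun x y => by
  simp only [LinearMap.add_apply, inner_add_left, inner_add_right, h x y, h' x y]

theorem neg (h : IsAdj A B) : IsAdj (-A) (-B) := fun x y => by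
  simp only [LinearMap.neg_apply, inner_neg_left, inner_neg_right, h x y]

theorem sub (h : IsAdj A B) (h' : IsAdj A' B') : IsAdj (A - A') (B - B') := by
  simpa only [sub_eq_add_neg] using h.add h'.neg

theorem mul (h : IsAdj A B) (h' : IsAdj A' B') : IsAdj (A * A') (B' * B) := fun x y => by
  simp only [Module.End.mul_apply, h _ y, h' x]

theorem smul (h : IsAdj A B) (a : ℂ) : IsAdj (a • A) (starRingEnd ℂ a • B) := fun x y => by
  simp only [LinearMap.smul_apply, inner_smul_left, inner_smul_right, h x y]

theorem zero : IsAdj (0 : Op N) 0 := fun x y => by simp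

theorem one : IsAdj (1 : Op N) 1 := fun x y => by simp

theorem smul_real (h : IsAdj A B) (a : ℝ) : IsAdj ((a : ℂ) • A) ((a : ℂ) • B) := by
  simpa using h.smul (a : ℂ)

theorem sum {ι : Type*} {s : Finset ι} {T S : ι → Op N} (h : ∀ i ∈ s, IsAdj (T i) (S i)) :
    IsAdj (∑ i ∈ s, T i) (∑ i ∈ s, S i) := fun x y => by
  rw [LinearMap.sum_apply, LinearMap.sum_apply, sum_inner, inner_sum]
  exact Finset.sum_congr rfl fun i hi => h i hi x y

theorem opSum {ι : Type} {T S : ι → Op N} (hT : LocFin T) (hS : LocFin S)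
    (h : ∀ i, IsAdj (T i) (S i)) : IsAdj (opSum T) (opSum S) := fun x y => by
  classical
  have hs := (hT.finite x).union (hS.finite y)
  rw [opSum_apply_eq_sum hT x (s := hs.toFinset) fun i hi => by simp [hi],
    opSum_apply_eq_sum hS y (s := hs.toFinset) fun i hi => by simp [hi], sum_inner, inner_sum]
  exact Finset.sum_congr rfl fun i _ => h i x y

/-- Pairing with Slater states reads off coordinates. Uniqueness is used below to obtain relations
between adjoints by taking adjoints of known relations. -/
theorem unique (h : IsAdj A B) (h' : IsAdj A B') : B = B' :=
  LinearMap.ext fun y => ext_inner_ket fun E => by rw [← h, ← h']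

end IsAdj

/-! ### Canonical anticommutation relations -/

theorem excite_ket (m : Mode N) (E : Finset (Mode N)) :
    excite m (ket E) = if m ∈ E then 0 else jwSign E m • ket (insert m E) := ofBasis_ket _ _

theorem deexcite_ket (m : Mode N) (E : Finset (Mode N)) :
    deexcite m (ket E) = if m ∈ E then jwSign E m • ket (E.erase m) else 0 := ofBasis_ket _ _

theorem jwSign_mul_self (E : Finset (Mode N)) (m : Mode N) : jwSign E m * jwSign E m = 1 := by
  rw [jwSign, ← mul_pow]
  simp

theorem jwSign_insert {E : Finset (Mode N)} {m m' : Mode N} (h : m' ∉ E) :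
    jwSign (insert m' E) m = (if m' < m then -1 else 1) * jwSign E m := by
  rw [jwSign, jwSign, Finset.filter_insert]
  split_ifs with h1
  · rw [Finset.card_insert_of_notMem (by simp [h]), pow_succ]
    ring
  · simp

theorem jwSign_erase {E : Finset (Mode N)} {m m' : Mode N} (h : m' ∈ E) :
    jwSign (E.erase m') m = (if m' < m then -1 else 1) * jwSign E m := by
  conv_rhs => rw [← Finset.insert_erase h]
  rw [jwSign_insert (by simp)]
  split_ifs <;> ring

theorem excite_adj (m : Mode N) : IsAdj (excite m) (deexcite m) := by
  refine IsAdj.of_ket fun E F => ?_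
  rw [ket_inner, ← inner_conj_symm, ket_inner, excite_ket, deexcite_ket]
  by_cases hE : m ∈ E <;> by_cases hF : m ∈ F
  · have : F.erase m ≠ E := by
      rintro rfl
      simp at hE
    simp [hE, hF, ket_apply, this]
  · simp [hE, hF]
  · rw [if_neg hE, if_pos hF]
    by_cases h : insert m E = F
    · subst h
      have hs : jwSign (insert m E) m = jwSign E m := by simp [jwSign_insert hE]
      rw [Finset.erase_insert hE, hs]
      simp [jwSign, ket_apply]
    · have h' : F.erase m ≠ E := by
        rintro rfl
        exact h (Finset.insert_erase hF)
      simp [ket_apply, h, h']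
  · have : insert m E ≠ F := by
      rintro rfl
      simp at hF
    simp [hE, hF, ket_apply, this]

/-- Both orders produce the same set of excitations, and of two distinct modes exactly one precedes
the other, so the two signs are opposite. -/
theorem excite_excite (m m' : Mode N) : excite m * excite m' + excite m' * excite m = 0 := by
  refine op_ext fun E => ?_
  simp only [LinearMap.add_apply, Module.End.mul_apply, LinearMap.zero_apply, excite_ket]
  by_cases hm : m ∈ E <;> by_cases hm' : m' ∈ E
  · simp [hm, hm']
  · simp [hm, hm', excite_ket]
  · simp [hm, hm', excite_ket]
  · rcases eq_or_ne m m' with rfl | hne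
    · simp [hm, excite_ket]
    · simp only [hm, hm', if_false, map_smul, excite_ket, Finset.mem_insert, hne, hne.symm,
        or_self, jwSign_insert hm, jwSign_insert hm', smul_smul, Finset.insert_comm m m', ← add_smul]
      rcases lt_or_gt_of_ne hne with h | h
      · simp [h, h.not_gt, mul_comm]
      · simp [h, h.not_gt, mul_comm]

theorem deexcite_deexcite (m m' : Mode N) :
    deexcite m * deexcite m' + deexcite m' * deexcite m = 0 := by
  have h := ((excite_adj m').mul (excite_adj m)).add ((excite_adj m).mul (excite_adj m'))
  rw [excite_excite] at h
  exact (h.unique IsAdj.zero)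

theorem excite_deexcite (m m' : Mode N) :
    excite m * deexcite m' + deexcite m' * excite m = if m = m' then 1 else 0 := by
  refine op_ext fun E => ?_
  simp only [LinearMap.add_apply, Module.End.mul_apply, excite_ket, deexcite_ket]
  rcases eq_or_ne m m' with rfl | hne
  · by_cases hm : m ∈ E
    · simp [hm, excite_ket, jwSign_erase hm, smul_smul, jwSign_mul_self]
    · simp [hm, deexcite_ket, jwSign_insert hm, smul_smul, jwSign_mul_self]
  · by_cases hm : m ∈ E <;> by_cases hm' : m' ∈ E
    · simp [hm, hm', hne, excite_ket]
    · simp [hm, hm', hne]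
    · simp only [hm, hm', if_true, if_false, map_smul, excite_ket, deexcite_ket, hne, hne.symm,
        Finset.mem_insert, Finset.mem_erase, and_false, or_true, jwSign_erase hm',
        jwSign_insert hm, smul_smul, LinearMap.zero_apply, Finset.erase_insert_of_ne hne,
        ← add_smul]
      rcases lt_or_gt_of_ne hne with h | h
      · simp [h, h.not_gt, mul_comm]
      · simp [h, h.not_gt, mul_comm]
    · simp [hm, hm', hne, hne.symm, deexcite_ket]

theorem deexcite_excite (m m' : Mode N) :
    deexcite m * excite m' + excite m' * deexcite m = if m = m' then 1 else 0 := by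
  rw [add_comm, excite_deexcite]
  simp only [eq_comm]

/-- The particle-hole transformation respects the relations: two modes on the same side of the Fermi
point obey those of the excitations, and two modes on different sides are distinct, so the Kronecker
delta vanishes. -/
theorem c_c (m m' : Mode N) : c m * c m' + c m' * c m = 0 := by
  unfold c
  split_ifs with h h' h'
  · exact excite_excite m m'
  · rw [excite_deexcite, if_neg (by rintro rfl; contradiction)]
  · rw [deexcite_excite, if_neg (by rintro rfl; contradiction)]
  · exact deexcite_deexcite m m'

theorem cdag_cdag (m m' : Mode N) : cdag m * cdag m' + cdag m' * cdag m = 0 := by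
  unfold cdag
  split_ifs with h h' h'
  · exact deexcite_deexcite m m'
  · rw [deexcite_excite, if_neg (by rintro rfl; contradiction)]
  · rw [excite_deexcite, if_neg (by rintro rfl; contradiction)]
  · exact excite_excite m m'

theorem c_cdag (m m' : Mode N) :
    c m * cdag m' + cdag m' * c m = if m = m' then 1 else 0 := by
  unfold c cdag
  split_ifs with h h' hm hm h' hm hm
  · rw [excite_deexcite, if_pos hm]
  · rw [excite_deexcite, if_neg hm]
  · exact absurd (hm ▸ h) h'
  · rw [excite_excite]
  · exact absurd (hm ▸ h') h
  · rw [deexcite_deexcite]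
  · rw [deexcite_excite, if_pos hm]
  · rw [deexcite_excite, if_neg hm]

theorem c_adj (m : Mode N) : IsAdj (c m) (cdag m) := by
  unfold c cdag
  split_ifs
  · exact excite_adj m
  · exact (excite_adj m).symm

/-! ### The energy grading -/

/-- Twice the kinetic energy of a Slater state, in units of `2π/L`. -/
def level (E : Finset (Mode N)) : ℤ := ∑ m ∈ E, |2 * m.k.1 + 1|

/-- The vectors of level `n`. -/
def V (N : ℕ) (n : ℤ) : Submodule ℂ (FockAlg N) := Finsupp.supported ℂ ℂ {E | level E = n}

theorem ket_mem_V (E : Finset (Mode N)) : ket E ∈ V N (level E) :=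
  Finsupp.single_mem_supported ℂ _ rfl

theorem level_nonneg (E : Finset (Mode N)) : 0 ≤ level E := Finset.sum_nonneg fun _ _ => abs_nonneg _

theorem V_eq_bot {n : ℤ} (hn : n < 0) : V N n = ⊥ := by
  have : {E : Finset (Mode N) | level E = n} = ∅ := by
    ext E
    have := level_nonneg E
    simp only [Set.mem_ofPred_eq, Set.mem_empty_iff_false, iff_false]
    omega
  rw [V, this, Finsupp.supported_empty]

instance : Finite (Perp N) := by
  refine Set.Finite.to_subtype ((Set.finite_Icc (-(N : ℤ)) N).subset ?_)
  rintro l ⟨h1, h2⟩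
  constructor <;> omega

theorem finite_modes (n : ℤ) : {m : Mode N | |2 * m.k.1 + 1| ≤ n}.Finite := by
  have hk : {k : FMom N | |2 * k.1 + 1| ≤ n}.Finite := by
    refine ((Set.finite_Icc (-n - 1) n).prod (Set.finite_univ (α := Perp N))).subset ?_
    rintro ⟨k, l⟩ h
    simp only [Set.mem_ofPred_eq, abs_le] at h
    simp only [Set.mem_prod, Set.mem_Icc, Set.mem_univ, and_true]
    omega
  have h := ((Set.finite_univ (α := ℤˣ × ℤˣ × ℤˣ)).prod hk).image
    fun x => (⟨x.1.1, x.1.2.1, x.1.2.2, x.2⟩ : Mode N)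
  refine h.subset fun m hm => ⟨((m.r, m.s, m.α), m.k), ⟨trivial, hm⟩, rfl⟩

/-- A mode occurring in a state of level n has |2k + 1| ≤ n, and there are finitely many such modes
because the transverse momenta are finite in number. The finite-dimensional levels carry both the
spectral theorem and the spanning arguments below. -/
theorem finite_level (n : ℤ) : {E : Finset (Mode N) | level E = n}.Finite := by
  refine ((finite_modes (N := N) n).toFinset.powerset.finite_toSet).subset fun E hE => ?_
  simp only [Finset.mem_coe, Finset.mem_powerset]
  intro m hm
  simp only [Set.Finite.mem_toFinset, Set.mem_ofPred_eq] at hE ⊢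
  rw [← hE]
  exact Finset.single_le_sum (f := fun m : Mode N => |2 * m.k.1 + 1|)
    (fun _ _ => abs_nonneg _) hm

instance (n : ℤ) : FiniteDimensional ℂ (V N n) := by
  have := (finite_level (N := N) n).to_subtype
  exact (Finsupp.supportedEquivFinsupp (M := ℂ) (R := ℂ) {E | level E = n}).symm.finiteDimensional

theorem iSup_V : ⨆ n, V N n = ⊤ := by
  refine (Submodule.eq_top_iff'.2 fun v => ?_)
  induction v using ket_induction with
  | h0 => exact zero_mem _
  | hadd x y hx hy => exact add_mem hx hy
  | hket a E => exact Submodule.smul_mem _ _ (Submodule.mem_iSup_of_mem _ (ket_mem_V E))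

theorem V_orthogonal {n n' : ℤ} (h : n ≠ n') {x y : FockAlg N} (hx : x ∈ V N n)
    (hy : y ∈ V N n') : inner ℂ x y = 0 := by
  have hx' : x = x.sum fun E a => a • ket E := by
    conv_lhs => rw [← Finsupp.sum_single x]
    simp [ket]
  rw [hx', Finsupp.sum, sum_inner]
  refine Finset.sum_eq_zero fun E hE => ?_
  rw [inner_smul_left, ket_inner]
  have h1 : level E = n := (Finsupp.mem_supported ℂ x).1 hx hE
  have h2 : y E = 0 := by
    by_contra h0
    exact h (h1.symm.trans ((Finsupp.mem_supported ℂ y).1 hy (Finsupp.mem_support_iff.2 h0)))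
  rw [h2, mul_zero]

/-- The operator `A` shifts the level by `d`. -/
def Graded (A : Op N) (d : ℤ) : Prop := ∀ n, ∀ v ∈ V N n, A v ∈ V N (n + d)

namespace Graded

variable {A B : Op N} {d e : ℤ}

theorem of_ket (h : ∀ E, A (ket E) ∈ V N (level E + d)) : Graded A d := fun n v hv => by
  have hv' : v = v.sum fun E a => a • ket E := by
    conv_lhs => rw [← Finsupp.sum_single v]
    simp [ket]
  rw [hv', Finsupp.sum, map_sum]
  refine Submodule.sum_mem _ fun E hE => ?_
  rw [map_smul]
  have h1 : level E = n := (Finsupp.mem_supported ℂ v).1 hv hE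
  exact Submodule.smul_mem _ _ (h1 ▸ h E)

theorem mul (hA : Graded A d) (hB : Graded B e) : Graded (A * B) (e + d) := fun n v hv => by
  rw [← add_assoc]
  exact hA _ _ (hB _ _ hv)

theorem add (hA : Graded A d) (hB : Graded B d) : Graded (A + B) d := fun n v hv =>
  add_mem (hA n v hv) (hB n v hv)

theorem sub (hA : Graded A d) (hB : Graded B d) : Graded (A - B) d := fun n v hv =>
  sub_mem (hA n v hv) (hB n v hv)

theorem smul (hA : Graded A d) (a : ℂ) : Graded (a • A) d := fun n v hv =>
  Submodule.smul_mem _ _ (hA n v hv)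

theorem zero : Graded (0 : Op N) d := fun _ _ _ => zero_mem _

theorem one : Graded (1 : Op N) 0 := fun n v hv => by simpa using hv

theorem sum {ι : Type*} {s : Finset ι} {T : ι → Op N} (h : ∀ i ∈ s, Graded (T i) d) :
    Graded (∑ i ∈ s, T i) d := fun n v hv => by
  rw [LinearMap.sum_apply]
  exact Submodule.sum_mem _ fun i hi => h i hi n v hv

theorem opSum {ι : Type} {T : ι → Op N} (hT : LocFin T) (h : ∀ i, Graded (T i) d) :
    Graded (opSum T) d := fun n v hv => by
  rw [opSum_apply hT]
  exact finsum_induction (· ∈ V N (n + d)) (zero_mem _) (fun _ _ => add_mem) fun i => h i n v hv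

end Graded

theorem excite_graded (m : Mode N) : Graded (excite m) |2 * m.k.1 + 1| := by
  refine Graded.of_ket fun E => ?_
  rw [excite_ket]
  split_ifs with h
  · exact zero_mem _
  · have : level E + |2 * m.k.1 + 1| = level (insert m E) := by
      rw [level, level, Finset.sum_insert h, add_comm]
    rw [this]
    exact Submodule.smul_mem _ _ (ket_mem_V _)

theorem deexcite_graded (m : Mode N) : Graded (deexcite m) (-|2 * m.k.1 + 1|) := by
  refine Graded.of_ket fun E => ?_
  rw [deexcite_ket]
  split_ifs with h
  · have : level E + -|2 * m.k.1 + 1| = level (E.erase m) := by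
      rw [level, level, ← Finset.add_sum_erase _ _ h]
      ring
    rw [this]
    exact Submodule.smul_mem _ _ (ket_mem_V _)
  · exact zero_mem _

theorem abs_of_inSea {m : Mode N} (h : InSea m) :
    |2 * m.k.1 + 1| = -((m.r : ℤ) * (2 * m.k.1 + 1)) := by
  unfold InSea at h
  rw [← abs_of_neg h, abs_mul]
  rcases Int.units_eq_one_or m.r with hr | hr <;> simp [hr]

theorem abs_of_not_inSea {m : Mode N} (h : ¬ InSea m) :
    |2 * m.k.1 + 1| = (m.r : ℤ) * (2 * m.k.1 + 1) := by
  unfold InSea at h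
  rw [← abs_of_nonneg (not_lt.1 h), abs_mul]
  rcases Int.units_eq_one_or m.r with hr | hr <;> simp [hr]

/-- Adding a particle costs its energy and removing a hole returns it. The quantity r(2k + 1) is
negative exactly in the sea, so one formula covers both cases. -/
theorem cdag_graded (m : Mode N) : Graded (cdag m) ((m.r : ℤ) * (2 * m.k.1 + 1)) := by
  unfold cdag
  split_ifs with h
  · simpa [abs_of_inSea h] using deexcite_graded m
  · simpa [abs_of_not_inSea h] using excite_graded m

theorem c_graded (m : Mode N) : Graded (c m) (-((m.r : ℤ) * (2 * m.k.1 + 1))) := by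
  unfold c
  split_ifs with h
  · simpa [abs_of_inSea h] using excite_graded m
  · simpa [abs_of_not_inSea h] using deexcite_graded m

end

end NodalMattis

/-! ### Densities as second-quantised translations; the current algebra. -/

namespace NodalMattis

noncomputable section

variable {N : ℕ}

/-! ### Transverse momenta modulo `N` -/

/-- The window -N ≤ 2l + 1 < N consists of N consecutive integers, a complete residue system;
umklapp thereby becomes addition in `ZMod N`. -/
theorem perp_bijective (hN : Odd N) :
    Function.Bijective fun l : Perp N => (((l : ℤ) : ℤ) : ZMod N) := by
  obtain ⟨M, hM⟩ := hN
  constructor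
  · rintro ⟨l, h1, h2⟩ ⟨l', h1', h2'⟩ h
    have h' := (ZMod.intCast_eq_intCast_iff_dvd_sub l l' N).1 h
    have := Int.eq_zero_of_abs_lt_dvd h' (by rw [abs_lt]; constructor <;> omega)
    exact Subtype.ext (by dsimp only at *; omega)
  · intro z
    obtain ⟨n, rfl⟩ := ZMod.intCast_surjective z
    have h0 := Int.emod_nonneg (n + M + 1) (b := (N : ℤ)) (by omega)
    have h1 := Int.emod_lt_of_pos (n + M + 1) (b := (N : ℤ)) (by omega)
    -- With N = 2M + 1 the window runs from -(M + 1) to M - 1, so the remainder is taken after a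
    -- shift by M + 1.
    refine ⟨⟨(n + M + 1) % (N : ℤ) - (M + 1), by omega, by omega⟩, ?_⟩
    simp only [Int.cast_sub, ZMod.intCast_mod]
    push_cast
    ring

/-- The transverse momentum labels are the residues modulo `N`. -/
def perpEquiv (hN : Odd N) : Perp N ≃ ZMod N := Equiv.ofBijective _ (perp_bijective hN)

theorem perpEquiv_apply (hN : Odd N) (l : Perp N) : perpEquiv hN l = ((l : ℤ) : ZMod N) := rfl

/-- Addition of a boson momentum to a fermion momentum. -/
def shift (hN : Odd N) (s : ℤˣ) (p : BMom) : FMom N ≃ FMom N :=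
  (Equiv.addRight (p s)).prodCongr
    (((perpEquiv hN).trans (Equiv.addRight ((p (-s) : ℤ) : ZMod N))).trans (perpEquiv hN).symm)

section shift

variable (hN : Odd N) (s : ℤˣ) (p q : BMom) (k : FMom N)

theorem shift_fst : (shift hN s p k).1 = k.1 + p s := rfl

theorem shift_snd :
    perpEquiv hN (shift hN s p k).2 = perpEquiv hN k.2 + ((p (-s) : ℤ) : ZMod N) := by
  simp [shift]

theorem fmom_ext {k k' : FMom N} (h1 : k.1 = k'.1) (h2 : perpEquiv hN k.2 = perpEquiv hN k'.2) :
    k = k' := Prod.ext h1 ((perpEquiv hN).injective h2)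

theorem shift_shift : shift hN s p (shift hN s q k) = shift hN s (p + q) k := by
  refine fmom_ext hN ?_ ?_
  · simp only [shift_fst, Pi.add_apply]
    ring
  · simp only [shift_snd, Pi.add_apply, Int.cast_add]
    ring

theorem shift_neg_symm : shift hN s (-p) = (shift hN s p).symm := by
  refine Equiv.ext fun k => ?_
  rw [Equiv.eq_symm_apply, shift_shift, add_neg_cancel]
  exact fmom_ext hN (by simp [shift_fst]) (by simp [shift_snd])

theorem shift_eq_iff (k' : FMom N) :
    k' = shift hN s p k ↔
      k.1 + p s = k'.1 ∧ ∃ n : ℤ, (k.2 : ℤ) + p (-s) = k'.2 + n * N := by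
  constructor
  · rintro rfl
    refine ⟨rfl, ?_⟩
    have h := shift_snd hN s p k
    rw [perpEquiv_apply, perpEquiv_apply, ← Int.cast_add,
      ZMod.intCast_eq_intCast_iff_dvd_sub] at h
    obtain ⟨n, hn⟩ := h
    exact ⟨n, by rw [mul_comm]; omega⟩
  · rintro ⟨h1, n, hn⟩
    refine fmom_ext hN ?_ ?_
    · rw [shift_fst, h1]
    · rw [shift_snd, perpEquiv_apply, perpEquiv_apply, ← Int.cast_add, hn]
      simp

theorem shift_fixed_iff :
    shift hN s p k = k ↔ p s = 0 ∧ ((p (-s) : ℤ) : ZMod N) = 0 := by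
  constructor
  · intro h
    constructor
    · have := congrArg Prod.fst h
      rw [shift_fst] at this
      omega
    · have := congrArg (fun k => perpEquiv hN k.2) h
      simpa [shift_snd] using this
  · rintro ⟨h1, h2⟩
    exact fmom_ext hN (by simp [shift_fst, h1]) (by simp [shift_snd, h2])

end shift

theorem card_perp (hN : Odd N) : Nat.card (Perp N) = N := by
  rw [Nat.card_congr (perpEquiv hN), Nat.card_zmod]

/-! ### Normal-ordered fermion bilinears -/

theorem vev_cdag_c (m₁ m₂ : Mode N) :
    vev (cdag m₁ * c m₂) = if m₁ = m₂ ∧ InSea m₁ then 1 else 0 := by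
  rw [vev, vac, Module.End.mul_apply]
  unfold c cdag
  by_cases h2 : InSea m₂
  · rw [if_pos h2, excite_ket]
    by_cases h1 : InSea m₁
    · rw [if_pos h1]
      rcases eq_or_ne m₁ m₂ with rfl | h
      · simp [deexcite_ket, h1, jwSign, ket_apply]
        rw [Finset.filter_singleton]
        simp
      · simp [deexcite_ket, h]
    · rw [if_neg h1]
      rcases eq_or_ne m₁ m₂ with rfl | h
      · exact absurd h2 h1
      · simp [excite_ket, h, jwSign, ket_apply]
  · rw [if_neg h2, deexcite_ket]
    simp only [Finset.notMem_empty, if_false, map_zero, Finsupp.coe_zero, Pi.zero_apply]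
    rw [if_neg]
    rintro ⟨rfl, h⟩
    exact h2 h

/-- The hypothesis `h` excludes pair creation, with m₂ in the sea and m₁ outside it. For m₁ = m₂ in
the sea the subtracted expectation value is what makes the term vanish. -/
theorem fermiProd_ket_eq_zero {m₁ m₂ : Mode N} {E : Finset (Mode N)} (h1 : m₁ ∉ E) (h2 : m₂ ∉ E)
    (h : InSea m₂ → InSea m₁) : fermiProd m₁ m₂ (ket E) = 0 := by
  rw [fermiProd, vev_cdag_c]
  by_cases hs2 : InSea m₂
  · have hs1 := h hs2
    rcases eq_or_ne m₁ m₂ with rfl | hne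
    · simp [c, cdag, hs1, excite_ket, deexcite_ket, h1, smul_smul, jwSign_insert h1,
        jwSign_mul_self]
    · simp [c, cdag, hs1, hs2, excite_ket, deexcite_ket, h1, h2, hne]
  · have : ¬ (m₁ = m₂ ∧ InSea m₁) := by
      rintro ⟨rfl, h'⟩
      exact hs2 h'
    simp [c, hs2, deexcite_ket, h2, this]

/-- A translation carries only finitely many momenta across the Fermi point. -/
theorem finite_sea_change (r s α : ℤˣ) (d : ℤ) :
    {k : FMom N | ¬ InSea ⟨r, s, α, k⟩ ∧ (r : ℤ) * (2 * (k.1 + d) + 1) < 0}.Finite := by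
  refine ((Set.finite_Icc (-|d| - 1) (|d| + 1)).prod (Set.finite_univ (α := Perp N))).subset ?_
  rintro ⟨k, l⟩ ⟨h1, h2⟩
  simp only [InSea, not_lt] at h1 h2
  simp only [Set.mem_prod, Set.mem_Icc, Set.mem_univ, and_true]
  have h3 := le_abs_self d
  have h4 := neg_abs_le d
  rcases Int.units_eq_one_or r with rfl | rfl <;> push_cast at h1 h2 <;> omega

/-- The second quantisation of a translation of the fermion momenta. -/
def secondQuant (r s α : ℤˣ) (σ : FMom N ≃ FMom N) : Op N :=
  opSum fun k => fermiProd ⟨r, s, α, k⟩ ⟨r, s, α, σ k⟩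

theorem mode_injective (r s α : ℤˣ) : Function.Injective fun k : FMom N => (⟨r, s, α, k⟩ : Mode N) :=
  fun _ _ h => congrArg Mode.k h

/-- On a given state a term survives only if one of its two modes is excited or if the translation
carries k into the sea; each alternative leaves finitely many k. -/
theorem secondQuant_locFin (r s α : ℤˣ) {σ : FMom N ≃ FMom N} {d : ℤ}
    (hσ : ∀ k, (σ k).1 = k.1 + d) :
    LocFin fun k => fermiProd (⟨r, s, α, k⟩ : Mode N) ⟨r, s, α, σ k⟩ := fun E => by
  have h1 := E.finite_toSet.preimage (mode_injective (N := N) r s α).injOn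
  have h2 := E.finite_toSet.preimage ((mode_injective (N := N) r s α).comp σ.injective).injOn
  refine ((h1.union h2).union (finite_sea_change r s α d)).subset fun k hk => ?_
  by_contra hcon
  simp only [Set.mem_union, not_or] at hcon
  refine hk (fermiProd_ket_eq_zero hcon.1.1 hcon.1.2 fun h => ?_)
  by_contra h'
  refine hcon.2 ⟨h', ?_⟩
  rw [← hσ]
  exact h

/-- For every k₁ exactly one k₂ satisfies momentum conservation modulo umklapp, so the double sum is
supported on the graph of the translation. -/
theorem density_eq (hN : Odd N) (r s α : ℤˣ) (p : BMom) :
    density (N := N) r s α p = secondQuant r s α (shift hN s p) := by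
  refine op_ext fun E => ?_
  rw [density, secondQuant, opSum, opSum, ofBasis_ket, ofBasis_ket]
  set g : FMom N → FMom N × FMom N := fun k => (k, shift hN s p k) with hg
  have hinj : Function.Injective g := fun a b h => congrArg Prod.fst h
  have h2 := finsum_mem_range (f := fun kk : FMom N × FMom N =>
    fermiProd (⟨r, s, α, kk.1⟩ : Mode N) ⟨r, s, α, kk.2⟩ (ket E)) hinj
  rw [show (∑ᶠ k, fermiProd (⟨r, s, α, k⟩ : Mode N) ⟨r, s, α, shift hN s p k⟩ (ket E)) = _ from
    h2.symm]
  refine finsum_congr fun kk => ?_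
  by_cases h : kk ∈ Set.range g
  · have h' := h
    obtain ⟨k, rfl⟩ := h'
    have := (shift_eq_iff hN s p k _).1 rfl
    rw [if_pos this]
    simp [h]
  · have : ¬ (kk.1.1 + p s = kk.2.1 ∧ ∃ n : ℤ, (kk.1.2 : ℤ) + p (-s) = kk.2.2 + n * N) := by
      intro h'
      exact h ⟨kk.1, Prod.ext rfl ((shift_eq_iff hN s p kk.1 kk.2).2 h').symm⟩
    rw [if_neg this]
    simp [h]

/-! ### Commutation relations of the densities -/

theorem bilinear_lie_cdag (a b x : Mode N) :
    ⁅cdag a * c b, cdag x⁆ = if b = x then cdag a else 0 := by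
  have h1 := c_cdag b x
  have h2 := cdag_cdag x a
  rw [Ring.lie_def]
  have h3 : cdag x * (cdag a * c b) = -(cdag a * cdag x * c b) := by
    rw [← mul_assoc, eq_neg_of_add_eq_zero_left h2, neg_mul]
  rw [h3, mul_assoc, eq_sub_of_add_eq h1, sub_neg_eq_add, mul_sub, mul_assoc, sub_add_cancel]
  split_ifs <;> simp

theorem bilinear_lie_c (a b x : Mode N) :
    ⁅cdag a * c b, c x⁆ = if a = x then -c b else 0 := by
  have h1 := c_cdag x a
  have h2 := c_c b x
  rw [Ring.lie_def]
  rw [← mul_assoc, eq_sub_of_add_eq h1, mul_assoc, eq_neg_of_add_eq_zero_left h2, sub_mul]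
  rcases eq_or_ne a x with rfl | h
  · simp only [if_true]
    noncomm_ring
  · rw [if_neg h.symm, if_neg h]
    noncomm_ring

theorem fermiProd_lie (a b : Mode N) (A : Op N) : ⁅fermiProd a b, A⁆ = ⁅cdag a * c b, A⁆ := by
  simp only [fermiProd, Ring.lie_def, sub_mul, mul_sub, smul_mul_assoc, mul_smul_comm, one_mul,
    mul_one]
  abel

section commutator

variable (r s α : ℤˣ) {σ τ : FMom N ≃ FMom N} {d e : ℤ}

theorem secondQuant_lie_cdag (hσ : ∀ k, (σ k).1 = k.1 + d) (k : FMom N) :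
    ⁅secondQuant r s α σ, cdag ⟨r, s, α, k⟩⁆ = cdag ⟨r, s, α, σ.symm k⟩ := by
  rw [secondQuant, opSum_lie (secondQuant_locFin r s α hσ)]
  simp only [fermiProd_lie, bilinear_lie_cdag]
  rw [opSum_eq_sum (s := {σ.symm k})]
  · simp
  · intro i hi
    rw [if_neg]
    intro h
    refine hi ?_
    have := mode_injective r s α h
    simp [← this]

theorem secondQuant_lie_c (hσ : ∀ k, (σ k).1 = k.1 + d) (k : FMom N) :
    ⁅secondQuant r s α σ, c ⟨r, s, α, k⟩⁆ = -c ⟨r, s, α, σ k⟩ := by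
  rw [secondQuant, opSum_lie (secondQuant_locFin r s α hσ)]
  simp only [fermiProd_lie, bilinear_lie_c]
  rw [opSum_eq_sum (s := {k})]
  · simp
  · intro i hi
    rw [if_neg]
    intro h
    exact hi (by simpa using mode_injective r s α h)

theorem secondQuant_lie_of_ne (hσ : ∀ k, (σ k).1 = k.1 + d) {m₁ m₂ : Mode N}
    (h1 : (m₁.r, m₁.s, m₁.α) ≠ (r, s, α)) (h2 : (m₂.r, m₂.s, m₂.α) ≠ (r, s, α)) :
    ⁅secondQuant r s α σ, fermiProd m₁ m₂⁆ = 0 := by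
  rw [secondQuant, opSum_lie (secondQuant_locFin r s α hσ)]
  rw [opSum_eq_sum (s := ∅), Finset.sum_empty]
  intro i _
  have h3 : ⁅fermiProd (⟨r, s, α, i⟩ : Mode N) ⟨r, s, α, σ i⟩, cdag m₁⁆ = 0 := by
    rw [fermiProd_lie, bilinear_lie_cdag, if_neg]
    rintro rfl
    exact h1 rfl
  have h4 : ⁅fermiProd (⟨r, s, α, i⟩ : Mode N) ⟨r, s, α, σ i⟩, c m₂⁆ = 0 := by
    rw [fermiProd_lie, bilinear_lie_c, if_neg]
    rintro rfl
    exact h2 rfl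
  rw [Ring.lie_def, sub_eq_zero] at h3 h4 ⊢
  have : Commute (fermiProd (⟨r, s, α, i⟩ : Mode N) ⟨r, s, α, σ i⟩) (fermiProd m₁ m₂) :=
    (Commute.mul_right h3 h4).sub_right ((Commute.one_right _).smul_right _)
  exact this

/-- The derivation rule gives products that are not normal ordered; ordering them again costs the
difference of expectation values, the source of the Schwinger term. -/
theorem secondQuant_lie_fermiProd (hσ : ∀ k, (σ k).1 = k.1 + d) (k k' : FMom N) :
    ⁅secondQuant r s α σ, fermiProd (⟨r, s, α, k⟩ : Mode N) ⟨r, s, α, k'⟩⁆ =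
      fermiProd ⟨r, s, α, σ.symm k⟩ ⟨r, s, α, k'⟩ - fermiProd ⟨r, s, α, k⟩ ⟨r, s, α, σ k'⟩ +
        (vev (cdag (⟨r, s, α, σ.symm k⟩ : Mode N) * c ⟨r, s, α, k'⟩) -
          vev (cdag (⟨r, s, α, k⟩ : Mode N) * c ⟨r, s, α, σ k'⟩)) • 1 := by
  have h1 := secondQuant_lie_cdag r s α hσ k
  have h2 := secondQuant_lie_c r s α hσ k'
  have h3 : ⁅secondQuant r s α σ, fermiProd (⟨r, s, α, k⟩ : Mode N) ⟨r, s, α, k'⟩⁆ =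
      ⁅secondQuant r s α σ, cdag (⟨r, s, α, k⟩ : Mode N)⁆ * c ⟨r, s, α, k'⟩ +
        cdag ⟨r, s, α, k⟩ * ⁅secondQuant r s α σ, c (⟨r, s, α, k'⟩ : Mode N)⁆ := by
    simp only [fermiProd, Ring.lie_def, sub_mul, mul_sub, smul_mul_assoc, mul_smul_comm, one_mul,
      mul_one]
    noncomm_ring
  rw [h3, h1, h2, fermiProd, fermiProd, sub_smul]
  noncomm_ring

/-- The bilinear parts are two sums that agree after reindexing by the inverse of σ, so they cancel
and only numbers remain. These numbers must stay grouped in one sum, since for σ τ = 1 each of the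
two counts the infinite sea. -/
theorem secondQuant_lie (hσ : ∀ k, (σ k).1 = k.1 + d) (hτ : ∀ k, (τ k).1 = k.1 + e)
    (hcomm : ∀ k, σ (τ k) = τ (σ k)) :
    ⁅secondQuant r s α σ, secondQuant r s α τ⁆ =
      opSum fun k : FMom N =>
        ((if σ (τ k) = k ∧ InSea (⟨r, s, α, σ.symm k⟩ : Mode N) then (1 : ℂ) else 0) -
          if σ (τ k) = k ∧ InSea (⟨r, s, α, k⟩ : Mode N) then (1 : ℂ) else 0) • (1 : Op N) := by
  have hLτ := secondQuant_locFin r s α hτ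
  have hστ : ∀ k, ((τ.trans σ) k).1 = k.1 + (e + d) := fun k => by
    rw [Equiv.trans_apply, hσ, hτ]
    ring
  have hA := secondQuant_locFin r s α hστ
  have hB := hA.comp σ.symm.injective
  have key : ∀ k, ⁅secondQuant r s α σ, fermiProd (⟨r, s, α, k⟩ : Mode N) ⟨r, s, α, τ k⟩⁆ -
      (fermiProd (⟨r, s, α, σ.symm k⟩ : Mode N) ⟨r, s, α, (τ.trans σ) (σ.symm k)⟩ -
        fermiProd ⟨r, s, α, k⟩ ⟨r, s, α, (τ.trans σ) k⟩) =
      ((if σ (τ k) = k ∧ InSea (⟨r, s, α, σ.symm k⟩ : Mode N) then (1 : ℂ) else 0) -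
          if σ (τ k) = k ∧ InSea (⟨r, s, α, k⟩ : Mode N) then (1 : ℂ) else 0) • (1 : Op N) := by
    intro k
    have e0 : σ (τ (σ.symm k)) = τ k := by rw [hcomm, Equiv.apply_symm_apply]
    rw [secondQuant_lie_fermiProd r s α hσ, Equiv.trans_apply, Equiv.trans_apply, e0,
      vev_cdag_c, vev_cdag_c]
    have e1 : ((⟨r, s, α, σ.symm k⟩ : Mode N) = ⟨r, s, α, τ k⟩) ↔ σ (τ k) = k := by
      rw [(mode_injective r s α).eq_iff (a := σ.symm k) (b := τ k), Equiv.symm_apply_eq, eq_comm]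
    have e2 : ((⟨r, s, α, k⟩ : Mode N) = ⟨r, s, α, σ (τ k)⟩) ↔ σ (τ k) = k := by
      rw [(mode_injective r s α).eq_iff (a := k) (b := σ (τ k)), eq_comm]
    rw [if_congr (and_congr_left' e1) rfl rfl, if_congr (and_congr_left' e2) rfl rfl]
    abel
  rw [← opSum_congr key]
  -- Each of the three operator families is locally finite, so the sum may be split here.
  rw [opSum_sub (hLτ.lie _) (hB.sub hA), opSum_sub hB hA,
    opSum_comp_equiv σ.symm (fun k => fermiProd (⟨r, s, α, k⟩ : Mode N) ⟨r, s, α, (τ.trans σ) k⟩),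
    sub_self, sub_zero, ← lie_opSum hLτ]
  rfl

end commutator

/-- Within a finite window both fillings can be counted separately; the difference is the net number
of states that crosses the Fermi point, with the sign of the chirality. -/
theorem sea_count (r : ℤˣ) {d M : ℤ} (h1 : d ≤ M) (h2 : -M ≤ d) :
    (∑ z ∈ Finset.Ico (-M) M, ((if (r : ℤ) * (2 * (z - d) + 1) < 0 then (1 : ℂ) else 0) -
      if (r : ℤ) * (2 * z + 1) < 0 then (1 : ℂ) else 0)) = (r : ℤ) * d := by
  rw [Finset.sum_sub_distrib, ← Finset.sum_filter, ← Finset.sum_filter, Finset.sum_const,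
    Finset.sum_const, nsmul_one, nsmul_one]
  rcases Int.units_eq_one_or r with rfl | rfl
  · have e1 : (Finset.Ico (-M) M).filter (fun z => ((1 : ℤˣ) : ℤ) * (2 * (z - d) + 1) < 0) =
        Finset.Ico (-M) d := by
      ext z
      simp only [Finset.mem_filter, Finset.mem_Ico, Units.val_one]
      omega
    have e2 : (Finset.Ico (-M) M).filter (fun z => ((1 : ℤˣ) : ℤ) * (2 * z + 1) < 0) =
        Finset.Ico (-M) 0 := by
      ext z
      simp only [Finset.mem_filter, Finset.mem_Ico, Units.val_one]
      omega
    rw [e1, e2, Int.card_Ico, Int.card_Ico]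
    have h3 : (((d - -M).toNat : ℤ) : ℂ) = d + M := by rw [Int.toNat_of_nonneg (by omega)]; simp
    have h4 : (((0 - -M).toNat : ℤ) : ℂ) = M := by rw [Int.toNat_of_nonneg (by omega)]; simp
    rw [Int.cast_natCast] at h3 h4
    rw [h3, h4]
    simp
  · have e1 : (Finset.Ico (-M) M).filter (fun z => ((-1 : ℤˣ) : ℤ) * (2 * (z - d) + 1) < 0) =
        Finset.Ico d M := by
      ext z
      simp only [Finset.mem_filter, Finset.mem_Ico, Units.val_neg, Units.val_one]
      omega
    have e2 : (Finset.Ico (-M) M).filter (fun z => ((-1 : ℤˣ) : ℤ) * (2 * z + 1) < 0) =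
        Finset.Ico 0 M := by
      ext z
      simp only [Finset.mem_filter, Finset.mem_Ico, Units.val_neg, Units.val_one]
      omega
    rw [e1, e2, Int.card_Ico, Int.card_Ico]
    have h3 : (((M - d).toNat : ℤ) : ℂ) = M - d := by rw [Int.toNat_of_nonneg (by omega)]; simp
    have h4 : (((M - 0).toNat : ℤ) : ℂ) = M := by rw [Int.toNat_of_nonneg (by omega)]; simp
    rw [Int.cast_natCast] at h3 h4
    rw [h3, h4]
    simp

/-- The densities satisfy the commutation relations of a current algebra. -/
theorem density_lie (hN : Odd N) (r s α : ℤˣ) (p q : BMom) :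
    ⁅density (N := N) r s α p, density (N := N) r s α q⁆ =
      (if p s + q s = 0 ∧ (((p + q) (-s) : ℤ) : ZMod N) = 0 then
        (((r : ℤ) * p s : ℤ) : ℂ) * N else 0) • (1 : Op N) := by
  rw [density_eq hN, density_eq hN, secondQuant_lie r s α (d := p s) (e := q s)
    (fun k => rfl) (fun k => rfl) (fun k => by rw [shift_shift, shift_shift, add_comm])]
  simp only [shift_shift, shift_fixed_iff]
  by_cases h : p s + q s = 0 ∧ (((p + q) (-s) : ℤ) : ZMod N) = 0
  · rw [if_pos h]
    rw [Pi.add_apply p q s]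
    simp only [h, true_and, ← shift_neg_symm, and_self]
    have : Fintype (Perp N) := Fintype.ofFinite _
    set M := |p s| + 1 with hM
    have h3 := le_abs_self (p s)
    have h4 := neg_abs_le (p s)
    -- Outside this window the translation does not change membership in the sea. All transverse
    -- momenta contribute equally, whence the factor N.
    rw [opSum_eq_sum (s := Finset.Ico (-M) M ×ˢ (Finset.univ : Finset (Perp N)))]
    · rw [← Finset.sum_smul, Finset.sum_product]
      have key : ∀ (x : ℤ) (y : Perp N),
          ((if InSea (⟨r, s, α, shift hN s (-p) (x, y)⟩ : Mode N) then (1 : ℂ) else 0) -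
            if InSea (⟨r, s, α, (x, y)⟩ : Mode N) then (1 : ℂ) else 0) =
          (if (r : ℤ) * (2 * (x - p s) + 1) < 0 then (1 : ℂ) else 0) -
            if (r : ℤ) * (2 * x + 1) < 0 then (1 : ℂ) else 0 := fun x y => rfl
      simp only [key, Finset.sum_const, Finset.card_univ]
      rw [← Nat.card_eq_fintype_card, card_perp hN, ← Finset.smul_sum,
        sea_count r (d := p s) (M := M) (by omega) (by omega)]
      push_cast
      rw [nsmul_eq_mul]
      congr 1
      ring
    · rintro ⟨k, l⟩ hk
      simp only [Finset.mem_product, Finset.mem_Ico, Finset.mem_univ, and_true] at hk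
      have : InSea (⟨r, s, α, shift hN s (-p) (k, l)⟩ : Mode N) ↔
          InSea (⟨r, s, α, (k, l)⟩ : Mode N) := by
        simp only [InSea, shift_fst, Pi.neg_apply]
        rcases Int.units_eq_one_or r with rfl | rfl <;> push_cast <;> omega
      simp [this]
  · rw [if_neg h]
    rw [Pi.add_apply p q s]
    rw [opSum_eq_sum (s := ∅)]
    · simp
    · intro i _
      have h' : ∀ P : Prop, ¬ ((p s + q s = 0 ∧ (((p + q) (-s) : ℤ) : ZMod N) = 0) ∧ P) :=
        fun P hP => h hP.1
      rw [if_neg (h' _), if_neg (h' _)]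
      simp

theorem density_lie_of_ne (hN : Odd N) {r s α r' s' α' : ℤˣ} (h : (r', s', α') ≠ (r, s, α))
    (p q : BMom) : ⁅density (N := N) r s α p, density (N := N) r' s' α' q⁆ = 0 := by
  rw [density_eq hN, density_eq hN]
  rw [secondQuant.eq_def r' s' α',
    lie_opSum (secondQuant_locFin r' s' α' (d := q s') fun k => rfl), opSum_eq_sum (s := ∅)]
  · simp
  · intro k _
    exact secondQuant_lie_of_ne r s α (d := p s) (fun k => rfl) h h

theorem cdag_adj (m : Mode N) : IsAdj (cdag m) (c m) := (c_adj m).symm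

theorem fermiProd_adj (a b : Mode N) : IsAdj (fermiProd a b) (fermiProd b a) := by
  rw [fermiProd, fermiProd, vev_cdag_c, vev_cdag_c]
  have h : (if a = b ∧ InSea a then (1 : ℂ) else 0) = if b = a ∧ InSea b then 1 else 0 := by
    congr 1
    apply propext
    constructor <;> (rintro ⟨rfl, h⟩; exact ⟨rfl, h⟩)
  rw [h]
  refine ((cdag_adj a).mul (c_adj b)).sub ?_
  have := IsAdj.one (N := N).smul (if b = a ∧ InSea b then (1 : ℂ) else 0)
  split_ifs at this ⊢ <;> simpa using this

/-- Taking adjoints exchanges the two modes of each bilinear; reindexing by the translation turns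
the result into the density at -p. -/
theorem density_adj (hN : Odd N) (r s α : ℤˣ) (p : BMom) :
    IsAdj (density (N := N) r s α p) (density r s α (-p)) := by
  rw [density_eq hN, density_eq hN]
  have h1 := secondQuant_locFin (N := N) r s α (σ := shift hN s p) (d := p s) fun k => rfl
  have h2 := secondQuant_locFin (N := N) r s α (σ := shift hN s (-p)) (d := -p s) fun k => rfl
  have h3 := h2.comp (shift hN s p).injective
  have h4 : secondQuant (N := N) r s α (shift hN s (-p)) =
      opSum fun k => fermiProd (⟨r, s, α, shift hN s p k⟩ : Mode N) ⟨r, s, α, k⟩ := by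
    rw [secondQuant, ← opSum_comp_equiv (shift hN s p)]
    simp only [shift_neg_symm, Equiv.symm_apply_apply]
  rw [h4]
  refine IsAdj.opSum h1 ?_ fun k => fermiProd_adj _ _
  simpa only [shift_neg_symm, Equiv.symm_apply_apply] using h3

theorem density_graded (hN : Odd N) (r s α : ℤˣ) (p : BMom) :
    Graded (density (N := N) r s α p) (-(2 * ((r : ℤ) * p s))) := by
  rw [density_eq hN]
  refine Graded.opSum (secondQuant_locFin r s α (d := p s) fun k => rfl) fun k => ?_
  have h1 : Graded (cdag (⟨r, s, α, k⟩ : Mode N) * c ⟨r, s, α, shift hN s p k⟩)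
      (-(2 * ((r : ℤ) * p s))) := by
    have := (cdag_graded (⟨r, s, α, k⟩ : Mode N)).mul (c_graded ⟨r, s, α, shift hN s p k⟩)
    convert this using 1
    simp only [shift_fst]
    ring
  rw [fermiProd, vev_cdag_c]
  refine h1.sub ?_
  split_ifs with h
  · have : p s = 0 := by
      have := mode_injective r s α h.1
      exact ((shift_fixed_iff hN s p k).1 this.symm).1
    rw [this]
    simpa using (Graded.one (N := N)).smul 1
  · rw [zero_smul]
    exact Graded.zero

end

end NodalMattis

/-! ### Closures of operators, eigenbases and unitary equivalence. -/

namespace NodalMattis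

noncomputable section

variable {N : ℕ}

/-! ### Graph closures and diagonal operators -/

/-- The graph of an operator on the algebraic Fock space. -/
def opGraph (A : Op N) : Submodule ℂ (Fock N × Fock N) :=
  LinearMap.range ((incl N).prod (incl N ∘ₗ A))

theorem mem_opGraph {A : Op N} {x : Fock N × Fock N} :
    x ∈ opGraph A ↔ ∃ v, (incl N v, incl N (A v)) = x := Iff.rfl

theorem graph_pmap (A : Op N) : (pmap A).graph = opGraph A := by
  ext ⟨x, y⟩
  rw [LinearPMap.mem_graph_iff, mem_opGraph]
  have key : ∀ v : FockAlg N, (pmap A) ⟨incl N v, ⟨v, rfl⟩⟩ = incl N (A v) := fun v => by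
    change incl N (A ((LinearEquiv.ofInjective (incl N) incl_injective).symm ⟨incl N v, ⟨v, rfl⟩⟩)) = _
    congr 2
    rw [LinearEquiv.symm_apply_eq]
    rfl
  constructor
  · rintro ⟨⟨_, v, rfl⟩, rfl, rfl⟩
    exact ⟨v, Prod.ext rfl (key v).symm⟩
  · rintro ⟨v, hv⟩
    obtain ⟨rfl, rfl⟩ := Prod.ext_iff.1 hv
    exact ⟨⟨incl N v, ⟨v, rfl⟩⟩, rfl, key v⟩

/-- The closure of the graph of an operator on the algebraic Fock space. -/
def closedGraph (A : Op N) : Submodule ℂ (Fock N × Fock N) := (opGraph A).topologicalClosure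

theorem opGraph_le (A : Op N) : opGraph A ≤ closedGraph A := Submodule.le_topologicalClosure _

theorem mem_closedGraph_incl (A : Op N) (v : FockAlg N) :
    (incl N v, incl N (A v)) ∈ closedGraph A := opGraph_le A ⟨v, rfl⟩

theorem closedGraph_le {A : Op N} {p : Set (Fock N × Fock N)} (hp : IsClosed p)
    (h : ∀ v, (incl N v, incl N (A v)) ∈ p) {x : Fock N × Fock N} (hx : x ∈ closedGraph A) :
    x ∈ p := by
  have : closure (opGraph A : Set (Fock N × Fock N)) ⊆ p := by
    refine closure_minimal ?_ hp
    rintro _ ⟨v, rfl⟩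
    exact h v
  exact this hx

theorem incl_dense : (LinearMap.range (incl N)).topologicalClosure = ⊤ := by
  refine Submodule.eq_top_iff'.2 fun x => ?_
  have h := lp.hasSum_single (p := 2) (by norm_num) x
  refine mem_closure_of_tendsto h (Filter.Eventually.of_forall fun s => ?_)
  refine Submodule.sum_mem _ fun E _ => ⟨x E • ket E, ?_⟩
  rw [map_smul, incl_ket, ← lp.single_smul, smul_eq_mul, mul_one]

section diag

variable {ι : Type} (f : HilbertBasis ι ℂ (Fock N)) (lam : ι → ℝ)

/-- The graph of the operator that is diagonal in an orthonormal basis. -/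
def diagGraph : Submodule ℂ (Fock N × Fock N) where
  carrier := {x | ∀ i, inner ℂ (f i) x.2 = (lam i : ℂ) * inner ℂ (f i) x.1}
  zero_mem' i := by simp
  add_mem' hx hy i := by
    simp only [Prod.fst_add, Prod.snd_add, inner_add_right, hx i, hy i, mul_add]
  smul_mem' a x hx i := by
    simp only [Prod.smul_fst, Prod.smul_snd, inner_smul_right, hx i]
    ring

theorem mem_diagGraph {x : Fock N × Fock N} :
    x ∈ diagGraph f lam ↔ ∀ i, inner ℂ (f i) x.2 = (lam i : ℂ) * inner ℂ (f i) x.1 := Iff.rfl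

theorem diagGraph_isClosed : IsClosed (diagGraph f lam : Set (Fock N × Fock N)) := by
  have : (diagGraph f lam : Set (Fock N × Fock N)) =
      ⋂ i, {x | inner ℂ (f i) x.2 = (lam i : ℂ) * inner ℂ (f i) x.1} := by
    ext x
    simp only [Set.mem_iInter, SetLike.mem_coe, mem_diagGraph]
    rfl
  rw [this]
  exact isClosed_iInter fun i => isClosed_eq (by fun_prop) (by fun_prop)

theorem mem_diagGraph_self (i : ι) : (f i, (lam i : ℂ) • f i) ∈ diagGraph f lam := fun j => by
  simp only [inner_smul_right]
  rcases eq_or_ne j i with rfl | h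
  · rfl
  · rw [f.orthonormal.2 h]
    simp

/-- Symmetry, tested against each eigenvector, places the graph of H inside the closed diagonal
graph. Conversely a pair in the diagonal graph is the limit of its partial expansions in the basis,
and these lie in the closed graph by `hf`. -/
theorem closedGraph_eq_diagGraph {H : Op N} (hH : IsAdj H H)
    (hf : ∀ i, (f i, (lam i : ℂ) • f i) ∈ closedGraph H) : closedGraph H = diagGraph f lam := by
  refine le_antisymm (fun x hx => ?_) fun x hx => ?_
  · refine closedGraph_le (diagGraph_isClosed f lam) (fun v i => ?_) hx
    have hc : IsClosed {z : Fock N × Fock N | inner ℂ z.1 (incl N (H v)) = inner ℂ z.2 (incl N v)} :=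
      isClosed_eq (by fun_prop) (by fun_prop)
    have := closedGraph_le hc (fun w => (hH w v).symm) (hf i)
    change inner ℂ (f i) (incl N (H v)) = inner ℂ ((lam i : ℂ) • f i) (incl N v) at this
    rw [this, inner_smul_left]
    simp
  · have h1 := f.hasSum_repr x.1
    have h2 := f.hasSum_repr x.2
    have h3 := h1.prodMk h2
    refine (Submodule.isClosed_topologicalClosure _).mem_of_tendsto h3
      (Filter.Eventually.of_forall fun s => ?_)
    refine Submodule.sum_mem _ fun i _ => ?_
    have : (f.repr x.1 i • f i, f.repr x.2 i • f i) = f.repr x.1 i • (f i, (lam i : ℂ) • f i) := by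
      rw [f.repr_apply_apply, f.repr_apply_apply, hx i, Prod.smul_mk, smul_smul, mul_comm]
    rw [this]
    exact Submodule.smul_mem _ _ (hf i)

/-- The second component of a diagonal pair is determined by the coordinates of the first, so the
diagonal graph is a graph; Parseval with real eigenvalues shows that it equals its own adjoint. -/
theorem essSelfAdjoint_of_diag {H : Op N} (h : closedGraph H = diagGraph f lam) :
    EssSelfAdjoint H ∧ (pmap H).closure.graph = closedGraph H := by
  have hg : (diagGraph f lam).toLinearPMap.graph = diagGraph f lam := by
    refine Submodule.toLinearPMap_graph_eq _ fun x hx h0 => ?_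
    refine f.repr.injective ?_
    ext i
    rw [f.repr_apply_apply, hx i, h0]
    simp
  have hcl : (pmap H).IsClosable := by
    refine ⟨(diagGraph f lam).toLinearPMap, ?_⟩
    rw [graph_pmap, hg, ← h]
    rfl
  have hgr : (pmap H).closure.graph = closedGraph H := by
    rw [← hcl.graph_closure_eq_closure_graph, graph_pmap]
    rfl
  refine ⟨⟨hcl, ?_⟩, hgr⟩
  have hd : Dense ((pmap H).closure.domain : Set (Fock N)) := by
    refine Dense.mono (s₁ := (LinearMap.range (incl N) : Set (Fock N))) ?_ ?_
    · exact (LinearPMap.le_closure (pmap H)).1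
    · have := incl_dense (N := N)
      rwa [← Submodule.dense_iff_topologicalClosure_eq_top] at this
  rw [LinearPMap.isSelfAdjoint_def]
  refine LinearPMap.eq_of_eq_graph ?_
  rw [LinearPMap.adjoint_graph_eq_graph_adjoint hd, hgr, h]
  ext x
  rw [Submodule.mem_adjoint_iff]
  constructor
  · intro hx i
    have := hx _ _ (mem_diagGraph_self f lam i)
    rw [inner_smul_left, sub_eq_zero] at this
    simpa using this.symm
  · intro hx a b' hab
    rw [← f.tsum_inner_mul_inner, ← f.tsum_inner_mul_inner, sub_eq_zero]
    refine tsum_congr fun i => ?_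
    rw [hx i, ← inner_conj_symm, hab i, ← inner_conj_symm a]
    simp only [map_mul, Complex.conj_ofReal, inner_conj_symm]
    ring

end diag

/-! ### Eigenbases of level-preserving operators -/

/-- A level-preserving symmetric operator is a direct sum of symmetric operators on
finite-dimensional spaces. The union of their eigenbases is a Hilbert basis consisting of vectors of
the Slater domain. -/
theorem exists_eigenbasis {D : Op N} (hD : IsAdj D D) (hg : Graded D 0) :
    ∃ (ι : Type) (f : HilbertBasis ι ℂ (Fock N)) (lam : ι → ℝ),
      ∀ i, ∃ v : FockAlg N, incl N v = f i ∧ D v = (lam i : ℂ) • v := by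
  have hmap : ∀ n, ∀ v ∈ V N n, D v ∈ V N n := fun n v hv => by simpa using hg n v hv
  let T : ∀ n, V N n →ₗ[ℂ] V N n := fun n => D.restrict (hmap n)
  have hT : ∀ n, (T n).IsSymmetric := fun n x y => hD x y
  let e : ∀ n, OrthonormalBasis (Fin (Module.finrank ℂ (V N n))) ℂ (V N n) :=
    fun n => (hT n).eigenvectorBasis rfl
  let g : (Σ n : ℤ, Fin (Module.finrank ℂ (V N n))) → Fock N :=
    fun i => incl N (e i.1 i.2 : FockAlg N)
  have hon : Orthonormal ℂ g := by
    classical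
    rw [orthonormal_iff_ite]
    rintro ⟨n, j⟩ ⟨n', j'⟩
    change inner ℂ (e n j : FockAlg N) (e n' j' : FockAlg N) = _
    rcases eq_or_ne n n' with rfl | h
    · have := orthonormal_iff_ite.1 (e n).orthonormal j j'
      rw [Submodule.coe_inner] at this
      rw [this]
      simp
    · rw [V_orthogonal h (e n j).2 (e n' j').2, if_neg]
      intro h'
      exact h (congrArg Sigma.fst h')
  have hsp : ⊤ ≤ (Submodule.span ℂ (Set.range g)).topologicalClosure := by
    rw [← incl_dense]
    refine Submodule.topologicalClosure_mono ?_
    rw [LinearMap.range_eq_map, ← iSup_V, Submodule.map_iSup]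
    refine iSup_le fun n => ?_
    rintro _ ⟨v, hv, rfl⟩
    have h1 := (e n).sum_repr ⟨v, hv⟩
    have h2 : v = ∑ j, (e n).repr ⟨v, hv⟩ j • (e n j : FockAlg N) := by
      exact (congrArg Subtype.val h1).symm.trans (by simp)
    rw [h2, map_sum]
    refine Submodule.sum_mem _ fun j _ => ?_
    rw [map_smul]
    exact Submodule.smul_mem _ _ (Submodule.subset_span ⟨⟨n, j⟩, rfl⟩)
  refine ⟨_, HilbertBasis.mk hon hsp, fun i => (hT i.1).eigenvalues rfl i.2, fun i => ?_⟩
  refine ⟨(e i.1 i.2 : FockAlg N), ?_, ?_⟩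
  · rw [HilbertBasis.coe_mk]
  · have := (hT i.1).apply_eigenvectorBasis rfl i.2
    exact congrArg Subtype.val this

/-! ### Unitary equivalence -/

/-- The unitary `U` carries `H'` into the closure of `H`. -/
def Transforms (U : Fock N ≃ₗᵢ[ℂ] Fock N) (H H' : Op N) : Prop :=
  ∀ x, (U (incl N x), U (incl N (H' x))) ∈ closedGraph H

theorem Transforms.map_closedGraph {U : Fock N ≃ₗᵢ[ℂ] Fock N} {H H' : Op N} (h : Transforms U H H')
    {x : Fock N × Fock N} (hx : x ∈ closedGraph H') : (U x.1, U x.2) ∈ closedGraph H := by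
  have hc : IsClosed {z : Fock N × Fock N | (U z.1, U z.2) ∈ closedGraph H} :=
    (Submodule.isClosed_topologicalClosure _).preimage (by fun_prop)
  exact closedGraph_le hc h hx

theorem Transforms.trans {U U' : Fock N ≃ₗᵢ[ℂ] Fock N} {H H' H'' : Op N} (h : Transforms U H H')
    (h' : Transforms U' H' H'') : Transforms (U'.trans U) H H'' := fun x => h.map_closedGraph (h' x)

theorem Transforms.refl (H : Op N) : Transforms (LinearIsometryEquiv.refl ℂ (Fock N)) H H :=
  fun x => mem_closedGraph_incl H x

theorem Transforms.smul_add {U : Fock N ≃ₗᵢ[ℂ] Fock N} {H H' : Op N} (h : Transforms U H H')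
    (a e : ℂ) : Transforms U (a • H + e • 1) (a • H' + e • 1) := fun x => by
  have hc : IsClosed {z : Fock N × Fock N |
      (z.1, a • z.2 + e • z.1) ∈ closedGraph (a • H + e • 1)} :=
    (Submodule.isClosed_topologicalClosure _).preimage (by fun_prop)
  have := closedGraph_le (A := H) hc (fun v => ?_) (h x)
  · simpa using this
  · have := mem_closedGraph_incl (a • H + e • 1) v
    simpa using this

/-- An eigenbasis of D in the Slater domain is mapped by U to an eigenbasis inside the closed graph
of H. Both closures are therefore diagonal with the same eigenvalues, which turns the one-sided
relation into an equality of operators with their domains. -/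
theorem Transforms.diagonalises {U : Fock N ≃ₗᵢ[ℂ] Fock N} {H D : Op N} (h : Transforms U H D)
    (hH : IsAdj H H) (hD : IsAdj D D) (hg : Graded D 0) :
    Diagonalises U H D ∧ (pmap H).closure.graph = closedGraph H ∧
      (pmap D).closure.graph = closedGraph D := by
  obtain ⟨ι, f, lam, hf⟩ := exists_eigenbasis hD hg
  let g : HilbertBasis ι ℂ (Fock N) := HilbertBasis.ofRepr (U.symm.trans f.repr)
  have hgf : ∀ i, g i = U (f i) := fun i => by
    classical
    rw [← g.repr_symm_single i]
    change U (f.repr.symm (lp.single 2 i (1 : ℂ))) = _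
    rw [f.repr_symm_single]
  have hDf : ∀ i, (f i, (lam i : ℂ) • f i) ∈ closedGraph D := fun i => by
    obtain ⟨v, hv, hv'⟩ := hf i
    have := mem_closedGraph_incl D v
    rwa [hv', map_smul, hv] at this
  have hHg : ∀ i, (g i, (lam i : ℂ) • g i) ∈ closedGraph H := fun i => by
    have := h.map_closedGraph (hDf i)
    rw [hgf, ← map_smul]
    exact this
  have e1 := closedGraph_eq_diagGraph f lam hD hDf
  have e2 := closedGraph_eq_diagGraph g lam hH hHg
  obtain ⟨s1, g1⟩ := essSelfAdjoint_of_diag f lam e1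
  obtain ⟨s2, g2⟩ := essSelfAdjoint_of_diag g lam e2
  refine ⟨⟨s2, s1, fun x y => ?_⟩, g2, g1⟩
  rw [g1, g2, e1, e2]
  simp only [mem_diagGraph, hgf, LinearIsometryEquiv.inner_map_map]

/-- A lower bound for the quadratic form is a closed condition on pairs in the graph, so it passes
to the closure of D and through U. The minimum is attained at U Ω. -/
theorem Transforms.isGroundEnergy {U : Fock N ≃ₗᵢ[ℂ] Fock N} {H D : Op N} (h : Transforms U H D)
    (hH : IsAdj H H) (hD : IsAdj D D) (hg : Graded D 0) {e : ℝ}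
    (hpos : ∀ v : FockAlg N, e * ‖v‖ ^ 2 ≤ (inner ℂ v (D v)).re)
    (hvac : D vac = (e : ℂ) • vac) : IsGroundEnergy H e := by
  obtain ⟨⟨_, _, hUD⟩, g2, g1⟩ := h.diagonalises hH hD hg
  constructor
  · intro x
    have hx' : (U.symm x, U.symm ((pmap H).closure x)) ∈ (pmap D).closure.graph := by
      rw [hUD]
      simp
    rw [g1] at hx'
    have hc : IsClosed {z : Fock N × Fock N | e * ‖z.1‖ ^ 2 ≤ (inner ℂ z.1 z.2).re} :=
      isClosed_le (by fun_prop) (by fun_prop)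
    have := closedGraph_le hc hpos hx'
    simpa using this
  · have h1 := h vac
    rw [hvac, map_smul, map_smul, ← g2, LinearPMap.mem_graph_iff] at h1
    obtain ⟨x, hx, hx'⟩ := h1
    refine ⟨x, ?_, ?_⟩
    · rw [hx]
      intro h0
      have h2 : incl N vac = 0 := U.map_eq_zero_iff.1 h0
      have h3 := incl_injective (h2.trans (map_zero (incl N)).symm)
      have : (vac : FockAlg N) ∅ = 0 := by rw [h3]; rfl
      simp [vac, ket_apply] at this
    · rw [hx', hx]

/-- An isometry with dense range maps the Slater basis to a Hilbert basis; the unitary is this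
change of basis. -/
theorem exists_unitary (R : FockAlg N →ₗ[ℂ] Fock N) (hR : ∀ x, ‖R x‖ = ‖x‖)
    (hd : (LinearMap.range R).topologicalClosure = ⊤) :
    ∃ U : Fock N ≃ₗᵢ[ℂ] Fock N, ∀ x, U (incl N x) = R x := by
  let R' : FockAlg N →ₗᵢ[ℂ] Fock N := ⟨R, hR⟩
  have hon : Orthonormal ℂ fun E : Finset (Mode N) => R (ket E) := by
    rw [orthonormal_iff_ite]
    intro E F
    have : inner ℂ (R' (ket E)) (R' (ket F)) = inner ℂ (ket E : FockAlg N) (ket F) :=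
      R'.inner_map_map _ _
    change inner ℂ (R' (ket E)) (R' (ket F)) = _
    rw [this, ket_inner, ket_apply]
    simp only [eq_comm]
  have hsp : ⊤ ≤ (Submodule.span ℂ (Set.range fun E : Finset (Mode N) => R (ket E))).topologicalClosure := by
    rw [← hd]
    refine Submodule.topologicalClosure_mono ?_
    rintro _ ⟨v, rfl⟩
    induction v using ket_induction with
    | h0 => simp
    | hadd x y hx hy => rw [map_add]; exact add_mem hx hy
    | hket a E => rw [map_smul]; exact Submodule.smul_mem _ _ (Submodule.subset_span ⟨E, rfl⟩)
  let hb := HilbertBasis.mk hon hsp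
  refine ⟨hb.repr.symm, fun x => ?_⟩
  induction x using ket_induction with
  | h0 => simp
  | hadd x y hx hy => rw [map_add, map_add, map_add, hx, hy]
  | hket a E =>
    rw [map_smul, map_smul, map_smul, incl_ket, hb.repr_symm_single]
    simp only [hb, HilbertBasis.coe_mk]

end

end NodalMattis

namespace NodalMattis

noncomputable section

/-! ### One oscillator: squeezed and shifted number states

A sequence `f : ℕ → ℝ` stands for the vector `∑ f m (a†)^m κ`, where `κ` is a unit vector annihilated
by `a`; the squared norm of the vector is `∑ m! (f m)^2`. -/

theorem lower_mul_raise_pow {R : Type*} [Ring R] {x y : R} (h : x * y - y * x = 1) (n : ℕ) :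
    x * y ^ n = y ^ n * x + n * y ^ (n - 1) := by
  induction n with
  | zero => simp
  | succ n ih =>
    have h' : x * y = y * x + 1 := by rw [← h]; abel
    rw [pow_succ, ← mul_assoc, ih, add_mul, mul_assoc, h', Nat.add_sub_cancel]
    rcases n with _ | n
    · simp
    · rw [Nat.add_sub_cancel, mul_assoc _ (y ^ n) y, ← pow_succ]
      push_cast
      noncomm_ring

/-- The annihilation operator on coefficient sequences. -/
def lowerSeq : Module.End ℝ (ℕ → ℝ) where
  toFun f m := (m + 1) * f (m + 1)
  map_add' f g := by ext m; simp [mul_add]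
  map_smul' a f := by ext m; simp; ring

/-- The creation operator on coefficient sequences. -/
def raiseSeq : Module.End ℝ (ℕ → ℝ) where
  toFun f m := Nat.casesOn m 0 f
  map_add' f g := by ext m; cases m <;> simp
  map_smul' a f := by ext m; cases m <;> simp

theorem lowerSeq_apply (f : ℕ → ℝ) (m : ℕ) : lowerSeq f m = (m + 1) * f (m + 1) := rfl

theorem raiseSeq_zero (f : ℕ → ℝ) : raiseSeq f 0 = 0 := rfl

theorem raiseSeq_succ (f : ℕ → ℝ) (m : ℕ) : raiseSeq f (m + 1) = f m := rfl

theorem lower_raise_seq : lowerSeq * raiseSeq - raiseSeq * lowerSeq = 1 := by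
  refine LinearMap.ext fun f => funext fun m => ?_
  simp only [LinearMap.sub_apply, Module.End.mul_apply, Module.End.one_apply, Pi.sub_apply]
  cases m with
  | zero => simp [lowerSeq_apply, raiseSeq_zero, raiseSeq_succ]
  | succ m =>
    simp only [lowerSeq_apply, raiseSeq_succ]
    push_cast
    ring

/-- Rapidly decreasing coefficient sequences. -/
def decaySeq : Submodule ℝ (ℕ → ℝ) where
  carrier := {f | ∀ k : ℕ, Summable fun m : ℕ => ((m : ℝ) + 1) ^ k * √(m.factorial) * |f m|}
  zero_mem' k := by simp
  add_mem' {f g} hf hg k := by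
    refine Summable.of_nonneg_of_le (fun m => by positivity) (fun m => ?_) ((hf k).add (hg k))
    rw [← mul_add]
    exact mul_le_mul_of_nonneg_left (abs_add_le _ _) (by positivity)
  smul_mem' a f hf k := by
    refine ((hf k).mul_left |a|).congr fun m => ?_
    simp only [Pi.smul_apply, smul_eq_mul, abs_mul]
    ring

theorem lowerSeq_mem {f : ℕ → ℝ} (hf : f ∈ decaySeq) : lowerSeq f ∈ decaySeq := fun k => by
  have h := (summable_nat_add_iff 1).2 (hf (k + 1))
  refine Summable.of_nonneg_of_le (fun m => by positivity) (fun m => ?_) h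
  rw [lowerSeq_apply, abs_mul, abs_of_nonneg (by positivity : (0 : ℝ) ≤ (m : ℝ) + 1)]
  push_cast
  rw [← mul_assoc]
  refine mul_le_mul_of_nonneg_right ?_ (abs_nonneg _)
  have h1 : √(m.factorial : ℝ) ≤ √((m + 1).factorial : ℝ) :=
    Real.sqrt_le_sqrt (by exact_mod_cast Nat.factorial_le (Nat.le_succ m))
  have h2 : ((m : ℝ) + 1) ^ (k + 1) ≤ ((m : ℝ) + 1 + 1) ^ (k + 1) := by gcongr; linarith
  calc ((m : ℝ) + 1) ^ k * √(m.factorial : ℝ) * (m + 1)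
      = ((m : ℝ) + 1) ^ (k + 1) * √(m.factorial : ℝ) := by ring
    _ ≤ _ := mul_le_mul h2 h1 (by positivity) (by positivity)

/-- Raising changes √(m!) into √((m+1)!), at the cost of a factor that one more power of m + 1
absorbs; this is why decay is required for every power. -/
theorem raiseSeq_mem {f : ℕ → ℝ} (hf : f ∈ decaySeq) : raiseSeq f ∈ decaySeq := fun k => by
  refine (summable_nat_add_iff 1).1 ?_
  refine Summable.of_nonneg_of_le (fun m => by positivity) (fun m => ?_)
    ((hf (k + 1)).mul_left (2 ^ k))
  rw [raiseSeq_succ, ← mul_assoc]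
  refine mul_le_mul_of_nonneg_right ?_ (abs_nonneg _)
  have h1 : √((m + 1).factorial : ℝ) ≤ (m + 1) * √(m.factorial : ℝ) := by
    rw [Nat.factorial_succ]
    push_cast
    rw [Real.sqrt_mul (by positivity)]
    refine mul_le_mul_of_nonneg_right ?_ (by positivity)
    rw [Real.sqrt_le_left (by positivity)]
    nlinarith [(Nat.cast_nonneg m : (0 : ℝ) ≤ m)]
  have h2 : (((m + 1 : ℕ) : ℝ) + 1) ^ k ≤ 2 ^ k * ((m : ℝ) + 1) ^ k := by
    rw [← mul_pow]
    push_cast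
    gcongr
    nlinarith [(Nat.cast_nonneg m : (0 : ℝ) ≤ m)]
  calc (((m + 1 : ℕ) : ℝ) + 1) ^ k * √((m + 1).factorial : ℝ)
      ≤ 2 ^ k * ((m : ℝ) + 1) ^ k * ((m + 1) * √(m.factorial : ℝ)) :=
        mul_le_mul h2 h1 (by positivity) (by positivity)
    _ = _ := by ring

/-- The weighted scalar product of coefficient sequences. -/
def ipSeq (f g : ℕ → ℝ) : ℝ := ∑' m : ℕ, m.factorial * f m * g m

theorem decaySeq_abs {f : ℕ → ℝ} (hf : f ∈ decaySeq) :
    Summable fun m : ℕ => √(m.factorial) * |f m| := by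
  simpa using hf 0

theorem ipSeq_summable {f g : ℕ → ℝ} (hf : f ∈ decaySeq) (hg : g ∈ decaySeq) :
    Summable fun m : ℕ => (m.factorial : ℝ) * f m * g m := by
  have hf' := decaySeq_abs hf
  have hg' := decaySeq_abs hg
  refine Summable.of_norm_bounded (hf'.mul_right (∑' m : ℕ, √(m.factorial) * |g m|)) fun m => ?_
  have h1 := hg'.le_tsum m fun j _ => by positivity
  have h2 : (m.factorial : ℝ) = √(m.factorial) * √(m.factorial) :=
    (Real.mul_self_sqrt (by positivity)).symm
  rw [Real.norm_eq_abs, abs_mul, abs_mul, abs_of_nonneg (by positivity : (0 : ℝ) ≤ m.factorial)]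
  calc (m.factorial : ℝ) * |f m| * |g m|
      = √(m.factorial) * |f m| * (√(m.factorial) * |g m|) := by
        conv_lhs => rw [h2]
        ring
    _ ≤ _ := mul_le_mul_of_nonneg_left h1 (by positivity)

theorem ipSeq_comm (f g : ℕ → ℝ) : ipSeq f g = ipSeq g f := tsum_congr fun m => by ring

theorem ipSeq_add {f g h : ℕ → ℝ} (hf : f ∈ decaySeq) (hg : g ∈ decaySeq) (hh : h ∈ decaySeq) :
    ipSeq (f + g) h = ipSeq f h + ipSeq g h := by
  rw [ipSeq, ipSeq, ipSeq, ← (ipSeq_summable hf hh).tsum_add (ipSeq_summable hg hh)]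
  exact tsum_congr fun m => by rw [Pi.add_apply]; ring

theorem ipSeq_smul (a : ℝ) (f h : ℕ → ℝ) : ipSeq (a • f) h = a * ipSeq f h := by
  rw [ipSeq, ipSeq, ← tsum_mul_left]
  exact tsum_congr fun m => by rw [Pi.smul_apply, smul_eq_mul]; ring

/-- The weight m! is the squared norm of (a†)^m κ; with it the shift of the index makes the two
operators adjoint. -/
theorem ipSeq_lower {f g : ℕ → ℝ} (hf : f ∈ decaySeq) (hg : g ∈ decaySeq) :
    ipSeq (lowerSeq f) g = ipSeq f (raiseSeq g) := by
  rw [ipSeq, ipSeq, (ipSeq_summable hf (raiseSeq_mem hg)).tsum_eq_zero_add]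
  simp only [raiseSeq_zero, raiseSeq_succ, lowerSeq_apply, mul_zero, zero_add]
  refine tsum_congr fun m => ?_
  rw [Nat.factorial_succ]
  push_cast
  ring

/-- The squeezed annihilation operator. -/
def sqLower (t ζ : ℝ) : Module.End ℝ (ℕ → ℝ) :=
  ((t⁻¹ + t) / 2) • lowerSeq + ((t⁻¹ - t) / 2) • raiseSeq - (t⁻¹ * ζ / 2) • 1

/-- The squeezed creation operator. -/
def sqRaise (t ζ : ℝ) : Module.End ℝ (ℕ → ℝ) :=
  ((t⁻¹ - t) / 2) • lowerSeq + ((t⁻¹ + t) / 2) • raiseSeq - (t⁻¹ * ζ / 2) • 1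

theorem combo_mem {f : ℕ → ℝ} (hf : f ∈ decaySeq) (x y z : ℝ) :
    (x • lowerSeq + y • raiseSeq - z • 1 : Module.End ℝ (ℕ → ℝ)) f ∈ decaySeq :=
  sub_mem (add_mem (decaySeq.smul_mem _ (lowerSeq_mem hf)) (decaySeq.smul_mem _ (raiseSeq_mem hf)))
    (decaySeq.smul_mem _ hf)

theorem combo_adj {f g : ℕ → ℝ} (hf : f ∈ decaySeq) (hg : g ∈ decaySeq) (x y z : ℝ) :
    ipSeq ((x • lowerSeq + y • raiseSeq - z • 1 : Module.End ℝ (ℕ → ℝ)) f) g =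
      ipSeq f ((y • lowerSeq + x • raiseSeq - z • 1 : Module.End ℝ (ℕ → ℝ)) g) := by
  have e : ∀ (x y : ℝ) (f g : ℕ → ℝ), f ∈ decaySeq → g ∈ decaySeq →
      ipSeq ((x • lowerSeq + y • raiseSeq - z • 1 : Module.End ℝ (ℕ → ℝ)) f) g =
        x * ipSeq (lowerSeq f) g + y * ipSeq (raiseSeq f) g - z * ipSeq f g := by
    intro x y f g hf hg
    have h1 := decaySeq.smul_mem x (lowerSeq_mem hf)
    have h2 := decaySeq.smul_mem y (raiseSeq_mem hf)
    have h3 := decaySeq.smul_mem (-z) hf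
    have : (x • lowerSeq + y • raiseSeq - z • 1 : Module.End ℝ (ℕ → ℝ)) f =
        (x • lowerSeq f + y • raiseSeq f) + (-z) • f := by
      simp [sub_eq_add_neg]
    rw [this, ipSeq_add (add_mem h1 h2) h3 hg, ipSeq_add h1 h2 hg, ipSeq_smul, ipSeq_smul,
      ipSeq_smul]
    ring
  rw [e x y f g hf hg, ipSeq_comm f ((y • lowerSeq + x • raiseSeq - z • 1 : Module.End ℝ _) g),
    e y x g f hg hf, ipSeq_lower hf hg, ipSeq_lower hg hf, ipSeq_comm g (raiseSeq f),
    ipSeq_comm (raiseSeq g) f, ipSeq_comm g f]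
  ring

/-- The two coefficients are, up to sign, the hyperbolic cosine and sine of log t, so the difference
of their squares is 1. Solving for the original pair, lower + raise is t times the squeezed sum plus
ζ, and lower - raise is 1/t times the squeezed difference. -/
theorem sq_commutator {t : ℝ} (ht : t ≠ 0) (ζ : ℝ) :
    sqLower t ζ * sqRaise t ζ - sqRaise t ζ * sqLower t ζ = 1 := by
  have h : sqLower t ζ * sqRaise t ζ - sqRaise t ζ * sqLower t ζ =
      (((t⁻¹ + t) / 2) * ((t⁻¹ + t) / 2) - ((t⁻¹ - t) / 2) * ((t⁻¹ - t) / 2)) •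
        (lowerSeq * raiseSeq - raiseSeq * lowerSeq) := by
    simp only [sqLower, sqRaise, sub_mul, mul_sub, add_mul, mul_add, smul_mul_assoc, mul_smul_comm,
      mul_one, one_mul, smul_sub, smul_add, smul_smul, sub_smul]
    module
  rw [h, lower_raise_seq]
  have : ((t⁻¹ + t) / 2) * ((t⁻¹ + t) / 2) - ((t⁻¹ - t) / 2) * ((t⁻¹ - t) / 2) = 1 := by
    field_simp
    ring
  rw [this, one_smul]

/-- With ρ² = (1 + q)/2 the bound C ρ^m reproduces itself as soon as ε ≤ (1 - q)/2, since (1 - q)/2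
+ q = ρ². The constant C takes care of the finitely many earlier indices. -/
theorem geometric_decay {h ε : ℕ → ℝ} {q : ℝ} (h0 : ∀ m, 0 ≤ h m) (hq0 : 0 ≤ q) (hq : q < 1)
    (hε : Filter.Tendsto ε Filter.atTop (nhds 0))
    (hrec : ∀ m, h (m + 2) ≤ ε m * h (m + 1) + q * h m) :
    ∃ C ρ : ℝ, 0 < ρ ∧ ρ < 1 ∧ ∀ m, h m ≤ C * ρ ^ m := by
  set ρ := √((1 + q) / 2) with hρ
  have hρ0 : 0 < ρ := Real.sqrt_pos.2 (by linarith)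
  have hρ2 : ρ ^ 2 = (1 + q) / 2 := Real.sq_sqrt (by linarith)
  have hρ1 : ρ < 1 := by nlinarith
  obtain ⟨M, hM⟩ := Filter.eventually_atTop.1
    (hε.eventually_le_const (show (0 : ℝ) < (1 - q) / 2 by linarith))
  refine ⟨∑ i ∈ Finset.range (M + 2), h i / ρ ^ i, ρ, hρ0, hρ1, fun m => ?_⟩
  set C := ∑ i ∈ Finset.range (M + 2), h i / ρ ^ i with hC
  have hC0 : 0 ≤ C := Finset.sum_nonneg fun i _ => div_nonneg (h0 i) (by positivity)
  induction m using Nat.strong_induction_on with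
  | _ m ih =>
    rcases lt_or_ge m (M + 2) with hm | hm
    · rw [← div_le_iff₀ (by positivity)]
      exact Finset.single_le_sum (f := fun i => h i / ρ ^ i)
        (fun i _ => div_nonneg (h0 i) (by positivity)) (Finset.mem_range.2 hm)
    · obtain ⟨j, rfl⟩ : ∃ j, m = j + 2 := ⟨m - 2, by omega⟩
      have h1 := ih (j + 1) (by omega)
      have h2 := ih j (by omega)
      have h3 := hM j (by omega)
      have h4 : ε j * h (j + 1) ≤ (1 - q) / 2 * (C * ρ ^ j) := by
        have : C * ρ ^ (j + 1) ≤ C * ρ ^ j := by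
          rw [pow_succ]
          have : 0 ≤ C * ρ ^ j := by positivity
          nlinarith
        calc ε j * h (j + 1) ≤ (1 - q) / 2 * h (j + 1) := mul_le_mul_of_nonneg_right h3 (h0 _)
          _ ≤ _ := mul_le_mul_of_nonneg_left (h1.trans this) (by linarith)
      have h5 : q * h j ≤ q * (C * ρ ^ j) := mul_le_mul_of_nonneg_left h2 hq0
      calc h (j + 2) ≤ (1 - q) / 2 * (C * ρ ^ j) + q * (C * ρ ^ j) := (hrec j).trans (by linarith)
        _ = C * ρ ^ j * ρ ^ 2 := by rw [hρ2]; ring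
        _ = C * ρ ^ (j + 2) := by ring

/-- The squeezed vacuum, not normalised. -/
def sqVac (t ζ : ℝ) : ℕ → ℝ
  | 0 => 1
  | 1 => t⁻¹ * ζ / (t⁻¹ + t)
  | m + 2 => (t⁻¹ * ζ * sqVac t ζ (m + 1) - (t⁻¹ - t) * sqVac t ζ m) / ((t⁻¹ + t) * (m + 2))

/-- The recursion defining `sqVac` is the annihilation condition solved for the highest coefficient.
-/
theorem sqLower_sqVac {t : ℝ} (ht : 0 < t) (ζ : ℝ) : sqLower t ζ (sqVac t ζ) = 0 := by
  have h : t⁻¹ + t ≠ 0 := by positivity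
  funext m
  simp only [sqLower, LinearMap.sub_apply, LinearMap.add_apply, LinearMap.smul_apply,
    Module.End.one_apply, Pi.sub_apply, Pi.add_apply, Pi.smul_apply, smul_eq_mul, lowerSeq_apply,
    Pi.zero_apply]
  rcases m with _ | m
  · rw [raiseSeq_zero, sqVac, sqVac]
    push_cast
    field_simp
    ring
  · rw [raiseSeq_succ, sqVac]
    push_cast
    have h2 : (m : ℝ) + 2 ≠ 0 := by positivity
    field_simp
    ring

/-- The normalised coefficients √(m!)|f m| satisfy a three-term recursion in which the coefficient
of the middle term is of order m^(-1/2) and the remaining ratio |t⁻¹ - t|/(t⁻¹ + t) is below 1, so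
they decay geometrically. -/
theorem sqVac_mem {t : ℝ} (ht : 0 < t) (ζ : ℝ) : sqVac t ζ ∈ decaySeq := by
  have hα : 0 < t⁻¹ + t := by positivity
  have hti : 0 < t⁻¹ := by positivity
  obtain ⟨C, ρ, hρ0, hρ1, hC⟩ := geometric_decay
    (h := fun m => √(m.factorial : ℝ) * |sqVac t ζ m|)
    (ε := fun m => |t⁻¹ * ζ| / (t⁻¹ + t) * (1 / √((m : ℝ) + 1))) (q := |t⁻¹ - t| / (t⁻¹ + t))
    (fun m => by positivity) (by positivity)
    (by
      rw [div_lt_one hα, abs_lt]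
      constructor <;> linarith)
    (by
      have h1 : Filter.Tendsto (fun m : ℕ => √((m : ℝ) + 1)) Filter.atTop Filter.atTop :=
        Real.tendsto_sqrt_atTop.comp
          (Filter.tendsto_atTop_add_const_right _ _ tendsto_natCast_atTop_atTop)
      have h2 := h1.inv_tendsto_atTop.const_mul (|t⁻¹ * ζ| / (t⁻¹ + t))
      simpa using h2)
    (by
      intro m
      have hm2 : (0 : ℝ) < (m : ℝ) + 2 := by positivity
      have hm1 : (0 : ℝ) < (m : ℝ) + 1 := by positivity
      have e2 : √((m + 2).factorial : ℝ) = √((m : ℝ) + 2) * √((m : ℝ) + 1) * √(m.factorial : ℝ) := by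
        rw [← Real.sqrt_mul hm2.le, ← Real.sqrt_mul (by positivity)]
        congr 1
        rw [Nat.factorial_succ, Nat.factorial_succ]
        push_cast
        ring
      have e1 : √((m + 1).factorial : ℝ) = √((m : ℝ) + 1) * √(m.factorial : ℝ) := by
        rw [← Real.sqrt_mul hm1.le]
        congr 1
        rw [Nat.factorial_succ]
        push_cast
        ring
      have hle : √((m : ℝ) + 1) ≤ √((m : ℝ) + 2) := Real.sqrt_le_sqrt (by linarith)
      have s2 : √((m : ℝ) + 2) * √((m : ℝ) + 2) = m + 2 := Real.mul_self_sqrt hm2.le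
      have s1 : 0 < √((m : ℝ) + 1) := Real.sqrt_pos.2 hm1
      have s2' : 0 < √((m : ℝ) + 2) := Real.sqrt_pos.2 hm2
      have key : √((m + 2).factorial : ℝ) * |sqVac t ζ (m + 2)| ≤
          √((m + 2).factorial : ℝ) * ((|t⁻¹ * ζ| * |sqVac t ζ (m + 1)| +
            |t⁻¹ - t| * |sqVac t ζ m|) / ((t⁻¹ + t) * (m + 2))) := by
        refine mul_le_mul_of_nonneg_left ?_ (by positivity)
        rw [sqVac, abs_div, abs_of_pos (by positivity : 0 < (t⁻¹ + t) * ((m : ℝ) + 2))]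
        gcongr
        refine (abs_sub _ _).trans ?_
        rw [abs_mul, abs_mul (t⁻¹ - t)]
      refine key.trans ?_
      set A := |t⁻¹ * ζ| * |sqVac t ζ (m + 1)| with hA
      set B := |t⁻¹ - t| * |sqVac t ζ m| with hB
      set F := √(m.factorial : ℝ) with hF
      set u := √((m : ℝ) + 1) with hu
      set w := √((m : ℝ) + 2) with hw
      have hA0 : 0 ≤ A := by positivity
      have hB0 : 0 ≤ B := by positivity
      have hF0 : 0 ≤ F := by positivity
      rw [e2, ← s2]
      have l : w * u * F * ((A + B) / ((t⁻¹ + t) * (w * w))) = F * (A + B) / (t⁻¹ + t) * (u / w) := by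
        field_simp
      have r : |t⁻¹ * ζ| / (t⁻¹ + t) * (1 / u) * (√((m + 1).factorial : ℝ) * |sqVac t ζ (m + 1)|) +
          |t⁻¹ - t| / (t⁻¹ + t) * (F * |sqVac t ζ m|) = F * (A + B) / (t⁻¹ + t) := by
        rw [e1, hA, hB]
        field_simp
      rw [l, r]
      refine mul_le_of_le_one_right (by positivity) ?_
      rw [div_le_one s2']
      exact hle)
  intro k
  have h1 := (summable_nat_add_iff 1).2
    (summable_pow_mul_geometric_of_norm_lt_one k (r := ρ) (by rwa [Real.norm_of_nonneg hρ0.le]))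
  refine Summable.of_nonneg_of_le (fun m => by positivity) (fun m => ?_) (h1.mul_left (C * ρ⁻¹))
  push_cast
  calc ((m : ℝ) + 1) ^ k * √(m.factorial : ℝ) * |sqVac t ζ m|
      = ((m : ℝ) + 1) ^ k * (√(m.factorial : ℝ) * |sqVac t ζ m|) := by ring
    _ ≤ ((m : ℝ) + 1) ^ k * (C * ρ ^ m) := mul_le_mul_of_nonneg_left (hC m) (by positivity)
    _ = C * ρ⁻¹ * (((m : ℝ) + 1) ^ k * ρ ^ (m + 1)) := by
      rw [pow_succ]
      field_simp

/-- The columns `G n` are the coefficient sequences of the squeezed and shifted number states. -/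
structure IsSqueeze (t ζ : ℝ) (G : ℕ → ℕ → ℝ) : Prop where
  mem : ∀ n, G n ∈ decaySeq
  field : ∀ n, lowerSeq (G n) + raiseSeq (G n) =
    t • (G (n + 1) + (n : ℝ) • G (n - 1)) + ζ • G n
  momentum : ∀ n, lowerSeq (G n) - raiseSeq (G n) = t⁻¹ • ((n : ℝ) • G (n - 1) - G (n + 1))
  orthogonal : ∀ n m, ipSeq (G n) (G m) = if n = m then (n.factorial : ℝ) else 0
  ne_zero : G 0 0 ≠ 0

/-- The columns are the number states over the normalised squeezed vacuum. Their orthogonality is a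
consequence of the canonical commutation relation and of the adjointness of the squeezed pair. -/
theorem exists_isSqueeze {t : ℝ} (ht : 0 < t) (ζ : ℝ) : ∃ G, IsSqueeze t ζ G := by
  set g := sqVac t ζ with hg
  have hgm : g ∈ decaySeq := sqVac_mem ht ζ
  have hpos : 0 < ipSeq g g := by
    have h := (ipSeq_summable hgm hgm).le_tsum 0 fun j _ => by
      rw [mul_assoc]
      exact mul_nonneg (by positivity) (mul_self_nonneg _)
    have h0 : g 0 = 1 := by rw [hg, sqVac]
    simp only [h0, Nat.factorial_zero, Nat.cast_one, mul_one] at h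
    exact lt_of_lt_of_le one_pos h
  set g' := (√(ipSeq g g))⁻¹ • g with hg'
  have hgm' : g' ∈ decaySeq := decaySeq.smul_mem _ hgm
  have hnorm : ipSeq g' g' = 1 := by
    rw [hg', ipSeq_smul, ipSeq_comm g (_ • g), ipSeq_smul]
    have := Real.mul_self_sqrt hpos.le
    have h' : √(ipSeq g g) ≠ 0 := (Real.sqrt_pos.2 hpos).ne'
    rw [inv_mul_eq_iff_eq_mul₀ h', inv_mul_eq_iff_eq_mul₀ h', mul_one, this]
  have hlow : sqLower t ζ g' = 0 := by rw [hg', map_smul, hg, sqLower_sqVac ht, smul_zero]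
  set G : ℕ → ℕ → ℝ := fun n => (sqRaise t ζ ^ n) g' with hG
  have hmem : ∀ n, G n ∈ decaySeq := fun n => by
    induction n with
    | zero => simpa [hG] using hgm'
    | succ n ih =>
      simp only [hG, pow_succ', Module.End.mul_apply] at ih ⊢
      exact combo_mem ih _ _ _
  have hraise : ∀ n, sqRaise t ζ (G n) = G (n + 1) := fun n => by
    simp only [hG, pow_succ', Module.End.mul_apply]
  have hlower : ∀ n, sqLower t ζ (G n) = (n : ℝ) • G (n - 1) := fun n => by
    have h := lower_mul_raise_pow (sq_commutator ht.ne' ζ) n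
    have h' := LinearMap.congr_fun h g'
    simp only [Module.End.mul_apply, LinearMap.add_apply, hlow, map_zero, zero_add] at h'
    rw [show sqLower t ζ (G n) = _ from h']
    rw [Module.End.natCast_apply, Nat.cast_smul_eq_nsmul]
  have h1 : ∀ f, lowerSeq f + raiseSeq f = t • (sqRaise t ζ f + sqLower t ζ f) + ζ • f := fun f => by
    simp only [sqLower, sqRaise, LinearMap.sub_apply, LinearMap.add_apply, LinearMap.smul_apply,
      Module.End.one_apply]
    have : t ≠ 0 := ht.ne'
    match_scalars <;> field_simp <;> ring
  have h2 : ∀ f, lowerSeq f - raiseSeq f = t⁻¹ • (sqLower t ζ f - sqRaise t ζ f) := fun f => by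
    simp only [sqLower, sqRaise, LinearMap.sub_apply, LinearMap.add_apply, LinearMap.smul_apply,
      Module.End.one_apply]
    have : t ≠ 0 := ht.ne'
    match_scalars <;> field_simp <;> ring
  have horth : ∀ n m, ipSeq (G n) (G m) = if n = m then (n.factorial : ℝ) else 0 := by
    intro n
    induction n with
    | zero =>
      intro m
      rcases m with _ | m
      · simpa [hG] using hnorm
      · rw [← hraise, ipSeq_comm]
        have := combo_adj (hmem m) (hmem 0) ((t⁻¹ - t) / 2) ((t⁻¹ + t) / 2) (t⁻¹ * ζ / 2)
        rw [show ipSeq (sqRaise t ζ (G m)) (G 0) = _ from this]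
        rw [show (((t⁻¹ + t) / 2) • lowerSeq + ((t⁻¹ - t) / 2) • raiseSeq - (t⁻¹ * ζ / 2) • 1 :
          Module.End ℝ (ℕ → ℝ)) (G 0) = _ from hlower 0]
        rw [ipSeq_comm, ipSeq_smul]
        simp
    | succ n ih =>
      intro m
      rw [← hraise]
      have := combo_adj (hmem n) (hmem m) ((t⁻¹ - t) / 2) ((t⁻¹ + t) / 2) (t⁻¹ * ζ / 2)
      rw [show ipSeq (sqRaise t ζ (G n)) (G m) = _ from this]
      rw [show (((t⁻¹ + t) / 2) • lowerSeq + ((t⁻¹ - t) / 2) • raiseSeq - (t⁻¹ * ζ / 2) • 1 :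
        Module.End ℝ (ℕ → ℝ)) (G m) = _ from hlower m]
      rw [ipSeq_comm, ipSeq_smul, ipSeq_comm, ih]
      rcases m with _ | m
      · simp
      · rw [Nat.add_sub_cancel]
        rcases eq_or_ne n m with rfl | h
        · simp [Nat.factorial_succ]
        · simp [h]
  refine ⟨G, hmem, fun n => ?_, fun n => ?_, horth, ?_⟩
  · rw [h1, hraise, hlower]
  · rw [h2, hraise, hlower]
  · simp only [hG, pow_zero, Module.End.one_apply, hg', Pi.smul_apply, smul_eq_mul]
    rw [hg, sqVac, mul_one]
    exact inv_ne_zero (Real.sqrt_pos.2 hpos).ne'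

/-- The matrix elements of a squeezing are determined by their recursion. -/
theorem squeeze_recursion_unique {t ζ : ℝ} (ht : 0 < t) {u : ℕ → ℕ → ℝ}
    (h1 : ∀ j n, u (j + 1) n + j * u (j - 1) n = t * (u j (n + 1) + n * u j (n - 1)) + ζ * u j n)
    (h2 : ∀ j n, u (j + 1) n - j * u (j - 1) n = t⁻¹ * (n * u j (n - 1) - u j (n + 1)))
    (h0 : u 0 0 = 0) (j n : ℕ) : u j n = 0 := by
  suffices h : ∀ s j n, j + n = s → u j n = 0 from h _ j n rfl
  intro s
  induction s using Nat.strong_induction_on with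
  | _ s ih =>
    -- Entries of smaller total degree vanish by induction. The two relations then read u (j+1) n =
    -- t u j (n+1) and u (j+1) n = -t⁻¹ u j (n+1), and t > 0 forces both entries to vanish.
    have key : ∀ j n, j + n + 1 = s → u (j + 1) n = 0 ∧ u j (n + 1) = 0 := by
      intro j n hs
      have e1 : (j : ℝ) * u (j - 1) n = 0 := by
        rcases j with _ | j
        · simp
        · rw [ih (j + n) (by omega) _ _ (by simp), mul_zero]
      have e2 : (n : ℝ) * u j (n - 1) = 0 := by
        rcases n with _ | n
        · simp
        · rw [ih (j + n) (by omega) _ _ (by simp), mul_zero]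
      have e3 := ih (j + n) (by omega) j n rfl
      have f1 := h1 j n
      have f2 := h2 j n
      rw [e1, e2, e3] at f1
      rw [e1, e2] at f2
      have hti : 0 < t⁻¹ := by positivity
      have f3 : (t + t⁻¹) * u j (n + 1) = 0 := by linarith
      have f4 : u j (n + 1) = 0 := by
        rcases mul_eq_zero.1 f3 with h | h
        · exact absurd h (by positivity)
        · exact h
      exact ⟨by rw [f4] at f1; linarith, f4⟩
    rintro (_ | j) (_ | n) hs
    · exact h0
    · exact (key 0 n (by omega)).2
    · exact (key j 0 (by omega)).1
    · exact (key j (n + 1) (by omega)).1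

theorem factorial_mul_raiseSeq (f : ℕ → ℝ) (j : ℕ) :
    (j.factorial : ℝ) * raiseSeq f j = j * ((j - 1).factorial * f (j - 1)) := by
  rcases j with _ | j
  · simp [raiseSeq_zero]
  · rw [raiseSeq_succ, Nat.factorial_succ, Nat.add_sub_cancel]
    push_cast
    ring

theorem factorial_mul_lowerSeq (f : ℕ → ℝ) (j : ℕ) :
    (j.factorial : ℝ) * lowerSeq f j = (j + 1).factorial * f (j + 1) := by
  rw [lowerSeq_apply, Nat.factorial_succ]
  push_cast
  ring

/-- Up to a factor, the transpose of a squeezing is the inverse squeezing. -/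
theorem IsSqueeze.transpose {t ζ : ℝ} (ht : 0 < t) {G G' : ℕ → ℕ → ℝ} (hG : IsSqueeze t ζ G)
    (hG' : IsSqueeze t⁻¹ (-(ζ / t)) G') :
    ∃ μ : ℝ, μ ≠ 0 ∧ ∀ n j, (j.factorial : ℝ) * G n j = μ * (n.factorial * G' j n) := by
  refine ⟨G 0 0 / G' 0 0, div_ne_zero hG.ne_zero hG'.ne_zero, ?_⟩
  set μ := G 0 0 / G' 0 0 with hμ
  -- The inverse parameters 1/t and -ζ/t, with rows and columns interchanged, lead to the same
  -- recursion as that of G. The factor μ is chosen so that the entries (0, 0) agree.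
  have key := squeeze_recursion_unique (t := t) (ζ := ζ) ht
    (u := fun j n => j.factorial * G n j - μ * (n.factorial * G' j n)) ?_ ?_ ?_
  · intro n j
    exact sub_eq_zero.1 (key j n)
  · intro j n
    have e1 := congrArg ((j.factorial : ℝ) * ·) (congrFun (hG.field n) j)
    have e2 := congrArg ((n.factorial : ℝ) * ·) (congrFun (hG'.field j) n)
    simp only [Pi.add_apply, Pi.smul_apply, smul_eq_mul, mul_add, factorial_mul_raiseSeq,
      factorial_mul_lowerSeq] at e1 e2
    have ht' : t ≠ 0 := ht.ne'
    have e3 : t * ((n + 1).factorial * G' j (n + 1) + n * ((n - 1).factorial * G' j (n - 1))) =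
        n.factorial * G' (j + 1) n + n.factorial * (j * G' (j - 1) n) - ζ * (n.factorial * G' j n) := by
      rw [e2]
      field_simp
      ring
    linear_combination e1 + μ * e3
  · intro j n
    have e1 := congrArg ((j.factorial : ℝ) * ·) (congrFun (hG.momentum n) j)
    have e2 := congrArg ((n.factorial : ℝ) * ·) (congrFun (hG'.momentum j) n)
    simp only [Pi.sub_apply, Pi.smul_apply, smul_eq_mul, mul_sub, factorial_mul_raiseSeq,
      factorial_mul_lowerSeq] at e1 e2
    have ht' : t ≠ 0 := ht.ne'
    rw [inv_inv] at e2
    have e3 : t⁻¹ * (n * ((n - 1).factorial * G' j (n - 1)) - (n + 1).factorial * G' j (n + 1)) =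
        n.factorial * G' (j + 1) n - n.factorial * (j * G' (j - 1) n) := by
      rw [← neg_sub, e2]
      field_simp
      ring
    linear_combination e1 + μ * e3
  · have := hG'.ne_zero
    simp only [Nat.factorial_zero, Nat.cast_one, one_mul, hμ]
    field_simp
    ring

end

end NodalMattis

namespace NodalMattis

noncomputable section

variable {N : ℕ}

/-! ### Isometries from Gram matrices, and spanning sets of number states -/

/-- The norm of a linear combination depends only on the Gram matrix. Hence every linear relation
among the u x holds among the v x, and the assignment extends linearly and isometrically. -/
theorem exists_isometry_of_gram {X F : Type*} [NormedAddCommGroup F] [InnerProductSpace ℂ F]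
    (u : X → FockAlg N) (v : X → F) (h : ∀ x y, inner ℂ (u x) (u y) = inner ℂ (v x) (v y))
    (hu : Submodule.span ℂ (Set.range u) = ⊤) :
    ∃ R : FockAlg N →ₗ[ℂ] F, (∀ x, R (u x) = v x) ∧ ∀ y, ‖R y‖ = ‖y‖ := by
  set Lu := Finsupp.linearCombination ℂ u with hLu
  set Lv := Finsupp.linearCombination ℂ v with hLv
  have hnorm : ∀ f, ‖Lv f‖ = ‖Lu f‖ := fun f => by
    have h2 : inner ℂ (Lv f) (Lv f) = inner ℂ (Lu f) (Lu f) := by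
      simp only [hLu, hLv, Finsupp.linearCombination_apply, Finsupp.sum, sum_inner, inner_sum,
        inner_smul_left, inner_smul_right, h]
    rw [inner_self_eq_norm_sq_to_K, inner_self_eq_norm_sq_to_K] at h2
    have h3 : ‖Lv f‖ ^ 2 = ‖Lu f‖ ^ 2 := by exact_mod_cast h2
    exact (sq_eq_sq₀ (norm_nonneg _) (norm_nonneg _)).1 h3
  have hsurj : LinearMap.range Lu = ⊤ := by rw [hLu, Finsupp.range_linearCombination, hu]
  obtain ⟨g, hg⟩ := Lu.exists_rightInverse_of_surjective hsurj
  have hg' : ∀ y, Lu (g y) = y := fun y => LinearMap.congr_fun hg y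
  refine ⟨Lv ∘ₗ g, fun x => ?_, fun y => ?_⟩
  · have h1 : Lv (g (u x) - Finsupp.single x 1) = 0 := by
      rw [← norm_eq_zero, hnorm, map_sub, hg', hLu, Finsupp.linearCombination_single, one_smul,
        sub_self, norm_zero]
    rw [map_sub, sub_eq_zero] at h1
    rw [LinearMap.comp_apply, h1, hLv, Finsupp.linearCombination_single, one_smul]
  · rw [LinearMap.comp_apply, hnorm, hg']

/-- Induction on the level. Creation operators strictly raise it, so their images in level n lie in
M by induction. A vector of level n orthogonal to these images is killed by every annihilation
operator, hence lies in M as well; finite dimension supplies the decomposition. -/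
theorem eq_top_of_graded {ι : Type*} {a ad : ι → Op N} {d : ι → ℤ} (hd : ∀ i, 0 < d i)
    (hadj : ∀ i, IsAdj (a i) (ad i)) (ha : ∀ i, Graded (a i) (-d i))
    (had : ∀ i, Graded (ad i) (d i)) (M : Submodule ℂ (FockAlg N))
    (hM : ∀ n, ∀ v ∈ V N n, (∀ i, a i v = 0) → v ∈ M) (hM' : ∀ i, ∀ v ∈ M, ad i v ∈ M) :
    M = ⊤ := by
  have key : ∀ k : ℕ, ∀ n : ℤ, n < k → V N n ≤ M := by
    intro k
    induction k with
    | zero =>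
      intro n hn
      rw [V_eq_bot (by exact_mod_cast hn)]
      exact bot_le
    | succ k ih =>
      intro n hn v hv
      set P : Submodule ℂ (FockAlg N) := ⨆ i, (V N (n - d i)).map (ad i) with hP
      have hPV : P ≤ V N n := iSup_le fun i => by
        rintro _ ⟨w, hw, rfl⟩
        simpa using had i _ w hw
      have hPM : P ≤ M := iSup_le fun i => by
        rintro _ ⟨w, hw, rfl⟩
        exact hM' i w (ih (n - d i) (by have := hd i; push_cast at hn; omega) hw)
      have : FiniteDimensional ℂ P := Submodule.finiteDimensional_of_le hPV
      have : CompleteSpace P := FiniteDimensional.complete ℂ P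
      obtain ⟨p, hp, w, hw, rfl⟩ := P.exists_add_mem_mem_orthogonal v
      refine add_mem (hPM hp) (hM n w ?_ fun i => ?_)
      · simpa using sub_mem hv (hPV hp)
      · have hwV : w ∈ V N n := by simpa using sub_mem hv (hPV hp)
        have h1 : ad i (a i w) ∈ P :=
          Submodule.mem_iSup_of_mem i ⟨a i w, ha i n w hwV, rfl⟩
        have h2 := (Submodule.mem_orthogonal P w).1 hw _ h1
        rw [(hadj i).symm] at h2
        exact inner_self_eq_zero.1 h2
  rw [eq_top_iff, ← iSup_V]
  exact iSup_le fun n => key (n.toNat + 1) n (by push_cast; omega)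

/-- In each level the kernel of a is finite-dimensional and invariant under the symmetric operator
z, so it is spanned by eigenvectors of z. -/
theorem eq_top_of_graded_eigen {a ad z : Op N} {d : ℤ} (hd : 0 < d) (hadj : IsAdj a ad)
    (ha : Graded a (-d)) (had : Graded ad d) (hz : IsAdj z z) (gz : Graded z 0)
    (hza : Commute z a) (M : Submodule ℂ (FockAlg N))
    (hM : ∀ v, a v = 0 → ∀ ζ : ℝ, z v = (ζ : ℂ) • v → v ∈ M) (hM' : ∀ v ∈ M, ad v ∈ M) :
    M = ⊤ := by
  refine eq_top_of_graded (ι := Unit) (fun _ => hd) (fun _ => hadj) (fun _ => ha) (fun _ => had) M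
    (fun n v hv hav => ?_) (fun _ => hM')
  set W : Submodule ℂ (FockAlg N) := V N n ⊓ LinearMap.ker a with hW
  have hmap : ∀ w ∈ W, z w ∈ W := fun w hw => by
    refine ⟨by simpa using gz n w hw.1, ?_⟩
    have : a (z w) = z (a w) := (LinearMap.congr_fun hza w).symm
    change a (z w) = 0
    rw [this, LinearMap.mem_ker.1 hw.2, map_zero]
  have : FiniteDimensional ℂ W := Submodule.finiteDimensional_of_le inf_le_left
  have hT : (z.restrict hmap).IsSymmetric := fun x y => hz x y
  have hvW : v ∈ W := ⟨hv, hav ()⟩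
  have h1 := (hT.eigenvectorBasis rfl).sum_repr ⟨v, hvW⟩
  have h2 := congrArg Subtype.val h1
  rw [AddSubmonoidClass.coe_finsetSum] at h2
  have h3 : v ∈ M ↔ (Subtype.val (⟨v, hvW⟩ : W)) ∈ M := Iff.rfl
  rw [h3, ← h2]
  refine Submodule.sum_mem _ fun j _ => ?_
  refine Submodule.smul_mem _ _ ?_
  refine hM _ (LinearMap.mem_ker.1 (hT.eigenvectorBasis rfl j).2.2) (hT.eigenvalues rfl j) ?_
  exact congrArg Subtype.val (hT.apply_eigenvectorBasis rfl j)

/-! ### Squeezing and shifting one oscillator -/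

section squeeze

variable {a ad : Op N}

theorem lower_pow_apply (hccr : a * ad - ad * a = 1) {κ : FockAlg N} (hκ : a κ = 0) (m : ℕ) :
    a ((ad ^ m) κ) = (m : ℂ) • (ad ^ (m - 1)) κ := by
  have h := LinearMap.congr_fun (lower_mul_raise_pow hccr m) κ
  simp only [Module.End.mul_apply, LinearMap.add_apply, hκ, map_zero, zero_add] at h
  rw [h, Module.End.natCast_apply, Nat.cast_smul_eq_nsmul]

/-- Two different vacuum vectors are allowed: their inner product factors out, which permits the
comparison of whole families of number states. -/
theorem pow_inner (hadj : IsAdj a ad) (hccr : a * ad - ad * a = 1) {κ κ' : FockAlg N}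
    (hκ : a κ = 0) (hκ' : a κ' = 0) (m n : ℕ) :
    inner ℂ ((ad ^ m) κ) ((ad ^ n) κ') = if m = n then (m.factorial : ℂ) * inner ℂ κ κ' else 0 := by
  induction m generalizing n with
  | zero =>
    rcases n with _ | n
    · simp
    · rw [pow_succ', Module.End.mul_apply, pow_zero, Module.End.one_apply, ← hadj, hκ]
      simp
  | succ m ih =>
    rw [pow_succ', Module.End.mul_apply, hadj.symm, lower_pow_apply hccr hκ', inner_smul_right, ih]
    rcases n with _ | n
    · simp
    · rcases eq_or_ne m n with rfl | h
      · simp only [Nat.add_sub_cancel, if_true, Nat.factorial_succ]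
        push_cast
        ring
      · simp [h]

theorem pow_norm (hadj : IsAdj a ad) (hccr : a * ad - ad * a = 1) {κ : FockAlg N}
    (hκ : a κ = 0) (m : ℕ) : ‖incl N ((ad ^ m) κ)‖ = √m.factorial * ‖κ‖ := by
  have h := pow_inner hadj hccr hκ hκ m m
  rw [if_pos rfl, inner_self_eq_norm_sq_to_K, inner_self_eq_norm_sq_to_K] at h
  have h' : ‖(ad ^ m) κ‖ ^ 2 = m.factorial * ‖κ‖ ^ 2 := by
    refine Complex.ofReal_injective ?_
    push_cast
    exact h
  rw [norm_incl, ← Real.sqrt_sq (norm_nonneg ((ad ^ m) κ)), h', Real.sqrt_mul (by positivity),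
    Real.sqrt_sq (norm_nonneg κ)]

/-- The vector `∑ f m (a†)^m κ`. -/
def seqVec (ad : Op N) (κ : FockAlg N) (f : ℕ → ℝ) : Fock N :=
  ∑' m : ℕ, (f m : ℂ) • incl N ((ad ^ m) κ)

variable (hadj : IsAdj a ad) (hccr : a * ad - ad * a = 1)
include hadj hccr

theorem seqVec_hasSum {κ : FockAlg N} (hκ : a κ = 0) {f : ℕ → ℝ} (hf : f ∈ decaySeq) :
    HasSum (fun m : ℕ => (f m : ℂ) • incl N ((ad ^ m) κ)) (seqVec ad κ f) := by
  refine Summable.hasSum (Summable.of_norm ?_)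
  refine ((decaySeq_abs hf).mul_right ‖κ‖).congr fun m => ?_
  rw [norm_smul, pow_norm hadj hccr hκ, Complex.norm_real, Real.norm_eq_abs]
  ring

theorem seqVec_add {κ : FockAlg N} (hκ : a κ = 0) {f g : ℕ → ℝ} (hf : f ∈ decaySeq)
    (hg : g ∈ decaySeq) : seqVec ad κ (f + g) = seqVec ad κ f + seqVec ad κ g := by
  have h := (seqVec_hasSum hadj hccr hκ hf).add (seqVec_hasSum hadj hccr hκ hg)
  rw [← h.tsum_eq]
  exact tsum_congr fun m => by rw [Pi.add_apply, Complex.ofReal_add, add_smul]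

theorem seqVec_smul {κ : FockAlg N} (hκ : a κ = 0) {f : ℕ → ℝ} (hf : f ∈ decaySeq) (x : ℝ) :
    seqVec ad κ (x • f) = (x : ℂ) • seqVec ad κ f := by
  have h := (seqVec_hasSum hadj hccr hκ hf).const_smul (x : ℂ)
  rw [← h.tsum_eq]
  exact tsum_congr fun m => by rw [Pi.smul_apply, smul_eq_mul, Complex.ofReal_mul, mul_smul]

theorem incl_pow_inner_seqVec {κ κ' : FockAlg N} (hκ : a κ = 0) (hκ' : a κ' = 0) {f : ℕ → ℝ}
    (hf : f ∈ decaySeq) (m : ℕ) :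
    inner ℂ (incl N ((ad ^ m) κ)) (seqVec ad κ' f) = (m.factorial * f m : ℝ) * inner ℂ κ κ' := by
  have h := (seqVec_hasSum hadj hccr hκ' hf).mapL (innerSL ℂ (incl N ((ad ^ m) κ)))
  rw [innerSL_apply_apply] at h
  have e : ∀ n, innerSL ℂ (incl N ((ad ^ m) κ)) ((f n : ℂ) • incl N ((ad ^ n) κ')) =
      (f n : ℂ) * if m = n then (m.factorial : ℂ) * inner ℂ κ κ' else 0 := fun n => by
    rw [innerSL_apply_apply, inner_smul_right, inner_incl, pow_inner hadj hccr hκ hκ']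
  rw [← h.tsum_eq, tsum_eq_single m fun n hn => by rw [e, if_neg hn.symm, mul_zero], e, if_pos rfl]
  push_cast
  ring

theorem seqVec_inner {κ κ' : FockAlg N} (hκ : a κ = 0) (hκ' : a κ' = 0) {f g : ℕ → ℝ}
    (hf : f ∈ decaySeq) (hg : g ∈ decaySeq) :
    inner ℂ (seqVec ad κ f) (seqVec ad κ' g) = (ipSeq f g : ℂ) * inner ℂ κ κ' := by
  have h := (seqVec_hasSum hadj hccr hκ' hg).mapL (innerSL ℂ (seqVec ad κ f))
  rw [innerSL_apply_apply] at h
  rw [← h.tsum_eq, ipSeq, Complex.ofReal_tsum, ← tsum_mul_right]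
  refine tsum_congr fun m => ?_
  rw [innerSL_apply_apply, inner_smul_right, ← inner_conj_symm,
    incl_pow_inner_seqVec hadj hccr hκ' hκ hf, map_mul, inner_conj_symm, Complex.conj_ofReal]
  push_cast
  ring

end squeeze

end

end NodalMattis

/-! ### Construction of the squeezing unitary. -/

namespace NodalMattis

noncomputable section

variable {N : ℕ}

/-- On the vectors `seqVec ad κ f` the operator `B` acts as `β` acts on the sequences `f`. -/
def ActsAs (ad : Op N) (κ : FockAlg N) (B : Op N) (β : Module.End ℝ (ℕ → ℝ)) : Prop :=
  ∀ f ∈ decaySeq, β f ∈ decaySeq ∧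
    HasSum (fun m : ℕ => (f m : ℂ) • incl N (B ((ad ^ m) κ))) (seqVec ad κ (β f))

section ActsAs

variable {a ad : Op N} {κ : FockAlg N} {B B' : Op N} {β β' : Module.End ℝ (ℕ → ℝ)}

theorem ActsAs.one (hadj : IsAdj a ad) (hccr : a * ad - ad * a = 1) (hκ : a κ = 0) :
    ActsAs ad κ 1 1 := fun _ hf => ⟨hf, seqVec_hasSum hadj hccr hκ hf⟩

/-- The new factor stands on the right, hence acts first and can be transferred to the coefficients;
no continuity of B is needed. -/
theorem ActsAs.mul_raise (h : ActsAs ad κ B β) : ActsAs ad κ (B * ad) (β * raiseSeq) := by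
  intro f hf
  obtain ⟨h1, h2⟩ := h (raiseSeq f) (raiseSeq_mem hf)
  refine ⟨h1, ?_⟩
  have h3 := (hasSum_nat_add_iff' 1).2 h2
  simp only [Finset.range_one, Finset.sum_singleton, raiseSeq_zero, raiseSeq_succ,
    Complex.ofReal_zero, zero_smul, sub_zero, pow_succ', Module.End.mul_apply] at h3
  exact h3

theorem ActsAs.mul_lower (hccr : a * ad - ad * a = 1) (hκ : a κ = 0) (h : ActsAs ad κ B β) :
    ActsAs ad κ (B * a) (β * lowerSeq) := by
  intro f hf
  obtain ⟨h1, h2⟩ := h (lowerSeq f) (lowerSeq_mem hf)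
  refine ⟨h1, ?_⟩
  rw [← hasSum_nat_add_iff' 1]
  simp only [Finset.range_one, Finset.sum_singleton, Module.End.mul_apply,
    lower_pow_apply hccr hκ, Nat.cast_zero, zero_smul, map_zero, smul_zero, sub_zero]
  convert h2 using 1
  ext1 m
  rw [lowerSeq_apply, map_smul, map_smul, smul_smul, Nat.add_sub_cancel]
  congr 1
  push_cast
  ring

theorem ActsAs.add (hadj : IsAdj a ad) (hccr : a * ad - ad * a = 1) (hκ : a κ = 0)
    (h : ActsAs ad κ B β) (h' : ActsAs ad κ B' β') : ActsAs ad κ (B + B') (β + β') := by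
  intro f hf
  obtain ⟨h1, h2⟩ := h f hf
  obtain ⟨h1', h2'⟩ := h' f hf
  refine ⟨add_mem h1 h1', ?_⟩
  rw [LinearMap.add_apply, seqVec_add hadj hccr hκ h1 h1']
  convert h2.add h2' using 1
  ext1 m
  rw [LinearMap.add_apply, map_add, smul_add]

theorem ActsAs.sub (hadj : IsAdj a ad) (hccr : a * ad - ad * a = 1) (hκ : a κ = 0)
    (h : ActsAs ad κ B β) (h' : ActsAs ad κ B' β') : ActsAs ad κ (B - B') (β - β') := by
  have hneg : ActsAs ad κ (-B') (-β') := by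
    intro f hf
    obtain ⟨h1, h2⟩ := h' f hf
    refine ⟨neg_mem h1, ?_⟩
    have e : (-β') f = (-1 : ℝ) • β' f := by simp
    rw [e, seqVec_smul hadj hccr hκ h1]
    convert h2.const_smul ((-1 : ℝ) : ℂ) using 1
    ext1 m
    rw [LinearMap.neg_apply, map_neg]
    simp
  have := h.add hadj hccr hκ hneg
  rwa [← sub_eq_add_neg, ← sub_eq_add_neg] at this

theorem ActsAs.mul_field (hadj : IsAdj a ad) (hccr : a * ad - ad * a = 1) (hκ : a κ = 0)
    (h : ActsAs ad κ B β) : ActsAs ad κ (B * (a + ad)) (β * (lowerSeq + raiseSeq)) := by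
  rw [mul_add, mul_add]
  exact (h.mul_lower hccr hκ).add hadj hccr hκ h.mul_raise

theorem ActsAs.mul_momentum (hadj : IsAdj a ad) (hccr : a * ad - ad * a = 1) (hκ : a κ = 0)
    (h : ActsAs ad κ B β) : ActsAs ad κ (B * (a - ad)) (β * (lowerSeq - raiseSeq)) := by
  rw [mul_sub, mul_sub]
  exact (h.mul_lower hccr hκ).sub hadj hccr hκ h.mul_raise

end ActsAs

theorem commute_pow_apply {T ad : Op N} (h : Commute T ad) (m : ℕ) (κ : FockAlg N) :
    T ((ad ^ m) κ) = (ad ^ m) (T κ) := LinearMap.congr_fun (h.pow_right m) κ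

theorem hasSum_mem {E : Type*} [NormedAddCommGroup E] [NormedSpace ℂ E] {P : Submodule ℂ E}
    (hP : IsClosed (P : Set E)) {f : ℕ → E} {x : E} (hf : ∀ m, f m ∈ P) (h : HasSum f x) : x ∈ P :=
  hP.mem_of_tendsto h (Filter.Eventually.of_forall fun _ => Submodule.sum_mem _ fun m _ => hf m)

/-- A squeezed and shifted oscillator is unitarily equivalent to the original one. -/
theorem exists_squeeze {a ad z : Op N} {d : ℤ} (hd : 0 < d) (hadj : IsAdj a ad)
    (hccr : a * ad - ad * a = 1) (ha : Graded a (-d)) (had : Graded ad d) (hz : IsAdj z z)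
    (gz : Graded z 0) (hza : Commute z a) (hzad : Commute z ad) {t : ℝ} (ht : 0 < t) :
    ∃ U : Fock N ≃ₗᵢ[ℂ] Fock N, ∀ (T₀ T₁ : Op N) (x y : ℂ),
      Commute T₀ a → Commute T₀ ad → Commute T₀ z → Commute T₁ a → Commute T₁ ad → Commute T₁ z →
      Transforms U (T₀ + T₁ * (a + ad) + x • ((a + ad) * (a + ad)) + y • ((a - ad) * (a - ad)))
        (T₀ + T₁ * ((t : ℂ) • (a + ad) + z) +
          x • (((t : ℂ) • (a + ad) + z) * ((t : ℂ) • (a + ad) + z)) +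
          y • (((t⁻¹ : ℝ) : ℂ) • (a - ad) * ((t⁻¹ : ℝ) : ℂ) • (a - ad))) := by
  -- On an eigenvector of z the operator-valued shift is a number ζ, so each ζ has its own
  -- squeezing. The number states over such vectors in the kernel of a are indexed by X.
  choose G hG using fun ζ => exists_isSqueeze ht ζ
  let X := ℕ × {κ : ℝ × FockAlg N // a κ.2 = 0 ∧ z κ.2 = (κ.1 : ℂ) • κ.2}
  let u : X → FockAlg N := fun i => (ad ^ i.1) i.2.1.2
  let v : X → Fock N := fun i => seqVec ad i.2.1.2 (G i.2.1.1 i.1)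
  have hgram : ∀ i j, inner ℂ (u i) (u j) = inner ℂ (v i) (v j) := by
    rintro ⟨m, ⟨ζ, κ⟩, hκ, hζ⟩ ⟨n, ⟨ζ', κ'⟩, hκ', hζ'⟩
    simp only [u, v]
    dsimp only at hκ hζ hκ' hζ'
    rw [pow_inner hadj hccr hκ hκ',
      seqVec_inner hadj hccr hκ hκ' ((hG ζ).mem m) ((hG ζ').mem n)]
    rcases eq_or_ne ζ ζ' with rfl | h
    · rw [(hG ζ).orthogonal]
      split_ifs <;> simp
    -- Squeezings with different shifts are not compared: eigenvectors of the symmetric z for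
    -- different eigenvalues are orthogonal.
    · have h0 : inner ℂ κ κ' = 0 := by
        have h1 := hz κ κ'
        rw [hζ, hζ', inner_smul_left, inner_smul_right, Complex.conj_ofReal] at h1
        by_contra h2
        exact h (Complex.ofReal_injective (mul_right_cancel₀ h2 h1))
      rw [h0]
      simp
  have hspan : Submodule.span ℂ (Set.range u) = ⊤ := by
    refine eq_top_of_graded_eigen hd hadj ha had hz gz hza _ (fun w hw ζ hζ => ?_) fun w hw => ?_
    · exact Submodule.subset_span ⟨⟨0, ⟨⟨ζ, w⟩, hw, hζ⟩⟩, rfl⟩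
    · induction hw using Submodule.span_induction with
      | mem x hx =>
        obtain ⟨⟨n, κ⟩, rfl⟩ := hx
        refine Submodule.subset_span ⟨⟨n + 1, κ⟩, ?_⟩
        simp only [u, pow_succ', Module.End.mul_apply]
      | zero => simp
      | add x y _ _ hx hy => rw [map_add]; exact add_mem hx hy
      | smul c x _ hx => rw [map_smul]; exact Submodule.smul_mem _ _ hx
  obtain ⟨R, hRu, hRn⟩ := exists_isometry_of_gram u v hgram hspan
  have hR : ∀ {ζ : ℝ} {κ : FockAlg N}, a κ = 0 → z κ = (ζ : ℂ) • κ → ∀ n,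
      R ((ad ^ n) κ) = seqVec ad κ (G ζ n) := fun {ζ κ} h1 h2 n => hRu ⟨n, ⟨ζ, κ⟩, h1, h2⟩
  -- The inverse squeezing writes every number state as a convergent series of vectors in the range
  -- of R.
  have hdense : (LinearMap.range R).topologicalClosure = ⊤ := by
    set W := (LinearMap.range R).topologicalClosure with hW
    have hWc : IsClosed (W : Set (Fock N)) := Submodule.isClosed_topologicalClosure _
    have hmem : ∀ {κ : FockAlg N}, a κ = 0 → ∀ ζ : ℝ, z κ = (ζ : ℂ) • κ → ∀ j,
        incl N ((ad ^ j) κ) ∈ W := by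
      intro κ hκ ζ hζ j
      obtain ⟨G', hG'⟩ := exists_isSqueeze (inv_pos.2 ht) (-(ζ / t))
      obtain ⟨μ, hμ0, hμ⟩ := (hG ζ).transpose ht hG'
      set P := (Submodule.span ℂ (Set.range fun m => incl N ((ad ^ m) κ))).topologicalClosure with hP
      have hPc : IsClosed (P : Set (Fock N)) := Submodule.isClosed_topologicalClosure _
      have hmP : ∀ m, incl N ((ad ^ m) κ) ∈ P := fun m =>
        Submodule.le_topologicalClosure _ (Submodule.subset_span ⟨m, rfl⟩)
      have hsum : Summable fun k : ℕ => (G' j k : ℂ) • R ((ad ^ k) κ) := by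
        refine Summable.of_norm (((decaySeq_abs (hG'.mem j)).mul_right ‖κ‖).congr fun m => ?_)
        rw [norm_smul, hRn, ← norm_incl ((ad ^ m) κ), pow_norm hadj hccr hκ, Complex.norm_real,
          Real.norm_eq_abs]
        ring
      -- This should be μ (a†)^j κ. Its inner product with (a†)^m κ is, by the transposition
      -- relation, μ‖κ‖² times the scalar product of the columns m and j of G', which are
      -- orthogonal. As w lies in the closed span of the number states over κ, these inner products
      -- determine it.
      set w := ∑' k : ℕ, (G' j k : ℂ) • R ((ad ^ k) κ) with hw
      have hwW : w ∈ W := hasSum_mem hWc (fun m => Submodule.smul_mem _ _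
        (Submodule.le_topologicalClosure _ ⟨_, rfl⟩)) hsum.hasSum
      have hwP : w ∈ P := hasSum_mem hPc (fun k => Submodule.smul_mem _ _ (by
        rw [hR hκ hζ]
        exact hasSum_mem hPc (fun m => Submodule.smul_mem _ _ (hmP m))
          (seqVec_hasSum hadj hccr hκ ((hG ζ).mem k)))) hsum.hasSum
      have hin : ∀ m, inner ℂ (incl N ((ad ^ m) κ)) (w - (μ : ℂ) • incl N ((ad ^ j) κ)) = 0 := by
        intro m
        have h1 := hsum.hasSum.mapL (innerSL ℂ (incl N ((ad ^ m) κ)))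
        rw [innerSL_apply_apply] at h1
        have e : ∀ k, innerSL ℂ (incl N ((ad ^ m) κ)) ((G' j k : ℂ) • R ((ad ^ k) κ)) =
            ((k.factorial * G' m k * G' j k : ℝ) : ℂ) * ((μ : ℂ) * inner ℂ κ κ) := fun k => by
          rw [innerSL_apply_apply, inner_smul_right, hR hκ hζ,
            incl_pow_inner_seqVec hadj hccr hκ hκ ((hG ζ).mem k), hμ]
          push_cast
          ring
        rw [inner_sub_right, ← h1.tsum_eq, tsum_congr e, tsum_mul_right, ← Complex.ofReal_tsum]
        change ((ipSeq (G' m) (G' j) : ℝ) : ℂ) * _ - _ = 0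
        rw [hG'.orthogonal, inner_smul_right, inner_incl, pow_inner hadj hccr hκ hκ]
        split_ifs
        · push_cast
          ring
        · simp
      have hzero : w - (μ : ℂ) • incl N ((ad ^ j) κ) = 0 := by
        set q := w - (μ : ℂ) • incl N ((ad ^ j) κ) with hq
        have hqP : q ∈ P := sub_mem hwP (Submodule.smul_mem _ _ (hmP j))
        have hqo : q ∈ (Submodule.span ℂ (Set.range fun m => incl N ((ad ^ m) κ)))ᗮ := by
          rw [Submodule.mem_orthogonal]
          intro p hp
          induction hp using Submodule.span_induction with
          | mem x hx => obtain ⟨m, rfl⟩ := hx; exact hin m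
          | zero => simp
          | add x y _ _ hx hy => rw [inner_add_left, hx, hy, add_zero]
          | smul c x _ hx => rw [inner_smul_left, hx, mul_zero]
        rw [← Submodule.orthogonal_closure] at hqo
        exact inner_self_eq_zero.1 ((Submodule.mem_orthogonal _ _).1 hqo q hqP)
      have hμ' : (μ : ℂ) ≠ 0 := by exact_mod_cast hμ0
      have : incl N ((ad ^ j) κ) = (μ : ℂ)⁻¹ • w := by
        rw [sub_eq_zero.1 hzero, smul_smul, inv_mul_cancel₀ hμ', one_smul]
      rw [this]
      exact Submodule.smul_mem _ _ hwW
    have htop : W.comap (incl N) = ⊤ := by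
      rw [eq_top_iff, ← hspan, Submodule.span_le]
      rintro _ ⟨⟨n, ⟨ζ, κ⟩, h1, h2⟩, rfl⟩
      exact hmem h1 ζ h2 n
    rw [eq_top_iff, ← incl_dense]
    refine Submodule.topologicalClosure_minimal _ ?_ hWc
    rintro _ ⟨x, rfl⟩
    have : x ∈ W.comap (incl N) := by rw [htop]; trivial
    exact this
  obtain ⟨U, hU⟩ := exists_unitary R hRn hdense
  refine ⟨U, fun T₀ T₁ x y h0a h0ad h0z h1a h1ad h1z => ?_⟩
  set H := T₀ + T₁ * (a + ad) + x • ((a + ad) * (a + ad)) + y • ((a - ad) * (a - ad)) with hH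
  set F : Op N := (t : ℂ) • (a + ad) + z with hF
  set D : Op N := ((t⁻¹ : ℝ) : ℂ) • (a - ad) with hD
  set H' := T₀ + T₁ * F + x • (F * F) + y • (D * D) with hH'
  set A : Module.End ℝ (ℕ → ℝ) := lowerSeq + raiseSeq with hA
  set B : Module.End ℝ (ℕ → ℝ) := lowerSeq - raiseSeq with hB
  have hAm : ∀ {f}, f ∈ decaySeq → A f ∈ decaySeq := fun hf =>
    add_mem (lowerSeq_mem hf) (raiseSeq_mem hf)
  have hBm : ∀ {f}, f ∈ decaySeq → B f ∈ decaySeq := fun hf =>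
    sub_mem (lowerSeq_mem hf) (raiseSeq_mem hf)
  have hker : ∀ {T : Op N}, Commute T a → ∀ {κ : FockAlg N}, a κ = 0 → a (T κ) = 0 :=
    fun {T} hT {κ} hκ => by
      have := LinearMap.congr_fun hT κ
      simp only [Module.End.mul_apply, hκ, map_zero] at this
      exact this.symm
  have heig : ∀ {T : Op N}, Commute T z → ∀ {κ : FockAlg N} {ζ : ℝ}, z κ = (ζ : ℂ) • κ →
      z (T κ) = (ζ : ℂ) • T κ :=
    fun {T} hT {κ ζ} hκ => by
      have := LinearMap.congr_fun hT κ
      simp only [Module.End.mul_apply, hκ, map_smul] at this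
      exact this.symm
  -- the closure of `H` on rapidly decreasing combinations of number states
  have hgraph : ∀ {κ : FockAlg N}, a κ = 0 → ∀ {f}, f ∈ decaySeq →
      (seqVec ad κ f, seqVec ad (T₀ κ) f + seqVec ad (T₁ κ) (A f) + x • seqVec ad κ (A (A f)) +
        y • seqVec ad κ (B (B f))) ∈ closedGraph H := by
    intro κ hκ f hf
    have one := ActsAs.one hadj hccr hκ
    have s0 := ((ActsAs.one hadj hccr (hker h0a hκ)) f hf).2
    have s1 := (((ActsAs.one hadj hccr (hker h1a hκ)).mul_field hadj hccr (hker h1a hκ)) f hf).2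
    have s2 := (((one.mul_field hadj hccr hκ).mul_field hadj hccr hκ) f hf).2
    have s3 := (((one.mul_momentum hadj hccr hκ).mul_momentum hadj hccr hκ) f hf).2
    rw [one_mul, one_mul] at s1 s2 s3
    have s := ((one f hf).2).prodMk (((s0.add s1).add (s2.const_smul x)).add (s3.const_smul y))
    refine hasSum_mem (Submodule.isClosed_topologicalClosure _) (fun m => ?_) s
    have h3 := Submodule.smul_mem _ (f m : ℂ) (mem_closedGraph_incl H ((ad ^ m) κ))
    have h1F : Commute T₁ (a + ad) := h1a.add_right h1ad
    have e : H ((ad ^ m) κ) = (1 : Op N) ((ad ^ m) (T₀ κ)) + (a + ad) ((ad ^ m) (T₁ κ)) +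
        x • ((a + ad) * (a + ad)) ((ad ^ m) κ) + y • ((a - ad) * (a - ad)) ((ad ^ m) κ) := by
      rw [hH]
      simp only [LinearMap.add_apply, LinearMap.smul_apply, Module.End.one_apply]
      rw [commute_pow_apply h0ad, h1F.eq, Module.End.mul_apply (a + ad) T₁,
        commute_pow_apply h1ad]
      simp only [LinearMap.add_apply]
    rw [e, Prod.smul_mk] at h3
    simp only [map_add, map_smul, smul_add] at h3 ⊢
    rw [smul_comm x, smul_comm y]
    exact h3
  -- the action of `U` on the transformed fields
  have hUn : ∀ {ζ : ℝ} {κ : FockAlg N}, a κ = 0 → z κ = (ζ : ℂ) • κ → ∀ n : ℕ,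
      U (incl N ((ad ^ n) κ)) = seqVec ad κ (G ζ n) := fun h1 h2 n => by rw [hU, hR h1 h2]
  have hFn : ∀ {ζ : ℝ} {κ : FockAlg N}, a κ = 0 → z κ = (ζ : ℂ) • κ → ∀ n : ℕ,
      F ((ad ^ n) κ) = (t : ℂ) • ((ad ^ (n + 1)) κ + (n : ℂ) • (ad ^ (n - 1)) κ) +
        (ζ : ℂ) • (ad ^ n) κ := fun {ζ κ} h1 h2 n => by
    rw [hF, LinearMap.add_apply, LinearMap.smul_apply, LinearMap.add_apply,
      lower_pow_apply hccr h1, commute_pow_apply hzad, h2, map_smul, pow_succ',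
      Module.End.mul_apply, add_comm ((n : ℂ) • _)]
  have hDn : ∀ {κ : FockAlg N}, a κ = 0 → ∀ n : ℕ,
      D ((ad ^ n) κ) = ((t⁻¹ : ℝ) : ℂ) • ((n : ℂ) • (ad ^ (n - 1)) κ - (ad ^ (n + 1)) κ) :=
    fun {κ} h1 n => by
      rw [hD, LinearMap.smul_apply, LinearMap.sub_apply, lower_pow_apply hccr h1, pow_succ',
        Module.End.mul_apply]
  -- The field relation of the columns with a further operator β applied; β = 1 gives the field and
  -- β = A its square.
  have hcombF : ∀ {ζ : ℝ} {κ : FockAlg N}, a κ = 0 → ∀ {β : Module.End ℝ (ℕ → ℝ)},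
      (∀ {f}, f ∈ decaySeq → β f ∈ decaySeq) → ∀ n : ℕ,
      (t : ℂ) • (seqVec ad κ (β (G ζ (n + 1))) + (n : ℂ) • seqVec ad κ (β (G ζ (n - 1)))) +
        (ζ : ℂ) • seqVec ad κ (β (G ζ n)) = seqVec ad κ (β (A (G ζ n))) := by
    intro ζ κ h1 β hβ n
    have m0 := hβ ((hG ζ).mem n)
    have m1 := hβ ((hG ζ).mem (n + 1))
    have m2 := hβ ((hG ζ).mem (n - 1))
    have m3 := decaySeq.smul_mem (n : ℝ) m2
    have e : A (G ζ n) = t • (G ζ (n + 1) + (n : ℝ) • G ζ (n - 1)) + ζ • G ζ n := (hG ζ).field n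
    rw [e, map_add, map_smul, map_add, map_smul, map_smul,
      seqVec_add hadj hccr h1 (decaySeq.smul_mem _ (add_mem m1 m3)) (decaySeq.smul_mem _ m0),
      seqVec_smul hadj hccr h1 (add_mem m1 m3), seqVec_add hadj hccr h1 m1 m3,
      seqVec_smul hadj hccr h1 m2, seqVec_smul hadj hccr h1 m0, Complex.ofReal_natCast]
  have hcombD : ∀ {ζ : ℝ} {κ : FockAlg N}, a κ = 0 → ∀ {β : Module.End ℝ (ℕ → ℝ)},
      (∀ {f}, f ∈ decaySeq → β f ∈ decaySeq) → ∀ n : ℕ,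
      ((t⁻¹ : ℝ) : ℂ) • ((n : ℂ) • seqVec ad κ (β (G ζ (n - 1))) - seqVec ad κ (β (G ζ (n + 1)))) =
        seqVec ad κ (β (B (G ζ n))) := by
    intro ζ κ h1 β hβ n
    have m1 := hβ ((hG ζ).mem (n + 1))
    have m2 := hβ ((hG ζ).mem (n - 1))
    have m3 := decaySeq.smul_mem (n : ℝ) m2
    have m4 := decaySeq.smul_mem (-1 : ℝ) m1
    have e : B (G ζ n) = t⁻¹ • ((n : ℝ) • G ζ (n - 1) + (-1 : ℝ) • G ζ (n + 1)) := by
      rw [neg_smul, one_smul, ← sub_eq_add_neg]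
      exact (hG ζ).momentum n
    rw [e, map_smul, map_add, map_smul, map_smul, seqVec_smul hadj hccr h1 (add_mem m3 m4),
      seqVec_add hadj hccr h1 m3 m4, seqVec_smul hadj hccr h1 m2, seqVec_smul hadj hccr h1 m1,
      Complex.ofReal_natCast, Complex.ofReal_neg, Complex.ofReal_one, neg_smul, one_smul,
      ← sub_eq_add_neg]
  have hUF : ∀ {ζ : ℝ} {κ : FockAlg N}, a κ = 0 → z κ = (ζ : ℂ) • κ → ∀ n : ℕ,
      U (incl N (F ((ad ^ n) κ))) = seqVec ad κ (A (G ζ n)) := fun {ζ κ} h1 h2 n => by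
    rw [hFn h1 h2]
    simp only [map_add, map_smul, hUn h1 h2]
    exact hcombF h1 (β := 1) (fun h => h) n
  have hUD : ∀ {ζ : ℝ} {κ : FockAlg N}, a κ = 0 → z κ = (ζ : ℂ) • κ → ∀ n : ℕ,
      U (incl N (D ((ad ^ n) κ))) = seqVec ad κ (B (G ζ n)) := fun {ζ κ} h1 h2 n => by
    rw [hDn h1]
    simp only [map_sub, map_smul, hUn h1 h2]
    exact hcombD h1 (β := 1) (fun h => h) n
  have hUFF : ∀ {ζ : ℝ} {κ : FockAlg N}, a κ = 0 → z κ = (ζ : ℂ) • κ → ∀ n : ℕ,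
      U (incl N (F (F ((ad ^ n) κ)))) = seqVec ad κ (A (A (G ζ n))) := fun {ζ κ} h1 h2 n => by
    rw [hFn h1 h2]
    simp only [map_add, map_smul, hUF h1 h2]
    exact hcombF h1 hAm n
  have hUDD : ∀ {ζ : ℝ} {κ : FockAlg N}, a κ = 0 → z κ = (ζ : ℂ) • κ → ∀ n : ℕ,
      U (incl N (D (D ((ad ^ n) κ)))) = seqVec ad κ (B (B (G ζ n))) := fun {ζ κ} h1 h2 n => by
    rw [hDn h1]
    simp only [map_sub, map_smul, hUD h1 h2]
    exact hcombD h1 hBm n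
  -- The claim is linear in w, so the spanning number states suffice; there T₀ and T₁ preserve the
  -- kernel of a and the eigenspaces of z.
  have hall : ∀ w : FockAlg N, (U (incl N w), U (incl N (H' w))) ∈ closedGraph H := by
    let L : FockAlg N →ₗ[ℂ] Fock N × Fock N :=
      (U.toLinearEquiv.toLinearMap ∘ₗ incl N).prod (U.toLinearEquiv.toLinearMap ∘ₗ incl N ∘ₗ H')
    have : (closedGraph H).comap L = ⊤ := by
      rw [eq_top_iff, ← hspan, Submodule.span_le]
      rintro _ ⟨⟨n, ⟨ζ, κ⟩, h1, h2⟩, rfl⟩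
      dsimp only at h1 h2
      change (U (incl N ((ad ^ n) κ)), U (incl N (H' ((ad ^ n) κ)))) ∈ closedGraph H
      have h1F : Commute T₁ F := ((h1a.add_right h1ad).smul_right _).add_right h1z
      have e : H' ((ad ^ n) κ) = (ad ^ n) (T₀ κ) + F ((ad ^ n) (T₁ κ)) +
          x • F (F ((ad ^ n) κ)) + y • D (D ((ad ^ n) κ)) := by
        rw [hH']
        simp only [LinearMap.add_apply, LinearMap.smul_apply]
        rw [commute_pow_apply h0ad, h1F.eq, Module.End.mul_apply F T₁, commute_pow_apply h1ad,
          Module.End.mul_apply, Module.End.mul_apply]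
      rw [e]
      simp only [map_add, map_smul]
      rw [hUn h1 h2, hUn (hker h0a h1) (heig h0z h2), hUF (hker h1a h1) (heig h1z h2),
        hUFF h1 h2, hUDD h1 h2]
      exact hgraph h1 ((hG ζ).mem n)
    intro w
    have hw : w ∈ (closedGraph H).comap L := by rw [this]; trivial
    exact hw
  exact hall

end

end NodalMattis

/-! ### Unitary equivalence of finite systems of coupled oscillators. -/

namespace NodalMattis

noncomputable section

variable {N : ℕ}

/-! ### Families of oscillators -/

/-- Mutually commuting oscillators that lower and raise the level by `d i`. -/
structure Oscillators {ι : Type} [DecidableEq ι] (a ad : ι → Op N) (d : ι → ℤ) : Prop where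
  pos : ∀ i, 0 < d i
  adj : ∀ i, IsAdj (a i) (ad i)
  comm : ∀ i j, Commute (a i) (a j)
  comm_ad : ∀ i j, Commute (ad i) (ad j)
  ccr : ∀ i j, a i * ad j - ad j * a i = if i = j then 1 else 0
  graded : ∀ i, Graded (a i) (-d i)
  graded_ad : ∀ i, Graded (ad i) (d i)

/-- The word in creation operators `ad` applied to `κ`. -/
def word {ι : Type} (ad : ι → Op N) (l : List ι) (κ : FockAlg N) : FockAlg N := (l.map ad).prod κ

theorem word_nil {ι : Type} (ad : ι → Op N) (κ : FockAlg N) : word ad [] κ = κ := rfl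

theorem word_cons {ι : Type} (ad : ι → Op N) (j : ι) (l : List ι) (κ : FockAlg N) :
    word ad (j :: l) κ = ad j (word ad l κ) := by
  simp only [word, List.map_cons, List.prod_cons, Module.End.mul_apply]

/-- The words obtained from `l` by removing one letter `i`. -/
def removals {ι : Type} [DecidableEq ι] (i : ι) : List ι → List (List ι)
  | [] => []
  | j :: l => (if i = j then [l] else []) ++ (removals i l).map (j :: ·)

/-- The Gram matrix of the words. -/
def wordGram {ι : Type} [DecidableEq ι] : List ι → List ι → ℂ
  | [], l' => if l' = [] then 1 else 0
  | j :: l, l' => ((removals j l').map (wordGram l)).sum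

section Words

variable {ι : Type} [DecidableEq ι] {a ad : ι → Op N}

theorem lower_word (ccr : ∀ i j, a i * ad j - ad j * a i = if i = j then 1 else 0)
    {κ : FockAlg N} (hκ : ∀ i, a i κ = 0) (i : ι) (l : List ι) :
    a i (word ad l κ) = ((removals i l).map fun m => word ad m κ).sum := by
  induction l with
  | nil => simp [removals, word_nil, hκ]
  | cons j l ih =>
    have h := LinearMap.congr_fun (ccr i j) (word ad l κ)
    rw [LinearMap.sub_apply, Module.End.mul_apply, Module.End.mul_apply, sub_eq_iff_eq_add, ih,
      map_list_sum, List.map_map] at h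
    rw [word_cons, h, removals, List.map_append, List.sum_append, List.map_map]
    congr 1
    split_ifs <;> simp

/-- Moving annihilation operators to the right uses only the commutation relations and the vacuum
property, so any two systems of oscillators with common vacuum vectors have equal Gram matrices of
words. -/
theorem word_inner (adj : ∀ i, IsAdj (a i) (ad i))
    (ccr : ∀ i j, a i * ad j - ad j * a i = if i = j then 1 else 0)
    {κ κ' : FockAlg N} (hκ : ∀ i, a i κ = 0) (hκ' : ∀ i, a i κ' = 0) (l l' : List ι) :
    inner ℂ (word ad l κ) (word ad l' κ') = wordGram l l' * inner ℂ κ κ' := by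
  induction l generalizing l' with
  | nil =>
    cases l' with
    | nil => simp [wordGram, word_nil]
    | cons j l' => rw [word_cons, word_nil, ← adj, hκ]; simp [wordGram]
  | cons j l ih =>
    rw [word_cons, (adj j).symm, lower_word ccr hκ', wordGram, ← innerSL_apply_apply ℂ,
      map_list_sum, List.map_map, ← List.sum_map_mul_right]
    congr 2
    ext1 m
    simp [ih]

end Words

/-- A canonical change of oscillators with the same vacuum vectors is unitary. -/
theorem exists_rotation {ι : Type} [DecidableEq ι] {a ad e ed : ι → Op N} {d : ι → ℤ}
    (h : Oscillators a ad d) (adj : ∀ i, IsAdj (e i) (ed i))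
    (ccr : ∀ i j, e i * ed j - ed j * e i = if i = j then 1 else 0)
    (hker : ∀ κ, (∀ i, a i κ = 0) → ∀ i, e i κ = 0)
    (hspan : ∀ M : Submodule ℂ (FockAlg N), (∀ i, ∀ v ∈ M, ed i v ∈ M) → ∀ i, ∀ v ∈ M, ad i v ∈ M) :
    ∃ (r : Op N) (U : Fock N ≃ₗᵢ[ℂ] Fock N), (∀ x, U (incl N x) = incl N (r x)) ∧
      (∀ i, SemiconjBy r (a i) (e i)) ∧ (∀ i, SemiconjBy r (ad i) (ed i)) ∧
      ∀ T : Op N, (∀ i, Commute T (a i)) → (∀ i, Commute T (ad i)) → (∀ i, Commute T (ed i)) →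
        SemiconjBy r T T := by
  let X := List ι × {κ : FockAlg N // ∀ i, a i κ = 0}
  let u : X → FockAlg N := fun x => word ad x.1 x.2.1
  let v : X → FockAlg N := fun x => word ed x.1 x.2.1
  have stable : ∀ (f : ι → Op N), ∀ i, ∀ w ∈ Submodule.span ℂ (Set.range fun x : X =>
      word f x.1 x.2.1), f i w ∈ Submodule.span ℂ (Set.range fun x : X => word f x.1 x.2.1) := by
    intro f i w hw
    induction hw using Submodule.span_induction with
    | mem x hx =>
      obtain ⟨⟨l, κ⟩, rfl⟩ := hx
      exact Submodule.subset_span ⟨⟨i :: l, κ⟩, word_cons f i l κ⟩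
    | zero => simp
    | add x y _ _ hx hy => rw [map_add]; exact add_mem hx hy
    | smul c x _ hx => rw [map_smul]; exact Submodule.smul_mem _ _ hx
  have hu : Submodule.span ℂ (Set.range u) = ⊤ :=
    eq_top_of_graded h.pos h.adj h.graded h.graded_ad _
      (fun n w _ hw => Submodule.subset_span ⟨⟨[], ⟨w, hw⟩⟩, rfl⟩) (stable ad)
  -- By `hspan` the span of the new words is also stable under the old creation operators, so the
  -- spanning argument for the old oscillators applies to it.
  have hv : Submodule.span ℂ (Set.range v) = ⊤ :=
    eq_top_of_graded h.pos h.adj h.graded h.graded_ad _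
      (fun n w _ hw => Submodule.subset_span ⟨⟨[], ⟨w, hw⟩⟩, rfl⟩) (hspan _ (stable ed))
  obtain ⟨r, hr, hrn⟩ := exists_isometry_of_gram u v (by
    rintro ⟨l, κ, hκ⟩ ⟨l', κ', hκ'⟩
    simp only [u, v]
    rw [word_inner h.adj h.ccr hκ hκ', word_inner adj ccr (hker κ hκ) (hker κ' hκ')]) hu
  have hrw : ∀ l κ, (∀ i, a i κ = 0) → r (word ad l κ) = word ed l κ :=
    fun l κ hκ => hr ⟨l, κ, hκ⟩
  have hsurj : LinearMap.range r = ⊤ := by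
    rw [eq_top_iff, ← hv, Submodule.span_le]
    rintro _ ⟨x, rfl⟩
    exact ⟨u x, hr x⟩
  have ext : ∀ A B : Op N, (∀ l κ, (∀ i, a i κ = 0) → A (word ad l κ) = B (word ad l κ)) → A = B := by
    intro A B hAB
    refine LinearMap.ext_on hu ?_
    rintro _ ⟨⟨l, κ, hκ⟩, rfl⟩
    exact hAB l κ hκ
  obtain ⟨U, hU⟩ := exists_unitary (incl N ∘ₗ r) (fun x => by
    rw [LinearMap.comp_apply, norm_incl, hrn]) (by
    rw [LinearMap.range_comp, hsurj, Submodule.map_top, incl_dense])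
  refine ⟨r, U, hU, fun i => ext _ _ fun l κ hκ => ?_, fun i => ext _ _ fun l κ hκ => ?_,
    fun T ha had hed => ext _ _ fun l κ hκ => ?_⟩
  · rw [Module.End.mul_apply, Module.End.mul_apply, hrw l κ hκ, lower_word h.ccr hκ,
      lower_word ccr (hker κ hκ), map_list_sum, List.map_map]
    congr 2
    ext1 m
    exact hrw m κ hκ
  · rw [Module.End.mul_apply, Module.End.mul_apply, hrw l κ hκ, ← word_cons, ← word_cons,
      hrw _ κ hκ]
  · have hT : ∀ (f : ι → Op N), (∀ i, Commute T (f i)) → ∀ l, T (word f l κ) = word f l (T κ) := by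
      intro f hf l
      induction l with
      | nil => rfl
      | cons j l ih =>
        rw [word_cons, word_cons, ← ih]
        exact LinearMap.congr_fun (hf j) _
    have hTκ : ∀ i, a i (T κ) = 0 := fun i => by
      have := LinearMap.congr_fun (ha i) κ
      simp only [Module.End.mul_apply, hκ, map_zero] at this
      exact this.symm
    rw [Module.End.mul_apply, Module.End.mul_apply, hrw l κ hκ, hT ad had, hT ed hed, hrw _ _ hTκ]

theorem transforms_of_semiconjBy {r H H' : Op N} {U : Fock N ≃ₗᵢ[ℂ] Fock N}
    (hU : ∀ x, U (incl N x) = incl N (r x)) (h : SemiconjBy r H' H) : Transforms U H H' := fun x => by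
  have : r (H' x) = H (r x) := LinearMap.congr_fun h x
  rw [hU, hU, this]
  exact mem_closedGraph_incl H (r x)

/-! ### Normal modes -/

/-- A quadratic expression in fields `ψ` and momenta `δ`. -/
def quadHam {ι : Type} [Fintype ι] (W : Op N) (x : ι → ℂ) (B : ι → ι → ℂ) (ψ δ : ι → Op N) : Op N :=
  W + ∑ i, x i • (δ i * δ i) + ∑ i, ∑ j, B i j • (ψ i * ψ j)

/-- The squeezing theorem with the shift absorbed. Expanding in φ = a + a† puts -2xz into the linear
coefficient and -Kz + xz² into the constant part; after the transformation the same terms recombine,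
and φ - z has become t φ. -/
theorem exists_squeeze_shift {a ad z : Op N} {d : ℤ} (hd : 0 < d) (hadj : IsAdj a ad)
    (hccr : a * ad - ad * a = 1) (ha : Graded a (-d)) (had : Graded ad d) (hz : IsAdj z z)
    (gz : Graded z 0) (hza : Commute z a) (hzad : Commute z ad) {t : ℝ} (ht : 0 < t) :
    ∃ U : Fock N ≃ₗᵢ[ℂ] Fock N, ∀ (R K : Op N) (x y : ℂ),
      Commute R a → Commute R ad → Commute R z → Commute K a → Commute K ad → Commute K z →
      Transforms U
        (R + K * (a + ad - z) + x • ((a + ad - z) * (a + ad - z)) + y • ((a - ad) * (a - ad)))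
        (R + K * (t : ℂ) • (a + ad) + x • ((t : ℂ) • (a + ad) * (t : ℂ) • (a + ad)) +
          y • (((t⁻¹ : ℝ) : ℂ) • (a - ad) * ((t⁻¹ : ℝ) : ℂ) • (a - ad))) := by
  obtain ⟨U, hU⟩ := exists_squeeze hd hadj hccr ha had hz gz hza hzad ht
  refine ⟨U, fun R K x y h1 h2 h3 h4 h5 h6 => ?_⟩
  have key : ∀ F E : Op N, Commute z F →
      (R - K * z + x • (z * z)) + (K - (2 * x) • z) * F + x • (F * F) + E =
        R + K * (F - z) + x • ((F - z) * (F - z)) + E := fun F E hF => by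
    have e : ((2 * x) • z) * F = x • (F * z) + x • (F * z) := by
      rw [smul_mul_assoc, hF.eq, mul_smul, two_smul]
    rw [sub_mul K, e]
    simp only [mul_sub, sub_mul, smul_sub, hF.eq]
    abel
  have hz0 : Commute z z := Commute.refl z
  have h := hU (R - K * z + x • (z * z)) (K - (2 * x) • z) x y
    ((h1.sub_left (h4.mul_left hza)).add_left ((hza.mul_left hza).smul_left x))
    ((h2.sub_left (h5.mul_left hzad)).add_left ((hzad.mul_left hzad).smul_left x))
    ((h3.sub_left (h6.mul_left hz0)).add_left ((hz0.mul_left hz0).smul_left x))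
    (h4.sub_left (hza.smul_left _)) (h5.sub_left (hzad.smul_left _)) (h6.sub_left (hz0.smul_left _))
  rw [key _ _ (hza.add_right hzad), key _ _ (((hza.add_right hzad).smul_right _).add_right hz0),
    add_sub_cancel_right] at h
  exact h

/-- Isolating one variable in a quadratic expression. -/
theorem quadHam_isolate {ι : Type} [Fintype ι] [DecidableEq ι] (W : Op N) (x : ι → ℂ)
    {B : ι → ι → ℂ} (hB : ∀ i j, B i j = B j i) (ψ δ : ι → Op N) (i : ι)
    (hψ : ∀ j, Commute (ψ i) (ψ j)) :
    quadHam W x B ψ δ =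
      (W + ∑ j ∈ Finset.univ.erase i, x j • (δ j * δ j) +
        ∑ j ∈ Finset.univ.erase i, ∑ k ∈ Finset.univ.erase i, B j k • (ψ j * ψ k)) +
      ((2 : ℂ) • ∑ j ∈ Finset.univ.erase i, B i j • ψ j) * ψ i + B i i • (ψ i * ψ i) +
      x i • (δ i * δ i) := by
  have hi := Finset.mem_univ i
  rw [quadHam, ← Finset.add_sum_erase _ _ hi, ← Finset.add_sum_erase _ (fun j => ∑ k, _) hi,
    ← Finset.add_sum_erase _ (fun j => B i j • (ψ i * ψ j)) hi]
  have e : ∀ j ∈ Finset.univ.erase i, (∑ k, B j k • (ψ j * ψ k)) =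
      B i j • (ψ j * ψ i) + ∑ k ∈ Finset.univ.erase i, B j k • (ψ j * ψ k) := fun j _ => by
    rw [← Finset.add_sum_erase _ _ hi, hB]
  rw [Finset.sum_congr rfl e, Finset.sum_add_distrib]
  have e2 : ∑ j ∈ Finset.univ.erase i, B i j • (ψ i * ψ j) =
      ∑ j ∈ Finset.univ.erase i, B i j • (ψ j * ψ i) :=
    Finset.sum_congr rfl fun j _ => by rw [(hψ j).eq]
  rw [e2, two_smul, add_mul, Finset.sum_mul]
  simp only [smul_mul_assoc]
  abel

section NormalModes

variable {ι : Type} [Fintype ι] [DecidableEq ι] {a ad : ι → Op N} {d : ι → ℤ}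

omit [Fintype ι] in
theorem Oscillators.commute_ad (h : Oscillators a ad d) {i j : ι} (hij : i ≠ j) :
    Commute (a i) (ad j) := by
  have := h.ccr i j
  rw [if_neg hij] at this
  exact sub_eq_zero.1 this

omit [Fintype ι] in
theorem Oscillators.commute_field (h : Oscillators a ad d) (i j : ι) :
    Commute (a i + ad i) (a j + ad j) := by
  rcases eq_or_ne i j with rfl | hij
  · exact Commute.refl _
  · exact ((h.comm i j).add_right (h.commute_ad hij)).add_left
      ((h.commute_ad hij.symm).symm.add_right (h.comm_ad i j))

/-- Rescaling and shifting all fields. -/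
theorem exists_rescale (h : Oscillators a ad d) {y : ι → Op N} (hy : ∀ i, IsAdj (y i) (y i))
    (gy : ∀ i, Graded (y i) 0) (hya : ∀ i j, Commute (y i) (a j)) (hyad : ∀ i j, Commute (y i) (ad j))
    (hyy : ∀ i j, Commute (y i) (y j)) {t : ι → ℝ} (ht : ∀ i, 0 < t i) {W : Op N}
    (hWa : ∀ i, Commute W (a i)) (hWad : ∀ i, Commute W (ad i)) (hWy : ∀ i, Commute W (y i))
    (x : ι → ℂ) {B : ι → ι → ℂ} (hB : ∀ i j, B i j = B j i) :
    ∃ U : Fock N ≃ₗᵢ[ℂ] Fock N, Transforms U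
      (quadHam W x B (fun i => a i + ad i - y i) fun i => a i - ad i)
      (quadHam W x B (fun i => (t i : ℂ) • (a i + ad i)) fun i => (((t i)⁻¹ : ℝ) : ℂ) • (a i - ad i)) := by
  -- The modes are treated one at a time: ψ S and δ S are the fields and momenta once those in S
  -- have been rescaled. For the next mode, all the others enter through the coefficients of its
  -- linear and constant parts.
  let ψ : Finset ι → ι → Op N := fun S i =>
    if i ∈ S then (t i : ℂ) • (a i + ad i) else a i + ad i - y i
  let δ : Finset ι → ι → Op N := fun S i =>
    if i ∈ S then (((t i)⁻¹ : ℝ) : ℂ) • (a i - ad i) else a i - ad i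
  suffices H : ∀ S : Finset ι, ∃ U : Fock N ≃ₗᵢ[ℂ] Fock N,
      Transforms U (quadHam W x B (ψ ∅) (δ ∅)) (quadHam W x B (ψ S) (δ S)) by
    obtain ⟨U, hU⟩ := H Finset.univ
    refine ⟨U, ?_⟩
    simpa [ψ, δ] using hU
  have hyφ : ∀ i j, Commute (y i) (a j + ad j) := fun i j => (hya i j).add_right (hyad i j)
  have hψψ : ∀ S i j, Commute (ψ S i) (ψ S j) := by
    intro S i j
    have h0 := h.commute_field i j
    have h1 := hyφ i j
    have h2 := hyφ j i
    have h3 := hyy i j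
    simp only [ψ]
    split_ifs
    · exact (h0.smul_left _).smul_right _
    · exact (h0.smul_left _).sub_right (h2.symm.smul_left _)
    · exact (h0.smul_right _).sub_left (h1.smul_right _)
    · exact (h0.sub_right h2.symm).sub_left (h1.sub_right h3)
  intro S
  induction S using Finset.induction_on with
  | empty => exact ⟨_, Transforms.refl _⟩
  | insert i S hi ih =>
    obtain ⟨U, hU⟩ := ih
    obtain ⟨U', hU'⟩ := exists_squeeze_shift (h.pos i) (h.adj i) (by simpa using h.ccr i i)
      (h.graded i) (h.graded_ad i) (hy i) (gy i) (hya i i) (hyad i i) (ht i)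
    have hψ : ∀ {C : Op N}, (∀ j, j ≠ i → Commute (a j) C) → (∀ j, j ≠ i → Commute (ad j) C) →
        (∀ j, Commute (y j) C) → ∀ j, j ≠ i → Commute (ψ S j) C := fun {C} h1 h2 h3 j hj => by
      simp only [ψ]
      split_ifs
      · exact ((h1 j hj).add_left (h2 j hj)).smul_left _
      · exact ((h1 j hj).add_left (h2 j hj)).sub_left (h3 j)
    have hδ : ∀ {C : Op N}, (∀ j, j ≠ i → Commute (a j) C) → (∀ j, j ≠ i → Commute (ad j) C) →
        ∀ j, j ≠ i → Commute (δ S j) C := fun {C} h1 h2 j hj => by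
      simp only [δ]
      split_ifs
      · exact ((h1 j hj).sub_left (h2 j hj)).smul_left _
      · exact (h1 j hj).sub_left (h2 j hj)
    have hRK : ∀ {C : Op N}, Commute W C → (∀ j, j ≠ i → Commute (a j) C) →
        (∀ j, j ≠ i → Commute (ad j) C) → (∀ j, Commute (y j) C) →
        Commute (W + ∑ j ∈ Finset.univ.erase i, x j • (δ S j * δ S j) +
          ∑ j ∈ Finset.univ.erase i, ∑ k ∈ Finset.univ.erase i, B j k • (ψ S j * ψ S k)) C ∧
        Commute ((2 : ℂ) • ∑ j ∈ Finset.univ.erase i, B i j • ψ S j) C := by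
      intro C h0 h1 h2 h3
      have p := hψ h1 h2 h3
      have q := hδ h1 h2
      refine ⟨(h0.add_left (Commute.sum_left _ _ _ fun j hj => ?_)).add_left
        (Commute.sum_left _ _ _ fun j hj => Commute.sum_left _ _ _ fun k hk => ?_),
        (Commute.sum_left _ _ _ fun j hj => ?_).smul_left _⟩
      · exact ((q j (Finset.ne_of_mem_erase hj)).mul_left
          (q j (Finset.ne_of_mem_erase hj))).smul_left _
      · exact ((p j (Finset.ne_of_mem_erase hj)).mul_left
          (p k (Finset.ne_of_mem_erase hk))).smul_left _
      · exact (p j (Finset.ne_of_mem_erase hj)).smul_left _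
    obtain ⟨r1, k1⟩ := hRK (hWa i) (fun j _ => h.comm j i)
      (fun j hj => (h.commute_ad hj.symm).symm) fun j => hya j i
    obtain ⟨r2, k2⟩ := hRK (hWad i) (fun j hj => h.commute_ad hj)
      (fun j _ => h.comm_ad j i) fun j => hyad j i
    obtain ⟨r3, k3⟩ := hRK (hWy i) (fun j _ => (hya i j).symm) (fun j _ => (hyad i j).symm)
      fun j => hyy j i
    have h1 := hU' _ _ (B i i) (x i) r1 r2 r3 k1 k2 k3
    refine ⟨U'.trans U, hU.trans ?_⟩
    have e0 : ψ S i = a i + ad i - y i := if_neg hi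
    have e1 : δ S i = a i - ad i := if_neg hi
    have e2 : ψ (insert i S) i = (t i : ℂ) • (a i + ad i) := if_pos (Finset.mem_insert_self i S)
    have e3 : δ (insert i S) i = (((t i)⁻¹ : ℝ) : ℂ) • (a i - ad i) :=
      if_pos (Finset.mem_insert_self i S)
    have e4 : ∀ j ∈ Finset.univ.erase i, ψ (insert i S) j = ψ S j := fun j hj => by
      simp [ψ, Finset.mem_insert, Finset.ne_of_mem_erase hj]
    have e5 : ∀ j ∈ Finset.univ.erase i, δ (insert i S) j = δ S j := fun j hj => by
      simp [δ, Finset.mem_insert, Finset.ne_of_mem_erase hj]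
    rw [quadHam_isolate W x hB (ψ S) (δ S) i (hψψ S i),
      quadHam_isolate W x hB (ψ (insert i S)) (δ (insert i S)) i (hψψ _ i), e0, e1, e2, e3,
      Finset.sum_congr rfl (fun j hj => by rw [e5 j hj] : ∀ j ∈ Finset.univ.erase i,
        x j • (δ (insert i S) j * δ (insert i S) j) = x j • (δ S j * δ S j)),
      Finset.sum_congr rfl (fun j hj => Finset.sum_congr rfl fun k hk => by rw [e4 j hj, e4 k hk] :
        ∀ j ∈ Finset.univ.erase i, ∑ k ∈ Finset.univ.erase i,
          B j k • (ψ (insert i S) j * ψ (insert i S) k) =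
          ∑ k ∈ Finset.univ.erase i, B j k • (ψ S j * ψ S k)),
      Finset.sum_congr rfl (fun j hj => by rw [e4 j hj] : ∀ j ∈ Finset.univ.erase i,
        B i j • ψ (insert i S) j = B i j • ψ S j)]
    exact h1

omit [DecidableEq ι] in
theorem sum_smul_mul_sum_smul (O : ι → ι → ℂ) (x : ι → ℂ) (f : ι → Op N) :
    ∑ k, x k • ((∑ i, O k i • f i) * ∑ j, O k j • f j) =
      ∑ i, ∑ j, (∑ k, x k * (O k i * O k j)) • (f i * f j) := by
  simp only [Finset.sum_mul_sum, Finset.smul_sum, smul_mul_smul_comm, smul_smul, Finset.sum_smul]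
  rw [Finset.sum_comm]
  refine Finset.sum_congr rfl fun i _ => ?_
  rw [Finset.sum_comm]

/-- An orthogonal rotation of the oscillators. -/
theorem exists_orthogonal (h : Oscillators a ad d) {O : ι → ι → ℝ}
    (hO : ∀ i j, ∑ k, O k i * O k j = if i = j then 1 else 0)
    (hO' : ∀ i j, ∑ k, O i k * O j k = if i = j then 1 else 0) {W : Op N}
    (hWa : ∀ i, Commute W (a i)) (hWad : ∀ i, Commute W (ad i)) (x : ℂ) (μ : ι → ℝ) :
    ∃ U : Fock N ≃ₗᵢ[ℂ] Fock N, Transforms U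
      (quadHam W (fun _ => x) (fun i j => ((∑ k, μ k * (O k i * O k j) : ℝ) : ℂ))
        (fun i => a i + ad i) fun i => a i - ad i)
      (quadHam W (fun _ => x) (fun i j => if i = j then (μ i : ℂ) else 0)
        (fun i => a i + ad i) fun i => a i - ad i) := by
  let e : ι → Op N := fun k => ∑ i, (O k i : ℂ) • a i
  let ed : ι → Op N := fun k => ∑ i, (O k i : ℂ) • ad i
  obtain ⟨r, U, hU, hra, hrad, hrT⟩ := exists_rotation (e := e) (ed := ed) h
    (fun i => IsAdj.sum fun j _ => (h.adj j).smul_real _) (fun i j => by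
      have e1 : e i * ed j - ed j * e i =
          ∑ k, ∑ l, ((O i k : ℂ) * O j l) • (a k * ad l - ad l * a k) := by
        simp only [e, ed, Finset.sum_mul_sum, smul_mul_smul_comm, smul_sub, Finset.sum_sub_distrib]
        congr 1
        rw [Finset.sum_comm]
        exact Finset.sum_congr rfl fun k _ => Finset.sum_congr rfl fun l _ => by rw [mul_comm]
      rw [e1]
      simp only [h.ccr, smul_ite, smul_zero, Finset.sum_ite_eq, Finset.mem_univ, if_true,
        ← Finset.sum_smul]
      have := hO' i j
      have h2 : ∑ k, (O i k : ℂ) * O j k = if i = j then 1 else 0 := by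
        have h3 := congrArg (fun y : ℝ => (y : ℂ)) this
        push_cast at h3
        rw [h3]
        split_ifs <;> simp
      rw [h2]
      split_ifs <;> simp)
    (fun κ hκ i => by simp [e, hκ]) (fun M hM i v hv => by
      have h1 : ad i = ∑ k, (O k i : ℂ) • ed k := by
        simp only [ed, Finset.smul_sum, smul_smul]
        rw [Finset.sum_comm]
        simp only [← Finset.sum_smul]
        have h2 : ∀ j, ∑ k, (O k i : ℂ) * O k j = if i = j then 1 else 0 := fun j => by
          have h3 := congrArg (fun y : ℝ => (y : ℂ)) (hO i j)
          push_cast at h3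
          rw [h3]
          split_ifs <;> simp
        simp [h2]
      rw [h1]
      simp only [LinearMap.sum_apply, LinearMap.smul_apply]
      exact Submodule.sum_mem _ fun k _ => Submodule.smul_mem _ _ (hM k v hv))
  refine ⟨U, transforms_of_semiconjBy hU ?_⟩
  have hφ : ∀ k, SemiconjBy r (a k + ad k) (∑ i, (O k i : ℂ) • (a i + ad i)) := fun k => by
    have := (hra k).add_right (hrad k)
    simpa only [e, ed, ← Finset.sum_add_distrib, ← smul_add] using this
  have hδ : ∀ k, SemiconjBy r (a k - ad k) (∑ i, (O k i : ℂ) • (a i - ad i)) := fun k => by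
    have := (hra k).sub_right (hrad k)
    simpa only [e, ed, ← Finset.sum_sub_distrib, ← smul_sub] using this
  have hsum : ∀ (y : ι → ℂ) (f g : ι → Op N), (∀ k, SemiconjBy r (f k) (g k)) →
      SemiconjBy r (∑ k, y k • (f k * f k)) (∑ k, y k • (g k * g k)) := fun y f g hfg => by
    rw [SemiconjBy, Finset.mul_sum, Finset.sum_mul]
    exact Finset.sum_congr rfl fun k _ => by
      rw [mul_smul_comm, smul_mul_assoc, ((hfg k).mul_right (hfg k)).eq]
  have hW := hrT W hWa hWad fun i => Commute.sum_right _ _ _ fun j _ => (hWad j).smul_right _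
  have main := (hW.add_right (hsum (fun _ => x) _ _ hδ)).add_right (hsum (fun k => (μ k : ℂ)) _ _ hφ)
  rw [sum_smul_mul_sum_smul, sum_smul_mul_sum_smul] at main
  have h1 : quadHam W (fun _ => x) (fun i j => if i = j then (μ i : ℂ) else 0)
      (fun i => a i + ad i) (fun i => a i - ad i) =
      W + ∑ k, x • ((a k - ad k) * (a k - ad k)) + ∑ k, (μ k : ℂ) • ((a k + ad k) * (a k + ad k)) := by
    rw [quadHam]
    simp [ite_smul]
  -- All momenta carry the same coefficient x, so an orthogonal rotation leaves the momentum part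
  -- unchanged.
  have h2 : ∀ i j, (∑ k, x * ((O k i : ℂ) * O k j)) = if i = j then x else 0 := fun i j => by
    have h3 := congrArg (fun y : ℝ => (y : ℂ)) (hO i j)
    push_cast at h3
    rw [← Finset.mul_sum, h3]
    split_ifs <;> simp
  rw [h1, quadHam]
  simp only [h2, ite_smul, zero_smul, Finset.sum_ite_eq, Finset.mem_univ, if_true] at main
  push_cast
  exact main

/-- The normal modes of a system of coupled oscillators. -/
theorem exists_normal_modes (h : Oscillators a ad d) {y : ι → Op N} (hy : ∀ i, IsAdj (y i) (y i))
    (gy : ∀ i, Graded (y i) 0) (hya : ∀ i j, Commute (y i) (a j)) (hyad : ∀ i j, Commute (y i) (ad j))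
    (hyy : ∀ i j, Commute (y i) (y j)) {W : Op N}
    (hWa : ∀ i, Commute W (a i)) (hWad : ∀ i, Commute W (ad i)) (hWy : ∀ i, Commute W (y i))
    {x ω : ι → ℝ} (hx : ∀ i, 0 < x i) (hω : ∀ i, 0 < ω i) {B O : ι → ι → ℝ}
    (hO : ∀ i j, ∑ k, O k i * O k j = if i = j then 1 else 0)
    (hO' : ∀ i j, ∑ k, O i k * O j k = if i = j then 1 else 0)
    (hB : ∀ i j, √(x i) * √(x j) * B i j = ∑ k, ω k ^ 2 * (O k i * O k j)) :
    ∃ U : Fock N ≃ₗᵢ[ℂ] Fock N, Transforms U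
      (quadHam W (fun i => (-x i : ℝ)) (fun i j => B i j) (fun i => a i + ad i - y i)
        fun i => a i - ad i)
      (W + ∑ i, (ω i : ℂ) • ((4 : ℂ) • (ad i * a i) + (2 : ℂ) • 1)) := by
  have hs : ∀ i, 0 < √(x i) := fun i => Real.sqrt_pos.2 (hx i)
  have hBs : ∀ i j, B i j = B j i := fun i j => by
    have h1 := hB i j
    rw [Finset.sum_congr rfl fun k _ => by rw [mul_comm (O k i)], ← hB j i,
      mul_comm √(x i)] at h1
    exact mul_left_cancel₀ (mul_pos (hs j) (hs i)).ne' h1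
  -- Rescaling by the square roots of x removes the shifts, makes all momentum coefficients -1 and
  -- turns B into the matrix that O diagonalises.
  obtain ⟨U₁, h₁⟩ := exists_rescale h hy gy hya hyad hyy hs hWa hWad hWy (fun i => (-x i : ℝ))
    (B := fun i j => (B i j : ℂ)) (fun i j => by rw [hBs])
  obtain ⟨U₂, h₂⟩ := exists_orthogonal h hO hO' hWa hWad (-1) fun k => ω k ^ 2
  have hsω : ∀ i, 0 < (√(ω i))⁻¹ := fun i => inv_pos.2 (Real.sqrt_pos.2 (hω i))
  -- The scale ω^(-1/2) balances -δ² + ω²φ² into ω(φ² - δ²), which equals ω(4a†a + 2).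
  obtain ⟨U₃, h₃⟩ := exists_rescale h (y := fun _ => 0) (fun i => IsAdj.zero)
    (fun _ => Graded.zero) (fun _ _ => Commute.zero_left _) (fun _ _ => Commute.zero_left _)
    (fun _ _ => Commute.zero_left _) hsω hWa hWad (fun _ => Commute.zero_right _) (fun _ => -1)
    (B := fun i j => if i = j then ((ω i ^ 2 : ℝ) : ℂ) else 0) (fun i j => by
      rcases eq_or_ne i j with rfl | hij
      · rfl
      · rw [if_neg hij, if_neg hij.symm])
  have e₁ : quadHam W (fun i => ((-x i : ℝ) : ℂ)) (fun i j => (B i j : ℂ))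
      (fun i => ((√(x i) : ℝ) : ℂ) • (a i + ad i))
      (fun i => (((√(x i))⁻¹ : ℝ) : ℂ) • (a i - ad i)) =
      quadHam W (fun _ => -1) (fun i j => ((∑ k, ω k ^ 2 * (O k i * O k j) : ℝ) : ℂ))
        (fun i => a i + ad i) fun i => a i - ad i := by
    simp only [quadHam, smul_mul_smul_comm, smul_smul, ← hB]
    congr 1
    · congr 1
      refine Finset.sum_congr rfl fun i _ => ?_
      congr 1
      have h1 : -x i * ((√(x i))⁻¹ * (√(x i))⁻¹) = -1 := by
        rw [← mul_inv, Real.mul_self_sqrt (hx i).le, neg_mul, mul_inv_cancel₀ (hx i).ne']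
      exact_mod_cast h1
    · refine Finset.sum_congr rfl fun i _ => Finset.sum_congr rfl fun j _ => ?_
      congr 1
      push_cast
      ring
  have e₃ : quadHam W (fun _ => -1) (fun i j => if i = j then ((ω i ^ 2 : ℝ) : ℂ) else 0)
      (fun i => (((√(ω i))⁻¹ : ℝ) : ℂ) • (a i + ad i))
      (fun i => ((((√(ω i))⁻¹)⁻¹ : ℝ) : ℂ) • (a i - ad i)) =
      W + ∑ i, (ω i : ℂ) • ((4 : ℂ) • (ad i * a i) + (2 : ℂ) • 1) := by
    simp only [quadHam, smul_mul_smul_comm, smul_smul, ite_mul, zero_mul, ite_smul, zero_smul, Finset.sum_ite_eq,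
      Finset.mem_univ, if_true]
    rw [add_assoc, ← Finset.sum_add_distrib]
    congr 1
    refine Finset.sum_congr rfl fun i _ => ?_
    have h0 : √(ω i) * √(ω i) = ω i := Real.mul_self_sqrt (hω i).le
    have h1 : (-1 : ℂ) * ((((√(ω i))⁻¹)⁻¹ : ℝ) * (((√(ω i))⁻¹)⁻¹ : ℝ)) = -(ω i : ℂ) := by
      rw [inv_inv, ← Complex.ofReal_mul, h0, neg_one_mul]
    have h2 : ((ω i ^ 2 : ℝ) : ℂ) * ((((√(ω i))⁻¹ : ℝ) : ℂ) * (((√(ω i))⁻¹ : ℝ) : ℂ)) = ω i := by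
      rw [← Complex.ofReal_mul, ← mul_inv, h0, ← Complex.ofReal_mul]
      congr 1
      field_simp [(hω i).ne']
    have h3 : a i * ad i = ad i * a i + 1 := by
      have := h.ccr i i
      rw [if_pos rfl, sub_eq_iff_eq_add] at this
      rw [this, add_comm]
    rw [h1, h2, neg_smul, ← smul_neg, ← smul_add]
    congr 1
    simp only [sub_mul, mul_sub, add_mul, mul_add, h3]
    rw [show (4 : ℂ) = 1 + 1 + 1 + 1 by norm_num]
    simp only [add_smul, one_smul, two_smul]
    abel
  simp only [sub_zero] at h₃
  rw [e₃] at h₃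
  rw [e₁] at h₁
  exact ⟨_, h₁.trans (h₂.trans h₃)⟩

end NormalModes

end

end NodalMattis

/-! ### Charge and spin oscillators built from the densities. -/

namespace NodalMattis

noncomputable section

variable {N : ℕ}

/-! ### Linear combinations of densities -/

section LinearCombinations

variable (A B : LinBos) (x : ℂ)

theorem op_eq (A : LinBos) : (op A : Op N) =
    Finsupp.linearCombination ℂ (fun i : Lab => density i.1 i.2.1 i.2.2.1 i.2.2.2) A := rfl

theorem op_add : (op (A + B) : Op N) = op A + op B := by simp only [op_eq, map_add]

theorem op_smul : (op (x • A) : Op N) = x • op A := by simp only [op_eq, map_smul]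

theorem op_neg : (op (-A) : Op N) = -op A := by simp only [op_eq, map_neg]

theorem op_zero : (op 0 : Op N) = 0 := by simp only [op_eq, map_zero]

theorem op_sum {ι : Type*} (s : Finset ι) (f : ι → LinBos) :
    (op (∑ i ∈ s, f i) : Op N) = ∑ i ∈ s, op (f i) := by simp only [op_eq, map_sum]

theorem op_gen (r s α : ℤˣ) (p : BMom) : (op (gen r s α p) : Op N) = density r s α p := by
  simp [op_eq, gen]

theorem dag_add : dag (A + B) = dag A + dag B := by
  rw [dag, Finsupp.sum_add_index'] <;> simp [dag, add_smul]

theorem dag_smul : dag (x • A) = (starRingEnd ℂ x) • dag A := by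
  rw [dag, Finsupp.sum_smul_index', dag, Finsupp.smul_sum] <;> simp [smul_smul]

theorem dag_zero : dag 0 = 0 := by simp [dag]

theorem dag_sum {ι : Type*} (s : Finset ι) (f : ι → LinBos) :
    dag (∑ i ∈ s, f i) = ∑ i ∈ s, dag (f i) := by
  classical
  induction s using Finset.induction_on with
  | empty => simp [dag_zero]
  | insert i s hi ih => rw [Finset.sum_insert hi, Finset.sum_insert hi, dag_add, ih]

theorem dag_gen (r s α : ℤˣ) (p : BMom) : dag (gen r s α p) = gen r s α (-p) := by
  simp [dag, gen]

theorem op_adj (hN : Odd N) : IsAdj (op A : Op N) (op (dag A)) := by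
  induction A using Finsupp.induction_linear with
  | zero => rw [dag_zero, op_zero]; exact IsAdj.zero
  | add f g hf hg => rw [dag_add, op_add, op_add]; exact hf.add hg
  | single i a =>
    have h : (Finsupp.single i a : LinBos) = a • gen i.1 i.2.1 i.2.2.1 i.2.2.2 := by simp [gen]
    rw [h, dag_smul, dag_gen, op_smul, op_smul, op_gen, op_gen]
    exact (density_adj hN _ _ _ _).smul a

theorem normalProd_add (C : LinBos) :
    (normalProd (A + B) C : Op N) = normalProd A C + normalProd B C := by
  rw [normalProd, Finsupp.sum_add_index']
  · rfl
  · simp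
  · intro i a b
    rw [add_smul]

theorem normalProd_smul (C : LinBos) : (normalProd (x • A) C : Op N) = x • normalProd A C := by
  rw [normalProd, Finsupp.sum_smul_index', normalProd, Finsupp.smul_sum]
  · simp [smul_smul]
  · simp

theorem normalProd_zero (C : LinBos) : (normalProd 0 C : Op N) = 0 := by simp [normalProd]

theorem normalProd_sum {ι : Type*} (s : Finset ι) (f : ι → LinBos) (C : LinBos) :
    (normalProd (∑ i ∈ s, f i) C : Op N) = ∑ i ∈ s, normalProd (f i) C := by
  classical
  induction s using Finset.induction_on with
  | empty => simp [normalProd_zero]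
  | insert i s hi ih => rw [Finset.sum_insert hi, Finset.sum_insert hi, normalProd_add, ih]

theorem normalProd_gen (r s α : ℤˣ) (p : BMom) (C : LinBos) :
    (normalProd (gen r s α p) C : Op N) =
      if (r : ℤ) * p s < 0 then density r s α p * op C else op C * density r s α p := by
  simp [normalProd, gen]

end LinearCombinations

/-! ### Charge and spin densities -/

instance : DecidableEq Chan := fun X Y => by
  cases X <;> cases Y
  exacts [isTrue rfl, isFalse nofun, isFalse nofun, isTrue rfl]

instance : Fintype Chan := ⟨{.C, .S}, fun X => by cases X <;> simp⟩

theorem sum_chan {M : Type*} [AddCommMonoid M] (f : Chan → M) : ∑ X, f X = f .C + f .S := by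
  have : (Finset.univ : Finset Chan) = {.C, .S} := rfl
  rw [this, Finset.sum_pair (by decide)]

theorem sum_sign {M : Type*} [AddCommMonoid M] (f : ℤˣ → M) : ∑ r, f r = f 1 + f (-1) := by
  rw [UnitsInt.univ, Finset.sum_pair (by decide)]

theorem Chan.weight_conj (X : Chan) (α : ℤˣ) : starRingEnd ℂ (X.weight α) = X.weight α := by
  cases X <;> simp [Chan.weight]

/-- Orthogonality of the spin weights decouples the two channels; the value 2 is the number of spin
states and reappears in the Schwinger term. -/
theorem Chan.sum_weight (X Y : Chan) :
    ∑ α, X.weight α * Y.weight α = if X = Y then 2 else 0 := by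
  rw [sum_sign]
  cases X <;> cases Y <;> simp [Chan.weight] <;> norm_num

/-- The charge and spin densities as operators. -/
def Jop (X : Chan) (r s : ℤˣ) (p : BMom) : Op N := op (J X r s p)

theorem Jop_eq (X : Chan) (r s : ℤˣ) (p : BMom) :
    (Jop X r s p : Op N) = ∑ α, X.weight α • density r s α p := by
  simp only [Jop, J, op_sum, op_smul, op_gen]

theorem dag_J (X : Chan) (r s : ℤˣ) (p : BMom) : dag (J X r s p) = J X r s (-p) := by
  simp only [J, dag_sum, dag_smul, dag_gen, Chan.weight_conj]

theorem normalProd_J (X : Chan) (r s : ℤˣ) (p : BMom) (C : LinBos) :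
    (normalProd (J X r s p) C : Op N) =
      if (r : ℤ) * p s < 0 then Jop X r s p * op C else op C * Jop X r s p := by
  simp only [J, normalProd_sum, normalProd_smul, normalProd_gen, Jop_eq]
  split_ifs
  · simp only [Finset.sum_mul, smul_mul_assoc]
  · simp only [Finset.mul_sum, mul_smul_comm]

theorem Jop_adj (hN : Odd N) (X : Chan) (r s : ℤˣ) (p : BMom) :
    IsAdj (Jop X r s p : Op N) (Jop X r s (-p)) := by
  rw [Jop, Jop, ← dag_J]
  exact op_adj _ hN

theorem Jop_graded (hN : Odd N) (X : Chan) (r s : ℤˣ) (p : BMom) :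
    Graded (Jop X r s p : Op N) (-(2 * ((r : ℤ) * p s))) := by
  rw [Jop_eq]
  exact Graded.sum fun α _ => (density_graded hN r s α p).smul _

theorem Jop_commutator (hN : Odd N) (X X' : Chan) (r r' s s' : ℤˣ) (p q : BMom) :
    (Jop X r s p * Jop X' r' s' q - Jop X' r' s' q * Jop X r s p : Op N) =
      (if X = X' ∧ r = r' ∧ s = s' ∧ p s + q s = 0 ∧ (((p + q) (-s) : ℤ) : ZMod N) = 0 then
        ((2 * N * ((r : ℤ) * p s : ℤ) : ℝ) : ℂ) else 0) • 1 := by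
  have h0 : (Jop X r s p * Jop X' r' s' q - Jop X' r' s' q * Jop X r s p : Op N) =
      ∑ α, ∑ β, (X.weight α * X'.weight β) • ⁅density (N := N) r s α p, density r' s' β q⁆ := by
    simp only [Ring.lie_def, smul_sub, Finset.sum_sub_distrib]
    have e1 : ∀ (f g : ℤˣ → Op N), (∑ α, X.weight α • f α) * (∑ β, X'.weight β • g β) =
        ∑ α, ∑ β, (X.weight α * X'.weight β) • (f α * g β) := fun f g => by
      rw [Finset.sum_mul_sum]
      simp only [smul_mul_smul_comm]
    have e2 : ∀ (f g : ℤˣ → Op N), (∑ β, X'.weight β • g β) * (∑ α, X.weight α • f α) =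
        ∑ α, ∑ β, (X.weight α * X'.weight β) • (g β * f α) := fun f g => by
      rw [Finset.sum_mul_sum, Finset.sum_comm]
      simp only [smul_mul_smul_comm, mul_comm (X'.weight _)]
    rw [Jop_eq, Jop_eq, e1, e2]
  rw [h0]
  by_cases hrs : r = r' ∧ s = s'
  · obtain ⟨rfl, rfl⟩ := hrs
    have h1 : ∀ α β, (X.weight α * X'.weight β) • ⁅density (N := N) r s α p, density r s β q⁆ =
        if α = β then (X.weight α * X'.weight α) • ⁅density (N := N) r s 1 p, density r s 1 q⁆
          else 0 := fun α β => by
      split_ifs with h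
      · subst h
        rw [density_lie hN, density_lie hN]
      · rw [density_lie_of_ne hN (by simpa using fun h' => h h'.symm), smul_zero]
    simp only [h1, Finset.sum_ite_eq, Finset.mem_univ, if_true, ← Finset.sum_smul,
      density_lie hN, smul_smul, true_and]
    congr 1
    rw [← Finset.sum_mul, Chan.sum_weight]
    by_cases hX : X = X'
    · rw [if_pos hX]
      split_ifs with h2 h3 h3
      · push_cast; ring
      · exact absurd ⟨hX, h2⟩ h3
      · exact absurd h3.2 h2
      · simp
    · rw [if_neg hX, zero_mul, if_neg fun h => hX h.1]
  · rw [if_neg fun h => hrs ⟨h.2.1, h.2.2.1⟩, zero_smul]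
    refine Finset.sum_eq_zero fun α _ => Finset.sum_eq_zero fun β _ => ?_
    rw [density_lie_of_ne hN, smul_zero]
    simp only [ne_eq, Prod.mk.injEq, not_and]
    exact fun h1 h2 => absurd ⟨h1.symm, h2.symm⟩ hrs

/-! ### The oscillators -/

/-- For odd N the lower bound -N ≤ 2n is never attained, so the box is symmetric; for even N the
label -N/2 would have no partner. -/
theorem InBox.neg (hN : Odd N) {n : ℤ} (h : InBox N n) : InBox N (-n) := by
  obtain ⟨m, rfl⟩ := hN
  obtain ⟨h1, h2⟩ := h
  constructor <;> omega

/-- The reflection `p ↦ -p`. -/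
def hneg (hN : Odd N) : HatIdx N ≃ HatIdx N :=
  Function.Involutive.toPerm
    (fun i => ⟨(i.1.1, -i.1.2), i.2.1.neg hN, by simpa using i.2.2⟩)
    fun i => Subtype.ext (Prod.ext rfl (neg_neg _))

theorem hneg_hneg (hN : Odd N) (i : HatIdx N) : hneg hN (hneg hN i) = i :=
  (hneg hN).apply_symm_apply i

theorem hneg_fst (hN : Odd N) (i : HatIdx N) : (hneg hN i).1.1 = i.1.1 := rfl

theorem hneg_snd (hN : Odd N) (i : HatIdx N) : (hneg hN i).1.2 = -i.1.2 := rfl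

/-- The label of `p_s`. -/
abbrev HatIdx.par (i : HatIdx N) : ℤ := i.1.2 i.1.1

theorem hneg_par (hN : Odd N) (i : HatIdx N) : (hneg hN i).par = -i.par := rfl

/-- The sign of `p_s`. -/
def HatIdx.sgn (i : HatIdx N) : ℤˣ := if 0 < i.par then 1 else -1

theorem HatIdx.sgn_mul (i : HatIdx N) : (i.sgn : ℤ) * i.par = |i.par| := by
  rw [HatIdx.sgn]
  split_ifs with h
  · simp [abs_of_pos h]
  · simp [abs_of_nonpos (not_lt.1 h)]

theorem HatIdx.abs_pos (i : HatIdx N) : 0 < |i.par| := _root_.abs_pos.2 i.2.2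

theorem sgn_hneg (hN : Odd N) (i : HatIdx N) : (hneg hN i).sgn = -i.sgn := by
  have := i.2.2
  change i.par ≠ 0 at this
  rw [HatIdx.sgn, HatIdx.sgn, hneg_par]
  rcases lt_or_gt_of_ne this with h | h
  · rw [if_pos (by omega), if_neg (by omega), neg_neg]
  · rw [if_neg (by omega), if_pos (by omega)]

/-- The normalisation of the oscillators. -/
def HatIdx.nrm (i : HatIdx N) : ℝ := (√(2 * N * |i.par|))⁻¹

theorem nrm_sq (hN : Odd N) (i : HatIdx N) : i.nrm ^ 2 * (2 * N * |(i.par : ℝ)|) = 1 := by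
  have h1 : (0 : ℝ) < N := by exact_mod_cast hN.pos
  have h2 : 0 < |(i.par : ℝ)| := _root_.abs_pos.2 (by exact_mod_cast i.2.2)
  have h3 : (0 : ℝ) < 2 * N * |(i.par : ℝ)| := by positivity
  rw [HatIdx.nrm, inv_pow]
  push_cast
  rw [Real.sq_sqrt h3.le, inv_mul_cancel₀ h3.ne']

theorem nrm_hneg (hN : Odd N) (i : HatIdx N) : (hneg hN i).nrm = i.nrm := by
  rw [HatIdx.nrm, HatIdx.nrm, hneg_par, abs_neg]

/-- The oscillator with momentum label `i`. -/
def osc (X : Chan) (i : HatIdx N) : Op N :=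
  (-Complex.I * ((i.sgn : ℤ) * i.nrm : ℝ)) • Jop X i.sgn i.1.1 i.1.2

/-- The adjoint of `osc X i`. -/
def oscDag (X : Chan) (i : HatIdx N) : Op N :=
  (Complex.I * ((i.sgn : ℤ) * i.nrm : ℝ)) • Jop X i.sgn i.1.1 (-i.1.2)

theorem osc_adj (hN : Odd N) (X : Chan) (i : HatIdx N) : IsAdj (osc X i) (oscDag X i) := by
  have := (Jop_adj hN X i.sgn i.1.1 i.1.2).smul (-Complex.I * ((i.sgn : ℤ) * i.nrm : ℝ))
  rw [map_mul, map_neg, Complex.conj_I, neg_neg, Complex.conj_ofReal] at this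
  exact this

theorem osc_graded (hN : Odd N) (X : Chan) (i : HatIdx N) : Graded (osc X i) (-(2 * |i.par|)) := by
  rw [← i.sgn_mul]
  exact (Jop_graded hN X i.sgn i.1.1 i.1.2).smul _

theorem oscDag_graded (hN : Odd N) (X : Chan) (i : HatIdx N) : Graded (oscDag X i) (2 * |i.par|) := by
  have := (Jop_graded hN X i.sgn i.1.1 (-i.1.2)).smul (Complex.I * ((i.sgn : ℤ) * i.nrm : ℝ))
  rwa [Pi.neg_apply, mul_neg, mul_neg, neg_neg, i.sgn_mul] at this

/-- A nonzero commutator needs opposite momenta and equal chirality, which is impossible since every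
`osc` has r p_s > 0. -/
theorem osc_comm (hN : Odd N) (X X' : Chan) (i j : HatIdx N) : Commute (osc X i) (osc X' j) := by
  refine Commute.smul_left (Commute.smul_right ?_ _) _
  have h := Jop_commutator hN X X' i.sgn j.sgn i.1.1 j.1.1 i.1.2 j.1.2
  rw [if_neg, zero_smul] at h
  · exact sub_eq_zero.1 h
  · rintro ⟨-, h1, h2, h3, -⟩
    have h4 := i.sgn_mul
    have h5 := j.sgn_mul
    have h6 := i.abs_pos
    have h7 := j.abs_pos
    simp only [HatIdx.par] at h4 h5 h6 h7
    rw [h2] at h3 h4 h6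
    rw [h1] at h4
    have : (j.sgn : ℤ) * (i.1.2 j.1.1 + j.1.2 j.1.1) = 0 := by rw [h3, mul_zero]
    rw [mul_add] at this
    omega

/-- Two labels in the box differ by less than N, so umklapp cannot identify distinct oscillators. -/
theorem InBox.eq_of_cast {m n : ℤ} (hm : InBox N m) (hn : InBox N n)
    (h : ((m - n : ℤ) : ZMod N) = 0) : m = n := by
  rw [ZMod.intCast_zmod_eq_zero_iff_dvd] at h
  obtain ⟨k, hk⟩ := h
  obtain ⟨h1, h2⟩ := hm
  obtain ⟨h3, h4⟩ := hn
  have hN : (0 : ℤ) < N := by omega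
  have h5 : k < 1 := by nlinarith
  have h6 : -1 < k := by nlinarith
  have : k = 0 := by omega
  subst this
  omega

theorem HatIdx.ext_of {i j : HatIdx N} (h1 : i.1.1 = j.1.1) (h2 : i.par = j.par)
    (h3 : i.1.2 (-i.1.1) = j.1.2 (-j.1.1)) : i = j := by
  refine Subtype.ext (Prod.ext h1 (funext fun t => ?_))
  rcases Int.units_eq_one_or (t * i.1.1) with h | h
  · have ht : t = i.1.1 := by rw [← mul_one t, ← Int.units_mul_self i.1.1, ← mul_assoc, h, one_mul]
    rw [ht]
    simp only [HatIdx.par] at h2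
    rw [h2, h1]
  · have ht : t = -i.1.1 := by
      rw [← mul_one t, ← Int.units_mul_self i.1.1, ← mul_assoc, h, neg_one_mul]
    rw [ht, h3, h1]

/-- The Schwinger term is 2N|n|, with n the label of p_s, a factor N for the transverse momenta and
2 for the spins; `nrm` is its inverse square root. -/
theorem osc_ccr (hN : Odd N) (X X' : Chan) (i j : HatIdx N) :
    osc X i * oscDag X' j - oscDag X' j * osc X i = if X = X' ∧ i = j then 1 else 0 := by
  have h := Jop_commutator hN X X' i.sgn j.sgn i.1.1 j.1.1 i.1.2 (-j.1.2)
  rw [osc, oscDag, smul_mul_smul_comm, smul_mul_smul_comm, mul_comm (Complex.I * _), ← smul_sub, h,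
    smul_smul]
  by_cases hX : X = X' ∧ i = j
  · obtain ⟨rfl, rfl⟩ := hX
    rw [if_pos (by simp), if_pos (by simp)]
    have h1 : ((i.sgn : ℤ) : ℝ) * ((i.sgn : ℤ) : ℝ) = 1 := by
      have := congrArg Units.val (Int.units_mul_self i.sgn)
      rw [Units.val_mul, Units.val_one] at this
      exact_mod_cast this
    have h2 := nrm_sq hN i
    have h3 : (((i.sgn : ℤ) * i.1.2 i.1.1 : ℤ) : ℝ) = |(i.par : ℝ)| := by
      have := i.sgn_mul
      rw [this]; push_cast; rfl
    rw [h3]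
    have h4 : -Complex.I * ((i.sgn : ℤ) * i.nrm : ℝ) * (Complex.I * ((i.sgn : ℤ) * i.nrm : ℝ)) *
        ((2 * N * |(i.par : ℝ)| : ℝ) : ℂ) =
        ((((i.sgn : ℤ) : ℝ) * ((i.sgn : ℤ) : ℝ) * (i.nrm ^ 2 * (2 * N * |(i.par : ℝ)|)) : ℝ) : ℂ) := by
      push_cast
      linear_combination (-(((i.sgn : ℤ) : ℂ) * i.nrm * (((i.sgn : ℤ) : ℂ) * i.nrm) *
        (2 * N * (|(i.par : ℝ)| : ℝ)))) * Complex.I_mul_I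
    rw [h4, h1, h2]
    simp
  · rw [if_neg hX, if_neg, mul_zero, zero_smul]
    rintro ⟨h1, -, h2, h3, h4⟩
    refine hX ⟨h1, HatIdx.ext_of h2 ?_ ?_⟩
    · simp only [HatIdx.par, Pi.neg_apply] at h3 ⊢
      rw [← h2]
      omega
    · refine i.2.1.eq_of_cast j.2.1 ?_
      rw [← h2]
      simpa [sub_eq_add_neg] using h4

theorem oscDag_comm (hN : Odd N) (X X' : Chan) (i j : HatIdx N) :
    Commute (oscDag X i) (oscDag X' j) := by
  have h1 := (osc_adj hN X' j).mul (osc_adj hN X i)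
  have h2 := (osc_adj hN X i).mul (osc_adj hN X' j)
  rw [(osc_comm hN X X' i j).eq] at h2
  exact h1.unique h2

theorem osc_oscDag_comm (hN : Odd N) {X X' : Chan} {i j : HatIdx N} (h : ¬(X = X' ∧ i = j)) :
    Commute (osc X i) (oscDag X' j) := by
  have := osc_ccr hN X X' i j
  rw [if_neg h] at this
  exact sub_eq_zero.1 this

theorem osc_vac (hN : Odd N) (X : Chan) (i : HatIdx N) : osc X i (vac : FockAlg N) = 0 := by
  have h1 : (vac : FockAlg N) ∈ V N 0 := ket_mem_V ∅
  have h2 := osc_graded hN X i 0 _ h1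
  rwa [V_eq_bot (by have := i.abs_pos; omega), Submodule.mem_bot] at h2

end

end NodalMattis

/-! ### Boson fields and zero modes in oscillator form. -/

namespace NodalMattis

noncomputable section

variable {N : ℕ}

/-! ### The boson fields in terms of the oscillators -/

/-- `|p_s|` for the momentum label `i`. -/
def HatIdx.absMom (L : ℝ) (i : HatIdx N) : ℝ := |mom L i.par|

theorem absMom_eq {L : ℝ} (hL : 0 < L) (i : HatIdx N) :
    i.absMom L = 2 * Real.pi / L * |(i.par : ℝ)| := by
  rw [HatIdx.absMom, mom, abs_mul, abs_of_pos (by positivity)]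

theorem absMom_pos {L : ℝ} (hL : 0 < L) (i : HatIdx N) : 0 < i.absMom L := by
  have : 0 < |(i.par : ℝ)| := _root_.abs_pos.2 (by exact_mod_cast i.2.2)
  rw [absMom_eq hL]
  positivity

theorem mom_par {L : ℝ} (hL : 0 < L) (i : HatIdx N) :
    mom L i.par = ((i.sgn : ℤ) : ℝ) * i.absMom L := by
  have h := i.sgn_mul
  have h1 : ((i.sgn : ℤ) : ℝ) * ((i.sgn : ℤ) : ℝ) = 1 := by
    have := congrArg Units.val (Int.units_mul_self i.sgn)
    rw [Units.val_mul, Units.val_one] at this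
    exact_mod_cast this
  have h2 : ((i.sgn : ℤ) : ℝ) * i.par = |(i.par : ℝ)| := by exact_mod_cast h
  rw [absMom_eq hL, mom, ← h2]
  linear_combination (-(2 * Real.pi / L * i.par)) * h1

theorem absMom_hneg (hN : Odd N) (L : ℝ) (i : HatIdx N) : (hneg hN i).absMom L = i.absMom L := by
  rw [HatIdx.absMom, HatIdx.absMom, hneg_par, mom, mom, Int.cast_neg, mul_neg, abs_neg]

/-- The field `osc + oscDag` at reflected momenta. -/
def posF (hN : Odd N) (X : Chan) (i : HatIdx N) : Op N := osc X i + oscDag X (hneg hN i)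

/-- The conjugate field. -/
def momF (hN : Odd N) (X : Chan) (i : HatIdx N) : Op N := osc X i - oscDag X (hneg hN i)

/-- Reflection reverses the sign of p_s, so the creation operator at -p is the density of the
opposite chirality at p; together they give both chiralities, as in Φ. -/
theorem posF_eq (hN : Odd N) (X : Chan) (i : HatIdx N) :
    posF hN X i = (-Complex.I * ((i.sgn : ℤ) * i.nrm : ℝ)) •
      (Jop X 1 i.1.1 i.1.2 + Jop X (-1) i.1.1 i.1.2) := by
  rw [posF, osc, oscDag, sgn_hneg, nrm_hneg, hneg_fst, hneg_snd, neg_neg]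
  rcases Int.units_eq_one_or i.sgn with h | h
  · rw [h, smul_add]
    congr 2
    push_cast
    ring
  · rw [h, neg_neg, smul_add, add_comm]
    congr 2
    push_cast
    ring

theorem momF_eq (hN : Odd N) (X : Chan) (i : HatIdx N) :
    momF hN X i = (Complex.I * i.nrm) •
      (-Jop X 1 i.1.1 i.1.2 + Jop X (-1) i.1.1 i.1.2) := by
  rw [momF, osc, oscDag, sgn_hneg, nrm_hneg, hneg_fst, hneg_snd, neg_neg]
  rcases Int.units_eq_one_or i.sgn with h | h
  · rw [h, smul_add, smul_neg, ← neg_smul, sub_eq_add_neg, ← neg_smul]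
    congr 2 <;> (push_cast; ring)
  · rw [h, neg_neg, smul_add, smul_neg, ← neg_smul, sub_eq_add_neg, ← neg_smul, add_comm]
    congr 2 <;> (push_cast; ring)

theorem nrm_pos (hN : Odd N) (i : HatIdx N) : 0 < i.nrm := by
  have h := nrm_sq hN i
  have h1 : 0 ≤ i.nrm := inv_nonneg.2 (Real.sqrt_nonneg _)
  rcases h1.eq_or_lt with h2 | h2
  · rw [← h2] at h; norm_num at h
  · exact h2

section Coefficients

variable {L : ℝ} (hL : 0 < L) (hN : Odd N) (i : HatIdx N)
include hL hN

/-- Both sides are positive, so their squares are compared; with ã = L/N and the defining relation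
of `nrm` all factors cancel. The coefficient of Π is treated in the same way. -/
theorem sqrt_coeff_b :
    1 / √2 * (1 / L * √(2 * Real.pi * aTilde L N / i.absMom L)) = i.nrm := by
  have hN' : (0 : ℝ) < N := by exact_mod_cast hN.pos
  have h0 := absMom_pos hL i
  have hm : 0 < |(i.par : ℝ)| := _root_.abs_pos.2 (by exact_mod_cast i.2.2)
  have hp := Real.pi_pos
  refine (sq_eq_sq₀ (by positivity) (nrm_pos hN i).le).1 ?_
  have h1 : 0 < 2 * Real.pi * aTilde L N / i.absMom L := by rw [aTilde]; positivity
  have h2 := nrm_sq hN i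
  rw [mul_pow, mul_pow, div_pow, Real.sq_sqrt (by norm_num), div_pow, Real.sq_sqrt h1.le,
    eq_div_of_mul_eq (by positivity) h2, absMom_eq hL, aTilde]
  field_simp

theorem sqrt_coeff_pi :
    2 * Real.pi / L * √(aTilde L N / (8 * Real.pi)) = √(i.absMom L / 2) * i.nrm := by
  have hN' : (0 : ℝ) < N := by exact_mod_cast hN.pos
  have h0 := absMom_pos hL i
  have hm : 0 < |(i.par : ℝ)| := _root_.abs_pos.2 (by exact_mod_cast i.2.2)
  have hp := Real.pi_pos
  have hn := nrm_pos hN i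
  refine (sq_eq_sq₀ (by positivity) (by positivity)).1 ?_
  have h1 : 0 < aTilde L N / (8 * Real.pi) := by rw [aTilde]; positivity
  have h2 := nrm_sq hN i
  rw [mul_pow, mul_pow, Real.sq_sqrt h1.le, Real.sq_sqrt (by positivity),
    eq_div_of_mul_eq (by positivity) h2, absMom_eq hL, aTilde]
  field_simp
  norm_num

theorem sqrt_coeff_phi :
    2 * Real.pi / L * √(aTilde L N / (8 * Real.pi)) / i.absMom L = (√(2 * i.absMom L))⁻¹ * i.nrm := by
  have h0 := absMom_pos hL i
  rw [sqrt_coeff_pi hL hN i, mul_div_right_comm]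
  congr 1
  rw [← one_div, div_eq_div_iff h0.ne' (by positivity), ← Real.sqrt_mul (by positivity)]
  rw [show i.absMom L / 2 * (2 * i.absMom L) = i.absMom L ^ 2 by ring, Real.sqrt_sq h0.le, one_mul]

theorem op_b (X : Chan) : (op (b L N X i.1.1 i.1.2) : Op N) = osc X i := by
  have hb : b L N X i.1.1 i.1.2 =
      (-Complex.I * ((i.sgn : ℤ) * i.nrm : ℝ)) • J X i.sgn i.1.1 i.1.2 := by
    rw [← sqrt_coeff_b hL hN i, b, J, Finset.smul_sum, Finset.smul_sum]
    refine Finset.sum_congr rfl fun α _ => ?_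
    rw [bSpin, HatIdx.sgn]
    split_ifs with h
    · rw [smul_smul, smul_smul, smul_smul, HatIdx.absMom]
      congr 1
      push_cast
      ring
    · rw [smul_smul, smul_smul, smul_smul, HatIdx.absMom]
      congr 1
      push_cast
      ring
  rw [hb, op_smul]
  rfl

theorem op_dag_b (X : Chan) : (op (dag (b L N X i.1.1 i.1.2)) : Op N) = oscDag X i := by
  have h := op_adj (N := N) (b L N X i.1.1 i.1.2) hN
  rw [op_b hL hN] at h
  exact h.unique (osc_adj hN X i)

theorem op_Phi (X : Chan) : ((2 * Real.pi / L : ℝ) : ℂ) • (op (PhiField L N X i.1.1 i.1.2) : Op N) =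
    (((√(2 * i.absMom L))⁻¹ : ℝ) : ℂ) • posF hN X i := by
  have h0 := absMom_pos hL i
  have h1 : ((i.sgn : ℤ) : ℂ) * ((i.sgn : ℤ) : ℂ) = 1 := by
    have := congrArg Units.val (Int.units_mul_self i.sgn)
    rw [Units.val_mul, Units.val_one] at this
    exact_mod_cast this
  have h2 : ((i.sgn : ℤ) : ℂ) ≠ 0 := left_ne_zero_of_mul_eq_one h1
  have h3 := congrArg (fun y : ℝ => (y : ℂ)) (sqrt_coeff_phi hL hN i)
  rw [posF_eq, PhiField, op_smul, op_add, smul_smul, smul_smul]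
  change _ • (Jop X 1 i.1.1 i.1.2 + Jop X (-1) i.1.1 i.1.2) = _
  congr 1
  have h4 : (mom L (i.1.2 i.1.1) : ℂ) = ((i.sgn : ℤ) : ℂ) * (i.absMom L : ℂ) := by
    have := mom_par hL i
    rw [show mom L (i.1.2 i.1.1) = _ from this]
    push_cast
    rfl
  have h5 : (i.absMom L : ℂ) ≠ 0 := by exact_mod_cast h0.ne'
  have h6 : 1 / (Complex.I * (mom L (i.1.2 i.1.1) : ℂ)) =
      -Complex.I * ((i.sgn : ℤ) : ℂ) / (i.absMom L : ℂ) := by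
    rw [h4, div_eq_div_iff (mul_ne_zero Complex.I_ne_zero (mul_ne_zero h2 h5)) h5]
    linear_combination (-(i.absMom L : ℂ)) * h1 + (((i.sgn : ℤ) : ℂ) * ((i.sgn : ℤ) : ℂ) * (i.absMom L : ℂ)) * Complex.I_mul_I
  rw [h6]
  push_cast at h3 ⊢
  linear_combination (-Complex.I * ((i.sgn : ℤ) : ℂ)) * h3

theorem op_Pi (X : Chan) : ((2 * Real.pi / L : ℝ) : ℂ) • (op (PiField L N X i.1.1 i.1.2) : Op N) =
    (-Complex.I * ((√(i.absMom L / 2) : ℝ) : ℂ)) • momF hN X i := by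
  have h3 := congrArg (fun y : ℝ => (y : ℂ)) (sqrt_coeff_pi hL hN i)
  rw [momF_eq, PiField, op_smul, op_add, op_neg, smul_smul, smul_smul]
  change _ • (-Jop X 1 i.1.1 i.1.2 + Jop X (-1) i.1.1 i.1.2) = _
  congr 1
  push_cast at h3 ⊢
  linear_combination h3 + ((√(i.absMom L / 2) : ℝ) * i.nrm : ℂ) * Complex.I_mul_I

end Coefficients

theorem posF_adj (hN : Odd N) (X : Chan) (i : HatIdx N) :
    IsAdj (posF hN X i) (posF hN X (hneg hN i)) := by
  have := (osc_adj hN X i).add (osc_adj hN X (hneg hN i)).symm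
  rw [add_comm (oscDag X i)] at this
  rw [posF, posF, hneg_hneg]
  exact this

theorem momF_adj (hN : Odd N) (X : Chan) (i : HatIdx N) :
    IsAdj (momF hN X i) (-momF hN X (hneg hN i)) := by
  have := (osc_adj hN X i).sub (osc_adj hN X (hneg hN i)).symm
  rw [momF, momF, hneg_hneg, neg_sub]
  exact this

/-! ### Zero modes -/

/-- The Schwinger term is proportional to p_s. -/
theorem Jop_commute_of_zero (hN : Odd N) (X X' : Chan) (r r' s s' : ℤˣ) {p : BMom} (hp : p s = 0)
    (q : BMom) : Commute (Jop X r s p : Op N) (Jop X' r' s' q) := by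
  have h := Jop_commutator hN X X' r r' s s' p q
  rw [hp] at h
  simp only [mul_zero, Int.cast_zero, Complex.ofReal_zero, ite_self, zero_smul] at h
  exact sub_eq_zero.1 h

theorem vev_density (r s α : ℤˣ) (p : BMom) : (density (N := N) r s α p vac) ∅ = 0 := by
  rw [vac, density, opSum, ofBasis_ket]
  refine finsum_induction (fun v : FockAlg N => v ∅ = 0) rfl (fun x y hx hy => ?_) fun kk => ?_
  · change x ∅ + y ∅ = 0
    rw [hx, hy, add_zero]
  · split_ifs
    · change (fermiProd _ _ vac) ∅ = 0
      rw [fermiProd, LinearMap.sub_apply, LinearMap.smul_apply, Module.End.one_apply]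
      change vev _ - _ * (vac : FockAlg N) ∅ = 0
      simp [vac, ket]
    · rfl

theorem eq_smul_vac {v : FockAlg N} (hv : v ∈ V N 0) : v = v ∅ • vac := by
  ext E
  rw [vac, ket, Finsupp.smul_single, smul_eq_mul, mul_one]
  by_cases hE : E = ∅
  · rw [hE, Finsupp.single_eq_same]
  · rw [Finsupp.single_eq_of_ne hE]
    by_contra h0
    have h1 : level E = 0 := (Finsupp.mem_supported ℂ v).1 hv (Finsupp.mem_support_iff.2 h0)
    obtain ⟨m, hm⟩ := Finset.nonempty_iff_ne_empty.2 hE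
    have h2 := (Finset.sum_eq_zero_iff_of_nonneg fun m _ => abs_nonneg _).1 h1 m hm
    have h3 := abs_eq_zero.1 h2
    omega

/-- At p_s = 0 each density preserves level zero, which is spanned by Ω, and fermion normal ordering
has removed its expectation value. -/
theorem Jop_vac_of_zero (hN : Odd N) (X : Chan) (r s : ℤˣ) {p : BMom} (hp : p s = 0) :
    Jop X r s p (vac : FockAlg N) = 0 := by
  rw [Jop_eq, LinearMap.sum_apply]
  refine Finset.sum_eq_zero fun α _ => ?_
  have h1 : (vac : FockAlg N) ∈ V N 0 := ket_mem_V ∅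
  have h2 := density_graded hN r s α p 0 _ h1
  rw [hp, mul_zero, mul_zero, neg_zero, add_zero] at h2
  rw [LinearMap.smul_apply, eq_smul_vac h2, vev_density, zero_smul, smul_zero]

/-- The operator of `Q̂_{X;r,s}(p)`. -/
def Zop (L : ℝ) (X : Chan) (r s : ℤˣ) (n : ℤ) : Op N := op (QHat L N X r s n)

theorem Zop_eq (L : ℝ) (X : Chan) (r s : ℤˣ) (n : ℤ) : (Zop L X r s n : Op N) =
    ((1 / √2 * √(aTilde L N / (2 * Real.pi)) : ℝ) : ℂ) • (Jop X 1 s (transverse s n) +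
      (((r : ℤ) : ℝ) : ℂ) • Jop X (-1) s (transverse s n)) := by
  simp only [Zop, QHat, zeroModeHat, op_smul, op_sum, op_add, op_gen, Jop_eq, smul_add,
    Finset.smul_sum, ← Finset.sum_add_distrib, smul_smul]
  refine Finset.sum_congr rfl fun α _ => ?_
  congr 2 <;> (push_cast; ring)

theorem transverse_self (s : ℤˣ) (n : ℤ) : transverse s n s = 0 := if_pos rfl

theorem transverse_neg (s : ℤˣ) (n : ℤ) : -transverse s n = transverse s (-n) := by
  ext t
  simp only [transverse, Pi.neg_apply]
  split_ifs <;> simp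

theorem Zop_commute_J (hN : Odd N) (L : ℝ) (X X' : Chan) (r r' s s' : ℤˣ) (n : ℤ) (q : BMom) :
    Commute (Zop L X r s n : Op N) (Jop X' r' s' q) := by
  rw [Zop_eq]
  exact ((Jop_commute_of_zero hN _ _ _ _ _ _ (transverse_self s n) q).add_left
    ((Jop_commute_of_zero hN _ _ _ _ _ _ (transverse_self s n) q).smul_left _)).smul_left _

theorem Zop_commute (hN : Odd N) (L : ℝ) (X X' : Chan) (r r' s s' : ℤˣ) (n n' : ℤ) :
    Commute (Zop L X r s n : Op N) (Zop L X' r' s' n') := by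
  rw [Zop_eq L X' r' s' n']
  exact ((Zop_commute_J hN L X X' r _ s _ n _).add_right
    ((Zop_commute_J hN L X X' r _ s _ n _).smul_right _)).smul_right _

theorem Zop_commute_osc (hN : Odd N) (L : ℝ) (X X' : Chan) (r s : ℤˣ) (n : ℤ) (i : HatIdx N) :
    Commute (Zop L X r s n : Op N) (osc X' i) := (Zop_commute_J hN L X X' r _ s _ n _).smul_right _

theorem Zop_commute_oscDag (hN : Odd N) (L : ℝ) (X X' : Chan) (r s : ℤˣ) (n : ℤ) (i : HatIdx N) :
    Commute (Zop L X r s n : Op N) (oscDag X' i) :=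
  (Zop_commute_J hN L X X' r _ s _ n _).smul_right _

theorem Zop_adj (hN : Odd N) (L : ℝ) (X : Chan) (r s : ℤˣ) (n : ℤ) :
    IsAdj (Zop L X r s n : Op N) (Zop L X r s (-n)) := by
  rw [Zop_eq, Zop_eq, ← transverse_neg]
  exact ((Jop_adj hN X 1 s _).add ((Jop_adj hN X (-1) s _).smul_real _)).smul_real _

theorem op_dag_QHat (hN : Odd N) (L : ℝ) (X : Chan) (r s : ℤˣ) (n : ℤ) :
    (op (dag (QHat L N X r s n)) : Op N) = Zop L X r s (-n) :=
  (op_adj (QHat L N X r s n) hN).unique (Zop_adj hN L X r s n)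

theorem Zop_graded (hN : Odd N) (L : ℝ) (X : Chan) (r s : ℤˣ) (n : ℤ) :
    Graded (Zop L X r s n : Op N) 0 := by
  have h : ∀ r', Graded (Jop X r' s (transverse s n) : Op N) 0 := fun r' => by
    have := Jop_graded hN X r' s (transverse s n)
    rwa [transverse_self, mul_zero, mul_zero, neg_zero] at this
  rw [Zop_eq]
  exact ((h 1).add ((h (-1)).smul _)).smul _

theorem Zop_vac (hN : Odd N) (L : ℝ) (X : Chan) (r s : ℤˣ) (n : ℤ) :
    Zop L X r s n (vac : FockAlg N) = 0 := by
  rw [Zop_eq, LinearMap.smul_apply, LinearMap.add_apply, LinearMap.smul_apply,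
    Jop_vac_of_zero hN _ _ _ (transverse_self s n), Jop_vac_of_zero hN _ _ _ (transverse_self s n),
    smul_zero, add_zero, smul_zero]

/-! ### Fourier transformation of the zero modes -/

theorem box_eq {M : ℕ} : box (2 * M + 1) = (Finset.range (2 * M + 1)).image fun j : ℕ => (j : ℤ) - M := by
  ext n
  simp only [box, InBox, Finset.mem_filter, Finset.mem_Ico, Finset.mem_image, Finset.mem_range]
  constructor
  · rintro ⟨-, h1, h2⟩
    exact ⟨(n + M).toNat, by omega, by omega⟩
  · rintro ⟨j, hj, rfl⟩
    push_cast
    omega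

theorem mem_box {n : ℤ} : n ∈ box N ↔ InBox N n := by
  simp only [box, InBox, Finset.mem_filter, Finset.mem_Ico]
  omega

theorem sum_box_zpow (hN : Odd N) {ζ : ℂ} (hζ : ζ ^ N = 1) :
    ∑ j ∈ box N, ζ ^ j = if ζ = 1 then (N : ℂ) else 0 := by
  have h0 : ζ ≠ 0 := by
    rintro rfl
    rw [zero_pow hN.pos.ne'] at hζ
    exact zero_ne_one hζ
  obtain ⟨M, rfl⟩ := hN
  rw [box_eq, Finset.sum_image (fun x _ y _ h => by simpa using h)]
  simp only [zpow_sub₀ h0, zpow_natCast]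
  rw [← Finset.sum_div]
  split_ifs with h
  · rw [h]; simp
  · rw [geom_sum_eq h, hζ, sub_self, zero_div, zero_div]

/-- The plane waves on the positions. -/
def wave (L : ℝ) (N : ℕ) (n j : ℤ) : ℂ :=
  Complex.exp (Complex.I * (mom L n * (aTilde L N * j) : ℝ))

theorem wave_eq {L : ℝ} (hL : 0 < L) (hN : Odd N) (n j : ℤ) :
    wave L N n j = Complex.exp (2 * Real.pi * Complex.I * (n / N)) ^ j := by
  have hN' : (N : ℂ) ≠ 0 := by exact_mod_cast hN.pos.ne'
  have hL' : (L : ℂ) ≠ 0 := by exact_mod_cast hL.ne'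
  rw [wave, ← Complex.exp_int_mul, mom, aTilde]
  congr 1
  push_cast
  field_simp

theorem wave_mul {L : ℝ} (n m j : ℤ) : wave L N n j * wave L N m j = wave L N (n + m) j := by
  rw [wave, wave, wave, ← Complex.exp_add]
  congr 1
  rw [mom, mom, mom]
  push_cast
  ring

theorem sum_wave {L : ℝ} (hL : 0 < L) (hN : Odd N) (n : ℤ) :
    ∑ j ∈ box N, wave L N n j = if ((n : ℤ) : ZMod N) = 0 then (N : ℂ) else 0 := by
  have hN' : (N : ℂ) ≠ 0 := by exact_mod_cast hN.pos.ne'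
  simp only [wave_eq hL hN]
  rw [sum_box_zpow hN]
  · congr 1
    rw [Complex.exp_eq_one_iff, ZMod.intCast_zmod_eq_zero_iff_dvd, eq_iff_iff]
    constructor
    · rintro ⟨k, hk⟩
      refine ⟨k, ?_⟩
      have h2 : (n : ℂ) / N = k := by
        refine mul_left_cancel₀ Complex.two_pi_I_ne_zero ?_
        rw [hk, mul_comm]
      rw [div_eq_iff hN'] at h2
      have h3 : n = k * N := by exact_mod_cast h2
      rw [h3, mul_comm]
    · rintro ⟨k, hk⟩
      refine ⟨k, ?_⟩
      rw [hk]
      push_cast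
      field_simp
  · rw [← Complex.exp_nat_mul, Complex.exp_eq_one_iff]
    refine ⟨n, ?_⟩
    field_simp

theorem op_Q (L : ℝ) (X : Chan) (r s : ℤˣ) (j : ℤ) : (op (Q L N X r s j) : Op N) =
    ((√(2 * Real.pi * aTilde L N) / L : ℝ) : ℂ) • ∑ n ∈ box N, wave L N n j • Zop L X r s n := by
  have h : ∀ n, Zop (N := N) L X r s n = (1 / (√2 : ℂ)) • ∑ α : ℤˣ, X.weight α •
      (op (zeroModeHat L N 1 s α n) + ((r : ℤ) : ℂ) • op (zeroModeHat L N (-1) s α n)) := fun n => by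
    simp only [Zop, QHat, op_smul, op_sum, op_add]
  simp only [h, Q, zeroMode, op_smul, op_sum, op_add, smul_add, Finset.smul_sum, smul_smul, ← wave.eq_1]
  rw [Finset.sum_comm]
  refine Finset.sum_congr rfl fun α _ => ?_
  rw [← Finset.sum_add_distrib]
  refine Finset.sum_congr rfl fun n _ => ?_
  congr 2 <;> (push_cast; ring)

theorem sum_Q {L : ℝ} (hL : 0 < L) (hN : Odd N) (X : Chan) (r s : ℤˣ) :
    ∑ j ∈ box N, (op (Q L N X r s j) : Op N) =
      ((√(2 * Real.pi * aTilde L N) / L * N : ℝ) : ℂ) • Zop L X r s 0 := by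
  simp only [op_Q]
  rw [← Finset.smul_sum, Finset.sum_comm]
  simp only [← Finset.sum_smul, sum_wave hL hN]
  rw [Finset.sum_eq_single_of_mem 0]
  · rw [Int.cast_zero, if_pos rfl, smul_smul]
    push_cast
    rfl
  · rw [mem_box]
    have := hN.pos
    constructor <;> omega
  · intro n hn h0
    rw [if_neg, zero_smul]
    intro h
    refine h0 ((mem_box.1 hn).eq_of_cast (n := 0) ?_ (by simpa using h))
    have := hN.pos
    constructor <;> omega

/-- Parseval for the discrete Fourier transform: summing the waves over positions keeps only m = -n,
because the symmetric box represents every residue once. -/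
theorem sum_Q_sq {L : ℝ} (hL : 0 < L) (hN : Odd N) (X : Chan) (r s : ℤˣ) :
    ∑ j ∈ box N, (op (Q L N X r s j) : Op N) ^ 2 =
      ((2 * Real.pi / L : ℝ) : ℂ) • ∑ n ∈ box N, Zop L X r s (-n) * Zop L X r s n := by
  have hN' : (0 : ℝ) < N := by exact_mod_cast hN.pos
  have h1 : ∀ j, (op (Q L N X r s j) : Op N) ^ 2 =
      ((√(2 * Real.pi * aTilde L N) / L * (√(2 * Real.pi * aTilde L N) / L) : ℝ) : ℂ) •
        ∑ n ∈ box N, ∑ m ∈ box N, wave L N (n + m) j • (Zop L X r s n * Zop L X r s m) := fun j => by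
    rw [op_Q, sq, smul_mul_smul_comm, Finset.sum_mul_sum, Complex.ofReal_mul]
    simp only [smul_mul_smul_comm, wave_mul]
  simp only [h1]
  rw [← Finset.smul_sum, Finset.sum_comm]
  have h2 : ∀ n ∈ box N, ∑ j ∈ box N, ∑ m ∈ box N,
      wave L N (n + m) j • (Zop L X r s n * Zop L X r s m : Op N) =
      (N : ℂ) • (Zop L X r s n * Zop L X r s (-n)) := fun n hn => by
    rw [Finset.sum_comm]
    simp only [← Finset.sum_smul, sum_wave hL hN]
    rw [Finset.sum_eq_single_of_mem (-n) (mem_box.2 ((mem_box.1 hn).neg hN))]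
    · rw [if_pos (by simp)]
    · intro m hm hne
      rw [if_neg, zero_smul]
      intro h
      refine hne (InBox.eq_of_cast (mem_box.1 hm) ((mem_box.1 hn).neg hN) ?_)
      rw [← h]
      push_cast
      ring
  rw [Finset.sum_congr rfl h2, ← Finset.smul_sum, smul_smul]
  have h3 : ∀ n ∈ box N, (Zop L X r s n * Zop L X r s (-n) : Op N) = Zop L X r s (-n) * Zop L X r s n :=
    fun n _ => Zop_commute hN L X X r r s s n (-n)
  rw [Finset.sum_congr rfl h3]
  congr 1
  have h4 : √(2 * Real.pi * aTilde L N) / L * (√(2 * Real.pi * aTilde L N) / L) * N =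
      2 * Real.pi / L := by
    have hp := Real.pi_pos
    have : 0 ≤ 2 * Real.pi * aTilde L N := by rw [aTilde]; positivity
    rw [div_mul_div_comm, Real.mul_self_sqrt this, aTilde]
    field_simp
  rw [← h4]
  push_cast
  rfl

end

end NodalMattis

namespace NodalMattis

noncomputable section

variable {N : ℕ}

/-! ### Hartley combinations -/

/-- The combination of a family and its reflection that turns complex modes into real ones. -/
def hart {ι : Type} (ν : ι → ι) (Z : ι → Op N) (i : ι) : Op N :=
  ((1 + Complex.I) / 2) • Z i + ((1 - Complex.I) / 2) • Z (ν i)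

theorem hart_mul {ι : Type} (ν : ι → ι) (Z Z' : ι → Op N) (i j : ι) :
    hart ν Z i * hart ν Z' j = (Complex.I / 2) • (Z i * Z' j) + (1 / 2 : ℂ) • (Z i * Z' (ν j)) +
      (1 / 2 : ℂ) • (Z (ν i) * Z' j) + (-(Complex.I / 2)) • (Z (ν i) * Z' (ν j)) := by
  have h1 : (1 + Complex.I) / 2 * ((1 + Complex.I) / 2) = Complex.I / 2 := by
    linear_combination (1 / 4 : ℂ) * Complex.I_mul_I
  have h2 : (1 + Complex.I) / 2 * ((1 - Complex.I) / 2) = 1 / 2 := by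
    linear_combination (-1 / 4 : ℂ) * Complex.I_mul_I
  have h3 : (1 - Complex.I) / 2 * ((1 + Complex.I) / 2) = 1 / 2 := by
    linear_combination (-1 / 4 : ℂ) * Complex.I_mul_I
  have h4 : (1 - Complex.I) / 2 * ((1 - Complex.I) / 2) = -(Complex.I / 2) := by
    linear_combination (1 / 4 : ℂ) * Complex.I_mul_I
  simp only [hart, add_mul, mul_add, smul_mul_smul_comm, h1, h2, h3, h4]
  abel

/-- The products of a mode with itself carry i/2 and those of the reflected mode -i/2, which cancel
in a reflection-invariant sum. The mixed products carry 1/2 each and coincide after reflection. -/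
theorem sum_hart {ι : Type} [Fintype ι] {ν : ι → ι} (hν : ∀ i, ν (ν i) = i) {c : ι → ℂ}
    (hc : ∀ i, c (ν i) = c i) (Z Z' : ι → Op N) :
    ∑ i, c i • (hart ν Z i * hart ν Z' i) = ∑ i, c i • (Z (ν i) * Z' i) := by
  have e := fun f : ι → Op N => Equiv.sum_comp (Function.Involutive.toPerm ν hν) f
  have e1 : ∑ i, c i • (Z i * Z' (ν i)) = ∑ i, c i • (Z (ν i) * Z' i) := by
    rw [← e fun i => c i • (Z i * Z' (ν i))]
    refine Finset.sum_congr rfl fun i _ => ?_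
    change c (ν i) • (Z (ν i) * Z' (ν (ν i))) = _
    rw [hc, hν]
  have e2 : ∑ i, c i • (Z (ν i) * Z' (ν i)) = ∑ i, c i • (Z i * Z' i) := by
    rw [← e fun i => c i • (Z i * Z' i)]
    refine Finset.sum_congr rfl fun i _ => ?_
    change _ = c (ν i) • (Z (ν i) * Z' (ν i))
    rw [hc]
  simp only [hart_mul, smul_add, Finset.sum_add_distrib, smul_comm (c _) (_ : ℂ) (_ : Op N)]
  simp only [← Finset.smul_sum, e1, e2]
  rw [neg_smul]
  have : ∀ A B : Op N, A + (1 / 2 : ℂ) • B + (1 / 2 : ℂ) • B + -A = B := fun A B => by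
    have h : (1 / 2 : ℂ) • B + (1 / 2 : ℂ) • B = B := by
      rw [← add_smul]; norm_num
    calc A + (1 / 2 : ℂ) • B + (1 / 2 : ℂ) • B + -A = (1 / 2 : ℂ) • B + (1 / 2 : ℂ) • B := by abel
      _ = B := h
  exact this _ _

/-- Complex conjugation interchanges the two coefficients exactly as reflection interchanges the two
terms. -/
theorem hart_adj {ι : Type} {ν : ι → ι} {Z Z' : ι → Op N}
    (h : ∀ i, IsAdj (Z i) (Z' (ν i))) (hν : ∀ i, ν (ν i) = i) (i : ι) :
    IsAdj (hart ν Z i) (hart ν Z' i) := by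
  have h1 := ((h i).smul ((1 + Complex.I) / 2)).add ((h (ν i)).smul ((1 - Complex.I) / 2))
  have h2 : starRingEnd ℂ ((1 + Complex.I) / 2) = (1 - Complex.I) / 2 := by
    rw [map_div₀, map_add, map_one, Complex.conj_I, map_ofNat, sub_eq_add_neg]
  have h3 : starRingEnd ℂ ((1 - Complex.I) / 2) = (1 + Complex.I) / 2 := by
    rw [map_div₀, map_sub, map_one, Complex.conj_I, map_ofNat, sub_neg_eq_add]
  rw [h2, h3, hν, add_comm (((1 - Complex.I) / 2) • Z' (ν i))] at h1
  exact h1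

theorem hart_commute {ι κ : Type} {ν : ι → ι} {μ : κ → κ} {Z : ι → Op N} {Z' : κ → Op N}
    (h : ∀ i j, Commute (Z i) (Z' j)) (i : ι) (j : κ) : Commute (hart ν Z i) (hart μ Z' j) :=
  ((((h i j).smul_right _).add_right ((h i (μ j)).smul_right _)).smul_left _).add_left
    ((((h (ν i) j).smul_right _).add_right ((h (ν i) (μ j)).smul_right _)).smul_left _)

theorem commute_hart {ι : Type} {ν : ι → ι} {Z : ι → Op N} {T : Op N}
    (h : ∀ i, Commute T (Z i)) (i : ι) : Commute T (hart ν Z i) :=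
  ((h i).smul_right _).add_right ((h (ν i)).smul_right _)

/-! ### Normal modes of coupled pairs -/

/-- This is O^T μ O for a rotation in each plane {i, τ i}. A fixed point of τ has sn = 0 by
antisymmetry, so the same formula covers it. -/
theorem sum_pair_mul {ι : Type} [Fintype ι] [DecidableEq ι] {τ : ι → ι} (hτ : ∀ i, τ (τ i) = i)
    {cs sn μ : ι → ℝ} (hcs : ∀ i, cs (τ i) = cs i) (hsn : ∀ i, sn (τ i) = -sn i) (i j : ι) :
    ∑ k, μ k * (((if i = k then cs k else 0) + if i = τ k then sn k else 0) *
      ((if j = k then cs k else 0) + if j = τ k then sn k else 0)) =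
      (if j = i then μ i * cs i ^ 2 + μ (τ i) * sn i ^ 2 else 0) +
        if j = τ i then (μ i - μ (τ i)) * (cs i * sn i) else 0 := by
  have h1 : ∀ i k, (i = τ k) ↔ (τ i = k) := fun i k =>
    ⟨fun h => by rw [h, hτ], fun h => by rw [← h, hτ]⟩
  simp only [h1, add_mul, mul_add, Finset.sum_add_distrib, ite_mul, mul_ite, zero_mul, mul_zero,
    Finset.sum_ite_eq, Finset.mem_univ, if_true]
  simp only [← h1, hsn, hcs, hτ]
  by_cases hji : j = i
  · subst hji
    simp only [if_true]
    by_cases h : j = τ j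
    · have h2 := hsn j
      rw [← h] at h2
      have h3 : sn j = 0 := by linarith
      simp only [← h, h3, if_true]
      ring
    · simp only [if_neg h]
      ring
  · have h2 : ¬ τ j = τ i := fun h => hji (by rw [← hτ j, h, hτ])
    have h3 : i = τ j ↔ j = τ i := ⟨fun h => by rw [h, hτ], fun h => by rw [h, hτ]⟩
    simp only [if_neg hji, if_neg (Ne.symm hji), h3]
    by_cases h : j = τ i
    · simp only [if_pos h]
      rw [show τ j = i by rw [h, hτ], h, hsn, hcs]
      ring
    · simp only [if_neg h]
      ring

/-- Normal modes of oscillators coupled in pairs `{i, τ i}`. -/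
theorem exists_pair_modes {ι : Type} [Fintype ι] [DecidableEq ι] {a ad : ι → Op N} {d : ι → ℤ}
    (h : Oscillators a ad d) {y : ι → Op N} (hy : ∀ i, IsAdj (y i) (y i))
    (gy : ∀ i, Graded (y i) 0) (hya : ∀ i j, Commute (y i) (a j)) (hyad : ∀ i j, Commute (y i) (ad j))
    (hyy : ∀ i j, Commute (y i) (y j)) {W : Op N}
    (hWa : ∀ i, Commute W (a i)) (hWad : ∀ i, Commute W (ad i)) (hWy : ∀ i, Commute W (y i))
    {τ : ι → ι} (hτ : ∀ i, τ (τ i) = i) {x ω β κ cs sn : ι → ℝ} (hx : ∀ i, 0 < x i)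
    (hω : ∀ i, 0 < ω i) (hcs : ∀ i, cs (τ i) = cs i) (hsn : ∀ i, sn (τ i) = -sn i)
    (h1 : ∀ i, cs i ^ 2 + sn i ^ 2 = 1)
    (hβ : ∀ i, x i * β i = ω i ^ 2 * cs i ^ 2 + ω (τ i) ^ 2 * sn i ^ 2)
    (hκ : ∀ i, √(x i) * √(x (τ i)) * κ i = (ω i ^ 2 - ω (τ i) ^ 2) * (cs i * sn i)) :
    ∃ U : Fock N ≃ₗᵢ[ℂ] Fock N, Transforms U
      (W + ∑ i, ((-x i : ℝ) : ℂ) • ((a i - ad i) * (a i - ad i)) +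
        ∑ i, ((β i : ℂ) • ((a i + ad i - y i) * (a i + ad i - y i)) +
          (κ i : ℂ) • ((a i + ad i - y i) * (a (τ i) + ad (τ i) - y (τ i)))))
      (W + ∑ i, (ω i : ℂ) • ((4 : ℂ) • (ad i * a i) + (2 : ℂ) • 1)) := by
  let O : ι → ι → ℝ := fun k i => (if i = k then cs k else 0) + if i = τ k then sn k else 0
  have hO : ∀ i j, ∑ k, O k i * O k j = if i = j then 1 else 0 := fun i j => by
    have := sum_pair_mul hτ (μ := fun _ => 1) hcs hsn i j
    simp only [one_mul, h1, sub_self, zero_mul, ite_self, add_zero] at this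
    simp only [O, this, eq_comm]
  have hO' : ∀ i j, ∑ k, O i k * O j k = if i = j then 1 else 0 := fun i j => by
    have e1 : (Matrix.of O).transpose * Matrix.of O = 1 := by
      ext i j
      rw [Matrix.mul_apply, Matrix.one_apply]
      exact hO i j
    have e0 : Matrix.of O * (Matrix.of O).transpose = 1 := mul_eq_one_comm.1 e1
    have e2 := congrFun (congrFun e0 i) j
    rw [Matrix.mul_apply, Matrix.one_apply] at e2
    exact e2
  obtain ⟨U, hU⟩ := exists_normal_modes h hy gy hya hyad hyy hWa hWad hWy hx hω (O := O)
    (B := fun i j => (if j = i then β i else 0) + if j = τ i then κ i else 0) hO hO' (fun i j => by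
      rw [sum_pair_mul hτ (μ := fun k => ω k ^ 2) hcs hsn i j, mul_add]
      congr 1
      · split_ifs with hij
        · rw [hij, Real.mul_self_sqrt (hx i).le, hβ]
        · rw [mul_zero]
      · split_ifs with hij
        · rw [hij, hκ]
        · rw [mul_zero])
  refine ⟨U, ?_⟩
  rw [quadHam] at hU
  have e : ∀ i, (∑ j, (((if j = i then β i else 0) + if j = τ i then κ i else 0 : ℝ) : ℂ) •
      ((a i + ad i - y i) * (a j + ad j - y j))) =
      (β i : ℂ) • ((a i + ad i - y i) * (a i + ad i - y i)) +
          (κ i : ℂ) • ((a i + ad i - y i) * (a (τ i) + ad (τ i) - y (τ i))) := fun i => by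
    have e1 : ∀ j, (((if j = i then β i else 0) + if j = τ i then κ i else 0 : ℝ) : ℂ) =
        (if j = i then (β i : ℂ) else 0) + if j = τ i then (κ i : ℂ) else 0 := fun j => by
      split_ifs <;> simp
    simp only [e1, add_smul, ite_smul, zero_smul, Finset.sum_add_distrib, Finset.sum_ite_eq',
      Finset.mem_univ, if_true]
  simp only [e] at hU
  exact hU

/-! ### The rotation angle -/

/-- Regard (x, y) as a unit complex number and halve its argument. -/
theorem exists_half_angle {x y : ℝ} (h : x ^ 2 + y ^ 2 = 1) :
    ∃ c s : ℝ, c ^ 2 + s ^ 2 = 1 ∧ c ^ 2 - s ^ 2 = x ∧ 2 * (c * s) = y := by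
  set z : ℂ := ⟨x, y⟩ with hz
  have hn : ‖z‖ = 1 := by
    rw [Complex.norm_eq_sqrt_sq_add_sq, h, Real.sqrt_one]
  have hz0 : z ≠ 0 := norm_ne_zero_iff.1 (by rw [hn]; exact one_ne_zero)
  have hc := Complex.cos_arg hz0
  have hs := Complex.sin_arg z
  rw [hn, div_one] at hc hs
  refine ⟨Real.cos (z.arg / 2), Real.sin (z.arg / 2), Real.cos_sq_add_sin_sq _, ?_, ?_⟩
  · have := Real.cos_two_mul (z.arg / 2)
    rw [mul_div_cancel₀ _ two_ne_zero, hc] at this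
    have h2 := Real.cos_sq_add_sin_sq (z.arg / 2)
    change _ = z.re
    linarith
  · have := Real.sin_two_mul (z.arg / 2)
    rw [mul_div_cancel₀ _ two_ne_zero, hs] at this
    change _ = z.im
    linarith

end

end NodalMattis

namespace NodalMattis

noncomputable section

variable {N : ℕ}

/-! ### Normal ordering of the boson fields -/

theorem sgn_cases (i : HatIdx N) : (i.sgn = 1 ∧ 0 < i.par) ∨ (i.sgn = -1 ∧ i.par < 0) := by
  rcases lt_or_gt_of_ne (show i.par ≠ 0 from i.2.2) with h | h
  · exact Or.inr ⟨if_neg (by omega), h⟩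
  · exact Or.inl ⟨if_pos h, h⟩

/-- At momentum -p the ordering rule moves to the right exactly the chirality opposite to the sign
of p_s; the correction is the commutator of that component alone. -/
theorem normalProd_pair (X : Chan) (i : HatIdx N) (x y : ℂ) (B : LinBos) :
    (normalProd (x • J X 1 i.1.1 (-i.1.2) + y • J X (-1) i.1.1 (-i.1.2)) B : Op N) =
      op (x • J X 1 i.1.1 (-i.1.2) + y • J X (-1) i.1.1 (-i.1.2)) * op B +
        (if i.sgn = 1 then y else x) • (op B * Jop X (-i.sgn) i.1.1 (-i.1.2) -
          Jop X (-i.sgn) i.1.1 (-i.1.2) * op B) := by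
  simp only [normalProd_add, normalProd_smul, normalProd_J, op_add, op_smul, Pi.neg_apply]
  rw [← Jop, ← Jop]
  rcases sgn_cases i with ⟨h1, h2⟩ | ⟨h1, h2⟩
  · simp only [HatIdx.par] at h2
    rw [h1, if_pos (by simpa using h2), if_neg (by simpa using h2.le), if_pos rfl, add_mul,
      smul_mul_assoc, smul_mul_assoc, smul_sub]
    abel
  · simp only [HatIdx.par] at h2
    rw [h1, if_neg (by simpa using h2.le), if_pos (by simpa using h2), if_neg (by decide), add_mul,
      smul_mul_assoc, smul_mul_assoc, smul_sub, neg_neg]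
    abel

theorem Jop_sgn_commutator (hN : Odd N) (X : Chan) (i : HatIdx N) (r : ℤˣ) :
    (Jop X r i.1.1 i.1.2 * Jop X (-i.sgn) i.1.1 (-i.1.2) -
      Jop X (-i.sgn) i.1.1 (-i.1.2) * Jop X r i.1.1 i.1.2 : Op N) =
      (if r = -i.sgn then -((2 * N * |(i.par : ℝ)| : ℝ) : ℂ) else 0) • 1 := by
  rw [Jop_commutator hN]
  congr 1
  by_cases h : r = -i.sgn
  · rw [if_pos h, if_pos (by simp [h]), h]
    have h1 := i.sgn_mul
    have h2 : (((-i.sgn : ℤˣ) : ℤ) * i.1.2 i.1.1 : ℤ) = -|i.par| := by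
      rw [Units.val_neg, neg_mul]
      exact congrArg _ h1
    rw [h2]
    push_cast
    ring
  · rw [if_neg h, if_neg fun h' => h h'.2.1]

/-- The sign ε = -1 gives Π and ε = 1 gives Φ. The constant is the Schwinger term of the one
component that is moved. -/
theorem normalProd_self (hN : Odd N) (X : Chan) (i : HatIdx N) (c : ℂ) (ε : ℤˣ) :
    (normalProd (dag (c • (((ε : ℤ) : ℂ) • J X 1 i.1.1 i.1.2 + J X (-1) i.1.1 i.1.2)))
        (c • (((ε : ℤ) : ℂ) • J X 1 i.1.1 i.1.2 + J X (-1) i.1.1 i.1.2)) : Op N) =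
      plainProd (dag (c • (((ε : ℤ) : ℂ) • J X 1 i.1.1 i.1.2 + J X (-1) i.1.1 i.1.2)))
        (c • (((ε : ℤ) : ℂ) • J X 1 i.1.1 i.1.2 + J X (-1) i.1.1 i.1.2)) -
      (starRingEnd ℂ c * c * ((2 * N * |(i.par : ℝ)| : ℝ) : ℂ)) • 1 := by
  have hε : ((ε : ℤ) : ℂ) * ((ε : ℤ) : ℂ) = 1 := by
    have := congrArg Units.val (Int.units_mul_self ε)
    rw [Units.val_mul, Units.val_one] at this
    exact_mod_cast this
  have hd : dag (c • (((ε : ℤ) : ℂ) • J X 1 i.1.1 i.1.2 + J X (-1) i.1.1 i.1.2)) =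
      (starRingEnd ℂ c * ((ε : ℤ) : ℂ)) • J X 1 i.1.1 (-i.1.2) +
        starRingEnd ℂ c • J X (-1) i.1.1 (-i.1.2) := by
    rw [dag_smul, dag_add, dag_smul, dag_J, dag_J, smul_add, smul_smul, map_intCast]
  rw [hd, normalProd_pair, plainProd, sub_eq_add_neg _ ((_ : ℂ) • (1 : Op N)), ← neg_smul]
  congr 1
  have h1 := Jop_sgn_commutator hN X i 1
  have h2 := Jop_sgn_commutator hN X i (-1)
  have e : ∀ T : Op N, op (c • (((ε : ℤ) : ℂ) • J X 1 i.1.1 i.1.2 + J X (-1) i.1.1 i.1.2)) * T -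
      T * op (c • (((ε : ℤ) : ℂ) • J X 1 i.1.1 i.1.2 + J X (-1) i.1.1 i.1.2)) =
      (c * ((ε : ℤ) : ℂ)) • (Jop X 1 i.1.1 i.1.2 * T - T * Jop X 1 i.1.1 i.1.2) +
        c • (Jop X (-1) i.1.1 i.1.2 * T - T * Jop X (-1) i.1.1 i.1.2) := fun T => by
    simp only [op_smul, op_add, ← Jop.eq_1, smul_add, smul_smul, add_mul, mul_add, smul_mul_assoc,
      mul_smul_comm, smul_sub]
    abel
  rw [e, h1, h2, smul_smul, smul_smul, ← add_smul, smul_smul]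
  congr 1
  rcases sgn_cases i with ⟨h, -⟩ | ⟨h, -⟩
  · rw [h, if_pos rfl, if_neg (by decide), if_pos rfl]
    ring
  · rw [h, if_neg (by decide), neg_neg, if_pos rfl, if_neg (by decide)]
    linear_combination (-(starRingEnd ℂ c * c * ((2 * N * |(i.par : ℝ)| : ℝ) : ℂ))) * hε

section Fields

variable {L : ℝ} (hL : 0 < L) (hN : Odd N) (X : Chan) (i : HatIdx N)
include hL hN

theorem mul_dag_Phi : ((2 * Real.pi / L : ℝ) : ℂ) • (op (dag (PhiField L N X i.1.1 i.1.2)) : Op N) =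
    (((√(2 * i.absMom L))⁻¹ : ℝ) : ℂ) • posF hN X (hneg hN i) := by
  have h1 := (op_adj (N := N) (PhiField L N X i.1.1 i.1.2) hN).smul_real (2 * Real.pi / L)
  rw [op_Phi hL hN] at h1
  exact h1.unique ((posF_adj hN X i).smul_real _)

theorem mul_dag_Pi : ((2 * Real.pi / L : ℝ) : ℂ) • (op (dag (PiField L N X i.1.1 i.1.2)) : Op N) =
    (-Complex.I * ((√(i.absMom L / 2) : ℝ) : ℂ)) • momF hN X (hneg hN i) := by
  have h1 := (op_adj (N := N) (PiField L N X i.1.1 i.1.2) hN).smul_real (2 * Real.pi / L)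
  rw [op_Pi hL hN] at h1
  have h2 := (momF_adj hN X i).smul (-Complex.I * ((√(i.absMom L / 2) : ℝ) : ℂ))
  rw [map_mul, map_neg, Complex.conj_I, neg_neg, Complex.conj_ofReal, smul_neg, ← neg_smul,
    ← neg_mul] at h2
  exact h1.unique h2

theorem plain_Pi : (((2 * Real.pi / L) ^ 2 : ℝ) : ℂ) •
    (plainProd (dag (PiField L N X i.1.1 i.1.2)) (PiField L N X i.1.1 i.1.2) : Op N) =
    ((-(i.absMom L / 2) : ℝ) : ℂ) • (momF hN X (hneg hN i) * momF hN X i) := by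
  have h0 := absMom_pos hL i
  rw [plainProd, sq, Complex.ofReal_mul, ← smul_mul_smul_comm, mul_dag_Pi hL hN, op_Pi hL hN,
    smul_mul_smul_comm]
  congr 1
  have h1 : ((√(i.absMom L / 2) : ℝ) : ℂ) * ((√(i.absMom L / 2) : ℝ) : ℂ) =
      ((i.absMom L / 2 : ℝ) : ℂ) := by
    rw [← Complex.ofReal_mul, Real.mul_self_sqrt (by positivity)]
  rw [Complex.ofReal_neg, ← h1]
  linear_combination ((√(i.absMom L / 2) : ℝ) * (√(i.absMom L / 2) : ℝ) : ℂ) * Complex.I_mul_I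

theorem plain_Phi_Phi (j : HatIdx N) : (((2 * Real.pi / L) ^ 2 : ℝ) : ℂ) •
    (plainProd (dag (PhiField L N X i.1.1 i.1.2)) (PhiField L N X j.1.1 j.1.2) : Op N) =
    (((√(2 * i.absMom L))⁻¹ * (√(2 * j.absMom L))⁻¹ : ℝ) : ℂ) •
      (posF hN X (hneg hN i) * posF hN X j) := by
  rw [plainProd, sq, Complex.ofReal_mul, ← smul_mul_smul_comm, mul_dag_Phi hL hN, op_Phi hL hN,
    smul_mul_smul_comm, Complex.ofReal_mul]

theorem plain_Phi : (((2 * Real.pi / L) ^ 2 : ℝ) : ℂ) • ((mom L (i.1.2 i.1.1) ^ 2 : ℝ) : ℂ) •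
    (plainProd (dag (PhiField L N X i.1.1 i.1.2)) (PhiField L N X i.1.1 i.1.2) : Op N) =
    ((i.absMom L / 2 : ℝ) : ℂ) • (posF hN X (hneg hN i) * posF hN X i) := by
  have h0 := absMom_pos hL i
  rw [smul_comm, plain_Phi_Phi hL hN, smul_smul, ← Complex.ofReal_mul, ← sq_abs]
  change ((i.absMom L ^ 2 * _ : ℝ) : ℂ) • _ = _
  congr 2
  rw [← mul_inv, Real.mul_self_sqrt (by positivity)]
  field_simp

theorem coeff_ordering :
    (2 * Real.pi / L) ^ 2 * (√(aTilde L N / (8 * Real.pi)) ^ 2 * (2 * N * |(i.par : ℝ)|)) =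
      i.absMom L / 2 := by
  have h0 := absMom_pos hL i
  rw [← mul_assoc, ← mul_pow, sqrt_coeff_pi hL hN i, mul_pow, mul_assoc, nrm_sq hN i, mul_one,
    Real.sq_sqrt (by positivity)]

theorem normal_Pi : (((2 * Real.pi / L) ^ 2 : ℝ) : ℂ) •
    (normalProd (dag (PiField L N X i.1.1 i.1.2)) (PiField L N X i.1.1 i.1.2) : Op N) =
    (((2 * Real.pi / L) ^ 2 : ℝ) : ℂ) •
      plainProd (dag (PiField L N X i.1.1 i.1.2)) (PiField L N X i.1.1 i.1.2) -
      ((i.absMom L / 2 : ℝ) : ℂ) • 1 := by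
  have h := normalProd_self hN X i (√(aTilde L N / (8 * Real.pi)) : ℂ) (-1)
  have e : (√(aTilde L N / (8 * Real.pi)) : ℂ) • ((((-1 : ℤˣ) : ℤ) : ℂ) • J X 1 i.1.1 i.1.2 +
      J X (-1) i.1.1 i.1.2) = PiField L N X i.1.1 i.1.2 := by
    rw [PiField]
    simp
  rw [e] at h
  rw [h, smul_sub, smul_smul, ← coeff_ordering hL hN i]
  congr 2
  rw [Complex.conj_ofReal]
  push_cast
  ring

theorem normal_Phi : (((2 * Real.pi / L) ^ 2 : ℝ) : ℂ) • ((mom L (i.1.2 i.1.1) ^ 2 : ℝ) : ℂ) •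
    (normalProd (dag (PhiField L N X i.1.1 i.1.2)) (PhiField L N X i.1.1 i.1.2) : Op N) =
    (((2 * Real.pi / L) ^ 2 : ℝ) : ℂ) • ((mom L (i.1.2 i.1.1) ^ 2 : ℝ) : ℂ) •
      plainProd (dag (PhiField L N X i.1.1 i.1.2)) (PhiField L N X i.1.1 i.1.2) -
      ((i.absMom L / 2 : ℝ) : ℂ) • 1 := by
  have h0 := absMom_pos hL i
  have hk : (mom L (i.1.2 i.1.1) : ℂ) ≠ 0 := by
    have : mom L i.par ≠ 0 := abs_pos.1 h0
    exact_mod_cast this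
  have h := normalProd_self hN X i ((√(aTilde L N / (8 * Real.pi)) : ℂ) *
    (1 / (Complex.I * (mom L (i.1.2 i.1.1) : ℂ)))) 1
  rw [Units.val_one, Int.cast_one, one_smul] at h
  rw [PhiField, h, smul_sub, smul_sub, smul_smul _ _ (1 : Op N), smul_smul _ _ (1 : Op N),
    ← coeff_ordering hL hN i]
  congr 2
  have e : starRingEnd ℂ ((√(aTilde L N / (8 * Real.pi)) : ℂ) *
      (1 / (Complex.I * (mom L (i.1.2 i.1.1) : ℂ)))) * ((√(aTilde L N / (8 * Real.pi)) : ℂ) *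
      (1 / (Complex.I * (mom L (i.1.2 i.1.1) : ℂ)))) * (mom L (i.1.2 i.1.1) : ℂ) ^ 2 =
      (√(aTilde L N / (8 * Real.pi)) : ℂ) ^ 2 := by
    rw [map_mul, map_div₀, map_mul, map_one, Complex.conj_I, Complex.conj_ofReal, Complex.conj_ofReal]
    field_simp
    rw [Complex.I_sq]
    ring
  push_cast
  linear_combination ((2 * Real.pi / L : ℂ) ^ 2 * (2 * N * (|(i.par : ℝ)| : ℝ))) * e

-- Densities of different directions commute, so ordering the mixed product costs nothing.
omit hL in
theorem normal_cross (L : ℝ) : (normalProd (dag (PhiField L N X i.1.1 i.1.2))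
    (PhiField L N X (-i.1.1) i.1.2) : Op N) =
    plainProd (dag (PhiField L N X i.1.1 i.1.2)) (PhiField L N X (-i.1.1) i.1.2) := by
  have hd : dag (PhiField L N X i.1.1 i.1.2) =
      (starRingEnd ℂ ((√(aTilde L N / (8 * Real.pi)) : ℂ) *
        (1 / (Complex.I * (mom L (i.1.2 i.1.1) : ℂ))))) • J X 1 i.1.1 (-i.1.2) +
      (starRingEnd ℂ ((√(aTilde L N / (8 * Real.pi)) : ℂ) *
        (1 / (Complex.I * (mom L (i.1.2 i.1.1) : ℂ))))) • J X (-1) i.1.1 (-i.1.2) := by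
    rw [PhiField, dag_smul, dag_add, dag_J, dag_J, smul_add]
  have hJ : ∀ r, Commute (Jop X r (-i.1.1) i.1.2 : Op N) (Jop X (-i.sgn) i.1.1 (-i.1.2)) := fun r => by
    have h := Jop_commutator hN X X r (-i.sgn) (-i.1.1) i.1.1 i.1.2 (-i.1.2)
    have hs : -i.1.1 ≠ i.1.1 := by
      rcases Int.units_eq_one_or i.1.1 with h | h <;> rw [h] <;> decide
    rw [if_neg fun h => hs h.2.2.1, zero_smul] at h
    exact sub_eq_zero.1 h
  have hc : Commute (op (PhiField L N X (-i.1.1) i.1.2) : Op N) (Jop X (-i.sgn) i.1.1 (-i.1.2)) := by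
    rw [PhiField, op_smul, op_add]
    exact ((hJ 1).add_left (hJ (-1))).smul_left _
  rw [hd, normalProd_pair, plainProd, hc.eq, sub_self, smul_zero, add_zero]

/-- The free part of the Hamiltonian. -/
theorem free_term : (((2 * Real.pi / L) ^ 2 : ℝ) : ℂ) •
    ((normalProd (dag (PiField L N X i.1.1 i.1.2)) (PiField L N X i.1.1 i.1.2) : Op N) +
      ((mom L (i.1.2 i.1.1) ^ 2 : ℝ) : ℂ) •
        normalProd (dag (PhiField L N X i.1.1 i.1.2)) (PhiField L N X i.1.1 i.1.2)) =
    ((i.absMom L : ℝ) : ℂ) • (oscDag X i * osc X i) +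
      ((i.absMom L : ℝ) : ℂ) • (oscDag X (hneg hN i) * osc X (hneg hN i)) := by
  rw [smul_add, normal_Pi hL hN, normal_Phi hL hN, plain_Pi hL hN, plain_Phi hL hN]
  have h := osc_ccr hN X X (hneg hN i) (hneg hN i)
  rw [if_pos ⟨rfl, rfl⟩, sub_eq_iff_eq_add] at h
  simp only [posF, momF, hneg_hneg]
  -- The pair terms cancel between the two squares, and the two ordering constants remove the
  -- zero-point energy.
  have e : ∀ (A A' B B' : Op N) (x : ℂ), B * B' = 1 + B' * B →
      (-x) • ((B - A') * (A - B')) - x • (1 : Op N) + (x • ((B + A') * (A + B')) - x • (1 : Op N)) =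
        (2 * x) • (A' * A) + (2 * x) • (B' * B) := fun A A' B B' x hB => by
    simp only [sub_mul, mul_sub, add_mul, mul_add, hB, two_mul, add_smul, smul_add, smul_sub, neg_smul]
    abel
  rw [Complex.ofReal_neg, e _ _ _ _ _ h]
  congr 2 <;> (push_cast; ring)

end Fields

end

end NodalMattis

namespace NodalMattis

noncomputable section

variable {N : ℕ}

/-! ### The interacting momenta -/

/-- The label of `p_{-s}`. -/
abbrev HatIdx.perp (i : HatIdx N) : ℤ := i.1.2 (-i.1.1)

/-- The momenta with `χ = 1`. -/
abbrev InIdx (N : ℕ) : Type := {i : HatIdx N // InBox N i.par}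

theorem finite_par_le (n : ℤ) : {i : HatIdx N | |i.par| ≤ n}.Finite := by
  let f : HatIdx N → ℤˣ × ℤ × ℤ := fun i => (i.1.1, i.par, i.perp)
  have hf : Function.Injective f := fun i j h => by
    simp only [f, Prod.mk.injEq] at h
    exact HatIdx.ext_of h.1 h.2.1 h.2.2
  refine ((Set.finite_univ.prod ((Set.finite_Icc (-n) n).prod (box N).finite_toSet)).preimage
    hf.injOn).subset fun i hi => ?_
  exact ⟨trivial, abs_le.1 hi, mem_box.2 i.2.1⟩

theorem finite_inBox : {i : HatIdx N | InBox N i.par}.Finite :=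
  (finite_par_le N).subset fun i hi => by
    obtain ⟨h1, h2⟩ := hi
    rw [Set.mem_ofPred_eq, abs_le]
    constructor <;> omega

instance : Fintype (InIdx N) := finite_inBox.fintype

/-- The transverse component of a momentum in the index set lies in the box by definition, so only
p_s decides. -/
theorem chi_eq (i : HatIdx N) : chi N i.1.2 = if InBox N i.par then 1 else 0 := by
  have h := i.2.1
  refine if_congr ?_ rfl rfl
  simp only [HatIdx.par]
  rcases Int.units_eq_one_or i.1.1 with hs | hs
  · rw [hs] at h ⊢
    simp only [h, and_true]
  · rw [hs, neg_neg] at h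
    rw [hs]
    simp only [h, true_and]

/-- The reflection of the interacting momenta. -/
def ineg (hN : Odd N) (i : InIdx N) : InIdx N := ⟨hneg hN i.1, i.2.neg hN⟩

theorem ineg_ineg (hN : Odd N) (i : InIdx N) : ineg hN (ineg hN i) = i :=
  Subtype.ext (hneg_hneg hN i.1)

/-- The other direction with the same momentum, if it exists. -/
def iswap (i : InIdx N) : InIdx N :=
  if h : i.1.perp ≠ 0 then
    ⟨⟨(-i.1.1.1, i.1.1.2), by simpa using i.2, h⟩, i.1.2.1⟩
  else i

theorem iswap_of_ne {i : InIdx N} (h : i.1.perp ≠ 0) : (iswap i).1.1 = (-i.1.1.1, i.1.1.2) := by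
  rw [iswap, dif_pos h]

theorem iswap_of_eq {i : InIdx N} (h : i.1.perp = 0) : iswap i = i := by
  rw [iswap, dif_neg (not_not.2 h)]

theorem iswap_perp {i : InIdx N} (h : i.1.perp ≠ 0) : (iswap i).1.perp = i.1.par := by
  rw [HatIdx.perp, iswap_of_ne h, neg_neg]

theorem iswap_snd (i : InIdx N) : (iswap i).1.1.2 = i.1.1.2 := by
  by_cases h : i.1.perp = 0
  · rw [iswap_of_eq h]
  · rw [iswap_of_ne h]

theorem iswap_iswap (i : InIdx N) : iswap (iswap i) = i := by
  by_cases h : i.1.perp = 0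
  · rw [iswap_of_eq h, iswap_of_eq h]
  · refine Subtype.ext (Subtype.ext ?_)
    rw [iswap_of_ne (by rw [iswap_perp h]; exact i.1.2.2), iswap_of_ne h, neg_neg]

theorem iswap_ineg (hN : Odd N) (i : InIdx N) : iswap (ineg hN i) = ineg hN (iswap i) := by
  have e : (ineg hN i).1.perp = -i.1.perp := rfl
  by_cases h : i.1.perp = 0
  · rw [iswap_of_eq h, iswap_of_eq (by rw [e, h, neg_zero])]
  · refine Subtype.ext (Subtype.ext ?_)
    rw [iswap_of_ne (by rw [e]; exact neg_ne_zero.2 h)]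
    change (-i.1.1.1, -i.1.1.2) = ((iswap i).1.1.1, -(iswap i).1.1.2)
    rw [iswap_of_ne h]

theorem mom_mul_mom (L : ℝ) (i : HatIdx N) :
    mom L (i.1.2 1) * mom L (i.1.2 (-1)) = mom L i.par * mom L i.perp := by
  simp only [HatIdx.par, HatIdx.perp]
  rcases Int.units_eq_one_or i.1.1 with hs | hs
  · rw [hs]
  · rw [hs, neg_neg, mul_comm]

/-! ### Splitting sums over all momenta -/

theorem opSum_split {ι : Type} {T : ι → Op N} (hT : LocFin T) (p : ι → Prop) [DecidablePred p]
    [Fintype {i // p i}] :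
    opSum T = ∑ i : {i // p i}, T i.1 + opSum (fun i => if p i then 0 else T i) := by
  have h1 : LocFin fun i => if p i then T i else 0 := fun E => (hT E).subset fun i hi h => hi (by
    simp only
    split_ifs
    · exact h
    · rfl)
  have h2 : LocFin fun i => if p i then 0 else T i := fun E => (hT E).subset fun i hi h => hi (by
    simp only
    split_ifs
    · rfl
    · exact h)
  have h3 : opSum T = opSum fun i => (if p i then T i else 0) + if p i then 0 else T i :=
    opSum_congr fun i => by split_ifs <;> simp
  rw [h3, opSum_add h1 h2]
  congr 1
  rw [opSum_eq_sum (s := Finset.univ.map (Function.Embedding.subtype p)), Finset.sum_map]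
  · exact Finset.sum_congr rfl fun i _ => if_pos i.2
  · intro i hi
    refine if_neg fun hp => hi ?_
    exact Finset.mem_map.2 ⟨⟨i, hp⟩, Finset.mem_univ _, rfl⟩

/-- An oscillator lowers the level by 2|n|, with n the label of p_s, hence kills states of smaller
level; bounded |n| leaves finitely many momenta. -/
theorem locFin_osc (hN : Odd N) (X : Chan) : LocFin fun i : HatIdx N => osc X i := fun E => by
  refine (finite_par_le (level E)).subset fun i hi => ?_
  rw [Set.mem_ofPred_eq]
  by_contra h
  refine hi ?_
  have := osc_graded hN X i _ _ (ket_mem_V E)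
  rwa [V_eq_bot (by have := level_nonneg E; omega), Submodule.mem_bot] at this

theorem LocFin.mul_family {ι : Type} {T : ι → Op N} (hT : LocFin T) (S : ι → Op N) :
    LocFin fun i => S i * T i := fun E => (hT E).subset fun i hi h => hi (by
  simp only [Module.End.mul_apply]
  rw [h, map_zero])

theorem LocFin.ite {ι : Type} {T : ι → Op N} (hT : LocFin T) (p : ι → Prop) [DecidablePred p] :
    LocFin fun i => if p i then 0 else T i := fun E => (hT E).subset fun i hi h => hi (by
  simp only
  split_ifs
  · rfl
  · exact h)

/-- Only finitely many number operators act non-trivially on a given Slater state. -/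
theorem locFin_number (hN : Odd N) (X : Chan) (f : HatIdx N → ℂ) :
    LocFin fun i : HatIdx N => f i • (oscDag X i * osc X i) :=
  ((locFin_osc hN X).mul_family _).smul f

theorem tsum_inBox {f : HatIdx N → ℝ} (hf : ∀ i, ¬ InBox N i.par → f i = 0) :
    Summable f ∧ ∑' i, f i = ∑ i : InIdx N, f i.1 := by
  have h1 : ∀ i ∉ Finset.univ.map (Function.Embedding.subtype fun i : HatIdx N => InBox N i.par),
      f i = 0 := fun i hi => hf i fun hp => hi (Finset.mem_map.2 ⟨⟨i, hp⟩, Finset.mem_univ _, rfl⟩)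
  refine ⟨summable_of_ne_finset_zero h1, ?_⟩
  rw [tsum_eq_sum h1, Finset.sum_map]
  rfl

/-! ### The Hamiltonian of a channel -/

/-- The summands of the Hamiltonian of a channel. -/
def chanTerm (P : LinBos → LinBos → Op N) (L : ℝ) (X : Chan) (g : Coupling) (i : HatIdx N) : Op N :=
  (((2 * Real.pi / L) ^ 2 : ℝ) : ℂ) •
    (normalProd (dag (PiField L N X i.1.1 i.1.2)) (PiField L N X i.1.1 i.1.2) +
      ((mom L (i.1.2 i.1.1) ^ 2 : ℝ) : ℂ) •
        normalProd (dag (PhiField L N X i.1.1 i.1.2)) (PhiField L N X i.1.1 i.1.2) +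
      (chi N i.1.2 : ℂ) •
        (((g.γ0 - g.γ1 : ℝ) : ℂ) • P (dag (PiField L N X i.1.1 i.1.2)) (PiField L N X i.1.1 i.1.2) +
          (((g.γ0 + g.γ1) * mom L (i.1.2 i.1.1) ^ 2 : ℝ) : ℂ) •
            P (dag (PhiField L N X i.1.1 i.1.2)) (PhiField L N X i.1.1 i.1.2) +
          ((g.γ2 * (mom L (i.1.2 1) * mom L (i.1.2 (-1))) : ℝ) : ℂ) •
            P (dag (PhiField L N X i.1.1 i.1.2)) (PhiField L N X (-i.1.1) i.1.2)))

theorem chanHam_eq (P : LinBos → LinBos → Op N) (L vF : ℝ) (X : Chan) (g : Coupling) :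
    chanHam P L vF X g =
      ((vF / 2 : ℝ) : ℂ) • opSum (chanTerm P L X g) + zeroModeHam L vF N X g := rfl

/-- The free energy of the momentum `i` together with its reflection. -/
def freeTerm (hN : Odd N) (L : ℝ) (X : Chan) (i : HatIdx N) : Op N :=
  ((i.absMom L : ℝ) : ℂ) • (oscDag X i * osc X i) +
    ((i.absMom L : ℝ) : ℂ) • (oscDag X (hneg hN i) * osc X (hneg hN i))

section ChanTerm

variable {L : ℝ} (hL : 0 < L) (hN : Odd N) (X : Chan) (g : Coupling)
include hL hN

theorem chanTerm_out (P : LinBos → LinBos → Op N) {i : HatIdx N} (h : ¬ InBox N i.par) :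
    chanTerm P L X g i = freeTerm hN L X i := by
  rw [chanTerm, chi_eq, if_neg h, Complex.ofReal_zero, zero_smul, add_zero, free_term hL hN]
  rfl

/-- Π†Π and p_s²Φ†Φ have equal ordering constants |p_s|/2, and the mixed term has none. Their
coefficients γ_0 - γ_1 and γ_0 + γ_1 add up to 2γ_0, so γ_1 drops out. -/
theorem chanTerm_normal (i : HatIdx N) :
    chanTerm normalProd L X g i = chanTerm plainProd L X g i -
      ((chi N i.1.2 * g.γ0 * i.absMom L : ℝ) : ℂ) • 1 := by
  have h1 := normal_Pi hL hN X i
  have h2 := normal_Phi hL hN X i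
  rw [chanTerm, chanTerm, normal_cross hN]
  simp only [smul_add]
  rw [Complex.ofReal_mul (g.γ0 + g.γ1), mul_smul, mul_smul]
  have e : ∀ (s x c : ℂ) (A A' : Op N) (y : ℂ), s • A = s • A' - y • 1 →
      s • x • c • A = s • x • c • A' - (x * c * y) • 1 := fun s x c A A' y h => by
    calc s • x • c • A = (x * c) • (s • A) := by module
      _ = _ := by rw [h]; module
  rw [e _ _ _ _ _ _ h1, e _ _ _ _ _ _ h2]
  have e2 : ((chi N i.1.2 * g.γ0 * i.absMom L : ℝ) : ℂ) =
      (chi N i.1.2 : ℂ) * ((g.γ0 - g.γ1 : ℝ) : ℂ) * ((i.absMom L / 2 : ℝ) : ℂ) +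
      (chi N i.1.2 : ℂ) * ((g.γ0 + g.γ1 : ℝ) : ℂ) * ((i.absMom L / 2 : ℝ) : ℂ) := by
    push_cast
    ring
  rw [e2, add_smul]
  abel

/-- The coefficient of the coupling of the two directions. -/
def crossCoeff (L : ℝ) (g : Coupling) (i : InIdx N) : ℝ :=
  g.γ2 * (mom L i.1.par * mom L i.1.perp) *
    ((√(2 * i.1.absMom L))⁻¹ * (√(2 * (iswap i).1.absMom L))⁻¹)

theorem chanTerm_in (i : InIdx N) :
    chanTerm plainProd L X g i.1 =
      ((-((1 + g.γ0 - g.γ1) * (i.1.absMom L / 2)) : ℝ) : ℂ) •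
        (momF hN X (ineg hN i).1 * momF hN X i.1) +
      (((1 + g.γ0 + g.γ1) * (i.1.absMom L / 2) : ℝ) : ℂ) •
        (posF hN X (ineg hN i).1 * posF hN X i.1) +
      ((crossCoeff L g i : ℝ) : ℂ) • (posF hN X (ineg hN i).1 * posF hN X (iswap i).1) -
      ((i.1.absMom L : ℝ) : ℂ) • 1 := by
  have hn : (ineg hN i).1 = hneg hN i.1 := rfl
  have h1 := plain_Pi hL hN X i.1
  have h2 := plain_Phi hL hN X i.1
  have h3 : (((2 * Real.pi / L) ^ 2 : ℝ) : ℂ) •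
      ((g.γ2 * (mom L (i.1.1.2 1) * mom L (i.1.1.2 (-1))) : ℝ) : ℂ) •
      (plainProd (dag (PhiField L N X i.1.1.1 i.1.1.2)) (PhiField L N X (-i.1.1.1) i.1.1.2) : Op N) =
      ((crossCoeff L g i : ℝ) : ℂ) • (posF hN X (hneg hN i.1) * posF hN X (iswap i).1) := by
    rw [mom_mul_mom, crossCoeff]
    by_cases h : i.1.perp = 0
    · rw [h]
      simp [mom]
    · have h4 := plain_Phi_Phi hL hN X i.1 (iswap i).1
      rw [iswap_of_ne h] at h4
      rw [smul_comm, h4, smul_smul, ← Complex.ofReal_mul]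
  rw [chanTerm, chi_eq, if_pos i.2, Complex.ofReal_one, one_smul]
  simp only [smul_add]
  rw [normal_Pi hL hN, normal_Phi hL hN, Complex.ofReal_mul (g.γ0 + g.γ1), mul_smul,
    smul_comm _ ((g.γ0 - g.γ1 : ℝ) : ℂ), smul_comm _ ((g.γ0 + g.γ1 : ℝ) : ℂ), h1, h2, h3, hn]
  have e : ∀ (x y z w : ℂ) (A B C : Op N), (-x) • A - x • (1 : Op N) + (x • B - x • (1 : Op N)) +
      (y • (-x) • A + z • x • B + w • C) =
      (-((1 + y) * x)) • A + ((1 + z) * x) • B + w • C - (2 * x) • (1 : Op N) := fun x y z w A B C => by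
    module
  rw [Complex.ofReal_neg, e]
  congr 2
  · congr 1
    · congr 2
      push_cast
      ring
    · congr 1
      push_cast
      ring
  · push_cast
    ring

end ChanTerm

end

end NodalMattis

/-! ### Completing the square in the presence of zero modes. -/

namespace NodalMattis

noncomputable section

variable {N : ℕ}

/-! ### The coupling of oscillators and zero modes -/

/-- The shift of the field `posF` by the zero modes. -/
def yv (L : ℝ) (X : Chan) (g : Coupling) (i : HatIdx N) : Op N :=
  if i.perp = 0 then
    (Complex.I * ((2 * Real.pi / L * (g.γ2 / (1 + g.γ0 + g.γ1)) * (i.sgn : ℤ) / √(i.absMom L) : ℝ) : ℂ)) •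
      Zop L X 1 (-i.1.1) i.par
  else 0

theorem yv_of_ne {L : ℝ} {X : Chan} {g : Coupling} {i : HatIdx N} (h : i.perp ≠ 0) :
    yv L X g i = 0 := if_neg h

theorem yv_hneg (hN : Odd N) (L : ℝ) (X : Chan) (g : Coupling) {i : HatIdx N} (h : i.perp = 0) :
    yv L X g (hneg hN i) =
      (-(Complex.I * ((2 * Real.pi / L * (g.γ2 / (1 + g.γ0 + g.γ1)) * (i.sgn : ℤ) / √(i.absMom L) : ℝ) : ℂ))) •
      Zop L X 1 (-i.1.1) (-i.par) := by
  rw [yv, if_pos (show (hneg hN i).perp = 0 from by rw [HatIdx.perp, hneg_snd, Pi.neg_apply, hneg_fst]; exact neg_eq_zero.2 h), sgn_hneg, absMom_hneg, hneg_par, hneg_fst]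
  congr 1
  push_cast
  ring

/-- The summands of the coupling of oscillators and zero modes. -/
def linTerm (L : ℝ) (X : Chan) (g : Coupling) (i : HatIdx N) : Op N :=
  normalProd (dag (Xi L N X g i.1.1 i.1.2)) (PhiField L N X i.1.1 i.1.2) +
    normalProd (dag (PhiField L N X i.1.1 i.1.2)) (Xi L N X g i.1.1 i.1.2)

theorem linTerm_eq_zero {L : ℝ} {X : Chan} {g : Coupling} {i : HatIdx N}
    (h : ¬ (i.perp = 0 ∧ InBox N i.par)) : linTerm L X g i = 0 := by
  have h1 : Xi L N X g i.1.1 i.1.2 = 0 := by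
    rw [Xi]
    split_ifs with h2
    · rw [chi_eq, if_neg fun h3 => h ⟨h2, h3⟩, Complex.ofReal_zero, mul_zero, zero_smul]
    · rfl
  rw [linTerm, h1, dag_zero, normalProd_zero, zero_add, normalProd]
  simp [op_zero]

/-- A zero mode has p_s = 0, which the ordering convention moves to the right. -/
theorem normalProd_dag_QHat (L : ℝ) (X : Chan) (r s : ℤˣ) (n : ℤ) (C : LinBos) :
    (normalProd (dag (QHat L N X r s n)) C : Op N) = op C * op (dag (QHat L N X r s n)) := by
  have h : ∀ r' α, (normalProd (dag (zeroModeHat L N r' s α n)) C : Op N) =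
      op C * op (dag (zeroModeHat L N r' s α n)) := fun r' α => by
    rw [zeroModeHat, dag_smul, dag_gen, normalProd_smul, normalProd_gen, op_smul, op_gen,
      Pi.neg_apply, transverse_self, neg_zero, mul_zero, if_neg (lt_irrefl _), mul_smul_comm]
  simp only [QHat, dag_smul, dag_sum, dag_add, normalProd_smul, normalProd_sum, normalProd_add, h,
    op_smul, op_sum, op_add, mul_add, Finset.mul_sum, mul_smul_comm]

theorem sqrt_half {x : ℝ} (hx : 0 < x) : 1 / √2 * (√(2 * x))⁻¹ * x = x / 2 / √x := by
  have h1 : √2 * √2 = 2 := Real.mul_self_sqrt (by norm_num)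
  have h2 : 0 < √2 := by positivity
  have h3 : 0 < √x := by positivity
  rw [Real.sqrt_mul (by norm_num)]
  field_simp
  nlinarith

section Linear

variable {L : ℝ} (hL : 0 < L) (hN : Odd N) (X : Chan) {g : Coupling} (hg : 1 + g.γ0 + g.γ1 ≠ 0)
include hL hg

/-- The shift `yv` is chosen such that the linear coupling is the cross term in the square of φ - y,
whose coefficient (1 + γ_0 + γ_1)|p_s|/2 is the one that φ already has. -/
theorem linTerm_in {i : HatIdx N} (h : InBox N i.par) :
    (((2 * Real.pi / L) ^ 2 : ℝ) : ℂ) • linTerm L X g i =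
      ((-((1 + g.γ0 + g.γ1) * (i.absMom L / 2)) : ℝ) : ℂ) •
        (posF hN X (hneg hN i) * yv L X g i + yv L X g (hneg hN i) * posF hN X i) := by
  by_cases h0 : i.perp = 0
  swap
  · have h1 : (hneg hN i).perp ≠ 0 := by
      rw [HatIdx.perp, hneg_snd, Pi.neg_apply, hneg_fst]
      exact neg_ne_zero.2 h0
    rw [linTerm_eq_zero fun h' => h0 h'.1, yv_of_ne h0, yv_of_ne h1, mul_zero, zero_mul, add_zero,
      smul_zero, smul_zero]
  have hk := absMom_pos hL i
  have hXi : Xi L N X g i.1.1 i.1.2 = (-(1 / (√2 : ℂ)) * (g.γ2 : ℂ) * Complex.I *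
      (mom L i.par : ℂ)) • QHat L N X 1 (-i.1.1) i.par := by
    rw [Xi, if_pos h0, chi_eq, if_pos h, Complex.ofReal_one, mul_one]
  have hZ : ∀ n, Commute (op (PhiField L N X i.1.1 i.1.2) : Op N) (Zop L X 1 (-i.1.1) n) := fun n => by
    rw [PhiField, op_smul, op_add]
    exact (((Zop_commute_J hN L X X 1 1 _ _ n _).symm).add_left
      (Zop_commute_J hN L X X 1 (-1) _ _ n _).symm).smul_left _
  have hZ2 : ∀ n, Commute (posF hN X i) (Zop L X 1 (-i.1.1) n) := fun n =>
    (Zop_commute_osc hN L X X 1 _ n i).symm.add_left (Zop_commute_oscDag hN L X X 1 _ n _).symm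
  have hJZ : ∀ (r : ℤˣ), (normalProd (J X r i.1.1 (-i.1.2)) (QHat L N X 1 (-i.1.1) i.par) : Op N) =
      op (J X r i.1.1 (-i.1.2)) * Zop L X 1 (-i.1.1) i.par := fun r => by
    rw [normalProd_J]
    split_ifs
    · rfl
    · exact Zop_commute_J hN L X X 1 r _ _ _ _
  have hPhi : (normalProd (dag (PhiField L N X i.1.1 i.1.2)) (QHat L N X 1 (-i.1.1) i.par) : Op N) =
      op (dag (PhiField L N X i.1.1 i.1.2)) * Zop L X 1 (-i.1.1) i.par := by
    rw [PhiField, dag_smul, dag_add, dag_J, dag_J, normalProd_smul, normalProd_add, hJZ, hJZ, op_smul,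
      op_add, smul_mul_assoc, add_mul]
  have hright : ∀ (A B : LinBos) (z : ℂ), (normalProd A (z • B) : Op N) = z • normalProd A B := by
    intro A B z
    rw [normalProd, normalProd, Finsupp.smul_sum]
    refine Finsupp.sum_congr fun j _ => ?_
    rw [op_smul, smul_comm z]
    congr 1
    split_ifs
    · rw [mul_smul_comm]
    · rw [smul_mul_assoc]
  have hcoef : (2 * Real.pi / L) * (1 / √2 * g.γ2 * mom L i.par) * (√(2 * i.absMom L))⁻¹ =
      (1 + g.γ0 + g.γ1) * (i.absMom L / 2) *
        (2 * Real.pi / L * (g.γ2 / (1 + g.γ0 + g.γ1)) * (i.sgn : ℤ) / √(i.absMom L)) := by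
    rw [mom_par hL]
    have e := sqrt_half hk
    calc _ = 2 * Real.pi / L * g.γ2 * (i.sgn : ℤ) * (1 / √2 * (√(2 * i.absMom L))⁻¹ * i.absMom L) := by
          ring
      _ = _ := by
          rw [e]
          field_simp
  have hcoef' := congrArg (fun y : ℝ => (y : ℂ)) hcoef
  rw [linTerm, hXi, dag_smul, normalProd_smul, normalProd_dag_QHat, op_dag_QHat hN, hright, hPhi,
    (hZ _).eq, yv, if_pos h0, yv_hneg hN L X g h0, smul_add, smul_add]
  have e1 : (((2 * Real.pi / L) ^ 2 : ℝ) : ℂ) •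
      (starRingEnd ℂ) (-(1 / (√2 : ℂ)) * (g.γ2 : ℂ) * Complex.I * (mom L i.par : ℂ)) •
      (Zop L X 1 (-i.1.1) (-i.par) * op (PhiField L N X i.1.1 i.1.2) : Op N) =
      (((2 * Real.pi / L : ℝ) : ℂ) * (starRingEnd ℂ)
        (-(1 / (√2 : ℂ)) * (g.γ2 : ℂ) * Complex.I * (mom L i.par : ℂ)) *
        (((√(2 * i.absMom L))⁻¹ : ℝ) : ℂ)) • (Zop L X 1 (-i.1.1) (-i.par) * posF hN X i) := by
    rw [mul_smul _ (((√(2 * i.absMom L))⁻¹ : ℝ) : ℂ), ← mul_smul_comm (((√(2 * i.absMom L))⁻¹ : ℝ) : ℂ), ← op_Phi hL hN, mul_smul_comm,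
      smul_smul, smul_smul]
    congr 1
    push_cast
    ring
  have e2 : (((2 * Real.pi / L) ^ 2 : ℝ) : ℂ) •
      (-(1 / (√2 : ℂ)) * (g.γ2 : ℂ) * Complex.I * (mom L i.par : ℂ)) •
      (op (dag (PhiField L N X i.1.1 i.1.2)) * Zop L X 1 (-i.1.1) i.par : Op N) =
      (((2 * Real.pi / L : ℝ) : ℂ) *
        (-(1 / (√2 : ℂ)) * (g.γ2 : ℂ) * Complex.I * (mom L i.par : ℂ)) *
        (((√(2 * i.absMom L))⁻¹ : ℝ) : ℂ)) • (posF hN X (hneg hN i) * Zop L X 1 (-i.1.1) i.par) := by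
    rw [mul_smul _ (((√(2 * i.absMom L))⁻¹ : ℝ) : ℂ), ← smul_mul_assoc (((√(2 * i.absMom L))⁻¹ : ℝ) : ℂ), ← mul_dag_Phi hL hN,
      smul_mul_assoc, smul_smul, smul_smul]
    congr 1
    push_cast
    ring
  rw [e1, e2, mul_smul_comm, smul_mul_assoc, smul_smul, smul_smul, add_comm]
  congr 2
  · push_cast at hcoef' ⊢
    linear_combination (-Complex.I) * hcoef'
  · simp only [map_mul, map_neg, map_div₀, map_one, Complex.conj_I, Complex.conj_ofReal]
    push_cast at hcoef' ⊢
    linear_combination Complex.I * hcoef'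

end Linear

/-! ### Zero mode part -/

/-- `∑_n Q̂(n)† Q̂(n)`. -/
def Zsum (L : ℝ) (X : Chan) (r s : ℤˣ) : Op N := ∑ n ∈ box N, Zop L X r s (-n) * Zop L X r s n

theorem zero_mem_box (hN : Odd N) : (0 : ℤ) ∈ box N := mem_box.2 (by
  have := hN.pos
  constructor <;> omega)

theorem Zsum_eq (hN : Odd N) (L : ℝ) (X : Chan) (r s : ℤˣ) : (Zsum L X r s : Op N) =
    Zop L X r s 0 * Zop L X r s 0 + ∑ n ∈ (box N).erase 0, Zop L X r s (-n) * Zop L X r s n := by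
  rw [Zsum, ← Finset.add_sum_erase _ _ (zero_mem_box hN), neg_zero]

/-- In Fourier space only the modes n ≠ 0 couple to oscillators and acquire the factor A. The
additional ã/L terms restore the full coefficient at n = 0 and supply the coupling of the two
directions there. -/
theorem zeroModeDiag_eq {L : ℝ} (hL : 0 < L) (hN : Odd N) (X : Chan) {g : Coupling}
    (hg : 1 + g.γ0 + g.γ1 ≠ 0) :
    (zeroModeDiag L N X g : Op N) = ((2 * Real.pi / L : ℝ) : ℂ) •
      (∑ s, (((1 + g.γ0 + g.γ1 : ℝ) : ℂ) •
          (∑ n ∈ (box N).erase 0, (g.A : ℂ) • (Zop L X 1 s (-n) * Zop L X 1 s n) +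
            Zop L X 1 s 0 * Zop L X 1 s 0) +
        ((1 + g.γ0 - g.γ1 : ℝ) : ℂ) • Zsum L X (-1) s) +
      (2 * g.γ2 : ℂ) • (Zop L X 1 1 0 * Zop L X 1 (-1) 0)) := by
  have hN' : (0 : ℝ) < N := by exact_mod_cast hN.pos
  have hp := Real.pi_pos
  have hk : aTilde L N / L * ((√(2 * Real.pi * aTilde L N) / L * N) *
      (√(2 * Real.pi * aTilde L N) / L * N)) = 2 * Real.pi / L := by
    have : 0 ≤ 2 * Real.pi * aTilde L N := by rw [aTilde]; positivity
    calc _ = aTilde L N / L * (√(2 * Real.pi * aTilde L N) * √(2 * Real.pi * aTilde L N)) *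
          (N / L) ^ 2 := by ring
      _ = _ := by rw [Real.mul_self_sqrt this, aTilde]; field_simp
  have hA : (1 + g.γ0 + g.γ1) * g.A = (1 + g.γ0 + g.γ1) - g.γ2 ^ 2 / (1 + g.γ0 + g.γ1) := by
    rw [Coupling.A]
    field_simp
  have hk' := congrArg (fun y : ℝ => (y : ℂ)) hk
  have hA' := congrArg (fun y : ℝ => (y : ℂ)) hA
  have hcomm : (Zop L X 1 (-1) 0 * Zop L X 1 1 0 : Op N) = Zop L X 1 1 0 * Zop L X 1 (-1) 0 :=
    Zop_commute hN L X X 1 1 (-1) 1 0 0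
  rw [zeroModeDiag]
  simp only [Finset.sum_add_distrib, ← Finset.smul_sum, sum_Q_sq hL hN, sum_Q hL hN, sq (_ • _),
    smul_mul_smul_comm]
  simp only [← Zsum.eq_1, Zsum_eq hN L X 1, sum_sign, neg_neg, hcomm]
  set S1 : Op N := ∑ n ∈ (box N).erase 0, Zop L X 1 1 (-n) * Zop L X 1 1 n
  set S2 : Op N := ∑ n ∈ (box N).erase 0, Zop L X 1 (-1) (-n) * Zop L X 1 (-1) n
  push_cast at hA' hk' ⊢
  match_scalars
  · linear_combination (2 * Real.pi / L : ℂ) * hA' +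
      ((g.γ2 : ℂ) ^ 2 / (1 + g.γ0 + g.γ1)) * hk'
  · ring
  · linear_combination (2 * Real.pi / L : ℂ) * hA' +
      ((g.γ2 : ℂ) ^ 2 / (1 + g.γ0 + g.γ1)) * hk'
  · ring
  · ring
  · ring
  · linear_combination (2 * g.γ2 : ℂ) * hk'

end

end NodalMattis

/-! ### Assembling the Hamiltonian of one channel. -/

namespace NodalMattis

noncomputable section

variable {N : ℕ}

theorem LocFin.mono_eq {ι : Type} {T S : ι → Op N} (hT : LocFin T) (h : ∀ i, T i = S i) : LocFin S := by
  rwa [← funext h]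

theorem sum_axis (hN : Odd N) (F : ℤˣ → ℤ → Op N) :
    ∑ i : InIdx N, (if i.1.perp = 0 then F i.1.1.1 i.1.par else 0) =
      ∑ s, ∑ n ∈ (box N).erase 0, F s n := by
  rw [← Finset.sum_filter, ← Finset.sum_product']
  refine Finset.sum_bij (fun i _ => (i.1.1.1, i.1.par)) (fun i _ => ?_) (fun i hi j hj h => ?_)
    (fun x hx => ?_) fun i _ => rfl
  · simp only [Finset.mem_product, Finset.mem_univ, true_and, Finset.mem_erase]
    exact ⟨i.1.2.2, mem_box.2 i.2⟩
  · simp only [Finset.mem_filter, Finset.mem_univ, true_and] at hi hj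
    simp only [Prod.mk.injEq] at h
    refine Subtype.ext (HatIdx.ext_of h.1 h.2 ?_)
    rw [← HatIdx.perp, hi, ← HatIdx.perp, hj]
  · obtain ⟨s, n⟩ := x
    simp only [Finset.mem_product, Finset.mem_univ, true_and, Finset.mem_erase] at hx
    have hs : -s ≠ s := by rcases Int.units_eq_one_or s with h | h <;> rw [h] <;> decide
    have h0 := mem_box.1 (zero_mem_box hN)
    let p : BMom := fun t => if t = s then n else 0
    have h1 : p s = n := if_pos rfl
    have h2 : p (-s) = 0 := if_neg hs
    have h3 : InBox N (p (-s)) := by rw [h2]; exact h0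
    have h4 : p s ≠ 0 := by rw [h1]; exact hx.1
    have h5 : InBox N (p s) := by rw [h1]; exact mem_box.1 hx.2
    refine ⟨⟨⟨(s, p), h3, h4⟩, h5⟩, ?_, ?_⟩
    · simp only [Finset.mem_filter, Finset.mem_univ, true_and]
      exact h2
    · simp only [HatIdx.par, h1]

section Channel

variable {L : ℝ} (hL : 0 < L) (hN : Odd N) (X : Chan) {g : Coupling} (hg : 1 + g.γ0 + g.γ1 ≠ 0)
  (vF : ℝ)
include hL hN hg

/-- The shift at direction s contains the zero mode of direction -s, whence the exchange of
directions. The result is the energy by which completing the square lowers the nonzero Fourier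
modes. -/
theorem sum_yv_mul :
    ∑ i : InIdx N, ((vF / 4 * (1 + g.γ0 + g.γ1) * i.1.absMom L : ℝ) : ℂ) •
        (yv L X g (ineg hN i).1 * yv L X g i.1) =
      ((vF / 4 * (2 * Real.pi / L) ^ 2 * (g.γ2 ^ 2 / (1 + g.γ0 + g.γ1)) : ℝ) : ℂ) •
        ∑ s, ∑ n ∈ (box N).erase 0, Zop L X 1 s (-n) * Zop L X 1 s n := by
  rw [← Equiv.sum_comp (Equiv.neg ℤˣ), Finset.smul_sum]
  simp only [Finset.smul_sum, Equiv.neg_apply]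
  rw [← sum_axis hN fun s n => _ • (Zop L X 1 (-s) (-n) * Zop L X 1 (-s) n)]
  refine Finset.sum_congr rfl fun i _ => ?_
  split_ifs with h
  · have hk := absMom_pos hL i.1
    have h1 : (((i.1.sgn : ℤ) : ℝ)) * ((i.1.sgn : ℤ) : ℝ) = 1 := by
      have := congrArg Units.val (Int.units_mul_self i.1.sgn)
      rw [Units.val_mul, Units.val_one] at this
      exact_mod_cast this
    have h2 : √(i.1.absMom L) * √(i.1.absMom L) = i.1.absMom L := Real.mul_self_sqrt hk.le
    have h3 : 0 < √(i.1.absMom L) := Real.sqrt_pos.2 hk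
    rw [show (ineg hN i).1 = hneg hN i.1 from rfl, yv_hneg hN L X g h, yv, if_pos h,
      smul_mul_smul_comm, smul_smul]
    congr 1
    have e : vF / 4 * (1 + g.γ0 + g.γ1) * i.1.absMom L *
        ((2 * Real.pi / L * (g.γ2 / (1 + g.γ0 + g.γ1)) * (i.1.sgn : ℤ) / √(i.1.absMom L)) *
        (2 * Real.pi / L * (g.γ2 / (1 + g.γ0 + g.γ1)) * (i.1.sgn : ℤ) / √(i.1.absMom L))) =
        vF / 4 * (2 * Real.pi / L) ^ 2 * (g.γ2 ^ 2 / (1 + g.γ0 + g.γ1)) := by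
      rw [div_mul_div_comm, h2]
      field_simp
      linear_combination (vF * g.γ2 ^ 2) * h1
    rw [← e]
    push_cast
    linear_combination (-((vF / 4 * (1 + g.γ0 + g.γ1) * i.1.absMom L : ℂ) *
      ((2 * Real.pi / L * (g.γ2 / (1 + g.γ0 + g.γ1)) * (i.1.sgn : ℤ) / (√(i.1.absMom L) : ℝ)) *
        (2 * Real.pi / L * (g.γ2 / (1 + g.γ0 + g.γ1)) * (i.1.sgn : ℤ) / (√(i.1.absMom L) : ℝ))))) *
        Complex.I_mul_I
  · rw [yv_of_ne h, mul_zero, smul_zero]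

/-- Since (1 + γ_0 + γ_1)A is (1 + γ_0 + γ_1) minus γ_2²/(1 + γ_0 + γ_1), splitting off the squares
of the shifts leaves exactly the zero mode energy in diagonal form. -/
theorem zeroModeHam_eq :
    zeroModeHam L vF N X g =
      ∑ i : InIdx N, ((vF / 2 : ℝ) : ℂ) • ((((2 * Real.pi / L) ^ 2 : ℝ) : ℂ) • linTerm L X g i.1) +
      ((vF * Real.pi / (2 * L) : ℝ) : ℂ) • zeroModeDiag L N X g +
      ∑ i : InIdx N, ((vF / 4 * (1 + g.γ0 + g.γ1) * i.1.absMom L : ℝ) : ℂ) •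
        (yv L X g (ineg hN i).1 * yv L X g i.1) := by
  have hlin : (opSum fun i : HatIdx N =>
      normalProd (dag (Xi L N X g i.1.1 i.1.2)) (PhiField L N X i.1.1 i.1.2) +
        normalProd (dag (PhiField L N X i.1.1 i.1.2)) (Xi L N X g i.1.1 i.1.2)) =
      ∑ i : InIdx N, linTerm L X g i.1 := by
    change opSum (linTerm L X g) = _
    rw [opSum_eq_sum (s := Finset.univ.map (Function.Embedding.subtype fun i : HatIdx N =>
      InBox N i.par)), Finset.sum_map]
    · rfl
    · intro i hi
      refine linTerm_eq_zero fun hp => hi ?_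
      exact Finset.mem_map.2 ⟨⟨i, hp.2⟩, Finset.mem_univ _, rfl⟩
  have hA : (1 + g.γ0 + g.γ1) * g.A = (1 + g.γ0 + g.γ1) - g.γ2 ^ 2 / (1 + g.γ0 + g.γ1) := by
    rw [Coupling.A]
    field_simp
  have hA' := congrArg (fun y : ℝ => (y : ℂ)) hA
  rw [zeroModeHam, hlin, sum_yv_mul hL hN X hg, zeroModeDiag_eq hL hN X hg]
  simp only [plainProd, op_dag_QHat hN, ← Zop.eq_1, ← Finset.smul_sum, ← Zsum.eq_1, sum_sign,
    Zsum_eq hN L X 1]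
  set S1 : Op N := ∑ n ∈ (box N).erase 0, Zop L X 1 1 (-n) * Zop L X 1 1 n
  set S2 : Op N := ∑ n ∈ (box N).erase 0, Zop L X 1 (-1) (-n) * Zop L X 1 (-1) n
  set Λ : Op N := ∑ i : InIdx N, linTerm L X g i.1
  have hLc : (L : ℂ) ≠ 0 := by exact_mod_cast hL.ne'
  push_cast at hA' ⊢
  simp only [one_mul, neg_mul, ← sub_eq_add_neg]
  have e : (vF * Real.pi / (2 * L) : ℂ) = vF / 4 * (2 * Real.pi / L) := by field_simp; ring
  rw [e]
  match_scalars
  · ring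
  · ring
  · linear_combination (-(vF / 4 * (2 * Real.pi / L) ^ 2 : ℂ)) * hA'
  · ring
  · linear_combination (-(vF / 4 * (2 * Real.pi / L) ^ 2 : ℂ)) * hA'
  · ring
  · ring
  · ring

/-- The oscillators without interaction. -/
def numberOut (L vF : ℝ) (X : Chan) : Op N :=
  opSum fun i : HatIdx N => if InBox N i.par then 0 else
    ((vF * i.absMom L : ℝ) : ℂ) • (oscDag X i * osc X i)

omit hg in
theorem locFin_chanTerm : LocFin (chanTerm (N := N) plainProd L X g) := by
  have hf := locFin_number hN X fun i => ((i.absMom L : ℝ) : ℂ)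
  have hfree : LocFin (freeTerm hN L X) := by
    refine (hf.add (hf.comp (hneg hN).injective)).mono_eq fun i => ?_
    rw [freeTerm, absMom_hneg]
  refine (hfree.add (LocFin.of_support finite_inBox
    (T := fun i => chanTerm plainProd L X g i - freeTerm hN L X i) fun i hi => ?_)).mono_eq fun i => ?_
  · rw [chanTerm_out hL hN X g _ hi, sub_self]
  · rw [add_sub_cancel]

-- Each free term contains p together with -p, so the sum counts every oscillator twice; this turns
-- vF/2 into vF.
omit hg in
theorem opSum_chanTerm :
    ((vF / 2 : ℝ) : ℂ) • opSum (chanTerm (N := N) plainProd L X g) =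
      ∑ i : InIdx N, ((vF / 2 : ℝ) : ℂ) • chanTerm plainProd L X g i.1 + numberOut L vF X := by
  have hf := locFin_number hN X fun i => ((i.absMom L : ℝ) : ℂ)
  have hT := locFin_chanTerm hL hN X (g := g)
  have hout : (opSum fun i => if InBox N i.par then 0 else chanTerm (N := N) plainProd L X g i) =
      (2 : ℂ) • opSum fun i : HatIdx N => if InBox N i.par then 0 else
        ((i.absMom L : ℝ) : ℂ) • (oscDag X i * osc X i) := by
    have e : ∀ i : HatIdx N, (if InBox N i.par then 0 else chanTerm (N := N) plainProd L X g i) =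
        (if InBox N i.par then 0 else ((i.absMom L : ℝ) : ℂ) • (oscDag X i * osc X i)) +
        (if InBox N (hneg hN i).par then 0 else
          (((hneg hN i).absMom L : ℝ) : ℂ) • (oscDag X (hneg hN i) * osc X (hneg hN i))) := fun i => by
      by_cases h : InBox N i.par
      · rw [if_pos h, if_pos h, if_pos (show InBox N (hneg hN i).par from h.neg hN), add_zero]
      · have h' : ¬ InBox N (hneg hN i).par := fun h' => h (by simpa [hneg_par] using h'.neg hN)
        rw [if_neg h, if_neg h, if_neg h', chanTerm_out hL hN X g _ h, freeTerm, absMom_hneg]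
    have hl := hf.ite fun i => InBox N i.par
    rw [opSum_congr e, opSum_add hl (hl.comp (hneg hN).injective),
      opSum_comp_equiv (hneg hN) fun i : HatIdx N => if InBox N i.par then 0 else
        ((i.absMom L : ℝ) : ℂ) • (oscDag X i * osc X i), two_smul]
  rw [opSum_split hT fun i => InBox N i.par, smul_add, Finset.smul_sum, hout, smul_smul, numberOut,
    smul_opSum (hf.ite fun i => InBox N i.par)]
  congr 1
  refine opSum_congr fun i => ?_
  split_ifs
  · rw [smul_zero]
  · rw [smul_smul]
    congr 1
    push_cast
    ring

theorem chanHam_plain :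
    chanHam plainProd L vF X g =
      numberOut L vF X + ((vF * Real.pi / (2 * L) : ℝ) : ℂ) • zeroModeDiag L N X g +
      ((-(vF / 2 * ∑ i : InIdx N, i.1.absMom L) : ℝ) : ℂ) • 1 +
      (∑ i : InIdx N, ((-(vF / 4 * (1 + g.γ0 - g.γ1) * i.1.absMom L) : ℝ) : ℂ) •
        (momF hN X (ineg hN i).1 * momF hN X i.1) +
      (∑ i : InIdx N, ((vF / 4 * (1 + g.γ0 + g.γ1) * i.1.absMom L : ℝ) : ℂ) •
        ((posF hN X (ineg hN i).1 - yv L X g (ineg hN i).1) * (posF hN X i.1 - yv L X g i.1)) +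
      ∑ i : InIdx N, ((vF / 2 * crossCoeff L g i : ℝ) : ℂ) •
        ((posF hN X (ineg hN i).1 - yv L X g (ineg hN i).1) *
          (posF hN X (iswap i).1 - yv L X g (iswap i).1)))) := by
  have hconst : ((-(vF / 2 * ∑ i : InIdx N, i.1.absMom L) : ℝ) : ℂ) • (1 : Op N) =
      ∑ i : InIdx N, ((-(vF / 2 * i.1.absMom L) : ℝ) : ℂ) • (1 : Op N) := by
    rw [← Finset.sum_smul, ← Complex.ofReal_sum, Finset.sum_neg_distrib, Finset.mul_sum]
  have hsum : ∀ i : InIdx N, ((vF / 2 : ℝ) : ℂ) • chanTerm plainProd L X g i.1 +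
      (((vF / 2 : ℝ) : ℂ) • ((((2 * Real.pi / L) ^ 2 : ℝ) : ℂ) • linTerm L X g i.1) +
        ((vF / 4 * (1 + g.γ0 + g.γ1) * i.1.absMom L : ℝ) : ℂ) •
        (yv L X g (ineg hN i).1 * yv L X g i.1)) =
      ((-(vF / 2 * i.1.absMom L) : ℝ) : ℂ) • (1 : Op N) +
      (((-(vF / 4 * (1 + g.γ0 - g.γ1) * i.1.absMom L) : ℝ) : ℂ) •
        (momF hN X (ineg hN i).1 * momF hN X i.1) +
      (((vF / 4 * (1 + g.γ0 + g.γ1) * i.1.absMom L : ℝ) : ℂ) •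
        ((posF hN X (ineg hN i).1 - yv L X g (ineg hN i).1) * (posF hN X i.1 - yv L X g i.1)) +
      ((vF / 2 * crossCoeff L g i : ℝ) : ℂ) •
        ((posF hN X (ineg hN i).1 - yv L X g (ineg hN i).1) *
          (posF hN X (iswap i).1 - yv L X g (iswap i).1)))) := fun i => by
    -- On an axis the coefficient vanishes and off the axes both shifts do, so shifting the fields
    -- does not affect the mixed term.
    have hcross : ((crossCoeff L g i : ℝ) : ℂ) •
        ((posF hN X (ineg hN i).1 - yv L X g (ineg hN i).1) *
          (posF hN X (iswap i).1 - yv L X g (iswap i).1)) =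
        ((crossCoeff L g i : ℝ) : ℂ) • (posF hN X (ineg hN i).1 * posF hN X (iswap i).1) := by
      by_cases h : i.1.perp = 0
      · rw [crossCoeff, h]
        simp [mom]
      · rw [yv_of_ne (i := (ineg hN i).1) (neg_ne_zero.2 h),
          yv_of_ne (i := (iswap i).1) (by rw [iswap_perp h]; exact i.1.2.2), sub_zero, sub_zero]
    rw [Complex.ofReal_mul (vF / 2) (crossCoeff L g i), mul_smul, hcross, chanTerm_in hL hN,
      linTerm_in hL hN X hg i.2, show hneg hN i.1 = (ineg hN i).1 from rfl,
      sub_mul (posF hN X (ineg hN i).1), mul_sub (posF hN X (ineg hN i).1),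
      mul_sub (yv L X g (ineg hN i).1)]
    generalize posF hN X (ineg hN i).1 * yv L X g i.1 = B1
    generalize yv L X g (ineg hN i).1 * posF hN X i.1 = B2
    generalize yv L X g (ineg hN i).1 * yv L X g i.1 = B3
    generalize posF hN X (ineg hN i).1 * posF hN X i.1 = B4
    generalize posF hN X (ineg hN i).1 * posF hN X (iswap i).1 = B5
    generalize momF hN X (ineg hN i).1 * momF hN X i.1 = B6
    push_cast
    module
  rw [chanHam_eq, opSum_chanTerm hL hN, zeroModeHam_eq hL hN X hg, hconst]
  have e := Finset.sum_congr (s₁ := (Finset.univ : Finset (InIdx N))) rfl fun i _ => hsum i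
  simp only [Finset.sum_add_distrib] at e
  generalize (∑ i : InIdx N, ((vF / 2 : ℝ) : ℂ) • chanTerm plainProd L X g i.1 : Op N) = A1 at e ⊢
  rw [add_assoc (numberOut L vF X + _), ← e]
  abel

end Channel

end

end NodalMattis

namespace NodalMattis

noncomputable section

variable {N : ℕ}

/-! ### The dispersion relation -/

section Dispersion

variable {L vF : ℝ} {g : Coupling}

theorem mom_ne_zero (hL : 0 < L) {n : ℤ} (hn : n ≠ 0) : mom L n ≠ 0 :=
  mul_ne_zero (by positivity) (by exact_mod_cast hn)

theorem mom_neg (L : ℝ) (n : ℤ) : mom L (-n) = -mom L n := by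
  rw [mom, mom, Int.cast_neg, mul_neg]

theorem chi_zero_or_one (p : BMom) : chi N p = 0 ∨ chi N p = 1 := by
  rw [chi]
  split_ifs
  · exact Or.inr rfl
  · exact Or.inl rfl

theorem Coupling.A_mem (h2 : |g.γ2| < |1 + g.γ0 + g.γ1|) : 0 < g.A ∧ g.A ≤ 1 := by
  have h0 : 0 < |1 + g.γ0 + g.γ1| := (abs_nonneg _).trans_lt h2
  have h : |g.γ2 / (1 + g.γ0 + g.γ1)| < |(1 : ℝ)| := by
    rw [abs_div, abs_one, div_lt_one h0]
    exact h2
  have h3 := sq_lt_sq.2 h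
  have h4 := sq_nonneg (g.γ2 / (1 + g.γ0 + g.γ1))
  rw [Coupling.A]
  constructor <;> linarith

/-- The discriminant is (x² - y²)² + 4(1 - A)x²y², nonnegative as A ≤ 1. It is smaller than (x² +
y²)² as A > 0, which keeps the lower branch positive. -/
theorem radicand_pos {A x y : ℝ} (hA : 0 < A) (hA1 : A ≤ 1) (hx : x ≠ 0) (hy : y ≠ 0) (s : ℤˣ) :
    0 ≤ (x ^ 2 + y ^ 2) ^ 2 - A * (2 * (x * y)) ^ 2 ∧
      0 < 1 / 2 * ((x ^ 2 + y ^ 2) + (s : ℤ) * √((x ^ 2 + y ^ 2) ^ 2 - A * (2 * (x * y)) ^ 2)) := by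
  have hx2 : 0 < x ^ 2 := by positivity
  have hy2 : 0 < y ^ 2 := by positivity
  have h1 : 0 < x ^ 2 * y ^ 2 := mul_pos hx2 hy2
  have h0 : 0 ≤ (x ^ 2 + y ^ 2) ^ 2 - A * (2 * (x * y)) ^ 2 := by
    have e : (x ^ 2 + y ^ 2) ^ 2 - A * (2 * (x * y)) ^ 2 =
      (x ^ 2 - y ^ 2) ^ 2 + 4 * ((1 - A) * (x ^ 2 * y ^ 2)) := by ring
    rw [e]
    have := mul_nonneg (sub_nonneg.2 hA1) h1.le
    positivity
  refine ⟨h0, ?_⟩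
  have h2 : √((x ^ 2 + y ^ 2) ^ 2 - A * (2 * (x * y)) ^ 2) < x ^ 2 + y ^ 2 := by
    rw [Real.sqrt_lt h0 (by positivity)]
    have : 0 < A * (2 * (x * y)) ^ 2 := mul_pos hA (by rw [show (2 * (x * y)) ^ 2 = 4 * (x ^ 2 * y ^ 2) by ring]; positivity)
    linarith
  have h3 := Real.sqrt_nonneg ((x ^ 2 + y ^ 2) ^ 2 - A * (2 * (x * y)) ^ 2)
  rcases Int.units_eq_one_or s with h | h <;> rw [h]
  · rw [Units.val_one, Int.cast_one, one_mul]
    linarith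
  · rw [Units.val_neg, Units.val_one, Int.cast_neg, Int.cast_one, neg_mul, one_mul]
    linarith

theorem omega_pos (hL : 0 < L) (hv : 0 < vF) (h1 : |g.γ1| < |1 + g.γ0|)
    (h2 : |g.γ2| < |1 + g.γ0 + g.γ1|) (i : HatIdx N) : 0 < omega L vF N g i.1.1 i.1.2 := by
  have h3 := sq_lt_sq.2 h1
  simp only [omega]
  split_ifs with h
  · have hx : mom L (i.1.2 1) ≠ 0 := (mul_ne_zero_iff.1 (mul_ne_zero_iff.1 h).2).1
    have hy : mom L (i.1.2 (-1)) ≠ 0 := (mul_ne_zero_iff.1 (mul_ne_zero_iff.1 h).2).2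
    obtain ⟨hA, hA1⟩ := Coupling.A_mem h2
    rw [Coupling.vTilde]
    exact mul_pos (mul_pos hv (Real.sqrt_pos.2 (by linarith)))
      (Real.sqrt_pos.2 (radicand_pos hA hA1 hx hy _).2)
  · refine mul_pos (mul_pos hv (Real.sqrt_pos.2 ?_)) (abs_pos.2 (mom_ne_zero hL i.2.2))
    rcases chi_zero_or_one (N := N) i.1.2 with h | h <;> rw [h]
    · norm_num
    · rw [mul_one, mul_one]
      linarith

theorem omega_of_chi {s : ℤˣ} {p : BMom} (h : chi N p = 0) :
    omega L vF N g s p = vF * |mom L (p s)| := by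
  simp [omega, h]

theorem omega_neg (s : ℤˣ) {p : BMom} (h : chi N (-p) = chi N p) :
    omega L vF N g s (-p) = omega L vF N g s p := by
  simp only [omega, h, Pi.neg_apply, mom_neg, neg_mul_neg, neg_sq, abs_neg]

/-- The rotation that decouples the two directions. -/
theorem exists_mode_angle (h1 : |g.γ1| < |1 + g.γ0|) (h2 : |g.γ2| < |1 + g.γ0 + g.γ1|)
    {p : BMom} (hp : chi N p = 1) :
    ∃ c s : ℝ, c ^ 2 + s ^ 2 = 1 ∧ (p 1 * p (-1) = 0 → s = 0) ∧ ∀ t : ℤˣ,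
      vF ^ 2 * ((1 + g.γ0) ^ 2 - g.γ1 ^ 2) * mom L (p t) ^ 2 =
        omega L vF N g t p ^ 2 * c ^ 2 + omega L vF N g (-t) p ^ 2 * s ^ 2 ∧
      vF ^ 2 * ((1 + g.γ0 - g.γ1) * g.γ2) * (mom L (p 1) * mom L (p (-1))) =
        (omega L vF N g t p ^ 2 - omega L vF N g (-t) p ^ 2) * (c * ((t : ℤ) * s)) := by
  have h3 := sq_lt_sq.2 h1
  have hg : 1 + g.γ0 + g.γ1 ≠ 0 := abs_pos.1 ((abs_nonneg _).trans_lt h2)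
  have hv2 : 0 ≤ (1 + g.γ0) ^ 2 - g.γ1 ^ 2 := by linarith
  by_cases h : g.γ2 * (mom L (p 1) * mom L (p (-1))) = 0
  · refine ⟨1, 0, by norm_num, fun _ => rfl, fun t => ⟨?_, ?_⟩⟩
    · simp only [omega, hp, mul_one, h, ne_eq, not_true_eq_false, if_false]
      rw [mul_pow, mul_pow, Real.sq_sqrt hv2, sq_abs]
      ring
    · rw [mul_zero, mul_zero, mul_zero]
      linear_combination vF ^ 2 * (1 + g.γ0 - g.γ1) * h
  · have hxy := (mul_ne_zero_iff.1 h).2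
    set x := mom L (p 1) with hx
    set y := mom L (p (-1)) with hy
    obtain ⟨hx0, hy0⟩ := mul_ne_zero_iff.1 hxy
    obtain ⟨hA, hA1⟩ := Coupling.A_mem h2
    have hω : ∀ t : ℤˣ, omega L vF N g t p ^ 2 = vF ^ 2 * ((1 + g.γ0) ^ 2 - g.γ1 ^ 2) *
        (1 / 2 * ((x ^ 2 + y ^ 2) + (t : ℤ) * √((x ^ 2 + y ^ 2) ^ 2 - g.A * (2 * (x * y)) ^ 2))) := by
      intro t
      simp only [omega, hp, mul_one, ← hx, ← hy]
      rw [if_pos h, Coupling.vTilde, mul_pow, mul_pow, Real.sq_sqrt hv2,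
        Real.sq_sqrt (radicand_pos hA hA1 hx0 hy0 t).2.le]
    set d := g.γ2 / (1 + g.γ0 + g.γ1) with hd
    have hd0 : d ≠ 0 := div_ne_zero (mul_ne_zero_iff.1 h).1 hg
    have hγ : g.γ2 = d * (1 + g.γ0 + g.γ1) := (div_mul_cancel₀ _ hg).symm
    -- The discriminant is the squared gap between the eigenvalues of the symmetric matrix with
    -- diagonal x², y² and off-diagonal entry d x y. Hence the double angle has cosine (x² - y²)/Δ
    -- and sine 2dxy/Δ.
    have hr : (x ^ 2 + y ^ 2) ^ 2 - g.A * (2 * (x * y)) ^ 2 =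
        (x ^ 2 - y ^ 2) ^ 2 + (2 * d * (x * y)) ^ 2 := by
      rw [Coupling.A, ← hd]
      ring
    rw [hr] at hω
    set Δ := √((x ^ 2 - y ^ 2) ^ 2 + (2 * d * (x * y)) ^ 2) with hΔ
    have hpos : 0 < (x ^ 2 - y ^ 2) ^ 2 + (2 * d * (x * y)) ^ 2 := by positivity
    have hΔ0 : 0 < Δ := Real.sqrt_pos.2 hpos
    have hΔ2 : Δ ^ 2 = (x ^ 2 - y ^ 2) ^ 2 + (2 * d * (x * y)) ^ 2 := Real.sq_sqrt hpos.le
    obtain ⟨c, s, hcs, hc, hs⟩ := exists_half_angle (x := (x ^ 2 - y ^ 2) / Δ)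
      (y := 2 * d * (x * y) / Δ) (by rw [div_pow, div_pow, ← add_div, ← hΔ2, div_self (by positivity)])
    rw [eq_div_iff hΔ0.ne'] at hc hs
    refine ⟨c, s, hcs, fun h0 => ?_, fun t => ?_⟩
    · exfalso
      rcases mul_eq_zero.1 h0 with h0 | h0
      · exact hx0 (by rw [hx, h0, mom, Int.cast_zero, mul_zero])
      · exact hy0 (by rw [hy, h0, mom, Int.cast_zero, mul_zero])
    · rw [hω, hω]
      rcases Int.units_eq_one_or t with rfl | rfl
      · simp only [Units.val_one, Units.val_neg, Int.cast_one, Int.cast_neg, ← hx]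
        constructor
        · linear_combination -(vF ^ 2 * ((1 + g.γ0) ^ 2 - g.γ1 ^ 2) * (1 / 2)) *
            ((x ^ 2 + y ^ 2) * hcs + hc)
        · rw [hγ]
          linear_combination -(vF ^ 2 * ((1 + g.γ0) ^ 2 - g.γ1 ^ 2) * (1 / 2)) * hs
      · simp only [neg_neg, Units.val_one, Units.val_neg, Int.cast_one, Int.cast_neg, ← hy]
        constructor
        · linear_combination -(vF ^ 2 * ((1 + g.γ0) ^ 2 - g.γ1 ^ 2) * (1 / 2)) *
            ((x ^ 2 + y ^ 2) * hcs - hc)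
        · rw [hγ]
          linear_combination -(vF ^ 2 * ((1 + g.γ0) ^ 2 - g.γ1 ^ 2) * (1 / 2)) * hs

end Dispersion

/-! ### Solvability at the smallest momenta -/

/-- The labels (1, 0) and (1, 1) lie inside the cutoff once N ≥ 3. A nonpositive radicand gives the
real square root 0, so strict positivity includes well-definedness: on the axis it yields the bound
on γ_1, and on the diagonal the lower branch is positive only if A > 0. -/
theorem constraint_of_omega_pos {L vF : ℝ} (hL : 0 < L) (hv : 0 < vF) (h3 : 3 ≤ N) {g : Coupling}
    (h : ∀ i : HatIdx N, 0 < omega L vF N g i.1.1 i.1.2) :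
    |g.γ1| < |1 + g.γ0| ∧ |g.γ2| < |1 + g.γ0 + g.γ1| := by
  have hb0 : InBox N 0 := by constructor <;> omega
  have hb1 : InBox N 1 := by constructor <;> omega
  have hlt : |g.γ1| < |1 + g.γ0| := by
    have h1 := h ⟨(1, fun t => if t = 1 then 1 else 0), hb0, one_ne_zero⟩
    have hc : chi N (fun t : ℤˣ => if t = 1 then (1 : ℤ) else 0) = 1 := if_pos ⟨hb1, hb0⟩
    simp only [omega, hc, mul_one, if_true] at h1
    rw [if_neg (by simp [mom])] at h1
    have h2 := pos_of_mul_pos_left h1 (abs_nonneg _)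
    have h4 := Real.sqrt_pos.1 (pos_of_mul_pos_left (by rwa [mul_comm] at h2) hv.le)
    exact sq_lt_sq.1 (by linarith)
  refine ⟨hlt, ?_⟩
  -- With a vanishing denominator, division by zero would give A = 1 and no information on γ_2; the
  -- first inequality excludes this.
  have h0 : 1 + g.γ0 + g.γ1 ≠ 0 := fun h0 => by
    have := sq_lt_sq.2 hlt
    rw [show 1 + g.γ0 = -g.γ1 by linarith, neg_sq] at this
    exact lt_irrefl _ this
  by_cases h2 : g.γ2 = 0
  · rw [h2, abs_zero]
    exact abs_pos.2 h0
  have h1 := h ⟨(-1, fun _ => 1), hb1, one_ne_zero⟩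
  have hc : chi N (fun _ : ℤˣ => (1 : ℤ)) = 1 := if_pos ⟨hb1, hb1⟩
  have hm := mom_ne_zero hL one_ne_zero
  simp only [omega, hc, mul_one] at h1
  rw [if_pos (mul_ne_zero h2 (mul_ne_zero hm hm))] at h1
  set x := mom L 1
  have hx2 : 0 < x ^ 2 := by positivity
  have hsq := pos_of_mul_pos_left (by rwa [mul_comm] at h1)
    (mul_nonneg hv.le (Real.sqrt_nonneg _))
  have hr := Real.sqrt_pos.1 hsq
  rw [Units.val_neg, Units.val_one, Int.cast_neg, Int.cast_one] at hr
  have hlt2 : √((x ^ 2 + x ^ 2) ^ 2 - g.A * (2 * (x * x)) ^ 2) < x ^ 2 + x ^ 2 := by linarith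
  have h4 := (Real.sqrt_lt' (by positivity)).1 hlt2
  have h5 : 0 < g.A * (2 * (x * x)) ^ 2 := by linarith
  have h6 : 0 < g.A := pos_of_mul_pos_left h5 (sq_nonneg _)
  rw [Coupling.A] at h6
  have h7 : (g.γ2 / (1 + g.γ0 + g.γ1)) ^ 2 < 1 ^ 2 := by linarith
  have h8 := sq_lt_sq.1 h7
  rw [abs_div, abs_one, div_lt_one (abs_pos.2 h0)] at h8
  exact h8

theorem constraints_iff_omega_pos {L vF : ℝ} (hL : 0 < L) (hv : 0 < vF) (h3 : 3 ≤ N)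
    {gC gS : Coupling} (hS : gS.γ0 = 0) :
    Constraints gC gS ↔ ∀ i : HatIdx N,
      0 < omega L vF N gC i.1.1 i.1.2 ∧ 0 < omega L vF N gS i.1.1 i.1.2 := by
  constructor
  · rintro ⟨h1, h2, h3, h4⟩ i
    exact ⟨omega_pos hL hv h1 h2 i,
      omega_pos hL hv (by rwa [hS, add_zero, abs_one]) (by rwa [hS, add_zero]) i⟩
  · intro h
    obtain ⟨h1, h2⟩ := constraint_of_omega_pos hL hv h3 fun i => (h i).1
    obtain ⟨h4, h5⟩ := constraint_of_omega_pos hL hv h3 fun i => (h i).2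
    rw [hS, add_zero, abs_one] at h4
    rw [hS, add_zero] at h5
    exact ⟨h1, h2, h4, h5⟩

end

end NodalMattis

/-! ### Symmetric oscillators of both channels inside the cutoff. -/

namespace NodalMattis

noncomputable section

variable {N : ℕ}

/-! ### The fields of both channels -/

/-- Oscillator labels inside the cutoff, with their channel. -/
abbrev Lbl (N : ℕ) : Type := Chan × InIdx N

instance : DecidableEq (Lbl N) := Classical.decEq _

/-- The reflection of an oscillator label. -/
def lneg (hN : Odd N) (p : Lbl N) : Lbl N := (p.1, ineg hN p.2)

theorem lneg_lneg (hN : Odd N) (p : Lbl N) : lneg hN (lneg hN p) = p :=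
  Prod.ext rfl (ineg_ineg hN p.2)

/-- The exchange of the two directions. -/
def lswap (p : Lbl N) : Lbl N := (p.1, iswap p.2)

theorem lswap_lswap (p : Lbl N) : lswap (lswap p) = p := Prod.ext rfl (iswap_iswap p.2)

theorem lswap_lneg (hN : Odd N) (p : Lbl N) : lswap (lneg hN p) = lneg hN (lswap p) :=
  Prod.ext rfl (iswap_ineg hN p.2)

/-- Real annihilation operators. -/
def oscA (hN : Odd N) (p : Lbl N) : Op N := hart (lneg hN) (fun p => osc p.1 p.2.1) p

/-- Real creation operators. -/
def oscAD (hN : Odd N) (p : Lbl N) : Op N :=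
  hart (lneg hN) (fun p => oscDag (lneg hN p).1 (lneg hN p).2.1) p

/-- Real shifts. -/
def shiftY (hN : Odd N) (L : ℝ) (G : Chan → Coupling) (p : Lbl N) : Op N :=
  hart (lneg hN) (fun p => yv L p.1 (G p.1) p.2.1) p

theorem osc_ccr_label (hN : Odd N) (p q : Lbl N) :
    osc p.1 p.2.1 * oscDag q.1 q.2.1 = oscDag q.1 q.2.1 * osc p.1 p.2.1 +
      (if p = q then (1 : ℂ) else 0) • 1 := by
  have h := osc_ccr hN p.1 q.1 p.2.1 q.2.1
  rw [sub_eq_iff_eq_add] at h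
  rw [h, add_comm]
  congr 1
  by_cases hpq : p = q
  · rw [if_pos hpq, one_smul, if_pos ⟨congrArg Prod.fst hpq, congrArg (fun x => x.2.1) hpq⟩]
  · rw [if_neg hpq, zero_smul, if_neg fun h => hpq (Prod.ext h.1 (Subtype.ext h.2))]

/-- The coefficients (1 ± i)/2 form a unitary mixing of p and -p, which have the same level shift,
so commutation relations and grading survive. -/
theorem oscillators (hN : Odd N) :
    Oscillators (oscA hN) (oscAD hN) fun p : Lbl N => 2 * |p.2.1.par| where
  pos p := by have := p.2.1.abs_pos; omega
  adj := hart_adj (fun p => by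
    rw [lneg_lneg]
    exact osc_adj hN _ _) (lneg_lneg hN)
  comm := hart_commute fun p q => osc_comm hN _ _ _ _
  comm_ad := hart_commute fun p q => oscDag_comm hN _ _ _ _
  ccr p q := by
    have h1 : ∀ p q : Lbl N, (lneg hN p = lneg hN q) = (p = q) := fun p q =>
      propext ⟨fun h => by rw [← lneg_lneg hN p, h, lneg_lneg], fun h => by rw [h]⟩
    have h2 : ∀ p q : Lbl N, (lneg hN p = q) = (p = lneg hN q) := fun p q => by
      rw [← h1 (lneg hN p) q, lneg_lneg]
    have h3 : (if p = q then (1 : Op N) else 0) = (if p = q then (1 : ℂ) else 0) • 1 := by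
      split_ifs
      · rw [one_smul]
      · rw [zero_smul]
    rw [oscA, oscAD, hart_mul, hart_mul, lneg_lneg]
    simp only [osc_ccr_label hN, h1, h2, h3]
    module
  graded p := by
    have h1 := osc_graded hN p.1 p.2.1
    have h2 := osc_graded hN p.1 (lneg hN p).2.1
    rw [show (lneg hN p).2.1.par = -p.2.1.par from rfl, abs_neg] at h2
    exact (h1.smul _).add (h2.smul _)
  graded_ad p := by
    have h1 := oscDag_graded hN p.1 p.2.1
    have h2 := oscDag_graded hN p.1 (lneg hN p).2.1
    rw [show (lneg hN p).2.1.par = -p.2.1.par from rfl, abs_neg] at h2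
    rw [oscAD, hart, lneg_lneg]
    exact (h2.smul _).add (h1.smul _)

theorem yv_commute (L : ℝ) (X : Chan) (g : Coupling) (i : HatIdx N) {T : Op N}
    (h : ∀ r s n, Commute (Zop L X r s n) T) : Commute (yv L X g i) T := by
  rw [yv]
  split_ifs
  · exact (h _ _ _).smul_left _
  · exact Commute.zero_left _

theorem yv_adj (hN : Odd N) (L : ℝ) (X : Chan) (g : Coupling) (i : HatIdx N) :
    IsAdj (yv L X g i) (yv L X g (hneg hN i)) := by
  by_cases h : i.perp = 0
  · rw [yv_hneg hN L X g h, yv, if_pos h]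
    have := (Zop_adj hN L X 1 (-i.1.1) i.par).smul (Complex.I *
      ((2 * Real.pi / L * (g.γ2 / (1 + g.γ0 + g.γ1)) * (i.sgn : ℤ) / √(i.absMom L) : ℝ) : ℂ))
    rwa [map_mul, Complex.conj_I, Complex.conj_ofReal, neg_mul] at this
  · rw [yv_of_ne h, yv_of_ne (i := hneg hN i) (neg_ne_zero.2 h)]
    intro v w
    simp

theorem yv_graded (hN : Odd N) (L : ℝ) (X : Chan) (g : Coupling) (i : HatIdx N) :
    Graded (yv L X g i) 0 := by
  rw [yv]
  split_ifs
  · exact (Zop_graded hN L X _ _ _).smul _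
  · exact Graded.zero

theorem shiftY_adj (hN : Odd N) (L : ℝ) (G : Chan → Coupling) (p : Lbl N) :
    IsAdj (shiftY hN L G p) (shiftY hN L G p) :=
  hart_adj (ν := lneg hN) (Z := fun p => yv L p.1 (G p.1) p.2.1)
    (Z' := fun p => yv L p.1 (G p.1) p.2.1)
    (fun p => by exact yv_adj hN L p.1 (G p.1) p.2.1) (lneg_lneg hN) p

theorem shiftY_graded (hN : Odd N) (L : ℝ) (G : Chan → Coupling) (p : Lbl N) :
    Graded (shiftY hN L G p) 0 := by
  rw [shiftY, hart]
  exact ((yv_graded hN L _ _ _).smul _).add ((yv_graded hN L _ _ _).smul _)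

theorem shiftY_oscA (hN : Odd N) (L : ℝ) (G : Chan → Coupling) (p q : Lbl N) :
    Commute (shiftY hN L G p) (oscA hN q) :=
  hart_commute (fun _ _ => yv_commute L _ _ _ fun _ _ _ => Zop_commute_osc hN _ _ _ _ _ _ _) p q

theorem shiftY_oscAD (hN : Odd N) (L : ℝ) (G : Chan → Coupling) (p q : Lbl N) :
    Commute (shiftY hN L G p) (oscAD hN q) :=
  hart_commute (fun _ _ => yv_commute L _ _ _ fun _ _ _ => Zop_commute_oscDag hN _ _ _ _ _ _ _) p q

theorem shiftY_shiftY (hN : Odd N) (L : ℝ) (G : Chan → Coupling) (p q : Lbl N) :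
    Commute (shiftY hN L G p) (shiftY hN L G q) :=
  hart_commute (fun _ _ => yv_commute L _ _ _ fun _ _ _ =>
    (yv_commute L _ _ _ fun _ _ _ => Zop_commute hN _ _ _ _ _ _ _ _ _).symm) p q

theorem posF_label (hN : Odd N) (p : Lbl N) : posF hN p.1 p.2.1 =
    osc p.1 p.2.1 + oscDag (lneg hN p).1 (lneg hN p).2.1 := rfl

theorem momF_label (hN : Odd N) (p : Lbl N) : momF hN p.1 p.2.1 =
    osc p.1 p.2.1 - oscDag (lneg hN p).1 (lneg hN p).2.1 := rfl

theorem add_sub_hart (hN : Odd N) (L : ℝ) (G : Chan → Coupling) (p : Lbl N) :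
    oscA hN p + oscAD hN p - shiftY hN L G p =
      hart (lneg hN) (fun p => posF hN p.1 p.2.1 - yv L p.1 (G p.1) p.2.1) p := by
  simp only [oscA, oscAD, shiftY, hart, posF_label, lneg_lneg]
  module

theorem sub_hart (hN : Odd N) (p : Lbl N) :
    oscA hN p - oscAD hN p = hart (lneg hN) (fun p => momF hN p.1 p.2.1) p := by
  simp only [oscA, oscAD, hart, momF_label, lneg_lneg]
  module

/-! ### The part that is left untouched -/

theorem numberOut_commute_osc (hN : Odd N) (L vF : ℝ) (X X' : Chan) {j : HatIdx N} (hj : InBox N j.par) :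
    Commute (numberOut L vF X) (osc X' j) := by
  refine opSum_commute (((locFin_number hN X _).ite _)) fun i => ?_
  split_ifs with h
  · exact Commute.zero_left _
  · have hij : j ≠ i := fun e => h (e ▸ hj)
    exact ((osc_oscDag_comm hN fun e => hij e.2).symm.mul_left (osc_comm hN _ _ _ _)).smul_left _

theorem numberOut_commute_oscDag (hN : Odd N) (L vF : ℝ) (X X' : Chan) {j : HatIdx N}
    (hj : InBox N j.par) : Commute (numberOut L vF X) (oscDag X' j) := by
  refine opSum_commute (((locFin_number hN X _).ite _)) fun i => ?_
  split_ifs with h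
  · exact Commute.zero_left _
  · have hij : i ≠ j := fun e => h (e ▸ hj)
    exact ((oscDag_comm hN _ _ _ _).mul_left (osc_oscDag_comm hN fun e => hij e.2)).smul_left _

theorem numberOut_commute_Zop (hN : Odd N) (L L' vF : ℝ) (X X' : Chan) (r s : ℤˣ) (n : ℤ) :
    Commute (numberOut L vF X : Op N) (Zop L' X' r s n) := by
  refine opSum_commute (((locFin_number hN X _).ite _)) fun i => ?_
  split_ifs with h
  · exact Commute.zero_left _
  · exact ((Zop_commute_oscDag hN _ _ _ _ _ _ _).mul_right (Zop_commute_osc hN _ _ _ _ _ _ _)).symm.smul_left _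

theorem op_Q_commute (L : ℝ) (X : Chan) (r s : ℤˣ) (j : ℤ) {T : Op N}
    (h : ∀ r s n, Commute (Zop L X r s n) T) : Commute (op (Q L N X r s j)) T := by
  rw [op_Q]
  exact (Commute.sum_left _ _ _ fun n _ => (h r s n).smul_left _).smul_left _

theorem zeroModeDiag_commute (L : ℝ) (X : Chan) (g : Coupling) {T : Op N}
    (h : ∀ r s n, Commute (Zop L X r s n) T) : Commute (zeroModeDiag L N X g) T := by
  have hQ := fun r s j => op_Q_commute L X r s j h
  refine (Commute.sum_left _ _ _ fun s _ => Commute.sum_left _ _ _ fun j _ => ?_).add_left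
    ((Commute.sum_left _ _ _ fun s _ => ?_).smul_left _)
  · exact (((hQ _ _ _).pow_left 2).smul_left _).add_left (((hQ _ _ _).pow_left 2).smul_left _)
  · have hs := fun s => Commute.sum_left (box N) (fun j => op (Q L N X 1 s j)) T fun j _ => hQ _ _ _
    exact (((hs s).pow_left 2).smul_left _).add_left (((hs s).mul_left (hs (-s))).smul_left _)

/-- The part of the Hamiltonian that commutes with the oscillators inside the cutoff. -/
def restHam (L vF : ℝ) (G : Chan → Coupling) : Op N :=
  ∑ X, (numberOut L vF X + ((vF * Real.pi / (2 * L) : ℝ) : ℂ) • zeroModeDiag L N X (G X) +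
    ((-(vF / 2 * ∑ i : InIdx N, i.1.absMom L) : ℝ) : ℂ) • 1)

theorem restHam_commute (L vF : ℝ) (G : Chan → Coupling) {T : Op N}
    (h1 : ∀ X, Commute (numberOut L vF X) T) (h2 : ∀ X r s n, Commute (Zop L X r s n) T) :
    Commute (restHam L vF G) T :=
  Commute.sum_left _ _ _ fun X _ => ((h1 X).add_left
    ((zeroModeDiag_commute L X _ (h2 X)).smul_left _)).add_left ((Commute.one_left _).smul_left _)

theorem restHam_oscA (hN : Odd N) (L vF : ℝ) (G : Chan → Coupling) (p : Lbl N) :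
    Commute (restHam L vF G) (oscA hN p) :=
  commute_hart (fun p => restHam_commute L vF G (fun _ => numberOut_commute_osc hN _ _ _ _ p.2.2)
    fun _ _ _ _ => Zop_commute_osc hN _ _ _ _ _ _ _) p

theorem restHam_oscAD (hN : Odd N) (L vF : ℝ) (G : Chan → Coupling) (p : Lbl N) :
    Commute (restHam L vF G) (oscAD hN p) :=
  commute_hart (fun p => restHam_commute L vF G
    (fun _ => numberOut_commute_oscDag hN _ _ _ _ (lneg hN p).2.2)
    fun _ _ _ _ => Zop_commute_oscDag hN _ _ _ _ _ _ _) p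

theorem restHam_shiftY (hN : Odd N) (L vF : ℝ) (G : Chan → Coupling) (p : Lbl N) :
    Commute (restHam L vF G) (shiftY hN L G p) := by
  refine commute_hart (fun p => restHam_commute L vF G (fun X => ?_) fun _ _ _ _ => ?_) p
  · exact (yv_commute L _ _ _ fun _ _ _ => (numberOut_commute_Zop hN _ _ _ _ _ _ _ _).symm).symm
  · exact (yv_commute L _ _ _ fun _ _ _ => Zop_commute hN _ _ _ _ _ _ _ _ _).symm

end

end NodalMattis

/-! ### Decoupling the two directions. -/

namespace NodalMattis

noncomputable section

variable {N : ℕ}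

theorem crossCoeff_ineg (hN : Odd N) (L : ℝ) (g : Coupling) (i : InIdx N) :
    crossCoeff L g (ineg hN i) = crossCoeff L g i := by
  rw [crossCoeff, crossCoeff, iswap_ineg]
  change g.γ2 * (mom L (-i.1.par) * mom L (-i.1.perp)) * ((√(2 * (hneg hN i.1).absMom L))⁻¹ *
    (√(2 * (hneg hN (iswap i).1).absMom L))⁻¹) = _
  rw [absMom_hneg, absMom_hneg, mom_neg, mom_neg, neg_mul_neg]

theorem hart_lswap (hN : Odd N) (Z : Lbl N → Op N) (p : Lbl N) :
    hart (lneg hN) Z (lswap p) = hart (lneg hN) (fun p => Z (lswap p)) p := by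
  rw [hart, hart, lswap_lneg]

/-- All coefficients are invariant under reflection, so products of fields at opposite momenta
become products of symmetric fields at a single label. -/
theorem mattisHam_plain {L : ℝ} (hL : 0 < L) (hN : Odd N) (vF : ℝ) {G : Chan → Coupling}
    (hG : ∀ X, 1 + (G X).γ0 + (G X).γ1 ≠ 0) :
    mattisHam plainProd L vF (G .C) (G .S) = restHam L vF G +
      ∑ p : Lbl N, ((-(vF / 4 * (1 + (G p.1).γ0 - (G p.1).γ1) * p.2.1.absMom L) : ℝ) : ℂ) •
        ((oscA hN p - oscAD hN p) * (oscA hN p - oscAD hN p)) +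
      ∑ p : Lbl N, (((vF / 4 * (1 + (G p.1).γ0 + (G p.1).γ1) * p.2.1.absMom L : ℝ) : ℂ) •
        ((oscA hN p + oscAD hN p - shiftY hN L G p) * (oscA hN p + oscAD hN p - shiftY hN L G p)) +
        ((vF / 2 * crossCoeff L (G p.1) p.2 : ℝ) : ℂ) •
        ((oscA hN p + oscAD hN p - shiftY hN L G p) *
          (oscA hN (lswap p) + oscAD hN (lswap p) - shiftY hN L G (lswap p)))) := by
  have habs : ∀ p : Lbl N, (lneg hN p).2.1.absMom L = p.2.1.absMom L := fun p => absMom_hneg hN L p.2.1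
  have hfst : ∀ p : Lbl N, (lneg hN p).1 = p.1 := fun p => rfl
  have hcr : ∀ p : Lbl N, crossCoeff L (G p.1) (lneg hN p).2 = crossCoeff L (G p.1) p.2 :=
    fun p => crossCoeff_ineg hN L _ p.2
  rw [mattisHam, ← sum_chan fun X => chanHam plainProd L vF X (G X), Finset.sum_add_distrib]
  simp only [add_sub_hart, sub_hart, hart_lswap]
  rw [sum_hart (lneg_lneg hN) (by intro p; rw [habs, hfst]),
    sum_hart (lneg_lneg hN) (by intro p; rw [habs, hfst]),
    sum_hart (lneg_lneg hN) (by intro p; rw [hfst, hcr]),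
    Fintype.sum_prod_type, Fintype.sum_prod_type, Fintype.sum_prod_type, restHam,
    ← Finset.sum_add_distrib, ← Finset.sum_add_distrib, ← Finset.sum_add_distrib]
  exact Finset.sum_congr rfl fun X _ => (chanHam_plain hL hN X (hG X) vF).trans (add_assoc _ _ _).symm

/-- The couplings for which a channel is stable. -/
structure Coupling.Stable (g : Coupling) : Prop where
  pos : 0 < 1 + g.γ0
  lt_one : |g.γ1| < |1 + g.γ0|
  lt_two : |g.γ2| < |1 + g.γ0 + g.γ1|

theorem Coupling.Stable.sub_pos {g : Coupling} (h : g.Stable) : 0 < 1 + g.γ0 - g.γ1 := by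
  have := h.lt_one
  rw [abs_of_pos h.pos, abs_lt] at this
  linarith

theorem Coupling.Stable.add_pos {g : Coupling} (h : g.Stable) : 0 < 1 + g.γ0 + g.γ1 := by
  have := h.lt_one
  rw [abs_of_pos h.pos, abs_lt] at this
  linarith

/-- The frequency of the oscillator `i`. -/
def freq (L vF : ℝ) (g : Coupling) (i : HatIdx N) : ℝ := omega L vF N g i.1.1 i.1.2

theorem chi_in (i : InIdx N) : chi N i.1.1.2 = 1 := by rw [chi_eq, if_pos i.2]

theorem absMom_sq (L : ℝ) (i : HatIdx N) : i.absMom L ^ 2 = mom L (i.1.2 i.1.1) ^ 2 := sq_abs _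

theorem freq_iswap (L vF : ℝ) (g : Coupling) {i : InIdx N} (h : i.1.perp ≠ 0) :
    freq L vF g (iswap i).1 = omega L vF N g (-i.1.1.1) i.1.1.2 := by
  rw [freq, iswap_of_ne h]

theorem prod_eq_par_mul_perp (i : HatIdx N) : i.1.2 1 * i.1.2 (-1) = i.par * i.perp := by
  rw [HatIdx.par, HatIdx.perp]
  rcases Int.units_eq_one_or i.1.1 with h | h <;> rw [h]
  rw [neg_neg, mul_comm]

/-- Rescaling by the momentum coefficients cancels the factors |p_s|^(-1/2) of the fields; the
rescaled coupling is proportional to p₊p₋, as the rotation angle requires. -/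
theorem sqrt_crossCoeff {L : ℝ} (hL : 0 < L) (g : Coupling) {a : ℝ} (ha : 0 ≤ a) (v : ℝ) (i : InIdx N) :
    √(a * i.1.absMom L) * √(a * (iswap i).1.absMom L) * (v * crossCoeff L g i) =
      a * v * g.γ2 * (mom L (i.1.1.2 1) * mom L (i.1.1.2 (-1))) / 2 := by
  have h1 := Real.sqrt_pos.2 (absMom_pos hL i.1)
  have h2 := Real.sqrt_pos.2 (absMom_pos hL (iswap i).1)
  have h3 : √(2 : ℝ) * √2 = 2 := Real.mul_self_sqrt zero_le_two
  have h4 : √a * √a = a := Real.mul_self_sqrt ha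
  have h5 : 0 < √(2 : ℝ) := by positivity
  rw [crossCoeff, ← mom_mul_mom, Real.sqrt_mul ha, Real.sqrt_mul ha, Real.sqrt_mul zero_le_two,
    Real.sqrt_mul zero_le_two]
  field_simp
  rw [pow_two, pow_two, h3, h4]
  ring

theorem exists_transforms {L vF : ℝ} (hL : 0 < L) (hv : 0 < vF) (hN : Odd N) {G : Chan → Coupling}
    (hG : ∀ X, (G X).Stable) :
    ∃ U : Fock N ≃ₗᵢ[ℂ] Fock N, Transforms U (mattisHam plainProd L vF (G .C) (G .S))
      (restHam L vF G + ∑ p : Lbl N, ((freq L vF (G p.1) p.2.1 / 4 : ℝ) : ℂ) •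
        ((4 : ℂ) • (oscAD hN p * oscA hN p) + (2 : ℂ) • 1)) := by
  have hex : ∀ (X : Chan) (p : BMom), ∃ c s : ℝ, chi N p = 1 → c ^ 2 + s ^ 2 = 1 ∧
      (p 1 * p (-1) = 0 → s = 0) ∧ ∀ t : ℤˣ,
      vF ^ 2 * ((1 + (G X).γ0) ^ 2 - (G X).γ1 ^ 2) * mom L (p t) ^ 2 =
        omega L vF N (G X) t p ^ 2 * c ^ 2 + omega L vF N (G X) (-t) p ^ 2 * s ^ 2 ∧
      vF ^ 2 * ((1 + (G X).γ0 - (G X).γ1) * (G X).γ2) * (mom L (p 1) * mom L (p (-1))) =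
        (omega L vF N (G X) t p ^ 2 - omega L vF N (G X) (-t) p ^ 2) * (c * ((t : ℤ) * s)) := by
    intro X p
    by_cases hp : chi N p = 1
    · obtain ⟨c, s, h⟩ := exists_mode_angle (vF := vF) (L := L) (hG X).lt_one (hG X).lt_two hp
      exact ⟨c, s, fun _ => h⟩
    · exact ⟨0, 0, fun h => absurd h hp⟩
  choose c s hcs using hex
  have hin : ∀ p : Lbl N, _ := fun p => hcs p.1 p.2.1.1.2 (chi_in p.2)
  have hs0 : ∀ p : Lbl N, p.2.1.perp = 0 → s p.1 p.2.1.1.2 = 0 := fun p h =>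
    (hin p).2.1 (by rw [prod_eq_par_mul_perp, h, mul_zero])
  have hsgn : ∀ t : ℤˣ, ((t : ℤ) : ℝ) ^ 2 = 1 := fun t => by
    rcases Int.units_eq_one_or t with h | h <;> rw [h] <;> norm_num
  rw [mattisHam_plain hL hN vF fun X => (hG X).add_pos.ne']
  have hswap : ∀ p : Lbl N, (lswap p).2.1.1.2 = p.2.1.1.2 := fun p => iswap_snd p.2
  have hx : ∀ p : Lbl N, 0 < vF / 4 * (1 + (G p.1).γ0 - (G p.1).γ1) := fun p => by
    have := (hG p.1).sub_pos
    positivity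
  -- The angle depends on channel and momentum only; the factor s in `sn` makes it odd under
  -- exchange of the directions, and on an axis, where the exchange is the identity, the angle
  -- vanishes. Frequencies are divided by 4 because a normal mode appears as 4a†a + 2.
  refine exists_pair_modes (oscillators hN) (shiftY_adj hN L G) (shiftY_graded hN L G)
    (shiftY_oscA hN L G) (shiftY_oscAD hN L G) (shiftY_shiftY hN L G) (restHam_oscA hN L vF G)
    (restHam_oscAD hN L vF G) (restHam_shiftY hN L vF G) (τ := lswap) lswap_lswap
    (x := fun p => vF / 4 * (1 + (G p.1).γ0 - (G p.1).γ1) * p.2.1.absMom L)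
    (cs := fun p => c p.1 p.2.1.1.2) (sn := fun p => (p.2.1.1.1 : ℤ) * s p.1 p.2.1.1.2)
    (fun p => mul_pos (hx p) (absMom_pos hL _))
    (fun p => div_pos (omega_pos hL hv (hG p.1).lt_one (hG p.1).lt_two _) (by norm_num))
    (fun p => ?_) (fun p => ?_) (fun p => ?_) (fun p => ?_) (fun p => ?_)
  · change c p.1 (lswap p).2.1.1.2 = _
    rw [hswap]
  · change _ * s p.1 (lswap p).2.1.1.2 = _
    rw [hswap]
    by_cases h : p.2.1.perp = 0
    · rw [hs0 p h, mul_zero, mul_zero, neg_zero]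
    · change (((iswap p.2).1.1.1 : ℤ) : ℝ) * _ = _
      rw [iswap_of_ne h, Units.val_neg, Int.cast_neg, neg_mul]
  · rw [mul_pow, hsgn, one_mul]
    exact (hin p).1
  · have h := ((hin p).2.2 p.2.1.1.1).1
    rw [← absMom_sq] at h
    have e : freq L vF (G (lswap p).1) (lswap p).2.1 ^ 2 * s p.1 p.2.1.1.2 ^ 2 =
        omega L vF N (G p.1) (-p.2.1.1.1) p.2.1.1.2 ^ 2 * s p.1 p.2.1.1.2 ^ 2 := by
      by_cases h0 : p.2.1.perp = 0
      · rw [hs0 p h0]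
        ring
      · rw [← freq_iswap L vF _ h0]
        rfl
    rw [mul_pow _ (s p.1 p.2.1.1.2), hsgn, one_mul,
      show freq L vF (G p.1) p.2.1 = omega L vF N (G p.1) p.2.1.1.1 p.2.1.1.2 from rfl]
    linear_combination h / 16 - e / 16
  · have h := ((hin p).2.2 p.2.1.1.1).2
    have e : freq L vF (G (lswap p).1) (lswap p).2.1 ^ 2 * s p.1 p.2.1.1.2 =
        omega L vF N (G p.1) (-p.2.1.1.1) p.2.1.1.2 ^ 2 * s p.1 p.2.1.1.2 := by
      by_cases h0 : p.2.1.perp = 0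
      · rw [hs0 p h0, mul_zero, mul_zero]
      · rw [← freq_iswap L vF _ h0]
        rfl
    refine (sqrt_crossCoeff hL (G p.1) (hx p).le (vF / 2) p.2).trans ?_
    rw [show freq L vF (G p.1) p.2.1 = omega L vF N (G p.1) p.2.1.1.1 p.2.1.1.2 from rfl]
    linear_combination h / 16 + e * (c p.1 p.2.1.1.2 * (p.2.1.1.1 : ℤ)) / 16

end

end NodalMattis

namespace NodalMattis

noncomputable section

variable {N : ℕ}

/-! ### Symmetry, grading and positivity -/

/-- Non-negative quadratic form. -/
def NonnegOp (A : Op N) : Prop := ∀ v : FockAlg N, 0 ≤ (inner ℂ v (A v)).re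

namespace NonnegOp

variable {A B : Op N}

theorem add (hA : NonnegOp A) (hB : NonnegOp B) : NonnegOp (A + B) := fun v => by
  rw [LinearMap.add_apply, inner_add_right, Complex.add_re]
  exact add_nonneg (hA v) (hB v)

theorem smul (hA : NonnegOp A) {a : ℝ} (ha : 0 ≤ a) : NonnegOp ((a : ℂ) • A) := fun v => by
  rw [LinearMap.smul_apply, inner_smul_right, Complex.re_ofReal_mul]
  exact mul_nonneg ha (hA v)

theorem sum {ι : Type*} {s : Finset ι} {T : ι → Op N} (h : ∀ i ∈ s, NonnegOp (T i)) :
    NonnegOp (∑ i ∈ s, T i) := fun v => by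
  rw [LinearMap.sum_apply, inner_sum, Complex.re_sum]
  exact Finset.sum_nonneg fun i hi => h i hi v

theorem opSum {ι : Type} {T : ι → Op N} (hT : LocFin T) (h : ∀ i, NonnegOp (T i)) :
    NonnegOp (opSum T) := fun v => by
  classical
  rw [opSum_apply_eq_sum hT v (s := (hT.finite v).toFinset) fun i hi => by simpa using hi, inner_sum,
    Complex.re_sum]
  exact Finset.sum_nonneg fun i _ => h i v

theorem of_isAdj (h : IsAdj A B) : NonnegOp (B * A) := fun v => by
  rw [Module.End.mul_apply, ← h]
  exact inner_self_nonneg (𝕜 := ℂ)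

end NonnegOp

section ZeroModes

variable {L : ℝ} (hL : 0 < L) (hN : Odd N) (X : Chan) {g : Coupling}
include hL hN

theorem zeroModeDiag_adj (hg : 1 + g.γ0 + g.γ1 ≠ 0) :
    IsAdj (zeroModeDiag L N X g) (zeroModeDiag L N X g) := by
  have h : ∀ r s n, IsAdj (Zop L X r s (-n) * Zop L X r s n : Op N) (Zop L X r s (-n) * Zop L X r s n) :=
    fun r s n => by
      have := (Zop_adj hN L X r s (-n)).mul (Zop_adj hN L X r s n)
      rwa [neg_neg] at this
  have h0 : ∀ s s', IsAdj (Zop L X 1 s 0 * Zop L X 1 s' 0 : Op N) (Zop L X 1 s 0 * Zop L X 1 s' 0) :=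
    fun s s' => by
      have := (Zop_adj hN L X 1 s 0).mul (Zop_adj hN L X 1 s' 0)
      rw [neg_zero] at this
      rwa [(Zop_commute hN L X X 1 1 s' s 0 0).eq] at this
  rw [zeroModeDiag_eq hL hN X hg]
  refine ((IsAdj.sum fun s _ => ?_).add ?_).smul_real _
  · exact (((IsAdj.sum fun n _ => (h 1 s n).smul_real _).add (h0 s s)).smul_real _).add
      ((IsAdj.sum fun n _ => h (-1) s n).smul_real _)
  · have := (h0 1 (-1)).smul_real (2 * g.γ2)
    rwa [Complex.ofReal_mul, Complex.ofReal_ofNat] at this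

theorem zeroModeDiag_graded (hg : 1 + g.γ0 + g.γ1 ≠ 0) : Graded (zeroModeDiag L N X g) 0 := by
  have h : ∀ r r' s s' n n', Graded (Zop L X r s n * Zop L X r' s' n' : Op N) 0 :=
    fun r r' s s' n n' => (Zop_graded hN L X r s n).mul (Zop_graded hN L X r' s' n')
  rw [zeroModeDiag_eq hL hN X hg]
  exact ((Graded.sum fun s _ => (((Graded.sum fun n _ => (h _ _ _ _ _ _).smul _).add
    (h _ _ _ _ _ _)).smul _).add ((Graded.sum fun n _ => h _ _ _ _ _ _).smul _)).add
      ((h _ _ _ _ _ _).smul _)).smul _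

theorem zeroModeDiag_vac (hg : 1 + g.γ0 + g.γ1 ≠ 0) : zeroModeDiag L N X g (vac : FockAlg N) = 0 := by
  have h : ∀ r r' s s' n n', (Zop L X r s n * Zop L X r' s' n' : Op N) vac = 0 :=
    fun r r' s s' n n' => by rw [Module.End.mul_apply, Zop_vac hN, map_zero]
  rw [zeroModeDiag_eq hL hN X hg]
  simp only [Zsum, LinearMap.smul_apply, LinearMap.add_apply, LinearMap.sum_apply, h, smul_zero,
    Finset.sum_const_zero, add_zero]

/-- Every term is a nonnegative multiple of some Z†Z once the n = 0 block is written in the sum and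
the difference of the two directions, with coefficients (1 + γ_0 + γ_1 ± γ_2)/2. Stability makes all
coefficients nonnegative. -/
theorem zeroModeDiag_nonneg (hg : g.Stable) : NonnegOp (zeroModeDiag L N X g) := by
  have h : ∀ r s n, NonnegOp (Zop L X r s (-n) * Zop L X r s n : Op N) := fun r s n =>
    NonnegOp.of_isAdj (Zop_adj hN L X r s n)
  have hA := Coupling.A_mem hg.lt_two
  have hγ := hg.lt_two
  rw [abs_of_pos hg.add_pos, abs_lt] at hγ
  have hself : ∀ s, IsAdj (Zop L X 1 s 0 : Op N) (Zop L X 1 s 0) := fun s => by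
    have := Zop_adj hN L X 1 s 0
    rwa [neg_zero] at this
  have e : (zeroModeDiag L N X g : Op N) = ((2 * Real.pi / L : ℝ) : ℂ) •
      (∑ s, (((1 + g.γ0 + g.γ1 : ℝ) : ℂ) •
          (∑ n ∈ (box N).erase 0, (g.A : ℂ) • (Zop L X 1 s (-n) * Zop L X 1 s n)) +
        ((1 + g.γ0 - g.γ1 : ℝ) : ℂ) • Zsum L X (-1) s) +
      ((((1 + g.γ0 + g.γ1 + g.γ2) / 2 : ℝ) : ℂ) •
          ((Zop L X 1 1 0 + Zop L X 1 (-1) 0) * (Zop L X 1 1 0 + Zop L X 1 (-1) 0)) +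
        (((1 + g.γ0 + g.γ1 - g.γ2) / 2 : ℝ) : ℂ) •
          ((Zop L X 1 1 0 - Zop L X 1 (-1) 0) * (Zop L X 1 1 0 - Zop L X 1 (-1) 0)))) := by
    rw [zeroModeDiag_eq hL hN X hg.add_pos.ne']
    simp only [sum_sign]
    have hc : (Zop L X 1 (-1) 0 * Zop L X 1 1 0 : Op N) = Zop L X 1 1 0 * Zop L X 1 (-1) 0 :=
      Zop_commute hN L X X 1 1 (-1) 1 0 0
    generalize (Zop L X 1 (-1) 0 : Op N) = Y at *
    generalize (Zop L X 1 1 0 : Op N) = Z at *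
    rw [add_mul Z Y, sub_mul Z Y, mul_add Z Z, mul_add Y Z, mul_sub Z Z, mul_sub Y Z, hc]
    push_cast
    module
  rw [e]
  refine ((NonnegOp.sum fun s _ => ?_).add ?_).smul (by positivity)
  · exact ((NonnegOp.sum fun n _ => (h _ _ _).smul hA.1.le).smul hg.add_pos.le).add
      ((NonnegOp.sum fun n _ => h _ _ _).smul hg.sub_pos.le)
  · exact ((NonnegOp.of_isAdj ((hself 1).add (hself (-1)))).smul (by linarith)).add
      ((NonnegOp.of_isAdj ((hself 1).sub (hself (-1)))).smul (by linarith))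

end ZeroModes

theorem number_adj (hN : Odd N) (X : Chan) (i : HatIdx N) :
    IsAdj (oscDag X i * osc X i) (oscDag X i * osc X i) :=
  (osc_adj hN X i).symm.mul (osc_adj hN X i)

/-! ### The diagonal Hamiltonian -/

/-- The oscillator Hamiltonian with frequencies `w`. -/
def oscHam (X : Chan) (w : HatIdx N → ℝ) : Op N :=
  opSum fun i : HatIdx N => (w i : ℂ) • (oscDag X i * osc X i)

section OscHam

variable (hN : Odd N) (X : Chan) (w : HatIdx N → ℝ)
include hN

theorem oscHam_adj : IsAdj (oscHam X w) (oscHam X w) :=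
  IsAdj.opSum (locFin_number hN X _) (locFin_number hN X _) fun i => (number_adj hN X i).smul_real _

theorem oscHam_graded : Graded (oscHam X w) 0 := by
  refine Graded.opSum (locFin_number hN X _) fun i => ?_
  have := (oscDag_graded hN X i).mul (osc_graded hN X i)
  rw [neg_add_cancel] at this
  exact this.smul _

theorem oscHam_nonneg (hw : ∀ i, 0 ≤ w i) : NonnegOp (oscHam X w) :=
  NonnegOp.opSum (locFin_number hN X _) fun i => (NonnegOp.of_isAdj (osc_adj hN X i)).smul (hw i)

theorem oscHam_vac : oscHam X w (vac : FockAlg N) = 0 := by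
  rw [oscHam, opSum_apply_eq_sum (locFin_number hN X _) _ (s := ∅), Finset.sum_empty]
  intro i hi
  refine absurd ?_ hi
  rw [LinearMap.smul_apply, Module.End.mul_apply, osc_vac hN, map_zero, smul_zero]

end OscHam

theorem diagHam_eq {L : ℝ} (hL : 0 < L) (hN : Odd N) (vF : ℝ) (G : Chan → Coupling) (e : ℝ) :
    diagHam L vF N (G .C) (G .S) e = ∑ X, (oscHam X (freq L vF (G X)) +
      ((vF * Real.pi / (2 * L) : ℝ) : ℂ) • zeroModeDiag L N X (G X)) + (e : ℂ) • 1 := by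
  rw [diagHam, HQ, sum_chan, smul_add]
  simp only [op_b hL hN, op_dag_b hL hN]
  rw [opSum_add (locFin_number hN .C _) (locFin_number hN .S _)]
  change oscHam .C (freq L vF (G .C)) + oscHam .S (freq L vF (G .S)) + _ + _ = _
  abel

theorem diagHam_adj {L : ℝ} (hL : 0 < L) (hN : Odd N) (vF : ℝ) {G : Chan → Coupling}
    (hG : ∀ X, (G X).Stable) (e : ℝ) :
    IsAdj (diagHam L vF N (G .C) (G .S) e) (diagHam L vF N (G .C) (G .S) e) := by
  rw [diagHam_eq hL hN]
  exact (IsAdj.sum fun X _ => (oscHam_adj hN X _).add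
    ((zeroModeDiag_adj hL hN X (hG X).add_pos.ne').smul_real _)).add (IsAdj.one.smul_real _)

theorem diagHam_graded {L : ℝ} (hL : 0 < L) (hN : Odd N) (vF : ℝ) {G : Chan → Coupling}
    (hG : ∀ X, (G X).Stable) (e : ℝ) : Graded (diagHam L vF N (G .C) (G .S) e) 0 := by
  rw [diagHam_eq hL hN]
  exact (Graded.sum fun X _ => (oscHam_graded hN X _).add
    ((zeroModeDiag_graded hL hN X (hG X).add_pos.ne').smul _)).add (Graded.one.smul _)

theorem diagHam_vac {L : ℝ} (hL : 0 < L) (hN : Odd N) (vF : ℝ) {G : Chan → Coupling}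
    (hG : ∀ X, (G X).Stable) (e : ℝ) :
    diagHam L vF N (G .C) (G .S) e vac = (e : ℂ) • vac := by
  rw [diagHam_eq hL hN]
  simp only [LinearMap.add_apply, LinearMap.sum_apply, LinearMap.smul_apply, oscHam_vac hN,
    zeroModeDiag_vac hL hN _ (hG _).add_pos.ne', smul_zero, add_zero, Finset.sum_const_zero, zero_add,
    Module.End.one_apply]

theorem le_diagHam {L vF : ℝ} (hL : 0 < L) (hv : 0 < vF) (hN : Odd N) {G : Chan → Coupling}
    (hG : ∀ X, (G X).Stable) (e : ℝ) (v : FockAlg N) :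
    e * ‖v‖ ^ 2 ≤ (inner ℂ v (diagHam L vF N (G .C) (G .S) e v)).re := by
  have h : NonnegOp (∑ X, (oscHam X (freq L vF (G X)) +
      ((vF * Real.pi / (2 * L) : ℝ) : ℂ) • zeroModeDiag L N X (G X)) : Op N) :=
    NonnegOp.sum fun X _ => (oscHam_nonneg hN X _ fun i =>
      (omega_pos hL hv (hG X).lt_one (hG X).lt_two i).le).add
      ((zeroModeDiag_nonneg hL hN X (hG X)).smul (by positivity))
  rw [diagHam_eq hL hN, LinearMap.add_apply, inner_add_right, Complex.add_re, LinearMap.smul_apply,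
    Module.End.one_apply, inner_smul_right, inner_self_eq_norm_sq_to_K, Complex.re_ofReal_mul]
  have h2 : (((‖v‖ : ℝ) : ℂ) ^ 2).re = ‖v‖ ^ 2 := by
    rw [← Complex.ofReal_pow, Complex.ofReal_re]
  have h3 := h v
  change e * ‖v‖ ^ 2 ≤ _ + e * (((‖v‖ : ℝ) : ℂ) ^ 2).re
  rw [h2]
  linarith

end

end NodalMattis

/-! ### Constants and the two operator orderings. -/

namespace NodalMattis

noncomputable section

variable {N : ℕ}

theorem numberOut_adj (hN : Odd N) (L vF : ℝ) (X : Chan) :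
    IsAdj (numberOut L vF X : Op N) (numberOut L vF X) := by
  have h := (locFin_number hN X fun i => ((vF * i.absMom L : ℝ) : ℂ)).ite fun i => InBox N i.par
  refine IsAdj.opSum h h fun i => ?_
  split_ifs
  · exact IsAdj.zero
  · exact (number_adj hN X i).smul_real _

/-- The momenta are skew, so their squares are symmetric; the mixed products are symmetric because
the shifted fields commute. -/
theorem mattisHam_adj {L : ℝ} (hL : 0 < L) (hN : Odd N) (vF : ℝ) {G : Chan → Coupling}
    (hG : ∀ X, (G X).Stable) :
    IsAdj (mattisHam (N := N) plainProd L vF (G .C) (G .S)) (mattisHam plainProd L vF (G .C) (G .S)) := by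
  have hψ : ∀ p : Lbl N, IsAdj (oscA hN p + oscAD hN p - shiftY hN L G p)
      (oscA hN p + oscAD hN p - shiftY hN L G p) := fun p => by
    have h := (oscillators hN).adj p
    have h1 := h.add h.symm
    rw [add_comm (oscAD hN p)] at h1
    exact h1.sub (shiftY_adj hN L G p)
  have hδ : ∀ p : Lbl N, IsAdj ((oscA hN p - oscAD hN p) * (oscA hN p - oscAD hN p))
      ((oscA hN p - oscAD hN p) * (oscA hN p - oscAD hN p)) := fun p => by
    have h := (oscillators hN).adj p
    have h1 := (h.sub h.symm).mul (h.sub h.symm)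
    rwa [← neg_sub (oscA hN p), neg_mul_neg] at h1
  have hc : ∀ p q : Lbl N, Commute (oscA hN p + oscAD hN p - shiftY hN L G p)
      (oscA hN q + oscAD hN q - shiftY hN L G q) := fun p q => by
    have hy : ∀ p q : Lbl N, Commute (shiftY hN L G p) (oscA hN q + oscAD hN q) := fun p q =>
      (shiftY_oscA hN L G p q).add_right (shiftY_oscAD hN L G p q)
    exact (((oscillators hN).commute_field p q).sub_right (hy q p).symm).sub_left
      ((hy p q).sub_right (shiftY_shiftY hN L G p q))
  have hcross : ∀ p q : Lbl N, IsAdj ((oscA hN p + oscAD hN p - shiftY hN L G p) *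
      (oscA hN q + oscAD hN q - shiftY hN L G q)) ((oscA hN p + oscAD hN p - shiftY hN L G p) *
      (oscA hN q + oscAD hN q - shiftY hN L G q)) := fun p q => by
    have h := (hψ p).mul (hψ q)
    rwa [(hc q p).eq] at h
  rw [mattisHam_plain hL hN vF fun X => (hG X).add_pos.ne', restHam]
  exact ((IsAdj.sum fun X _ => ((numberOut_adj hN L vF X).add
    ((zeroModeDiag_adj hL hN X (hG X).add_pos.ne').smul_real _)).add (IsAdj.one.smul_real _)).add
    (IsAdj.sum fun p _ => (hδ p).smul_real _)).add
    (IsAdj.sum fun p _ => ((hcross p p).smul_real _).add ((hcross p (lswap p)).smul_real _))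

/-! ### Constants -/

/-- Outside the cutoff both channels have the free frequency, so the energy is in fact a finite sum.
-/
theorem energyTerm_out {L vF : ℝ} {gC gS : Coupling} {i : HatIdx N} (h : ¬ InBox N i.par) :
    energyTerm L vF N gC gS i = 0 := by
  have hc : chi N i.1.2 = 0 := by rw [chi_eq, if_neg h]
  rw [energyTerm, omega_of_chi hc, omega_of_chi hc]
  ring

theorem energy0_eq (L vF : ℝ) (G : Chan → Coupling) :
    energy0 L vF N (G .C) (G .S) =
      ∑ X, ∑ i : InIdx N, (freq L vF (G X) i.1 / 2 - vF / 2 * i.1.absMom L) := by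
  rw [energy0, (tsum_inBox fun i hi => energyTerm_out hi).2, sum_chan, ← Finset.sum_add_distrib,
    Finset.mul_sum]
  refine Finset.sum_congr rfl fun i _ => ?_
  rw [energyTerm, freq, freq, HatIdx.absMom]
  ring

theorem orderingShift_eq (L vF : ℝ) (g : Coupling) :
    orderingShift L vF N g = vF / 2 * g.γ0 * ∑ i : InIdx N, i.1.absMom L := by
  rw [orderingShift, (tsum_inBox fun i hi => by rw [chi_eq, if_neg hi]; ring).2, Finset.mul_sum,
    Finset.mul_sum]
  refine Finset.sum_congr rfl fun i _ => ?_
  rw [chi_in, HatIdx.absMom]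
  ring

theorem oscHam_freq (hN : Odd N) (L vF : ℝ) (X : Chan) (g : Coupling) :
    oscHam X (freq L vF g) = ∑ i : InIdx N, ((freq L vF g i.1 : ℝ) : ℂ) • (oscDag X i.1 * osc X i.1) +
      numberOut L vF X := by
  rw [oscHam, opSum_split (locFin_number hN X _) fun i => InBox N i.par, numberOut]
  congr 1
  refine opSum_congr fun i => ?_
  split_ifs with h
  · rfl
  · rw [freq, omega_of_chi (by rw [chi_eq, if_neg h]), HatIdx.absMom]

theorem freq_ineg (hN : Odd N) (L vF : ℝ) (g : Coupling) (i : InIdx N) :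
    freq L vF g (ineg hN i).1 = freq L vF g i.1 :=
  omega_neg _ (by rw [chi_in i]; exact chi_in (ineg hN i))

/-- The zero-point energies ω/2 combine with the constants -vF|p_s|/2 to the ground-state energy,
and the number operators return to complex modes because ω is invariant under reflection. -/
theorem restHam_add_modes {L : ℝ} (hL : 0 < L) (hN : Odd N) (vF : ℝ) (G : Chan → Coupling) :
    restHam L vF G + ∑ p : Lbl N, ((freq L vF (G p.1) p.2.1 / 4 : ℝ) : ℂ) •
        ((4 : ℂ) • (oscAD hN p * oscA hN p) + (2 : ℂ) • 1) =
      diagHam L vF N (G .C) (G .S) (energy0 L vF N (G .C) (G .S)) := by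
  have h1 : ∑ p : Lbl N, ((freq L vF (G p.1) p.2.1 / 4 : ℝ) : ℂ) •
        ((4 : ℂ) • (oscAD hN p * oscA hN p) + (2 : ℂ) • (1 : Op N)) =
      ∑ p : Lbl N, ((freq L vF (G p.1) p.2.1 : ℝ) : ℂ) • (oscAD hN p * oscA hN p) +
        ∑ p : Lbl N, ((freq L vF (G p.1) p.2.1 / 2 : ℝ) : ℂ) • (1 : Op N) := by
    rw [← Finset.sum_add_distrib]
    refine Finset.sum_congr rfl fun p _ => ?_
    push_cast
    module
  have h2 : ∑ p : Lbl N, ((freq L vF (G p.1) p.2.1 : ℝ) : ℂ) • (oscAD hN p * oscA hN p) =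
      ∑ X, ∑ i : InIdx N, ((freq L vF (G X) i.1 : ℝ) : ℂ) • (oscDag X i.1 * osc X i.1) := by
    have hf : ∀ p : Lbl N, ((freq L vF (G (lneg hN p).1) (lneg hN p).2.1 : ℝ) : ℂ) =
        ((freq L vF (G p.1) p.2.1 : ℝ) : ℂ) := fun p => by
      have := freq_ineg hN L vF (G p.1) p.2
      exact congrArg _ this
    simp only [oscAD, oscA]
    rw [sum_hart (lneg_lneg hN) hf]
    simp only [lneg_lneg]
    rw [Fintype.sum_prod_type]
  rw [h1, h2, diagHam_eq hL hN, energy0_eq, restHam, Fintype.sum_prod_type,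
    Finset.sum_congr rfl fun X _ => congrArg (· + _) (oscHam_freq hN L vF X (G X)),
    Complex.ofReal_sum, Finset.sum_smul, ← Finset.sum_add_distrib, ← Finset.sum_add_distrib,
    ← Finset.sum_add_distrib]
  refine Finset.sum_congr rfl fun X _ => ?_
  rw [← Finset.sum_smul, ← Complex.ofReal_sum, Finset.sum_sub_distrib, ← Finset.mul_sum, sub_eq_add_neg,
    Complex.ofReal_add, add_smul]
  abel

theorem chanHam_normal {L : ℝ} (hL : 0 < L) (hN : Odd N) (vF : ℝ) (X : Chan) (g : Coupling) :
    chanHam normalProd L vF X g =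
      chanHam plainProd L vF X g + ((-orderingShift L vF N g : ℝ) : ℂ) • (1 : Op N) := by
  have hs : ∀ i : HatIdx N, i ∉ Finset.univ.map (Function.Embedding.subtype fun i : HatIdx N =>
      InBox N i.par) → ((chi N i.1.2 * g.γ0 * i.absMom L : ℝ) : ℂ) • (1 : Op N) = 0 := fun i hi => by
    have hp : ¬ InBox N i.par := fun hp => hi (Finset.mem_map.2 ⟨⟨i, hp⟩, Finset.mem_univ _, rfl⟩)
    rw [chi_eq, if_neg hp, zero_mul, zero_mul, Complex.ofReal_zero, zero_smul]
  have hl : LocFin fun i : HatIdx N => ((chi N i.1.2 * g.γ0 * i.absMom L : ℝ) : ℂ) • (1 : Op N) :=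
    LocFin.of_support (Finset.finite_toSet _) hs
  rw [chanHam_eq, chanHam_eq, opSum_congr (chanTerm_normal hL hN X g),
    opSum_sub (locFin_chanTerm hL hN X) hl, opSum_eq_sum hs, Finset.sum_map, ← Finset.sum_smul,
    ← Complex.ofReal_sum, smul_sub, smul_smul, ← Complex.ofReal_mul, orderingShift_eq]
  have e : vF / 2 * ∑ i : InIdx N, chi N i.1.1.2 * g.γ0 * i.1.absMom L =
      vF / 2 * g.γ0 * ∑ i : InIdx N, i.1.absMom L := by
    simp only [chi_in, one_mul, ← Finset.mul_sum, mul_assoc]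
  change _ - ((vF / 2 * ∑ i : InIdx N, chi N i.1.1.2 * g.γ0 * i.1.absMom L : ℝ) : ℂ) • 1 + _ = _
  rw [e, Complex.ofReal_neg, neg_smul]
  abel

/-- Since γ_0^S = 0, only the charge channel contributes a constant. The factor 1 brings the
identity into the form of `Transforms.smul_add`. -/
theorem mattisHam_normal {L : ℝ} (hL : 0 < L) (hN : Odd N) (vF : ℝ) (gC : Coupling) {gS : Coupling}
    (hS : gS.γ0 = 0) : mattisHam normalProd L vF gC gS =
      (1 : ℂ) • mattisHam plainProd L vF gC gS + ((-orderingShift L vF N gC : ℝ) : ℂ) • (1 : Op N) := by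
  have h : orderingShift L vF N gS = 0 := by rw [orderingShift_eq, hS]; ring
  rw [mattisHam, mattisHam, chanHam_normal hL hN, chanHam_normal hL hN vF .S, h, neg_zero,
    Complex.ofReal_zero, zero_smul, one_smul]
  abel

theorem diagHam_shift (L vF : ℝ) (gC gS : Coupling) (e f : ℝ) :
    diagHam L vF N gC gS (e - f) = (1 : ℂ) • diagHam L vF N gC gS e + ((-f : ℝ) : ℂ) • (1 : Op N) := by
  rw [diagHam, diagHam, one_smul, sub_eq_add_neg, Complex.ofReal_add, add_smul, ← add_assoc]

/-- The charge and the spin coupling as a family. -/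
def pairing (gC gS : Coupling) : Chan → Coupling
  | .C => gC
  | .S => gS

/-- Both orderings share one unitary, because the two Hamiltonians differ by a constant and so do
their diagonal forms. -/
theorem exists_diagonalisation_family {L vF : ℝ} (hL : 0 < L) (hv : 0 < vF) (hN : Odd N)
    {G : Chan → Coupling} (hG : ∀ X, (G X).Stable) (hS0 : (G .S).γ0 = 0) :
    ∃ U : Fock N ≃ₗᵢ[ℂ] Fock N,
      (Diagonalises U (mattisHam normalProd L vF (G .C) (G .S))
          (diagHam L vF N (G .C) (G .S) (energy0 L vF N (G .C) (G .S) - orderingShift L vF N (G .C))) ∧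
        IsGroundEnergy (mattisHam (N := N) normalProd L vF (G .C) (G .S))
          (energy0 L vF N (G .C) (G .S) - orderingShift L vF N (G .C))) ∧
      (Diagonalises U (mattisHam plainProd L vF (G .C) (G .S))
          (diagHam L vF N (G .C) (G .S) (energy0 L vF N (G .C) (G .S))) ∧
        IsGroundEnergy (mattisHam (N := N) plainProd L vF (G .C) (G .S))
          (energy0 L vF N (G .C) (G .S))) := by
  obtain ⟨U, hU⟩ := exists_transforms (N := N) hL hv hN hG
  rw [restHam_add_modes hL hN] at hU
  have hadj := mattisHam_adj (N := N) hL hN vF hG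
  have hU' := hU.smul_add 1 ((-orderingShift L vF N (G .C) : ℝ) : ℂ)
  rw [← mattisHam_normal hL hN vF (G .C) hS0, ← diagHam_shift] at hU'
  have hadj' : IsAdj (mattisHam (N := N) normalProd L vF (G .C) (G .S))
      (mattisHam normalProd L vF (G .C) (G .S)) := by
    rw [mattisHam_normal hL hN vF (G .C) hS0, one_smul]
    exact hadj.add (IsAdj.one.smul_real _)
  have hD := fun e => diagHam_adj (N := N) hL hN vF hG e
  have hg := fun e => diagHam_graded (N := N) hL hN vF hG e
  have hp := fun e => le_diagHam (N := N) hL hv hN hG e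
  have hvac := fun e => diagHam_vac (N := N) hL hN vF hG e
  exact ⟨U, ⟨(hU'.diagonalises hadj' (hD _) (hg _)).1,
      hU'.isGroundEnergy hadj' (hD _) (hg _) (hp _) (hvac _)⟩,
    (hU.diagonalises hadj (hD _) (hg _)).1, hU.isGroundEnergy hadj (hD _) (hg _) (hp _) (hvac _)⟩

theorem exists_diagonalisation {L vF : ℝ} (hL : 0 < L) (hv : 0 < vF) (hN : Odd N) {gC gS : Coupling}
    (hC : gC.Stable) (hS : gS.Stable) (hS0 : gS.γ0 = 0) :
    ∃ U : Fock N ≃ₗᵢ[ℂ] Fock N,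
      (Diagonalises U (mattisHam normalProd L vF gC gS)
          (diagHam L vF N gC gS (energy0 L vF N gC gS - orderingShift L vF N gC)) ∧
        IsGroundEnergy (mattisHam (N := N) normalProd L vF gC gS)
          (energy0 L vF N gC gS - orderingShift L vF N gC)) ∧
      (Diagonalises U (mattisHam plainProd L vF gC gS)
          (diagHam L vF N gC gS (energy0 L vF N gC gS)) ∧
        IsGroundEnergy (mattisHam (N := N) plainProd L vF gC gS) (energy0 L vF N gC gS)) := by
  have hG : ∀ X, (pairing gC gS X).Stable := by
    rintro (_ | _)
    exacts [hC, hS]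
  have h := exists_diagonalisation_family (N := N) hL hv hN hG hS0
  simp only [pairing] at h
  exact h

end

end NodalMattis

theorem theoremC5 (L vF : ℝ) (hL : 0 < L) (hv : 0 < vF) (N : ℕ) (hN : Odd N)
    (γC0 γC1 γC2 γS1 γS2 : ℝ) (gC gS : NodalMattis.Coupling)
    (hgC : gC = ⟨γC0, γC1, γC2⟩) (hgS : gS = ⟨0, γS1, γS2⟩) :
    (3 ≤ N →
      (NodalMattis.Constraints gC gS ↔
        ∀ i : NodalMattis.HatIdx N,
          0 < NodalMattis.omega L vF N gC i.1.1 i.1.2 ∧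
            0 < NodalMattis.omega L vF N gS i.1.1 i.1.2)) ∧
    (0 < 1 + γC0 → NodalMattis.Constraints gC gS →
      Summable (NodalMattis.energyTerm L vF N gC gS) ∧
      ∃ U : NodalMattis.Fock N ≃ₗᵢ[ℂ] NodalMattis.Fock N,
        (NodalMattis.Diagonalises U
            (NodalMattis.mattisHam NodalMattis.normalProd L vF gC gS)
            (NodalMattis.diagHam L vF N gC gS
              (NodalMattis.energy0 L vF N gC gS - NodalMattis.orderingShift L vF N gC)) ∧
          NodalMattis.IsGroundEnergy
            (NodalMattis.mattisHam (N := N) NodalMattis.normalProd L vF gC gS)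
            (NodalMattis.energy0 L vF N gC gS - NodalMattis.orderingShift L vF N gC)) ∧
        (NodalMattis.Diagonalises U
            (NodalMattis.mattisHam NodalMattis.plainProd L vF gC gS)
            (NodalMattis.diagHam L vF N gC gS (NodalMattis.energy0 L vF N gC gS)) ∧
          NodalMattis.IsGroundEnergy
            (NodalMattis.mattisHam (N := N) NodalMattis.plainProd L vF gC gS)
            (NodalMattis.energy0 L vF N gC gS))) := by
  have hS0 : gS.γ0 = 0 := by rw [hgS]
  refine ⟨fun h3 => NodalMattis.constraints_iff_omega_pos hL hv h3 hS0, fun hpos hc => ?_⟩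
  obtain ⟨h1, h2, h3, h4⟩ := hc
  refine ⟨(NodalMattis.tsum_inBox fun i hi => NodalMattis.energyTerm_out hi).1,
    NodalMattis.exists_diagonalisation hL hv hN ⟨by rw [hgC]; exact hpos, h1, h2⟩
      ⟨by rw [hS0]; norm_num, by rwa [hS0, add_zero, abs_one], by rwa [hS0, add_zero]⟩ hS0⟩
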